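/- **Khovanov homology and its spaces.** Let $D$ be a link diagram with set of crossings $A$. For $x\subseteq A$ let $D(x)$ be the collection of planar circles obtained by $1$-smoothing the crossings in $x$ and $0$-smoothing the others. (If the over-strand of a crossing runs from lower left to upper right, the $0$-smoothing is the vertical one, $)\,($, and the $1$-smoothing is the horizontal one.) Let $V=\mathbb Z[u]/(u^2)$, with its multiplication $m$ and with the comultiplication $\Delta(1)=1\otimes u+u\otimes 1$, $\Delta(u)=u\otimes u$. Put $F_{KH}(x)=V^{\otimes k}$, with one tensor factor for each circle of $D(x)$; adding one crossing to $x$ merges two circles or splits a circle in two, and induces $m$, respectively $\Delta$, on the factors concerned and the identity on the other ones. Let $\mathbf B$ be the poset of subsets of $A$ under reverse inclusion, whose maximum $\mathbf 1$ is $\varnothing$, and let $\mathbf Q=\mathbf B\cup\{\mathbf 1'\}$, where $\mathbf 1'$ is above every element of $\mathbf B$ except $\mathbf 1$, and $\mathbf 1,\mathbf 1'$ are incomparable. With $F_{KH}(\mathbf 1')=0$ this gives a functor $F_{KH}:\mathbf Q^{op}\to\mathbf{Ab}$ (the Khovanov presheaf). For $n\ge 0$ put $$\mathcal Y_nD=\operatorname{holim}_{\mathbf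 Q^{op}}K(-,n)\circ F_{KH},$$ a pointed space, where $K(-,n)$ is the Eilenberg–Mac Lane functor. Let $\overline{KH}{}^{*}(D)$ be the cohomology of the Khovanov complex $K^i=\bigoplus_{|x|=i}F_{KH}(x)$, whose differential is the sum of the edge maps with the usual signs, and for an oriented diagram $D$ with $c$ negative crossings let $KH^i(D)=\overline{KH}{}^{\,i+c}(D)$, for all $i\in\mathbb Z$ (the internal $q$-grading is ignored). **Statement.** Let $D_1$ and $D_2$ be link diagrams, each cut open at a point of its outer boundary, so that each of them has two ends. Let $D_1\#D_2$ be the link diagram obtained by joining the two ends of $D_1$ to the two ends of $D_2$ by two parallel arcs without crossings. Let $D_1\#\#D_2$ be the link diagram obtained by joining the two ends of $D_1$ to each other by an arc, and those of $D_2$ to each other by another arc, such that the two arcs are hooked into each other (a clasp) by two crossings; with $D_1$ drawn below $D_2$, at each of the two crossings the over-strand runs from lower left to upper right. Then: 1. For every $n\ge 0$ there is a pointed homotopy equivalence $$\mathcal Y_n(D_1\#\#D_2)\;\simeq\;\mathcal Y_n(D_1\#D_2)\times\Omega^2\,\mathcal Y_n(D_1\#D_2).$$ 2. Let $D_1,D_2$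 be oriented in such a way that the orientations fit together to an orientation of $D_1\#D_2$, and let $D_1\#\#D_2$ have the orientation that is given by the same orientations of $D_1$ and $D_2$ (the two new crossings are then both positive). Then for every $i\in\mathbb Z$ $$KH^i(D_1\#\#D_2)\;\cong\;KH^i(D_1\#D_2)\oplus KH^{i-2}(D_1\#D_2).$$ -/

import Mathlib

namespace Khovanov

noncomputable section

open CategoryTheory MonoidalCategory Simplicial Opposite

/-- Pointed simplicial sets. -/
abbrev Sp := Under (Δ[0] : SSet.{0})

namespace Sp

/-- The simplicial set underlying a simplicial abelian group, pointed at `0`. -/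
def ofSimplicialGroup : SimplicialObject AddCommGrpCat.{0} ⥤ Sp where
  obj M := Under.mk (Y := ((SimplicialObject.whiskering _ _).obj (forget AddCommGrpCat.{0})).obj M)
    { app := fun k => TypeCat.ofHom fun _ => (0 : M.obj k)
      naturality := fun k l f => by
        ext x
        exact (map_zero (M.map f).hom).symm }
  map f := Under.homMk (((SimplicialObject.whiskering _ _).obj (forget AddCommGrpCat.{0})).map f) (by
    ext k x
    exact map_zero (f.app k).hom)

/-- The Eilenberg–Mac Lane functor `K(-, n)`: the Dold–Kan correspondence applied to the chain
complex with the given group in degree `n` and `0` elsewhere. -/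
def eilenbergMacLane (n : ℕ) : AddCommGrpCat.{0} ⥤ Sp :=
  HomologicalComplex.single AddCommGrpCat.{0} (ComplexShape.down ℕ) n ⋙
    CategoryTheory.Abelian.DoldKan.Γ ⋙ ofSimplicialGroup

/-- The map `A ⟶ X` that is constant at the base point. -/
def base (X : Sp) (A : SSet.{0}) : A ⟶ X.right :=
  SSet.stdSimplex.isTerminalObj₀.from A ≫ X.hom

theorem comp_base (X : Sp) {A B : SSet.{0}} (f : A ⟶ B) : f ≫ X.base B = X.base A := by
  rw [base, ← Category.assoc]
  exact congrArg (· ≫ X.hom) (SSet.stdSimplex.isTerminalObj₀.hom_ext _ _)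

theorem base_comp {X Y : Sp} (f : X ⟶ Y) (A : SSet.{0}) : X.base A ≫ f.right = Y.base A := by
  simp [base]

/-- The cosimplicial simplicial set `[k] ↦ Δ[k]`. -/
def simplex : SimplexCategory ⥤ SSet.{0} := SSet.stdSimplex

/-- The product of two pointed simplicial sets. -/
def prod (X Y : Sp) : Sp :=
  Under.mk (Y := X.right ⊗ Y.right) (CartesianMonoidalCategory.lift X.hom Y.hom)

/-- The loop space: its `k`-simplices are the maps `Δ[k] × Δ[1] ⟶ X` which send both
`Δ[k] × {0}` and `Δ[k] × {1}` to the base point, i.e. the pointed function complex of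
`Δ[1] / ∂Δ[1]` and `X`. -/
def loop (X : Sp) : Sp :=
  Under.mk (Y :=
    ({ obj := fun k => { h : simplex.obj k.unop ⊗ Δ[1] ⟶ X.right //
          SSet.ι₀ ≫ h = X.base _ ∧ SSet.ι₁ ≫ h = X.base _ }
       map := fun f => TypeCat.ofHom fun h =>
          ⟨(simplex.map f.unop ▷ Δ[1]) ≫ h.1, by
            rw [SSet.ι₀_comp_assoc, h.2.1, comp_base], by
            rw [SSet.ι₁_comp_assoc, h.2.2, comp_base]⟩
       map_id := fun k => by
        refine ConcreteCategory.hom_ext _ _ fun h => ?_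
        apply Subtype.ext
        change simplex.map (𝟙 _) ▷ _ ≫ h.1 = h.1
        rw [CategoryTheory.Functor.map_id, MonoidalCategory.id_whiskerRight, Category.id_comp]
       map_comp := fun f g => by
        refine ConcreteCategory.hom_ext _ _ fun h => ?_
        apply Subtype.ext
        change simplex.map (g.unop ≫ f.unop) ▷ _ ≫ h.1 = _ ▷ _ ≫ _ ▷ _ ≫ h.1
        rw [CategoryTheory.Functor.map_comp, MonoidalCategory.comp_whiskerRight, Category.assoc] } : SSet.{0}))
    { app := fun k => TypeCat.ofHom fun _ => ⟨X.base _, comp_base _ _, comp_base _ _⟩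
      naturality := fun k l f => by
        refine ConcreteCategory.hom_ext _ _ fun x => ?_
        apply Subtype.ext
        exact (X.comp_base (simplex.map f.unop ▷ Δ[1])).symm }

/-- Two pointed maps are homotopic (relative to the base point). -/
def Homotopic {X Y : Sp} (f g : X ⟶ Y) : Prop :=
  ∃ H : X.right ⊗ Δ[1] ⟶ Y.right,
    SSet.ι₀ ≫ H = f.right ∧ SSet.ι₁ ≫ H = g.right ∧ (X.hom ▷ Δ[1]) ≫ H = Y.base _

/-- Pointed homotopy equivalence `X ≃ Y`. -/
def HomotopyEquivalent (X Y : Sp) : Prop :=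
  ∃ (f : X ⟶ Y) (g : Y ⟶ X), Homotopic (f ≫ g) (𝟙 X) ∧ Homotopic (g ≫ f) (𝟙 Y)

/-- The diagram `c ↦ N(C/c)` of nerves of over categories. -/
def overNerve (C : Type) [SmallCategory C] : C ⥤ SSet.{0} :=
  Over.mapFunctor C ⋙ nerveFunctor

/-- The Bousfield–Kan homotopy limit of a diagram `X` of pointed simplicial sets: the function
complex of maps of diagrams from `c ↦ N(C/c)` to `X`. Its `k`-simplices are the natural
transformations from `c ↦ N(C/c) × Δ[k]` to `X`. -/
def holim {C : Type} [SmallCategory C] (X : C ⥤ Sp) : Sp :=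
  Under.mk (Y :=
    ({ obj := fun k => (overNerve C ⊗ (Functor.const C).obj (simplex.obj k.unop)) ⟶
        (X ⋙ Under.forget _)
       map := fun f => TypeCat.ofHom fun φ =>
        (overNerve C ◁ (Functor.const C).map (simplex.map f.unop)) ≫ φ
       map_id := fun k => by
        refine ConcreteCategory.hom_ext _ _ fun φ => ?_
        change _ ◁ (Functor.const C).map (simplex.map (𝟙 _)) ≫ φ = φ
        rw [CategoryTheory.Functor.map_id, CategoryTheory.Functor.map_id,
          MonoidalCategory.whiskerLeft_id, Category.id_comp]
       map_comp := fun f g => by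
        refine ConcreteCategory.hom_ext _ _ fun φ => ?_
        change _ ◁ (Functor.const C).map (simplex.map (g.unop ≫ f.unop)) ≫ φ =
          _ ◁ _ ≫ _ ◁ _ ≫ φ
        rw [CategoryTheory.Functor.map_comp, CategoryTheory.Functor.map_comp,
          MonoidalCategory.whiskerLeft_comp, Category.assoc] } : SSet.{0}))
    { app := fun k => TypeCat.ofHom fun _ =>
        { app := fun c => (X.obj c).base _
          naturality := fun c d f =>
            (comp_base _ _).trans (base_comp (X.map f) _).symm }
      naturality := fun k l f => by
        refine ConcreteCategory.hom_ext _ _ fun x => ?_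
        apply NatTrans.ext
        funext c
        exact (comp_base _ _).symm }

end Sp
end

/-- A link diagram is cut by horizontal lines into elementary slices, read from bottom to top.
Besides vertical strands, a slice contains exactly one of the following; positions of strands are
counted from the left, starting with `0`.
* `cup i`: a local minimum `∪`, whose two ends become the strands `i` and `i + 1` at the top;
* `cap i`: a local maximum `∩` joining the strands `i` and `i + 1` at the bottom;
* `cross i o`: a crossing of the strands `i` and `i + 1`; the over-strand is the one that rises
  from the lower left to the upper right if `o = true`, the other one if `o = false`. -/
inductive Slice where
  | cup (i : ℕ)
  | cap (i : ℕ)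
  | cross (i : ℕ) (risingOver : Bool)

namespace Slice

/-- The slice can be put on top of `n` strands. -/
def Fits : Slice → ℕ → Prop
  | cup i, n => i ≤ n
  | cap i, n => i + 2 ≤ n
  | cross i _, n => i + 2 ≤ n

/-- The number of strands above the slice, when there are `n` strands below it. -/
def top : Slice → ℕ → ℕ
  | cup _, n => n + 2
  | cap _, n => n - 2
  | cross _ _, n => n

/-- Is the slice a crossing? -/
def isCrossing : Slice → Bool
  | cross _ _ => true
  | _ => false

/-- The position of the leftmost strand taking part in the slice. -/
def pos : Slice → ℕ
  | cup i => i
  | cap i => i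
  | cross i _ => i

/-- Is the strand from the lower left to the upper right the over-strand? -/
def risingOver : Slice → Bool
  | cross _ o => o
  | _ => false

/-- A boundary point of a slice is written `(e, j)`: the point number `j` of the lower boundary
if `e = false`, of the upper boundary if `e = true`. In a slice whose crossing (if there is one) is
replaced by its `0`-smoothing (`r = false`) or its `1`-smoothing (`r = true`), every boundary point
is one end of an arc; `s.mate r a` is the other end of the arc at `a`.

For the crossing whose over-strand rises from the lower left to the upper right, the two arcs of
the `0`-smoothing are vertical, `) (`, and those of the `1`-smoothing are a cap and a cup. For the
crossing with the other over-strand it is the other way round. -/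
def mate (r : Bool) : Slice → Bool × ℕ → Bool × ℕ
  | cup i, (false, j) => (true, if j < i then j else j + 2)
  | cup i, (true, j) =>
      if j < i then (false, j) else if j = i then (true, i + 1)
      else if j = i + 1 then (true, i) else (false, j - 2)
  | cap i, (true, j) => (false, if j < i then j else j + 2)
  | cap i, (false, j) =>
      if j < i then (true, j) else if j = i then (false, i + 1)
      else if j = i + 1 then (false, i) else (true, j - 2)
  | cross i o, (e, j) =>
      if r = o then
        if j = i then (e, i + 1) else if j = i + 1 then (e, i) else (!e, j)
      else (!e, j)

/-- The other end of the strand at `a`, in the slice with its crossing unresolved. -/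
def strand : Slice → Bool × ℕ → Bool × ℕ
  | cross i _, (e, j) => (!e, if j = i then i + 1 else if j = i + 1 then i else j)
  | s, a => s.mate false a

/-- `a` is a boundary point of the slice `s` put on top of `n` strands. -/
def Valid (s : Slice) (n : ℕ) (a : Bool × ℕ) : Prop :=
  a.2 < if a.1 then s.top n else n

theorem mate_valid {s : Slice} {n : ℕ} (hs : s.Fits n) (r : Bool) {a : Bool × ℕ}
    (ha : s.Valid n a) : s.Valid n (s.mate r a) := by
  obtain ⟨e, j⟩ := a
  rcases s with i | i | ⟨i, o⟩ <;> cases e <;>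
    simp only [Fits, Valid, mate, top] at * <;> split_ifs <;> simp at * <;> omega

theorem strand_valid {s : Slice} {n : ℕ} (hs : s.Fits n) {a : Bool × ℕ}
    (ha : s.Valid n a) : s.Valid n (s.strand a) := by
  rcases s with i | i | ⟨i, o⟩
  · exact mate_valid hs false ha
  · exact mate_valid hs false ha
  · obtain ⟨e, j⟩ := a
    cases e <;> simp only [Fits, Valid, strand, top] at * <;> split_ifs <;> simp at * <;> omega

theorem mate_mate {s : Slice} {n : ℕ} (hs : s.Fits n) (r : Bool) {a : Bool × ℕ}
    (ha : s.Valid n a) : s.mate r (s.mate r a) = a := by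
  obtain ⟨e, j⟩ := a
  rcases s with i | i | ⟨i, o⟩ <;> cases e <;>
    simp only [Fits, Valid, mate, top] at * <;> grind [mate]

theorem mate_parity (s : Slice) (r : Bool) (a : Bool × ℕ) :
    (s.mate r a).1 = a.1 ↔ ((s.mate r a).2 + a.2) % 2 = 1 := by
  obtain ⟨e, j⟩ := a
  rcases s with i | i | ⟨i, o⟩ <;> cases e <;> simp only [mate] <;> split_ifs <;> simp <;> omega

end Slice

/-- The number of strands below slice number `k` (slices are numbered from `0`), when the stack
`w` of slices is put on top of `m` strands. -/
def width (m : ℕ) (w : List Slice) (k : ℕ) : ℕ :=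
  (w.take k).foldl (fun n s => s.top n) m

/-- A tangle diagram with `m` ends at the bottom and `n` ends at the top, given as a stack of
slices. Every link diagram in the plane is, up to planar isotopy, a `Tangle 0 0`. -/
structure Tangle (m n : ℕ) where
  slices : List Slice
  fits : ∀ k (h : k < slices.length), slices[k].Fits (width m slices k)
  top : width m slices slices.length = n

theorem width_succ (m : ℕ) (w : List Slice) (k : ℕ) (h : k < w.length) :
    width m w (k + 1) = w[k].top (width m w k) := by
  rw [width, width, ← List.take_concat_get' w k h, List.foldl_append]
  rfl

theorem width_append_left (m : ℕ) (v w : List Slice) (k : ℕ) (h : k ≤ v.length) :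
    width m (v ++ w) k = width m v k := by
  simp [width, List.take_append_of_le_length h]

theorem width_append_right (m n : ℕ) (v w : List Slice) (h : width m v v.length = n) (k : ℕ) :
    width m (v ++ w) (v.length + k) = width n w k := by
  subst h
  simp [width, List.take_append, List.take_of_length_le]

namespace Tangle

variable {l m n : ℕ}

/-- The number of slices. -/
abbrev height (T : Tangle m n) : ℕ := T.slices.length

/-- Slice number `k`. -/
def slice (T : Tangle m n) (k : Fin T.height) : Slice := T.slices[k]

theorem slice_fits (T : Tangle m n) (k : Fin T.height) :
    (T.slice k).Fits (width m T.slices k) := T.fits k k.2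

theorem width_succ (T : Tangle m n) (k : Fin T.height) :
    width m T.slices (k + 1) = (T.slice k).top (width m T.slices k) :=
  Khovanov.width_succ _ _ _ k.2

/-- The diagram `S` with the diagram `T` stacked on top of it. -/
def comp (S : Tangle l m) (T : Tangle m n) : Tangle l n where
  slices := S.slices ++ T.slices
  fits k h := by
    rcases lt_or_ge k S.slices.length with hk | hk
    · rw [List.getElem_append_left hk, width_append_left _ _ _ _ hk.le]
      exact S.fits k hk
    · obtain ⟨j, rfl⟩ := Nat.exists_eq_add_of_le hk
      rw [List.getElem_append_right hk, width_append_right _ _ _ _ S.top]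
      simpa using T.fits j (by simpa using h)
  top := by
    rw [List.length_append, width_append_right _ _ _ _ S.top]
    exact T.top

/-- Two strands hooked into each other by two crossings: a cap whose two legs are the two lower
ends and a cup whose two legs are the two upper ends, such that the top of the cap is pulled
over the bottom of the cup at one leg and under it at the other one. -/
def claspTangle : Tangle 2 2 where
  slices := [.cup 1, .cross 0 true, .cross 2 true, .cap 1]
  fits k h := by
    have : k < 4 := h
    interval_cases k <;> simp [width, Slice.Fits, Slice.top]
  top := rfl

/-- `D₁ # D₂`: the two ends of `D₁` are joined to the two ends of `D₂` by two parallel strands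
without crossings. Here `D₁` and `D₂` are the two link diagrams, each cut open at one point of
its outer boundary; `D₁` is drawn below `D₂`. -/
def sum (D₁ : Tangle 0 2) (D₂ : Tangle 2 0) : Tangle 0 0 := D₁.comp D₂

/-- `D₁ ## D₂`: the two ends of `D₁` are joined to each other by one strand, those of `D₂` by
another one, and the two strands are hooked into each other by two crossings. -/
def claspSum (D₁ : Tangle 0 2) (D₂ : Tangle 2 0) : Tangle 0 0 := D₁.comp (claspTangle.comp D₂)

/-- The crossings of a diagram, linearly ordered from bottom to top. -/
abbrev Crossing (T : Tangle m n) : Type := { k : Fin T.height // (T.slice k).isCrossing = true }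

/-- The points in which the diagram meets the horizontal lines separating the slices: `(k, j)` is
the point number `j` of the line below slice number `k`. -/
abbrev Point (T : Tangle m n) : Type := { p : ℕ × ℕ // p.1 ≤ T.height ∧ p.2 < width m T.slices p.1 }

instance (T : Tangle m n) : Finite T.Point := by
  let S : Finset (ℕ × ℕ) :=
    (Finset.range (T.height + 1)).biUnion fun k =>
      (Finset.range (width m T.slices k)).image fun j => (k, j)
  refine Finite.of_injective (β := S) (fun p => ⟨p.1, ?_⟩) ?_
  · simp only [S, Finset.mem_biUnion, Finset.mem_image, Finset.mem_range]
    exact ⟨p.1.1, by have := p.2.1; omega, p.1.2, p.2.2, rfl⟩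
  · intro p q h
    exact Subtype.ext (congrArg (fun z : S => z.1) h)

/-- The boundary point `a` of slice number `k`, as a point of the diagram. -/
def place (k : ℕ) (a : Bool × ℕ) : ℕ × ℕ := (k + a.1.toNat, a.2)

/-- Is the crossing in slice `k` a member of `x`, and therefore to be `1`-smoothed? -/
def resolution (T : Tangle m n) (x : Finset T.Crossing) (k : Fin T.height) : Bool :=
  decide (∃ c ∈ x, c.1 = k)

/-- In the smoothing of `T` in which the crossings in `x` are `1`-smoothed and the other ones are
`0`-smoothed, `p` and `q` are the two ends of an arc of some slice. -/
def Joined (T : Tangle m n) (x : Finset T.Crossing) (p q : T.Point) : Prop :=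
  ∃ (k : Fin T.height) (a : Bool × ℕ),
    p.1 = place k a ∧ q.1 = place k ((T.slice k).mate (T.resolution x k) a)

/-- The components (circles, for a link diagram) of the smoothing of `T` given by `x`. -/
def Circle (T : Tangle m n) (x : Finset T.Crossing) : Type := Quot (T.Joined x)

instance (T : Tangle m n) (x : Finset T.Crossing) : Finite (T.Circle x) :=
  Quot.finite _

/-- The circle through the point `p`. -/
def circle (T : Tangle m n) (x : Finset T.Crossing) (p : T.Point) : T.Circle x := Quot.mk _ p

theorem valid_place {T : Tangle m n} {k : Fin T.height} {a : Bool × ℕ} :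
    (T.slice k).Valid (width m T.slices k) a ↔ a.2 < width m T.slices (place k a).1 := by
  obtain ⟨e, j⟩ := a
  cases e <;> simp [Slice.Valid, place, width_succ]

/-- The lower left of the four points around a crossing. The `0`-smoothing and the `1`-smoothing
have one arc at this point and another one at the `upperRight` point. -/
def lowerLeft (T : Tangle m n) (c : T.Crossing) : T.Point :=
  ⟨(c.1, (T.slice c.1).pos), c.1.2.le, by
    have h := T.slice_fits c.1
    have h' := c.2
    rcases hs : T.slice c.1 with i | i | ⟨i, o⟩ <;>
      simp_all [Slice.Fits, Slice.isCrossing, Slice.pos]; omega⟩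

/-- The upper right of the four points around a crossing. -/
def upperRight (T : Tangle m n) (c : T.Crossing) : T.Point :=
  ⟨(c.1 + 1, (T.slice c.1).pos + 1), c.1.2, by
    have h := T.slice_fits c.1
    have h' := c.2
    have h'' := T.width_succ c.1
    rcases hs : T.slice c.1 with i | i | ⟨i, o⟩ <;>
      simp_all [Slice.Fits, Slice.isCrossing, Slice.pos, Slice.top]; omega⟩

end Tangle

section Permutations

variable {P : Type} [DecidableEq P]

/-- `p` and `q` become equivalent once `a` and `b` are identified. -/
def Linked (r : P → P → Prop) (a b p q : P) : Prop :=
  r p q ∨ (r p a ∧ r b q) ∨ (r p b ∧ r a q)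

theorem linked_of_sameCycle [Finite P] (σ : Equiv.Perm P) (a b p q : P)
    (h : (σ * Equiv.swap a b).SameCycle p q) : Linked σ.SameCycle a b p q := by
  obtain ⟨n, rfl⟩ := h.exists_nat_pow_eq
  clear h
  have refl : ∀ z, σ.SameCycle z z := fun z => Equiv.Perm.SameCycle.refl _ _
  induction n with
  | zero => exact Or.inl (by simpa using refl p)
  | succ n ih =>
    rw [pow_succ', Equiv.Perm.mul_apply]
    set z := ((σ * Equiv.swap a b) ^ n) p
    have key : ∀ u v, σ.SameCycle u v → σ.SameCycle u (σ v) := fun u v h =>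
      Equiv.Perm.sameCycle_apply_right.2 h
    rw [Equiv.Perm.mul_apply]
    rcases eq_or_ne z a with hza | hza
    · rw [hza] at ih ⊢
      rw [Equiv.swap_apply_left]
      rcases ih with h | ⟨h, h'⟩ | ⟨h, h'⟩
      · exact Or.inr (Or.inl ⟨h, key _ _ (refl _)⟩)
      · exact Or.inr (Or.inl ⟨h, key _ _ (refl _)⟩)
      · exact Or.inl (key _ _ h)
    · rcases eq_or_ne z b with hzb | hzb
      · rw [hzb] at ih ⊢
        rw [Equiv.swap_apply_right]
        rcases ih with h | ⟨h, h'⟩ | ⟨h, h'⟩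
        · exact Or.inr (Or.inr ⟨h, key _ _ (refl _)⟩)
        · exact Or.inl (key _ _ h)
        · exact Or.inr (Or.inr ⟨h, key _ _ (refl _)⟩)
      · rw [Equiv.swap_apply_of_ne_of_ne hza hzb]
        rcases ih with h | ⟨h, h'⟩ | ⟨h, h'⟩
        · exact Or.inl (key _ _ h)
        · exact Or.inr (Or.inl ⟨h, key _ _ h'⟩)
        · exact Or.inr (Or.inr ⟨h, key _ _ h'⟩)

theorem sameCycle_mul_swap [Finite P] (σ : Equiv.Perm P) {a b : P}
    (h : ¬ σ.SameCycle a b) : (σ * Equiv.swap a b).SameCycle a b := by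
  by_contra hc
  have key : ∀ n : ℕ, (σ * Equiv.swap a b).SameCycle a ((σ ^ (n + 1)) b) := by
    intro n
    induction n with
    | zero =>
      refine ⟨1, ?_⟩
      simp
    | succ n ih =>
      have hb : (σ ^ (n + 1)) b ≠ b := fun hb => hc (by rwa [hb] at ih)
      have ha : (σ ^ (n + 1)) b ≠ a := fun ha =>
        h (Equiv.Perm.SameCycle.symm ⟨((n + 1 : ℕ) : ℤ), by rw [zpow_natCast]; exact ha⟩)
      have := Equiv.Perm.sameCycle_apply_right.2 ih
      rwa [Equiv.Perm.mul_apply, Equiv.swap_apply_of_ne_of_ne ha hb, ← Equiv.Perm.mul_apply,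
        ← pow_succ'] at this
  obtain ⟨N, hN, hN'⟩ := (isOfFinOrder_of_finite σ).exists_pow_eq_one
  have := key (N - 1)
  rw [Nat.sub_add_cancel hN, hN', Equiv.Perm.one_apply] at this
  exact hc this

theorem not_sameCycle_mul_swap [Finite P] (σ : Equiv.Perm P) {a b : P} (hab : a ≠ b)
    (h : σ.SameCycle a b) : ¬ (σ * Equiv.swap a b).SameCycle a b := by
  classical
  intro hc
  have hex : ∃ n : ℕ, (σ ^ n) a = b := h.exists_nat_pow_eq
  let N := Nat.find hex
  have hN : (σ ^ N) a = b := Nat.find_spec hex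
  have hmin : ∀ i < N, (σ ^ i) a ≠ b := fun i hi => Nat.find_min hex hi
  have hNpos : 0 < N := by
    rcases Nat.eq_zero_or_pos N with h0 | h0
    · rw [h0] at hN
      exact absurd hN hab
    · exact h0
  have hne : ∀ i, 0 < i → i ≤ N → (σ ^ i) a ≠ a := by
    intro i hi hiN ha
    rcases hiN.eq_or_lt with rfl | hlt
    · exact hab (ha.symm.trans hN)
    · refine hmin (N - i) (by omega) ?_
      rw [← hN]
      conv_lhs => rw [← ha]
      rw [← Equiv.Perm.mul_apply, ← pow_add, Nat.sub_add_cancel hiN]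
  have hstep : ∀ z, (∃ i, 0 < i ∧ i ≤ N ∧ (σ ^ i) a = z) →
      ∃ i, 0 < i ∧ i ≤ N ∧ (σ ^ i) a = (σ * Equiv.swap a b) z := by
    rintro z ⟨i, hi, hiN, rfl⟩
    rw [Equiv.Perm.mul_apply]
    rcases hiN.eq_or_lt with rfl | hlt
    · refine ⟨1, one_pos, hNpos, ?_⟩
      rw [hN, Equiv.swap_apply_right, pow_one]
    · refine ⟨i + 1, by omega, hlt, ?_⟩
      rw [Equiv.swap_apply_of_ne_of_ne (hne i hi hiN) (hmin i hlt), pow_succ',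
        Equiv.Perm.mul_apply]
  obtain ⟨n, hn⟩ := hc.symm.exists_nat_pow_eq
  have : ∀ n : ℕ, ∃ i, 0 < i ∧ i ≤ N ∧ (σ ^ i) a = ((σ * Equiv.swap a b) ^ n) b := by
    intro n
    induction n with
    | zero => exact ⟨N, hNpos, le_rfl, hN⟩
    | succ n ih =>
      rw [pow_succ', Equiv.Perm.mul_apply]
      exact hstep _ ih
  obtain ⟨i, hi, hiN, hia⟩ := this n
  exact hne i hi hiN (hia.trans hn)

end Permutations

namespace Slice

/-- Colour the regions of the diagram like a checkerboard, and orient the arcs of every smoothing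
as boundaries of the black regions: the arc at `a` enters the slice at `a`. -/
def Inward (ε : ℕ) (a : Bool × ℕ) : Prop := (a.1.toNat + a.2 + ε) % 2 = 0

theorem inward_mate (s : Slice) (r : Bool) (a : Bool × ℕ) (ε : ℕ) :
    Inward ε (s.mate r a) ↔ ¬ Inward ε a := by
  have h := s.mate_parity r a
  unfold Inward
  rcases h1 : (s.mate r a).1 <;> rcases h2 : a.1 <;> simp [h1, h2] at h ⊢ <;> omega

end Slice

namespace Tangle

theorem exists_place {D : Tangle 0 0} (ε : ℕ) (p : D.Point) :
    ∃ (k : Fin D.height) (a : Bool × ℕ), Slice.Inward ε a ∧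
      (D.slice k).Valid (width 0 D.slices k) a ∧ p.1 = place k a := by
  obtain ⟨⟨k, j⟩, hk, hj⟩ := p
  simp only at hk hj
  by_cases h : (j + ε) % 2 = 0
  · have hk' : k < D.height := by
      rcases hk.eq_or_lt with rfl | h'
      · rw [D.top] at hj
        omega
      · exact h'
    refine ⟨⟨k, hk'⟩, (false, j), by simpa [Slice.Inward] using h, ?_, rfl⟩
    rw [valid_place]
    exact hj
  · rcases k with _ | k
    · simp [width] at hj
    · refine ⟨⟨k, hk⟩, (true, j), ?_, ?_, rfl⟩
      · simp [Slice.Inward]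
        omega
      · rw [valid_place]
        exact hj

theorem place_inj {D : Tangle 0 0} {ε : ℕ} {k l : Fin D.height} {a b : Bool × ℕ}
    (ha : Slice.Inward ε a) (hb : Slice.Inward ε b) (h : place k a = place l b) :
    k = l ∧ a = b := by
  obtain ⟨e, i⟩ := a
  obtain ⟨f, j⟩ := b
  simp only [place, Prod.mk.injEq, Slice.Inward] at *
  rw [Fin.ext_iff]
  obtain ⟨h1, rfl⟩ := h
  cases e <;> cases f <;> simp at * <;> omega

theorem place_valid {D : Tangle 0 0} {k : Fin D.height} {a : Bool × ℕ} {p : D.Point}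
    (h : p.1 = place k a) : (D.slice k).Valid (width 0 D.slices k) a := by
  rw [valid_place, ← h]
  have := p.2.2
  rw [h] at this ⊢
  exact this

theorem exists_next (D : Tangle 0 0) (x : Finset D.Crossing) (ε : ℕ) (p : D.Point) :
    ∃ q : D.Point, ∀ (k : Fin D.height) (a : Bool × ℕ), Slice.Inward ε a → p.1 = place k a →
      q.1 = place k ((D.slice k).mate (D.resolution x k) a) := by
  obtain ⟨k, a, ha, hv, hp⟩ := exists_place ε p
  refine ⟨⟨place k ((D.slice k).mate (D.resolution x k) a), ?_,
    valid_place.1 (Slice.mate_valid (D.slice_fits k) _ hv)⟩, ?_⟩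
  · have := k.2
    simp only [place]
    cases ((D.slice k).mate (D.resolution x k) a).1
    · simp
    · simp
  · intro l b hb hp'
    obtain ⟨rfl, rfl⟩ := place_inj ha hb (hp.symm.trans hp')
    rfl

/-- The point following `p` on its circle, in the checkerboard orientation. -/
noncomputable def next (D : Tangle 0 0) (x : Finset D.Crossing) (ε : ℕ) (p : D.Point) : D.Point :=
  (D.exists_next x ε p).choose

theorem next_eq (D : Tangle 0 0) (x : Finset D.Crossing) {ε : ℕ} {p : D.Point}
    {k : Fin D.height} {a : Bool × ℕ} (ha : Slice.Inward ε a) (hp : p.1 = place k a) :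
    (D.next x ε p).1 = place k ((D.slice k).mate (D.resolution x k) a) :=
  (D.exists_next x ε p).choose_spec k a ha hp

theorem next_next (D : Tangle 0 0) (x : Finset D.Crossing) {ε ε' : ℕ} (h : (ε + ε') % 2 = 1)
    (p : D.Point) : D.next x ε' (D.next x ε p) = p := by
  obtain ⟨k, a, ha, hv, hp⟩ := exists_place ε p
  apply Subtype.ext
  rw [D.next_eq x (k := k) (a := (D.slice k).mate (D.resolution x k) a) _ (D.next_eq x ha hp),
    Slice.mate_mate (D.slice_fits k) _ hv, hp]
  have := (not_congr (Slice.inward_mate (D.slice k) (D.resolution x k) a ε)).2 (not_not.2 ha)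
  unfold Slice.Inward at *
  omega

/-- Following the circles of a smoothing, in the checkerboard orientation. -/
noncomputable def nextPerm (D : Tangle 0 0) (x : Finset D.Crossing) (ε : ℕ) :
    Equiv.Perm D.Point where
  toFun := D.next x ε
  invFun := D.next x (ε + 1)
  left_inv := D.next_next x (by omega)
  right_inv := D.next_next x (by omega)

theorem joined_next (D : Tangle 0 0) (x : Finset D.Crossing) (ε : ℕ) (p : D.Point) :
    D.Joined x p (D.next x ε p) := by
  obtain ⟨k, a, ha, hv, hp⟩ := exists_place ε p
  exact ⟨k, a, hp, D.next_eq x ha hp⟩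

theorem circle_eq_iff (D : Tangle 0 0) (x : Finset D.Crossing) (ε : ℕ) (p q : D.Point) :
    D.circle x p = D.circle x q ↔ (D.nextPerm x ε).SameCycle p q := by
  constructor
  · intro h
    replace h := Quot.eq.1 h
    induction h with
    | rel p q h =>
      obtain ⟨k, a, hp, hq⟩ := h
      by_cases ha : Slice.Inward ε a
      · refine ⟨1, ?_⟩
        rw [zpow_one]
        exact Subtype.ext ((D.next_eq x ha hp).trans hq.symm)
      · refine Equiv.Perm.SameCycle.symm ⟨1, ?_⟩
        rw [zpow_one]
        apply Subtype.ext
        change (D.next x ε q).1 = _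
        rw [D.next_eq x (((D.slice k).inward_mate _ a ε).2 ha) hq,
          Slice.mate_mate (D.slice_fits k) _ (place_valid hp), hp]
    | refl p => exact Equiv.Perm.SameCycle.refl _ _
    | symm p q _ ih => exact ih.symm
    | trans p q r _ _ ih ih' => exact ih.trans ih'
  · intro h
    obtain ⟨n, rfl⟩ := h.exists_nat_pow_eq
    clear h
    induction n with
    | zero => rfl
    | succ n ih =>
      rw [pow_succ', Equiv.Perm.mul_apply]
      exact ih.trans (Quot.sound (D.joined_next x ε _))

theorem resolution_of_mem {D : Tangle 0 0} {x : Finset D.Crossing} {c : D.Crossing} (h : c ∈ x) :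
    D.resolution x c.1 = true := by
  simp only [resolution, decide_eq_true_eq]
  exact ⟨c, h, rfl⟩

theorem resolution_of_notMem {D : Tangle 0 0} {x : Finset D.Crossing} {c : D.Crossing}
    (h : c ∉ x) : D.resolution x c.1 = false := by
  simp only [resolution, decide_eq_false_iff_not]
  rintro ⟨d, hd, h'⟩
  exact h (Subtype.ext h' ▸ hd)

theorem resolution_insert_of_ne {D : Tangle 0 0} {x : Finset D.Crossing} {c : D.Crossing}
    {k : Fin D.height} (h : k ≠ c.1) : D.resolution (insert c x) k = D.resolution x k := by
  simp only [resolution]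
  congr 1
  simp [Ne.symm h]

theorem lowerLeft_ne_upperRight {D : Tangle 0 0} (c : D.Crossing) :
    D.lowerLeft c ≠ D.upperRight c := by
  intro h
  have := congrArg (fun p : D.Point => p.1.1) h
  simp [lowerLeft, upperRight] at this

theorem nextPerm_insert (D : Tangle 0 0) {x : Finset D.Crossing} {c : D.Crossing} (h : c ∉ x) :
    D.nextPerm (insert c x) (D.slice c.1).pos = D.nextPerm x (D.slice c.1).pos *
      (Equiv.swap (D.lowerLeft c) (D.upperRight c) : Equiv.Perm D.Point) := by
  obtain ⟨i, o, hs⟩ : ∃ i o, D.slice c.1 = .cross i o := by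
    have := c.2
    rcases hs : D.slice c.1 with i | i | ⟨i, o⟩ <;> simp [hs, Slice.isCrossing] at this ⊢
  have hpos : (D.slice c.1).pos = i := by rw [hs]; rfl
  have hl : (D.lowerLeft c).1 = place c.1 (false, i) := by simp [lowerLeft, place, hpos]
  have hu : (D.upperRight c).1 = place c.1 (true, i + 1) := by simp [upperRight, place, hpos]
  have hli : Slice.Inward i (false, i) := by simp [Slice.Inward]; omega
  have hui : Slice.Inward i (true, i + 1) := by simp [Slice.Inward]; omega
  rw [hpos]
  ext1 p
  rw [Equiv.Perm.mul_apply]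
  apply Subtype.ext
  change (D.next _ _ _).1 = (D.next _ _ _).1
  obtain ⟨k, a, ha, hv, hp⟩ := exists_place i p
  rcases eq_or_ne p (D.lowerLeft c) with rfl | hpl
  · rw [Equiv.swap_apply_left, D.next_eq _ hli hl, D.next_eq _ hui hu,
      resolution_of_notMem h, resolution_of_mem (Finset.mem_insert_self _ _), hs]
    cases o <;> simp [Slice.mate]
  rcases eq_or_ne p (D.upperRight c) with rfl | hpu
  · rw [Equiv.swap_apply_right, D.next_eq _ hli hl, D.next_eq _ hui hu,
      resolution_of_notMem h, resolution_of_mem (Finset.mem_insert_self _ _), hs]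
    cases o <;> simp [Slice.mate]
  rw [Equiv.swap_apply_of_ne_of_ne hpl hpu, D.next_eq _ ha hp, D.next_eq _ ha hp]
  rcases eq_or_ne k c.1 with rfl | hk
  · rw [resolution_of_notMem h, resolution_of_mem (Finset.mem_insert_self _ _), hs]
    have h1 : a ≠ (false, i) := fun h => hpl (Subtype.ext (by rw [hp, hl, h]))
    have h2 : a ≠ (true, i + 1) := fun h => hpu (Subtype.ext (by rw [hp, hu, h]))
    obtain ⟨e, j⟩ := a
    have hj : j ≠ i ∧ j ≠ i + 1 := by
      unfold Slice.Inward at ha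
      cases e <;> simp at ha h1 h2 <;> omega
    cases o <;> simp [Slice.mate, hj.1, hj.2]
  · rw [resolution_insert_of_ne hk]

end Tangle

noncomputable section

open TensorProduct

/-- The ring `V = ℤ[u] / (u ^ 2)`, free on `1` and `u`. -/
def V : Type := DualNumber ℤ

instance : CommRing V := inferInstanceAs (CommRing (DualNumber ℤ))

/-- The generator `u` of `V`. -/
def u : V := (DualNumber.eps : DualNumber ℤ)

theorem u_mul_u : u * u = 0 := DualNumber.eps_mul_eps

theorem dualNumber_eq (v : DualNumber ℤ) : ∃ a b : ℤ, v = (a : DualNumber ℤ) + (b : DualNumber ℤ) * DualNumber.eps := by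
  refine ⟨v.fst, v.snd, ?_⟩
  ext <;> simp

theorem V_eq (v : V) : ∃ a b : ℤ, v = a + b * u := dualNumber_eq v

/-- The tensor power of `V` with one factor for each element of `S`. -/
abbrev Tensor (S : Type) : Type := ⨂[ℤ] _ : S, V

open Classical in
/-- `v` in the tensor factor number `s`, and `1` in all the other ones. -/
def factor {S : Type} (s : S) : V →ₐ[ℤ] Tensor S := PiTensorProduct.singleAlgHom (R := ℤ) (A := fun _ : S => V) s

/-- The map `⨂ v_s ↦ ∏ v_s` which multiplies together all the factors with the same image
under `f`. -/
def pushforward {S T : Type} [Finite S] (f : S → T) : Tensor S →ₐ[ℤ] Tensor T :=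
  letI := Fintype.ofFinite S
  PiTensorProduct.liftAlgHom
    ((MultilinearMap.mkPiAlgebra ℤ S (Tensor T)).compLinearMap fun s => (factor (f s)).toLinearMap)
    (by simp) (by intro v w; simp [Finset.prod_mul_distrib])

theorem pushforward_tprod {S T : Type} [inst : Fintype S] (f : S → T) (v : S → V) :
    pushforward f (PiTensorProduct.tprod ℤ v) = ∏ s, factor (f s) (v s) := by
  have h : ∀ i : Fintype S, (@Finset.univ S i).prod (fun s => factor (f s) (v s)) =
      (@Finset.univ S inst).prod (fun s => factor (f s) (v s)) := by
    intro i
    rw [Subsingleton.elim i inst]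
  refine (PiTensorProduct.lift.tprod v).trans ?_
  exact h (Fintype.ofFinite S)

theorem tensor_ext {S : Type} [Finite S] {M : Type} [AddCommGroup M] {f g : Tensor S →+ M}
    (h : ∀ v : S → V, f (PiTensorProduct.tprod ℤ v) = g (PiTensorProduct.tprod ℤ v)) : f = g := by
  have : f.toIntLinearMap = g.toIntLinearMap := PiTensorProduct.ext (MultilinearMap.ext h)
  ext r
  exact congrArg (fun φ : Tensor S →ₗ[ℤ] M => φ r) this

theorem pushforward_id {S : Type} [Finite S] (r : Tensor S) : pushforward (fun s : S => s) r = r := by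
  classical
  have : (pushforward (fun s : S => s)) = AlgHom.id ℤ (Tensor S) := by
    let _ := Fintype.ofFinite S
    apply AlgHom.toLinearMap_injective
    refine PiTensorProduct.ext (MultilinearMap.ext fun v => ?_)
    simp only [LinearMap.compMultilinearMap_apply, AlgHom.toLinearMap_apply, pushforward_tprod,
      AlgHom.id_apply]
    simp only [factor, PiTensorProduct.singleAlgHom_apply]
    rw [← PiTensorProduct.tprod_prod]
    congr 1
    ext s : 1
    rw [Finset.prod_apply, Finset.prod_eq_single s]
    · simp [MonoidHom.mulSingle_apply]
    · intro b _ hb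
      rw [MonoidHom.mulSingle_apply, Pi.mulSingle_eq_of_ne hb.symm]
    · simp
  rw [this]
  rfl

theorem pushforward_factor {S T : Type} [Finite S] (f : S → T) (s : S) (v : V) :
    pushforward f (factor s v) = factor (f s) v := by
  classical
  let _ := Fintype.ofFinite S
  simp only [factor, PiTensorProduct.singleAlgHom_apply]
  rw [pushforward_tprod, Finset.prod_eq_single s]
  · simp [factor]
  · intro b _ hb
    simp [Pi.mulSingle_eq_of_ne hb]
  · simp

theorem pushforward_mul_congr {S T : Type} [Finite S] (f g : S → T) (θ : Tensor T)
    (h : ∀ s v, factor (f s) v * θ = factor (g s) v * θ) (r : Tensor S) :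
    pushforward f r * θ = pushforward g r * θ := by
  let _ := Fintype.ofFinite S
  have key : (AddMonoidHom.mulRight θ).comp (pushforward f).toRingHom.toAddMonoidHom =
      (AddMonoidHom.mulRight θ).comp (pushforward g).toRingHom.toAddMonoidHom := by
    refine tensor_ext fun v => ?_
    change pushforward f _ * θ = pushforward g _ * θ
    rw [pushforward_tprod, pushforward_tprod]
    induction (Finset.univ : Finset S) using Finset.cons_induction with
    | empty => rfl
    | cons s t _ ih =>
      rw [Finset.prod_cons, Finset.prod_cons, mul_assoc, ih, mul_left_comm, h, mul_left_comm,
        mul_assoc]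
  exact congrArg (fun φ : Tensor S →+ Tensor T => φ r) key

theorem pushforward_pushforward {S T U : Type} [Finite S] [Finite T] (f : S → T) (g : T → U)
    (r : Tensor S) : pushforward g (pushforward f r) = pushforward (g ∘ f) r := by
  let _ := Fintype.ofFinite S
  have key : (pushforward g).toRingHom.toAddMonoidHom.comp (pushforward f).toRingHom.toAddMonoidHom =
      (pushforward (g ∘ f)).toRingHom.toAddMonoidHom := by
    refine tensor_ext fun v => ?_
    change pushforward g (pushforward f _) = pushforward (g ∘ f) _
    rw [pushforward_tprod, pushforward_tprod, map_prod]
    simp [pushforward_factor]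
  exact congrArg (fun φ : Tensor S →+ Tensor U => φ r) key

/-- `Δ(1) = 1 ⊗ u + u ⊗ 1` in the two factors `a` and `b`. The comultiplication `Δ` of `V`, given
by `Δ(1) = 1 ⊗ u + u ⊗ 1` and `Δ(u) = u ⊗ u`, is `Δ(v) = (v ⊗ 1) * Δ(1) = (1 ⊗ v) * Δ(1)`. -/
def comulOne {S : Type} (a b : S) : Tensor S := factor a u + factor b u

theorem factor_mul_comulOne {S : Type} (a b : S) (v : V) :
    factor a v * comulOne a b = factor b v * comulOne a b := by
  obtain ⟨m, n, rfl⟩ := V_eq v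
  have ha : factor a u * factor a u = 0 := by rw [← map_mul, u_mul_u, map_zero]
  have hb : factor b u * factor b u = 0 := by rw [← map_mul, u_mul_u, map_zero]
  simp only [map_add, map_mul, map_intCast, comulOne]
  linear_combination (n : Tensor S) * ha - (n : Tensor S) * hb

namespace Tangle

variable {m n : ℕ}

/-- Changing the crossing `c` from a `0`-smoothing to a `1`-smoothing splits a circle of the
smoothing `x` into two (and does not merge two circles into one). -/
def Bifurcates (T : Tangle m n) (x : Finset T.Crossing) (c : T.Crossing) : Prop :=
  T.circle x (T.lowerLeft c) = T.circle x (T.upperRight c)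

open Classical in
/-- Those crossings of a list at which a circle splits, when one starts from the smoothing `x` and
changes the crossings of the list one by one. -/
def splits (T : Tangle m n) : Finset T.Crossing → List T.Crossing → List T.Crossing
  | _, [] => []
  | x, c :: l => if T.Bifurcates x c then c :: T.splits (insert c x) l else T.splits (insert c x) l

/-- The product of the elements `Δ(1)` for the crossings of a list. -/
def comulFactor (T : Tangle m n) (y : Finset T.Crossing) (l : List T.Crossing) :
    Tensor (T.Circle y) :=
  (l.map fun c => comulOne (T.circle y (T.lowerLeft c)) (T.circle y (T.upperRight c))).prod

/-- The map of the Khovanov cube from the smoothing `x` to the smoothing `y ⊇ x`. The crossings in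
`y \ x` are changed one by one; if two circles merge, then the two factors are multiplied by
`m : V ⊗ V → V`, and if a circle splits in two, then `Δ : V → V ⊗ V` is applied to its factor.

As `Δ(v) = (v ⊗ 1) * Δ(1)`, the composition of these maps moves the factor of each circle `C` of
`x` to one circle of `y` meeting `C`, and multiplies by the `Δ(1)` of all the splittings. The
choices do not matter (see `factor_mul_comulFactor` and `comulFactor_perm`). -/
def cubeMap (T : Tangle m n) (x y : Finset T.Crossing) :
    Tensor (T.Circle x) →+ Tensor (T.Circle y) :=
  (AddMonoidHom.mulRight (T.comulFactor y (T.splits x ((y \ x).sort (· ≤ ·))))).comp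
    (pushforward fun C => T.circle y C.out : Tensor (T.Circle x) →ₐ[ℤ] Tensor (T.Circle y))

theorem circle_insert_iff (D : Tangle 0 0) {x : Finset D.Crossing} {c : D.Crossing} (h : c ∉ x) :
    D.Bifurcates x c ↔ ¬ D.Bifurcates (insert c x) c := by
  classical
  have h1 := D.circle_eq_iff x (D.slice c.1).pos (D.lowerLeft c) (D.upperRight c)
  have h2 := D.circle_eq_iff (insert c x) (D.slice c.1).pos (D.lowerLeft c) (D.upperRight c)
  unfold Bifurcates
  rw [h1, h2, D.nextPerm_insert h]
  refine ⟨not_sameCycle_mul_swap _ (lowerLeft_ne_upperRight c), fun h' => ?_⟩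
  by_contra hc
  exact h' (sameCycle_mul_swap _ hc)

theorem linked_insert (D : Tangle 0 0) {x : Finset D.Crossing} {c : D.Crossing} (h : c ∉ x)
    {p q : D.Point} (hpq : D.circle (insert c x) p = D.circle (insert c x) q) :
    Linked (fun p q => D.circle x p = D.circle x q) (D.lowerLeft c) (D.upperRight c) p q := by
  classical
  have h1 := D.circle_eq_iff x (D.slice c.1).pos
  have h2 := (D.circle_eq_iff (insert c x) (D.slice c.1).pos p q).1 hpq
  rw [D.nextPerm_insert h] at h2
  have := linked_of_sameCycle _ _ _ _ _ h2
  unfold Linked at *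
  simpa only [h1] using this

theorem linked_of_insert (D : Tangle 0 0) {x : Finset D.Crossing} {c : D.Crossing} (h : c ∉ x)
    {p q : D.Point} (hpq : D.circle x p = D.circle x q) :
    Linked (fun p q => D.circle (insert c x) p = D.circle (insert c x) q)
      (D.lowerLeft c) (D.upperRight c) p q := by
  classical
  have h1 := D.circle_eq_iff (insert c x) (D.slice c.1).pos
  have h2 := (D.circle_eq_iff x (D.slice c.1).pos p q).1 hpq
  have h3 : D.nextPerm x (D.slice c.1).pos = D.nextPerm (insert c x) (D.slice c.1).pos *
      (Equiv.swap (D.lowerLeft c) (D.upperRight c) : Equiv.Perm D.Point) := by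
    rw [D.nextPerm_insert h, mul_assoc, Equiv.swap_mul_self, mul_one]
  rw [h3] at h2
  have := linked_of_sameCycle _ _ _ _ _ h2
  unfold Linked at *
  simpa only [h1] using this

theorem circle_insert_of_not (D : Tangle 0 0) {x : Finset D.Crossing} {c : D.Crossing} (h : c ∉ x)
    (hb : ¬ D.Bifurcates x c) {p q : D.Point} (hpq : D.circle x p = D.circle x q) :
    D.circle (insert c x) p = D.circle (insert c x) q := by
  have hb' : D.Bifurcates (insert c x) c := by
    by_contra h'
    exact hb ((D.circle_insert_iff h).2 h')
  rcases D.linked_of_insert h hpq with h1 | ⟨h1, h2⟩ | ⟨h1, h2⟩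
  · exact h1
  · exact h1.trans (hb'.trans h2)
  · exact h1.trans (hb'.symm.trans h2)

theorem circle_of_insert (D : Tangle 0 0) {x : Finset D.Crossing} {c : D.Crossing} (h : c ∉ x)
    (hb : D.Bifurcates x c) {p q : D.Point}
    (hpq : D.circle (insert c x) p = D.circle (insert c x) q) :
    D.circle x p = D.circle x q := by
  rcases D.linked_insert h hpq with h1 | ⟨h1, h2⟩ | ⟨h1, h2⟩
  · exact h1
  · exact h1.trans (hb.trans h2)
  · exact h1.trans (hb.symm.trans h2)

@[simp] theorem comulFactor_nil (T : Tangle m n) (y : Finset T.Crossing) :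
    T.comulFactor y [] = 1 := rfl

@[simp] theorem comulFactor_cons (T : Tangle m n) (y : Finset T.Crossing) (c : T.Crossing)
    (l : List T.Crossing) : T.comulFactor y (c :: l) =
      comulOne (T.circle y (T.lowerLeft c)) (T.circle y (T.upperRight c)) * T.comulFactor y l := by
  simp [comulFactor]

theorem comulFactor_append (T : Tangle m n) (y : Finset T.Crossing) (l l' : List T.Crossing) :
    T.comulFactor y (l ++ l') = T.comulFactor y l * T.comulFactor y l' := by
  simp [comulFactor]

theorem splits_append (T : Tangle m n) (x : Finset T.Crossing) (l l' : List T.Crossing) :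
    T.splits x (l ++ l') = T.splits x l ++ T.splits (x ∪ l.toFinset) l' := by
  induction l generalizing x with
  | nil => simp [splits]
  | cons c l ih =>
    have : x ∪ (c :: l).toFinset = insert c x ∪ l.toFinset := by
      ext d
      simp
    simp only [List.cons_append, splits, ih, this]
    split_ifs <;> simp

theorem factor_mul_comulFactor (D : Tangle 0 0) (y x : Finset D.Crossing) (l : List D.Crossing)
    (hl : l.Nodup) (hx : ∀ c ∈ l, c ∉ x) (hy : y = x ∪ l.toFinset) {p q : D.Point}
    (hpq : D.circle x p = D.circle x q) (v : V) :
    factor (D.circle y p) v * D.comulFactor y (D.splits x l) =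
      factor (D.circle y q) v * D.comulFactor y (D.splits x l) := by
  induction l generalizing x p q with
  | nil =>
    obtain rfl : y = x := by simpa using hy
    rw [hpq]
  | cons c l ih =>
    have hc : c ∉ x := hx c (by simp)
    have ih' := fun {p q : D.Point} (h : D.circle (insert c x) p = D.circle (insert c x) q) =>
      ih (insert c x) (List.nodup_cons.1 hl).2 (fun d hd hd' => by
        rcases Finset.mem_insert.1 hd' with rfl | h
        · exact (List.nodup_cons.1 hl).1 hd
        · exact hx d (by simp [hd]) h) (by rw [hy]; ext d; simp) h
    by_cases hb : D.Bifurcates x c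
    · simp only [splits, if_pos hb, comulFactor_cons]
      set Θ := D.comulFactor y (D.splits (insert c x) l)
      have hΔ := factor_mul_comulOne (D.circle y (D.lowerLeft c)) (D.circle y (D.upperRight c)) v
      set θ := comulOne (D.circle y (D.lowerLeft c)) (D.circle y (D.upperRight c))
      rcases D.linked_of_insert hc hpq with h1 | ⟨h1, h2⟩ | ⟨h1, h2⟩
      · rw [mul_left_comm, ih' h1, mul_left_comm]
      · rw [mul_left_comm, ih' h1, mul_left_comm, ← mul_assoc, hΔ, mul_assoc, mul_left_comm,
          ih' h2, mul_left_comm]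
      · rw [mul_left_comm, ih' h1, mul_left_comm, ← mul_assoc, ← hΔ, mul_assoc, mul_left_comm,
          ih' h2, mul_left_comm]
    · simp only [splits, if_neg hb]
      exact ih' (D.circle_insert_of_not hc hb hpq)

theorem square (D : Tangle 0 0) {x : Finset D.Crossing} {c d : D.Crossing} (hc : c ∉ x)
    (hd : d ∉ x) (hcd : c ≠ d) (h1 : D.Bifurcates x c) (h2 : ¬ D.Bifurcates (insert d x) c) :
    D.Bifurcates x d ∧ ¬ D.Bifurcates (insert c x) d ∧
      D.circle (insert c (insert d x)) (D.lowerLeft c) =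
        D.circle (insert c (insert d x)) (D.lowerLeft d) ∧
      D.circle (insert c (insert d x)) (D.upperRight c) =
        D.circle (insert c (insert d x)) (D.upperRight d) := by
  have hcd' : c ∉ insert d x := by simp [hcd, hc]
  have hdc' : d ∉ insert c x := by simp [hcd.symm, hd]
  have hd1 : D.Bifurcates x d := by
    by_contra h
    exact h2 (D.circle_insert_of_not hd h h1)
  have hcb : D.Bifurcates (insert c (insert d x)) c := by
    by_contra h
    exact h2 ((D.circle_insert_iff hcd').2 h)
  have hle := fun {p q : D.Point} (h : D.circle (insert d x) p = D.circle (insert d x) q) =>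
    D.circle_insert_of_not hcd' h2 h
  have key : D.Bifurcates (insert c (insert d x)) d ∧
      D.circle (insert c (insert d x)) (D.lowerLeft c) =
        D.circle (insert c (insert d x)) (D.lowerLeft d) := by
    rcases D.linked_of_insert hd h1 with h | ⟨h, h'⟩ | ⟨h, h'⟩
    · exact absurd h h2
    · exact ⟨(hle h).symm.trans (hcb.trans (hle h').symm), hle h⟩
    · exact ⟨(hle h').trans (hcb.symm.trans (hle h)), hcb.trans (hle h').symm⟩
  refine ⟨hd1, ?_, key.2, hcb.symm.trans (key.2.trans key.1)⟩
  rw [D.circle_insert_iff hdc', Finset.insert_comm]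
  exact not_not.2 key.1

theorem square' (D : Tangle 0 0) {x : Finset D.Crossing} {c d : D.Crossing} (hc : c ∉ x)
    (hd : d ∉ x) (hcd : c ≠ d) (h1 : ¬ D.Bifurcates x c) (h2 : D.Bifurcates (insert d x) c) :
    ¬ D.Bifurcates x d ∧ D.Bifurcates (insert c x) d ∧
      ((D.circle (insert c (insert d x)) (D.lowerLeft c) =
        D.circle (insert c (insert d x)) (D.lowerLeft d) ∧
      D.circle (insert c (insert d x)) (D.upperRight c) =
        D.circle (insert c (insert d x)) (D.upperRight d)) ∨
      (D.circle (insert c (insert d x)) (D.lowerLeft c) =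
        D.circle (insert c (insert d x)) (D.upperRight d) ∧
      D.circle (insert c (insert d x)) (D.upperRight c) =
        D.circle (insert c (insert d x)) (D.lowerLeft d))) := by
  have hcd' : c ∉ insert d x := by simp [hcd, hc]
  have hdc' : d ∉ insert c x := by simp [hcd.symm, hd]
  have hd1 : ¬ D.Bifurcates x d := fun h => h1 (D.circle_of_insert hd h h2)
  have hcb : ¬ D.Bifurcates (insert c (insert d x)) c := (D.circle_insert_iff hcd').1 h2
  have hd2 : D.Bifurcates (insert d x) d := by
    by_contra h
    exact hd1 ((D.circle_insert_iff hd).2 h)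
  have hc2 : D.Bifurcates (insert c x) c := by
    by_contra h
    exact h1 ((D.circle_insert_iff hc).2 h)
  have hle := fun {p q : D.Point} (h : D.circle x p = D.circle x q) =>
    D.circle_insert_of_not hc h1 h
  have hb : D.Bifurcates (insert c x) d := by
    rcases D.linked_insert hd h2 with h | ⟨h, h'⟩ | ⟨h, h'⟩
    · exact absurd h h1
    · exact (hle h).symm.trans (hc2.trans (hle h').symm)
    · exact (hle h').trans (hc2.symm.trans (hle h))
  refine ⟨hd1, hb, ?_⟩
  have hdb : ¬ D.Bifurcates (insert c (insert d x)) d := by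
    rw [Finset.insert_comm]
    exact (D.circle_insert_iff hdc').1 hb
  rcases D.linked_of_insert hcd' hd2 with h | ⟨h, h'⟩ | ⟨h, h'⟩
  · exact absurd h hdb
  · exact Or.inl ⟨h.symm, h'⟩
  · exact Or.inr ⟨h', h.symm⟩

theorem factor_comul_congr (D : Tangle 0 0) (y : Finset D.Crossing) (Θ : Tensor (D.Circle y))
    (a b a' b' : D.Point)
    (h : factor (D.circle y a) u * Θ = factor (D.circle y a') u * Θ)
    (h' : factor (D.circle y b) u * Θ = factor (D.circle y b') u * Θ) :
    comulOne (D.circle y a) (D.circle y b) * Θ = comulOne (D.circle y a') (D.circle y b') * Θ := by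
  rw [comulOne, comulOne, add_mul, add_mul, h, h']

theorem comulFactor_perm (D : Tangle 0 0) (y : Finset D.Crossing) {l l' : List D.Crossing}
    (hp : l.Perm l') (x : Finset D.Crossing) (hl : l.Nodup) (hx : ∀ c ∈ l, c ∉ x)
    (hy : y = x ∪ l.toFinset) :
    D.comulFactor y (D.splits x l) = D.comulFactor y (D.splits x l') := by
  induction hp generalizing x with
  | nil => rfl
  | cons c _ ih =>
    have ih' := ih (insert c x) (List.nodup_cons.1 hl).2 (fun d hd hd' => by
        rcases Finset.mem_insert.1 hd' with rfl | h
        · exact (List.nodup_cons.1 hl).1 hd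
        · exact hx d (by simp [hd]) h) (by rw [hy]; ext d; simp)
    simp only [splits]
    split_ifs
    · rw [comulFactor_cons, comulFactor_cons, ih']
    · exact ih'
  | swap c d l =>
    have hcd : c ≠ d := by
      rintro rfl
      simp at hl
    have hc : c ∉ x := hx c (by simp)
    have hd : d ∉ x := hx d (by simp)
    have hrest := fun {p q : D.Point}
        (h : D.circle (insert c (insert d x)) p = D.circle (insert c (insert d x)) q) =>
      D.factor_mul_comulFactor y (insert c (insert d x)) l (by simp at hl; tauto) (by
        intro e he he'
        simp only [Finset.mem_insert] at he'
        rcases he' with rfl | rfl | h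
        · simp [he] at hl
        · simp [he] at hl
        · exact hx e (by simp [he]) h) (by rw [hy]; ext e; simp; tauto) h u
    simp only [splits, Finset.insert_comm d c]
    by_cases h1 : D.Bifurcates x c <;> by_cases h2 : D.Bifurcates (insert d x) c
    · by_cases h3 : D.Bifurcates x d <;> by_cases h4 : D.Bifurcates (insert c x) d
      · simp only [if_pos h1, if_pos h2, if_pos h3, if_pos h4, comulFactor_cons]
        rw [mul_left_comm]
      · exact absurd h2 (D.square hd hc hcd.symm h3 h4).2.1
      · exact absurd h1 (D.square' hd hc hcd.symm h3 h4).1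
      · simp only [if_pos h1, if_pos h2, if_neg h3, if_neg h4, comulFactor_cons]
    · obtain ⟨h3, h4, h5, h6⟩ := D.square hc hd hcd h1 h2
      simp only [if_pos h1, if_neg h2, if_pos h3, if_neg h4, comulFactor_cons]
      exact D.factor_comul_congr y _ _ _ _ _ (hrest h5.symm) (hrest h6.symm)
    · obtain ⟨h3, h4, h5⟩ := D.square' hc hd hcd h1 h2
      simp only [if_neg h1, if_pos h2, if_neg h3, if_pos h4, comulFactor_cons]
      rcases h5 with ⟨h5, h6⟩ | ⟨h5, h6⟩
      · exact D.factor_comul_congr y _ _ _ _ _ (hrest h5) (hrest h6)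
      · rw [D.factor_comul_congr y _ _ _ _ _ (hrest h5) (hrest h6), comulOne, comulOne, add_comm]
    · by_cases h3 : D.Bifurcates x d <;> by_cases h4 : D.Bifurcates (insert c x) d
      · simp only [if_neg h1, if_neg h2, if_pos h3, if_pos h4, comulFactor_cons]
      · exact absurd (D.square hd hc hcd.symm h3 h4).1 h1
      · exact absurd (D.square' hd hc hcd.symm h3 h4).2.1 h2
      · simp only [if_neg h1, if_neg h2, if_neg h3, if_neg h4]
  | trans h1 h2 ih1 ih2 =>
    rw [ih1 x hl hx hy, ih2 x (h1.nodup_iff.1 hl) (fun c hc => hx c (h1.mem_iff.2 hc))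
      (by rw [hy, List.toFinset_eq_of_perm _ _ h1])]

theorem cubeMap_self (D : Tangle 0 0) (x : Finset D.Crossing) (r : Tensor (D.Circle x)) :
    D.cubeMap x x r = r := by
  have : (fun C : D.Circle x => D.circle x C.out) = fun C => C := by
    funext C
    exact Quot.out_eq C
  change pushforward _ r * D.comulFactor x (D.splits x ((x \ x).sort (· ≤ ·))) = r
  rw [this, pushforward_id, Finset.sdiff_self, Finset.sort_empty]
  simp [splits]

theorem cubeMap_cubeMap (D : Tangle 0 0) {x y z : Finset D.Crossing} (hxy : x ⊆ y) (hyz : y ⊆ z)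
    (r : Tensor (D.Circle x)) : D.cubeMap y z (D.cubeMap x y r) = D.cubeMap x z r := by
  change pushforward _ (pushforward _ r * _) * _ = pushforward _ r * _
  set Θ := D.comulFactor z (D.splits y ((z \ y).sort (· ≤ ·))) with hΘ
  have hz : z = y ∪ ((z \ y).sort (· ≤ ·)).toFinset := by
    rw [Finset.sort_toFinset, Finset.union_sdiff_of_subset hyz]
  have hy : y = x ∪ ((y \ x).sort (· ≤ ·)).toFinset := by
    rw [Finset.sort_toFinset, Finset.union_sdiff_of_subset hxy]
  have hA := fun {p q : D.Point} (h : D.circle y p = D.circle y q) (v : V) =>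
    D.factor_mul_comulFactor z y ((z \ y).sort (· ≤ ·)) (Finset.sort_nodup _ _)
      (fun c hc => (Finset.mem_sdiff.1 ((Finset.mem_sort _).1 hc)).2) hz h v
  rw [← hΘ] at hA
  have hpush : ∀ l : List D.Crossing,
      pushforward (fun C : D.Circle y => D.circle z C.out) (D.comulFactor y l) * Θ =
        D.comulFactor z l * Θ := by
    intro l
    induction l with
    | nil => simp
    | cons c l ih =>
      rw [comulFactor_cons, comulFactor_cons, map_mul, mul_assoc, ih, mul_left_comm, mul_assoc,
        mul_left_comm (comulOne _ _)]
      congr 1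
      rw [comulOne, comulOne, map_add, pushforward_factor, pushforward_factor, add_mul, add_mul,
        hA (Quot.out_eq _), hA (Quot.out_eq _)]
  have hperm : D.comulFactor z (D.splits x ((z \ x).sort (· ≤ ·))) =
      D.comulFactor z (D.splits x ((y \ x).sort (· ≤ ·))) * Θ := by
    rw [hΘ]
    have e : D.splits y ((z \ y).sort (· ≤ ·)) =
        D.splits (x ∪ ((y \ x).sort (· ≤ ·)).toFinset) ((z \ y).sort (· ≤ ·)) := by rw [← hy]
    rw [e, ← comulFactor_append, ← splits_append]
    refine D.comulFactor_perm z ?_ x (Finset.sort_nodup _ _)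
      (fun c hc => (Finset.mem_sdiff.1 ((Finset.mem_sort _).1 hc)).2)
      (by rw [Finset.sort_toFinset, Finset.union_sdiff_of_subset (hxy.trans hyz)])
    refine (List.perm_ext_iff_of_nodup (Finset.sort_nodup _ _) ?_).2 ?_
    · refine List.Nodup.append (Finset.sort_nodup _ _) (Finset.sort_nodup _ _) ?_
      intro c hc hc'
      simp only [Finset.mem_sort, Finset.mem_sdiff] at hc hc'
      exact hc'.2 hc.1
    · intro c
      simp only [List.mem_append, Finset.mem_sort, Finset.mem_sdiff]
      have := @hxy c
      have := @hyz c
      tauto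
  rw [map_mul, mul_assoc, hpush, hperm, pushforward_pushforward, mul_left_comm, mul_left_comm (pushforward _ r)]
  congr 1
  exact pushforward_mul_congr _ _ _ (fun C v => hA (Quot.out_eq _) v) r

end Tangle
end

/-- The poset `Q` obtained from the Boolean lattice `B` of all subsets of `A`, ordered by reverse
inclusion (`x ≤ y` if `y ⊆ x`), so that `∅` is its maximum `1`: one further element is added,
which is above all the elements of `B` except `1`, and not comparable to `1`. -/
inductive Augmented (A : Type) where
  | cell (x : Finset A)
  | extra

namespace Augmented

variable {A : Type}

/-- The order of `Q`. -/
def Le : Augmented A → Augmented A → Prop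
  | cell x, cell y => y ⊆ x
  | cell x, extra => x ≠ ∅
  | extra, cell _ => False
  | extra, extra => True

instance : PartialOrder (Augmented A) where
  le := Le
  le_refl p := by
    cases p
    · exact Finset.Subset.refl _
    · trivial
  le_trans p q r h h' := by
    cases p <;> cases q <;> cases r
    · exact Finset.Subset.trans h' h
    · exact fun h0 => h' (Finset.subset_empty.1 (h0 ▸ h))
    · exact h'.elim
    · exact h
    · exact h.elim
    · exact h.elim
    · exact h'.elim
    · trivial
  le_antisymm p q h h' := by
    cases p <;> cases q
    · exact congrArg cell (Finset.Subset.antisymm h' h)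
    · exact h'.elim
    · exact h.elim
    · rfl

end Augmented

namespace Tangle

open CategoryTheory Augmented

noncomputable section

/-- The values of the Khovanov presheaf: a tensor power of `V` for each smoothing, and `0` at the
additional element. -/
def presheafObj (D : Tangle 0 0) : Augmented D.Crossing → AddCommGrpCat.{0}
  | cell x => AddCommGrpCat.of (Tensor (D.Circle x))
  | extra => AddCommGrpCat.of PUnit

/-- The maps of the Khovanov presheaf. -/
def presheafMap (D : Tangle 0 0) :
    (p q : Augmented D.Crossing) → D.presheafObj p ⟶ D.presheafObj q
  | cell x, cell y => AddCommGrpCat.ofHom (D.cubeMap x y)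
  | cell _, extra => 0
  | extra, _ => 0

/-- The Khovanov presheaf `F_KH` on the poset `Q` of the set of crossings. -/
def khovanovPresheaf (D : Tangle 0 0) : (Augmented D.Crossing)ᵒᵖ ⥤ AddCommGrpCat.{0} where
  obj p := D.presheafObj p.unop
  map {p q} _ := D.presheafMap p.unop q.unop
  map_id p := by
    rcases hp : p.unop with x | _
    · ext r
      exact D.cubeMap_self x r
    · ext r
      rfl
  map_comp {p q r} f g := by
    have hf := leOfHom f.unop
    have hg := leOfHom g.unop
    generalize p.unop = p at *
    generalize q.unop = q at *
    generalize r.unop = r at *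
    rcases p with x | _ <;> rcases q with y | _ <;> rcases r with z | _
    · ext t
      exact (D.cubeMap_cubeMap hf hg t).symm
    · exact hg.elim
    · exact hf.elim
    · exact hf.elim
    · exact (Limits.zero_comp).symm
    · exact hg.elim
    · exact (Limits.zero_comp).symm
    · exact (Limits.zero_comp).symm

/-- The space `Y_n(D) = holim K(F_KH(-), n)`, the homotopy limit over `Qᵒᵖ`. -/
def space (D : Tangle 0 0) (n : ℕ) : Sp :=
  Sp.holim (D.khovanovPresheaf ⋙ Sp.eilenbergMacLane n)

/-- The Khovanov cochains of degree `i`: families of elements of the tensor powers of all the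
smoothings with exactly `i` crossings `1`-smoothed. -/
def Cochain (D : Tangle 0 0) (i : ℤ) : Type :=
  (x : { x : Finset D.Crossing // (x.card : ℤ) = i }) → Tensor (D.Circle x.1)

instance (D : Tangle 0 0) (i : ℤ) : AddCommGroup (D.Cochain i) :=
  inferInstanceAs (AddCommGroup
    ((x : { x : Finset D.Crossing // (x.card : ℤ) = i }) → Tensor (D.Circle x.1)))

/-- The sign of the edge of the cube from `y` without `c` to `y`. -/
def edgeSign (D : Tangle 0 0) (y : Finset D.Crossing) (c : D.Crossing) : ℤ :=
  (-1) ^ (y.filter (· < c)).card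

theorem card_erase {A : Type} [DecidableEq A] {i j : ℤ} (h : i + 1 = j) {y : Finset A}
    (hy : (y.card : ℤ) = j) {c : A} (hc : c ∈ y) : ((y.erase c).card : ℤ) = i := by
  have := Finset.card_erase_add_one hc
  omega

/-- The differential of the Khovanov complex. -/
def differential (D : Tangle 0 0) (i j : ℤ) (h : i + 1 = j) : D.Cochain i →+ D.Cochain j where
  toFun a y := ∑ c ∈ y.1.attach, D.edgeSign y.1 c.1 •
    D.cubeMap (y.1.erase c.1) y.1 (a ⟨y.1.erase c.1, card_erase h y.2 c.2⟩)
  map_zero' := by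
    funext y
    refine Finset.sum_eq_zero fun c _ => ?_
    change _ • D.cubeMap _ _ 0 = 0
    rw [map_zero, smul_zero]
  map_add' a b := by
    funext y
    refine (Finset.sum_congr rfl fun c _ => ?_).trans Finset.sum_add_distrib
    rw [← smul_add, ← map_add]
    rfl

/-- The unnormalised Khovanov homology. -/
abbrev UnnormalisedKH (D : Tangle 0 0) (i : ℤ) : Type :=
  (D.differential i (i + 1) rfl).ker ⧸
    (D.differential (i - 1) i (by omega)).range.addSubgroupOf (D.differential i (i + 1) rfl).ker

end

variable {l m n : ℕ}

/-- An orientation of the strands of a diagram: `up k j` says whether the strand at the point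
`(k, j)` points upwards. The two ends `a` and `b` of a strand of a slice have the same direction
if one of them is at the bottom and the other one at the top (a strand going through), and
opposite directions if they are at the same level (a cup or a cap). -/
structure Orientation (T : Tangle m n) where
  up : ℕ → ℕ → Bool
  compat : ∀ (k : Fin T.height) (a : Bool × ℕ), (T.slice k).Valid (width m T.slices k) a →
    (up (k + a.1.toNat) a.2 =
      up (k + ((T.slice k).strand a).1.toNat) ((T.slice k).strand a).2 ↔
        a.1 ≠ ((T.slice k).strand a).1)

theorem slice_comp_left (S : Tangle l m) (T : Tangle m n) (k : Fin S.height)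
    (h : k.1 < (S.comp T).height) : (S.comp T).slice ⟨k, h⟩ = S.slice k :=
  List.getElem_append_left k.2

theorem slice_comp_right (S : Tangle l m) (T : Tangle m n) (k : Fin T.height)
    (h : S.height + k.1 < (S.comp T).height) :
    (S.comp T).slice ⟨S.height + k, h⟩ = T.slice k := by
  have key : ∀ (v w : List Slice) (i : ℕ) (hw : i < w.length) (h' : v.length + i < (v ++ w).length),
      (v ++ w)[v.length + i] = w[i] := by
    intro v w i hw _
    simp
  exact key S.slices T.slices k.1 k.2 h

namespace Orientation

/-- Orientations of two diagrams which agree at the common ends give one of the stacked diagram. -/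
def comp {S : Tangle l m} {T : Tangle m n} (o : S.Orientation) (o' : T.Orientation)
    (h : ∀ j < m, o.up S.height j = o'.up 0 j) : (S.comp T).Orientation where
  up k j := if k ≤ S.height then o.up k j else o'.up (k - S.height) j
  compat k a ha := by
    obtain ⟨k, hk⟩ := k
    rcases lt_or_ge k S.height with hkS | hkS
    · have hs := S.slice_comp_left T ⟨k, hkS⟩ hk
      simp only at hs
      rw [hs] at ha ⊢
      have := o.compat ⟨k, hkS⟩ a (by
        rw [← width_append_left l S.slices T.slices k hkS.le]
        exact ha)
      rw [if_pos, if_pos]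
      · exact this
      · cases (Slice.strand (S.slice ⟨k, hkS⟩) a).1 <;> simp <;> omega
      · cases a.1 <;> simp <;> omega
    · obtain ⟨j, rfl⟩ := Nat.exists_eq_add_of_le hkS
      have hj : j < T.height := by
        have h1 : (S.comp T).height = S.height + T.height := List.length_append
        omega
      have hs := S.slice_comp_right T ⟨j, hj⟩ hk
      simp only at hs
      rw [hs] at ha ⊢
      have ha' : (T.slice ⟨j, hj⟩).Valid (width m T.slices j) a := by
        rw [← width_append_right l m S.slices T.slices S.top j]
        exact ha
      have hb' := Slice.strand_valid (T.slice_fits ⟨j, hj⟩) ha'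
      have := o'.compat ⟨j, hj⟩ a ha'
      have key : ∀ b : Bool × ℕ, (T.slice ⟨j, hj⟩).Valid (width m T.slices j) b →
          (if S.height + j + b.1.toNat ≤ S.height then o.up (S.height + j + b.1.toNat) b.2
            else o'.up (S.height + j + b.1.toNat - S.height) b.2) = o'.up (j + b.1.toNat) b.2 := by
        rintro ⟨e, i⟩ hb
        split_ifs with h0
        · have hj0 : j = 0 := by omega
          have he : e = false := by
            cases e
            · rfl
            · simp at h0
          subst hj0 he
          simpa using h i (by simpa [Slice.Valid, width] using hb)
        · congr 1
          omega
      rw [key _ ha', key _ hb']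
      exact this

end Orientation

/-- Is a crossing negative? If the strand rising from the lower left to the upper right is the
over-strand, then the crossing is positive if both strands point up or both point down, and
negative otherwise. If the other strand is the over-strand, then it is the other way round. -/
def Negative {T : Tangle m n} (o : T.Orientation) (c : T.Crossing) : Prop :=
  (decide (o.up c.1 (T.slice c.1).pos = o.up c.1 ((T.slice c.1).pos + 1))) ≠
    (T.slice c.1).risingOver

instance {T : Tangle m n} (o : T.Orientation) : DecidablePred (Negative o) :=
  fun _ => inferInstanceAs (Decidable (_ ≠ _))

/-- Khovanov homology of an oriented link diagram, normalised by the number `c` of negative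
crossings: `KH^i` is the unnormalised homology in degree `i + c`. The internal grading is
forgotten. -/
abbrev KH (D : Tangle 0 0) (o : D.Orientation) (i : ℤ) : Type :=
  D.UnnormalisedKH (i + (Finset.univ.filter (Negative o)).card)

/-- Two antiparallel ends: the left one points up if `s = true` and the right one if `s = false`. -/
def ends (s : Bool) (j : ℕ) : Bool := if j = 0 then s else !s

/-- The orientation of the two hooked strands with the given directions of the two lower ends and
of the two upper ends. Both crossings are positive, see `not_negative_claspOrientation`. -/
def claspOrientation (s : Bool) : claspTangle.Orientation where
  up k j := if k = 0 ∨ k = 4 then ends s j else ends s (j / 2)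
  compat k a ha := by
    obtain ⟨k, hk⟩ := k
    obtain ⟨e, j⟩ := a
    have hk' : k < 4 := hk
    have hj : j < 4 := by
      interval_cases k <;> cases e <;>
        simp [claspTangle, slice, Slice.Valid, Slice.top, width] at ha <;> omega
    revert ha
    interval_cases k <;> interval_cases j <;> cases e <;> cases s <;>
      simp [claspTangle, slice, Slice.Valid, Slice.top, width, Slice.strand, Slice.mate, ends]

theorem not_negative_claspOrientation (s : Bool) (c : claspTangle.Crossing) :
    ¬ Negative (claspOrientation s) c := by
  obtain ⟨⟨k, hk⟩, hc⟩ := c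
  have hk' : k < 4 := hk
  interval_cases k <;> cases s <;>
    simp [Negative, claspOrientation, claspTangle, slice, Slice.pos, Slice.risingOver, ends,
      Slice.isCrossing] at hc ⊢

/-- The orientation of `D₁ # D₂` given by orientations of `D₁` and `D₂` which agree at the ends. -/
def sumOrientation {D₁ : Tangle 0 2} {D₂ : Tangle 2 0} {s : Bool} (o₁ : D₁.Orientation)
    (o₂ : D₂.Orientation) (h₁ : ∀ j < 2, o₁.up D₁.height j = ends s j)
    (h₂ : ∀ j < 2, o₂.up 0 j = ends s j) : (D₁.sum D₂).Orientation :=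
  o₁.comp o₂ fun j hj => (h₁ j hj).trans (h₂ j hj).symm

/-- The orientation of `D₁ ## D₂` given by orientations of `D₁` and `D₂` which agree at the ends. -/
def claspSumOrientation {D₁ : Tangle 0 2} {D₂ : Tangle 2 0} {s : Bool} (o₁ : D₁.Orientation)
    (o₂ : D₂.Orientation) (h₁ : ∀ j < 2, o₁.up D₁.height j = ends s j)
    (h₂ : ∀ j < 2, o₂.up 0 j = ends s j) : (D₁.claspSum D₂).Orientation :=
  o₁.comp ((claspOrientation s).comp o₂ fun j hj => (h₂ j hj).symm) fun j hj => h₁ j hj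

end Tangle
end Khovanov

/-! Let `S` be the diagram D₁ # D₂, let `D` be D₁ ## D₂, and let G be the Khovanov cube of `S`. The
cube of `D` has four copies of the cube of subsets of crossings of `S`, according to the smoothings
of the two crossings of the clasp. If both are 0-smoothed, the two strands run straight through and
a small circle is left inside the clasp: the value is G ⊗ V. If exactly one is 1-smoothed, the
result is planar isotopic to the smoothing of `S`: the value is G. If both are 1-smoothed, the lower
and the upper part fall apart, and the circle of `S` through the joining strands is cut into two.
That there is only one such circle is a conservation law: a circle crosses a level upwards as often
as downwards (`circle_eq_of_width_two`).

1-smoothing the first crossing merges the small circle with another one when the second crossing is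
0-smoothed; this is an isomorphism on G ⊗ 1. When the second crossing is 1-smoothed, it is a
comultiplication, which is injective. So G ⊗ 1, the two mixed corners and the image of the
comultiplication form a subcube in which one direction consists of isomorphisms, and its complex is
exact (`exact_of_bijective`). The quotient is (G ⊗ V)/(G ⊗ 1) ≅ G at the first corner, a cokernel
isomorphic to G at the last corner, and 0 at the mixed corners; every map from the first to the last
corner passes through a mixed one, hence the quotient complex is the direct sum of the complex of
`S` and of its shift by 2. This is `CubeFunctor.Doubling` with `Doubling.nonempty_H_equiv`.

The delicate point is the last corner. In the cokernel the generators of the two circles through the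
clasp are negatives of each other. The identification with G therefore changes the sign of u on all
circles above the clasp, and it commutes with the maps of the cube only up to a sign for every
splitting above the clasp. The number of these splittings on the way to a given smoothing does not
depend on the order of the crossings (`countP_splits_perm`), so the signs can be absorbed
(`highQuotient`). As the two new crossings are positive, the normalisations of the two diagrams
agree, which gives the second statement.

For the spaces, the homotopy limit is identified with the simplicial abelian group of normalised
n-cocycles on the nerves of Q_{≥x} times Δ[k], relative to the additional element (`holimIso`). Its
j-th homotopy group is the cohomology of the cube in degree n − j (`CubeFunctor.nonempty_π_equiv`);
the nerve complex and the cube complex are compared by dimension shifting along F → hull → cohull.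
All groups of simplices are finitely generated and free, and such simplicial groups are determined
up to homotopy by their homotopy groups (`SimplicialGroup.homotopyEquivalent`). Looping twice shifts
these groups by 2, so the first statement follows from the same isomorphism of cohomology groups. -/

namespace Khovanov

/-! ### Isomorphisms of subquotients from additive relations -/

/-- An additive relation which is total on both sides and matches the two subgroups of boundaries
induces an isomorphism of the quotients. -/
theorem nonempty_quotient_equiv {G G' : Type*} [AddCommGroup G] [AddCommGroup G']
    {Z B : AddSubgroup G} {Z' B' : AddSubgroup G'} (R : AddSubgroup (G × G'))
    (h1 : ∀ z ∈ Z, ∃ z' ∈ Z', (z, z') ∈ R) (h2 : ∀ z' ∈ Z', ∃ z ∈ Z, (z, z') ∈ R)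
    (h3 : ∀ z ∈ Z, ∀ z' ∈ Z', (z, z') ∈ R → (z ∈ B ↔ z' ∈ B')) :
    Nonempty ((Z ⧸ B.addSubgroupOf Z) ≃+ (Z' ⧸ B'.addSubgroupOf Z')) := by
  choose! c hc hR using h1
  -- The chosen partners are not additive in z. But two partners of the same z differ by an element
  -- related to 0, and 0 is a boundary, so by `h3` the difference is a boundary as well: the class
  -- of the partner is well defined and additive.
  have key : ∀ z ∈ Z, ∀ z' ∈ Z', (z, z') ∈ R → c z - z' ∈ B' := fun z hz z' hz' h => by
    have := R.sub_mem (hR z hz) h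
    simp only [Prod.mk_sub_mk, sub_self] at this
    exact (h3 0 Z.zero_mem _ (Z'.sub_mem (hc z hz) hz') this).1 B.zero_mem
  let f : Z →+ Z' ⧸ B'.addSubgroupOf Z' := AddMonoidHom.mk'
    (fun z => QuotientAddGroup.mk ⟨c z, hc z z.2⟩) (fun a b => by
      refine (QuotientAddGroup.eq_iff_sub_mem).2 ?_
      rw [AddSubgroup.mem_addSubgroupOf]
      exact key (a + b) (a + b).2 (c a + c b) (Z'.add_mem (hc a a.2) (hc b b.2))
        (R.add_mem (hR a a.2) (hR b b.2)))
  have hf : Function.Surjective f := by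
    intro q
    obtain ⟨⟨z', hz'⟩, rfl⟩ := QuotientAddGroup.mk_surjective q
    obtain ⟨z, hz, h⟩ := h2 z' hz'
    refine ⟨⟨z, hz⟩, (QuotientAddGroup.eq_iff_sub_mem).2 ?_⟩
    rw [AddSubgroup.mem_addSubgroupOf]
    exact key z hz z' hz' h
  have hk : f.ker = B.addSubgroupOf Z := by
    ext z
    rw [AddMonoidHom.mem_ker, AddSubgroup.mem_addSubgroupOf]
    refine (QuotientAddGroup.eq_zero_iff _).trans ?_
    rw [AddSubgroup.mem_addSubgroupOf]
    exact (h3 z z.2 (c z) (hc z z.2) (hR z z.2)).symm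
  exact ⟨(QuotientAddGroup.quotientAddEquivOfEq hk.symm).trans
    (QuotientAddGroup.quotientKerEquivOfSurjective f hf)⟩

/-! ### Simplicial cochains on the chains of a poset -/

section Chains

variable {J J' : Type*} [PartialOrder J] [PartialOrder J'] {M M' : Type*} [AddCommGroup M]
  [AddCommGroup M'] {m : ℕ}

/-- The inclusion of the face opposite to the vertex `i`. -/
abbrev faceMap (i : Fin (m + 2)) : Fin (m + 1) →o Fin (m + 2) := (Fin.succAboveOrderEmb i).toOrderHom

/-- The simplicial coboundary of a cochain on the chains of a poset. -/
def altSum (z : (Fin (m + 1) →o J) → M) (w : Fin (m + 2) →o J) : M :=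
  ∑ i : Fin (m + 2), (-1 : ℤ) ^ (i : ℕ) • z (w.comp (faceMap i))

theorem altSum_add (z z' : (Fin (m + 1) →o J) → M) (w : Fin (m + 2) →o J) :
    altSum (z + z') w = altSum z w + altSum z' w := by
  simp [altSum, Finset.sum_add_distrib]

theorem altSum_sub (z z' : (Fin (m + 1) →o J) → M) (w : Fin (m + 2) →o J) :
    altSum (z - z') w = altSum z w - altSum z' w := by
  simp [altSum, smul_sub]

theorem altSum_neg (z : (Fin (m + 1) →o J) → M) (w : Fin (m + 2) →o J) :
    altSum (-z) w = -altSum z w := by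
  simp [altSum]

theorem altSum_zero (w : Fin (m + 2) →o J) :
    altSum (0 : (Fin (m + 1) →o J) → M) w = 0 := by
  simp [altSum]

theorem map_altSum (f : M →+ M') (z : (Fin (m + 1) →o J) → M) (w : Fin (m + 2) →o J) :
    f (altSum z w) = altSum (fun v => f (z v)) w := by
  simp [altSum, map_sum, map_zsmul]

theorem altSum_comp (g : J →o J') (z : (Fin (m + 1) →o J') → M) (w : Fin (m + 2) →o J) :
    altSum z (g.comp w) = altSum (fun v => z (g.comp v)) w := rfl

/-- The cosimplicial identity, in the form that matches the two halves of the double sum in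
`altSum_altSum`. -/
theorem faceMap_comp_faceMap {i : Fin (m + 2)} {j : Fin (m + 3)} (h : (j : ℕ) ≤ i) :
    (faceMap j).comp (faceMap i) = (faceMap i.succ).comp (faceMap (j.castLT (h.trans_lt i.2))) := by
  refine OrderHom.ext _ _ (funext fun a => Fin.ext ?_)
  simp only [OrderHom.comp_coe, Function.comp_apply, OrderEmbedding.toOrderHom_coe,
    Fin.succAboveOrderEmb_apply, Fin.succAbove, Fin.lt_def]
  split_ifs <;> simp at * <;> omega

/-- Removing two vertices in either order gives the same chain. The pairs (i, j) with i ≤ j are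
matched with the remaining ones by (i, j) ↦ (j + 1, i), which reverses the sign. -/
theorem altSum_altSum (z : (Fin (m + 1) →o J) → M) (w : Fin (m + 3) →o J) :
    altSum (altSum z) w = 0 := by
  simp only [altSum, Finset.smul_sum, ← Finset.sum_product']
  let P := Fin (m + 3) × Fin (m + 2)
  let S : Finset P := {ij : P | (ij.1 : ℕ) ≤ (ij.2 : ℕ)}
  rw [Finset.univ_product_univ, ← Finset.sum_add_sum_compl S, ← eq_neg_iff_add_eq_zero,
    ← Finset.sum_neg_distrib]
  let φ : ∀ ij : P, ij ∈ S → P := fun ij hij =>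
    (ij.2.succ, Fin.castLT ij.1 (lt_of_le_of_lt (Finset.mem_filter.mp hij).right (Fin.is_lt ij.2)))
  apply Finset.sum_bij φ
  · intro ij hij
    simp_rw [S, φ, Finset.compl_filter, Finset.mem_filter_univ, Fin.val_succ,
      Fin.val_castLT] at hij ⊢
    lia
  · rintro ⟨i, j⟩ hij ⟨i', j'⟩ hij' h
    have h1 := congrArg (fun p : P => (p.1 : ℕ)) h
    have h2 := congrArg (fun p : P => (p.2 : ℕ)) h
    simp only [φ, Fin.val_succ, Fin.val_castLT] at h1 h2
    exact Prod.ext (Fin.ext h2) (Fin.ext (Nat.succ.inj h1))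
  · rintro ⟨i', j'⟩ hij'
    simp_rw [S, Finset.compl_filter, Finset.mem_filter_univ, not_le] at hij'
    refine ⟨(Fin.castSucc j', i'.pred ?_), ?_, ?_⟩
    · rintro rfl
      simp only [Fin.val_zero, not_lt_zero] at hij'
    · simpa [S] using! Nat.le_sub_one_of_lt hij'
    · simp only [φ, Fin.castLT_castSucc, Fin.succ_pred]
  · rintro ⟨i, j⟩ hij
    have hij' : (i : ℕ) ≤ j := by simpa [S] using! hij
    simp only [φ, smul_smul, ← neg_smul, OrderHom.comp_assoc]
    rw [faceMap_comp_faceMap hij']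
    congr 1
    simp only [Fin.val_succ, Fin.val_castLT]
    ring

theorem exists_castSucc_eq_succ {w : Fin (m + 2) →o J} (hw : ¬ Function.Injective w) :
    ∃ a : Fin (m + 1), w a.castSucc = w a.succ := by
  by_contra! h
  exact hw (Fin.strictMono_iff_lt_succ.2 fun a =>
    lt_of_le_of_ne (w.monotone (Fin.castSucc_le_succ a)) (h a)).injective

/-- Normalised cochains form a subcomplex: a chain with two equal neighbours has two equal faces
with opposite signs, and all its other faces still contain the repetition. -/
theorem altSum_eq_zero_of_not_injective {z : (Fin (m + 1) →o J) → M}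
    (hz : ∀ v : Fin (m + 1) →o J, ¬ Function.Injective v → z v = 0) {w : Fin (m + 2) →o J}
    (hw : ¬ Function.Injective w) : altSum z w = 0 := by
  obtain ⟨a, ha⟩ := exists_castSucc_eq_succ hw
  have hne : a.castSucc ≠ a.succ := (Fin.castSucc_lt_succ (i := a)).ne
  rw [altSum, Finset.sum_eq_add a.castSucc a.succ hne]
  · have : w.comp (faceMap a.castSucc) = w.comp (faceMap a.succ) := by
      refine OrderHom.ext _ _ (funext fun b => ?_)
      simp only [OrderHom.comp_coe, Function.comp_apply, OrderEmbedding.toOrderHom_coe,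
        Fin.succAboveOrderEmb_apply]
      rcases lt_trichotomy b a with h | rfl | h
      · rw [Fin.succAbove_of_castSucc_lt _ _ (Fin.castSucc_lt_castSucc_iff.2 h),
          Fin.succAbove_of_castSucc_lt _ _ (Fin.lt_def.2 (by have := Fin.lt_def.1 h; simp; omega))]
      · rw [Fin.succAbove_castSucc_self, Fin.succAbove_succ_self, ha]
      · rw [Fin.succAbove_of_le_castSucc _ _ (Fin.castSucc_le_castSucc_iff.2 h.le),
          Fin.succAbove_of_le_castSucc _ _ (Fin.le_def.2 (by have := Fin.lt_def.1 h; simp; omega))]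
    rw [this, ← add_smul]
    simp [pow_succ]
  · intro i _ hi
    rw [hz, smul_zero]
    obtain ⟨b, hb⟩ := Fin.exists_succAbove_eq hi.1.symm
    obtain ⟨c, hc⟩ := Fin.exists_succAbove_eq hi.2.symm
    intro hinj
    have : b = c := hinj (by
      change w (i.succAbove b) = w (i.succAbove c)
      rw [hb, hc, ha])
    rw [← hb, ← hc, this] at hne
    exact hne rfl
  · simp
  · simp

/-- Append a last element to a chain. -/
def snoc (w : Fin (m + 1) →o J) (t : J) (h : w (Fin.last m) ≤ t) : Fin (m + 2) →o J where
  toFun := Fin.snoc (α := fun _ => J) w t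
  monotone' := by
    intro a b hab
    induction b using Fin.lastCases with
    | last =>
      induction a using Fin.lastCases with
      | last => exact le_rfl
      | cast a =>
        simp only [Fin.snoc_castSucc, Fin.snoc_last]
        exact (w.monotone (Fin.le_last a)).trans h
    | cast b =>
      induction a using Fin.lastCases with
      | last => exact absurd hab (by simp)
      | cast a =>
        simp only [Fin.snoc_castSucc]
        exact w.monotone hab

theorem snoc_castSucc (w : Fin (m + 1) →o J) (t : J) (h : w (Fin.last m) ≤ t) (i : Fin (m + 1)) :
    snoc w t h i.castSucc = w i :=
  Fin.snoc_castSucc (α := fun _ => J) _ _ _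

theorem snoc_last (w : Fin (m + 1) →o J) (t : J) (h : w (Fin.last m) ≤ t) :
    snoc w t h (Fin.last (m + 1)) = t :=
  Fin.snoc_last (α := fun _ => J) _ _

theorem snoc_not_injective {w : Fin (m + 1) →o J} (hw : ¬ Function.Injective w) (t : J)
    (h : w (Fin.last m) ≤ t) : ¬ Function.Injective (snoc w t h) := by
  intro hi
  refine hw fun a b hab => Fin.castSucc_injective _ (hi ?_)
  rwa [snoc_castSucc, snoc_castSucc]

theorem snoc_comp_last (w : Fin (m + 1) →o J) (t : J) (h : w (Fin.last m) ≤ t) :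
    (snoc w t h).comp (faceMap (Fin.last (m + 1))) = w := by
  refine OrderHom.ext _ _ (funext fun a => ?_)
  simp [snoc_castSucc]

theorem snoc_comp_castSucc (w : Fin (m + 2) →o J) (t : J) (ht : ∀ j, j ≤ t) (i : Fin (m + 2)) :
    (snoc w t (ht _)).comp (faceMap i.castSucc) = snoc (w.comp (faceMap i)) t (ht _) := by
  refine OrderHom.ext _ _ (funext fun a => ?_)
  simp only [OrderHom.comp_coe, Function.comp_apply, OrderEmbedding.toOrderHom_coe,
    Fin.succAboveOrderEmb_apply]
  induction a using Fin.lastCases with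
  | last => rw [Fin.succAbove_ne_last_last (Fin.castSucc_lt_last i).ne, snoc_last, snoc_last]
  | cast a => rw [Fin.castSucc_succAbove_castSucc, snoc_castSucc, snoc_castSucc]; rfl

/-- The contraction of the cochains of a poset with a greatest element. -/
theorem altSum_snoc (z : (Fin (m + 2) →o J) → M) (t : J) (ht : ∀ j, j ≤ t) (w : Fin (m + 2) →o J) :
    altSum z (snoc w t (ht _)) =
      altSum (fun v => z (snoc v t (ht _))) w + (-1 : ℤ) ^ (m + 2) • z w := by
  rw [altSum, Fin.sum_univ_castSucc, snoc_comp_last]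
  simp only [snoc_comp_castSucc _ _ ht]
  rfl

end Chains
end Khovanov

/-! ### Cube functors, their cochain complexes and their hulls -/

namespace Khovanov

/-- A functor from the poset of finite subsets of `A` to abelian groups. -/
structure CubeFunctor (A : Type) where
  obj : Finset A → Type
  [grp : ∀ x, AddCommGroup (obj x)]
  map : ∀ {x y : Finset A}, x ⊆ y → obj x →+ obj y
  map_self : ∀ {x : Finset A} (h : x ⊆ x) (r : obj x), map h r = r
  map_map : ∀ {x y z : Finset A} (h : x ⊆ y) (h' : y ⊆ z) (r : obj x),
    map h' (map h r) = map (h.trans h') r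

namespace CubeFunctor

attribute [instance] CubeFunctor.grp

variable {A : Type}

theorem map_congr (F : CubeFunctor A) {x x' y : Finset A} (e : x = x') (h : x ⊆ y) (h' : x' ⊆ y)
    (f : ∀ x, F.obj x) : F.map h (f x) = F.map h' (f x') := by
  subst e
  rfl

section Edges

variable [LinearOrder A]

/-- The sign of the edge from `y` without `c` to `y`. -/
def sign (y : Finset A) (c : A) : ℤ := (-1) ^ (y.filter (· < c)).card

theorem sign_mul_self (y : Finset A) (c : A) : sign y c * sign y c = 1 := by
  rw [sign, ← mul_pow]
  simp

theorem sign_erase_of_lt {y : Finset A} {b c : A} (h : b < c) : sign (y.erase c) b = sign y b := by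
  unfold sign
  congr 2
  ext a
  simp only [Finset.mem_filter, Finset.mem_erase]
  refine ⟨fun ha => ⟨ha.1.2, ha.2⟩, fun ha => ⟨⟨(ha.2.trans h).ne, ha.1⟩, ha.2⟩⟩

theorem sign_erase_of_gt {y : Finset A} {b c : A} (hb : b ∈ y) (h : b < c) :
    sign (y.erase b) c = -sign y c := by
  unfold sign
  have : (y.erase b).filter (· < c) = (y.filter (· < c)).erase b := by
    ext a
    simp only [Finset.mem_filter, Finset.mem_erase]
    tauto
  rw [this, ← Finset.card_erase_add_one (Finset.mem_filter.2 ⟨hb, h⟩), pow_succ]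
  ring

/-- Removing the smaller of two elements changes the sign of the larger one and not conversely. Thus
every square of the cube anticommutes once the signs are inserted. -/
theorem sign_mul_sign {y : Finset A} {b c : A} (hb : b ∈ y) (hc : c ∈ y) (h : b ≠ c) :
    sign y c * sign (y.erase c) b = -(sign y b * sign (y.erase b) c) := by
  rcases lt_or_gt_of_ne h with h | h
  · rw [sign_erase_of_lt h, sign_erase_of_gt hb h]
    ring
  · rw [sign_erase_of_lt h, sign_erase_of_gt hc h]
    ring

variable (F : CubeFunctor A)

/-- The differential of the cube complex, on cochains of all degrees at once. -/
def d : (∀ x, F.obj x) →+ (∀ x, F.obj x) where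
  toFun f y := ∑ c ∈ y, sign y c • F.map (y.erase_subset c) (f (y.erase c))
  map_zero' := by
    funext y
    simp
  map_add' f g := by
    funext y
    simp [Finset.sum_add_distrib]

theorem d_apply (f : ∀ x, F.obj x) (y : Finset A) :
    F.d f y = ∑ c ∈ y, sign y c • F.map (y.erase_subset c) (f (y.erase c)) := rfl

theorem d_d (f : ∀ x, F.obj x) : F.d (F.d f) = 0 := by
  funext y
  simp only [d_apply, map_sum, map_zsmul, Finset.smul_sum, smul_smul, F.map_map]
  rw [Finset.sum_sigma']
  refine Finset.sum_involution (fun p _ => ⟨p.2, p.1⟩) ?_ ?_ ?_ ?_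
  · rintro ⟨c, b⟩ h
    simp only [Finset.mem_sigma, Finset.mem_erase] at h
    rw [sign_mul_sign h.2.2 h.1 h.2.1, F.map_congr Finset.erase_right_comm _
      (((y.erase b).erase_subset c).trans (y.erase_subset b)), neg_smul, neg_add_cancel]
  · rintro ⟨c, b⟩ h _ e
    simp only [Finset.mem_sigma, Finset.mem_erase] at h
    simp only [Sigma.mk.injEq] at e
    exact h.2.1 e.1
  · rintro ⟨c, b⟩ h
    simp only [Finset.mem_sigma, Finset.mem_erase] at h ⊢
    exact ⟨h.2.2, h.2.1.symm, h.1⟩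
  · rintro ⟨c, b⟩ _
    rfl

/-- The cochains of degree `i`. -/
def cochains (i : ℤ) : AddSubgroup (∀ x, F.obj x) where
  carrier := {f | ∀ x, (x.card : ℤ) ≠ i → f x = 0}
  zero_mem' _ _ := rfl
  add_mem' hf hg x h := by rw [Pi.add_apply, hf x h, hg x h, add_zero]
  neg_mem' hf x h := by rw [Pi.neg_apply, hf x h, neg_zero]

theorem d_mem {i j : ℤ} (hij : i + 1 = j) {f : ∀ x, F.obj x} (hf : f ∈ F.cochains i) :
    F.d f ∈ F.cochains j := by
  intro y hy
  refine Finset.sum_eq_zero fun c hc => ?_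
  rw [hf, map_zero, smul_zero]
  have := Finset.card_erase_add_one hc
  omega

/-- The cocycles of degree `i`. -/
def cocycles (i : ℤ) : AddSubgroup (∀ x, F.obj x) := F.cochains i ⊓ F.d.ker

/-- The coboundaries of degree `i`. -/
def coboundaries (i : ℤ) : AddSubgroup (∀ x, F.obj x) := (F.cochains (i - 1)).map F.d

/-- The cohomology of the cube complex. -/
abbrev H (i : ℤ) : Type := F.cocycles i ⧸ (F.coboundaries i).addSubgroupOf (F.cocycles i)

/-- If adding the element `c` always induces an isomorphism, then the cube complex is exact. -/
theorem exact_of_bijective (c : A)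
    (hc : ∀ x, c ∉ x → Function.Bijective (F.map (Finset.subset_insert c x))) {i : ℤ}
    {f : ∀ x, F.obj x} (hf : f ∈ F.cocycles i) : f ∈ F.coboundaries i := by
  classical
  -- The primitive is supported on the sets without `c`; its value there is forced by the
  -- requirement that the edge in direction `c` alone produces `f` at `insert c x`.
  have hex : ∀ x : Finset A, ∃ r : F.obj x, (c ∈ x → r = 0) ∧
      (c ∉ x → F.map (Finset.subset_insert c x) r = sign (insert c x) c • f (insert c x)) := by
    intro x
    by_cases h : c ∈ x
    · exact ⟨0, fun _ => rfl, fun h' => absurd h h'⟩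
    · obtain ⟨r, hr⟩ := (hc x h).2 (sign (insert c x) c • f (insert c x))
      exact ⟨r, fun h' => absurd h' h, fun _ => hr⟩
  choose g hg0 hg using hex
  refine ⟨g, fun x hx => ?_, ?_⟩
  · by_cases h : c ∈ x
    · exact hg0 x h
    · apply (hc x h).1
      rw [hg x h, map_zero, hf.1, smul_zero]
      rw [Finset.card_insert_of_notMem h]
      push_cast
      omega
  · have hin : ∀ y, c ∈ y → F.d g y = f y := by
      intro y hy
      rw [d_apply, Finset.sum_eq_single c]
      · have h1 : c ∉ y.erase c := by simp
        have e : insert c (y.erase c) = y := Finset.insert_erase hy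
        have := congrArg (F.map (by rw [e] : insert c (y.erase c) ⊆ y)) (hg _ h1)
        rw [F.map_map, map_zsmul, F.map_congr e _ subset_rfl, F.map_self] at this
        rw [this, smul_smul, e, sign_mul_self, one_smul]
      · intro b hb hbc
        rw [hg0 _ (by simp [hy, hbc.symm]), map_zero, smul_zero]
      · exact fun h => absurd hy h
    funext y
    by_cases hy : c ∈ y
    · exact hin y hy
    · -- both sides agree after adding `c`
      apply (hc y hy).1
      have hcy : c ∈ insert c y := Finset.mem_insert_self _ _
      -- The difference is a cocycle which is already known to vanish on the sets containing `c`; at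
      -- `insert c y` its differential therefore has only the term of the edge in direction `c`, and
      -- that edge is injective.
      have h1 : F.d (F.d g - f) (insert c y) = 0 := by
        rw [map_sub, d_d, (AddMonoidHom.mem_ker).1 hf.2, sub_zero]
        rfl
      rw [d_apply, Finset.sum_eq_single c] at h1
      · have e : (insert c y).erase c = y := Finset.erase_insert hy
        rw [F.map_congr e _ (Finset.subset_insert c y), Pi.sub_apply] at h1
        have h2 := congrArg (fun r => sign (insert c y) c • r) h1
        simp only [smul_smul, sign_mul_self, one_smul, smul_zero, map_sub] at h2
        exact sub_eq_zero.1 h2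
      · intro b hb hbc
        rw [Pi.sub_apply, hin, sub_self, map_zero, smul_zero]
        simp [hbc.symm]
      · exact fun h => absurd hcy h

end Edges

/-- Natural transformations of cube functors. -/
structure Hom (F G : CubeFunctor A) where
  app : ∀ x, F.obj x →+ G.obj x
  naturality : ∀ {x y} (h : x ⊆ y) (r : F.obj x), app y (F.map h r) = G.map h (app x r)

/-- Short exact sequences of cube functors. -/
structure ShortExact (F I G : CubeFunctor A) where
  ι : F.Hom I
  π : I.Hom G
  injective : ∀ x, Function.Injective (ι.app x)
  surjective : ∀ x, Function.Surjective (π.app x)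
  exact : ∀ x r, π.app x r = 0 ↔ ∃ s, ι.app x s = r

section

variable {F I G : CubeFunctor A}

theorem Hom.map_mem (φ : F.Hom G) {i : ℤ} {f : ∀ x, F.obj x} (hf : f ∈ F.cochains i) :
    (fun x => φ.app x (f x)) ∈ G.cochains i := fun x h => by
  simp only [hf x h, map_zero]

theorem ShortExact.lift (E : ShortExact F I G) {i : ℤ} {f : ∀ x, G.obj x} (hf : f ∈ G.cochains i) :
    ∃ g ∈ I.cochains i, (fun x => E.π.app x (g x)) = f := by
  have : ∀ x, ∃ r, E.π.app x r = f x ∧ ((x.card : ℤ) ≠ i → r = 0) := fun x => by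
    by_cases h : (x.card : ℤ) = i
    · obtain ⟨r, hr⟩ := E.surjective x (f x)
      exact ⟨r, hr, fun h' => absurd h h'⟩
    · exact ⟨0, by rw [map_zero, hf x h], fun _ => rfl⟩
  choose g hg hg' using this
  exact ⟨g, hg', funext hg⟩

theorem ShortExact.descend (E : ShortExact F I G) {i : ℤ} {f : ∀ x, I.obj x}
    (hf : f ∈ I.cochains i) (h : ∀ x, E.π.app x (f x) = 0) :
    ∃ g ∈ F.cochains i, (fun x => E.ι.app x (g x)) = f := by
  choose g hg using fun x => (E.exact x (f x)).1 (h x)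
  refine ⟨g, fun x hx => E.injective x ?_, funext hg⟩
  rw [hg, hf x hx, map_zero]

variable [LinearOrder A]

theorem Hom.map_d (φ : F.Hom G) (f : ∀ x, F.obj x) (y : Finset A) :
    φ.app y (F.d f y) = G.d (fun x => φ.app x (f x)) y := by
  simp only [d_apply, map_sum, map_zsmul, φ.naturality]

end

/-- The product of the values of `F` at all larger sets. -/
def hull (F : CubeFunctor A) : CubeFunctor A where
  obj x := ∀ y : { y : Finset A // x ⊆ y }, F.obj y
  grp x := inferInstanceAs (AddCommGroup (∀ y : { y : Finset A // x ⊆ y }, F.obj y))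
  map h :=
    { toFun := fun f y => f ⟨y, h.trans y.2⟩
      map_zero' := rfl
      map_add' := fun _ _ => rfl }
  map_self _ _ := rfl
  map_map _ _ _ := rfl

/-- The embedding into the hull. -/
def toHull (F : CubeFunctor A) : F.Hom F.hull where
  app x :=
    { toFun := fun r y => F.map y.2 r
      map_zero' := funext fun _ => map_zero _
      map_add' := fun r s => funext fun _ => map_add _ r s }
  naturality h r := funext fun y => F.map_map h y.2 r

theorem toHull_injective (F : CubeFunctor A) (x : Finset A) :
    Function.Injective (F.toHull.app x) := by
  intro r s h
  have := congrFun h ⟨x, subset_rfl⟩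
  change F.map _ r = F.map _ s at this
  rwa [F.map_self, F.map_self] at this

/-- The quotient of the hull. -/
def cohull (F : CubeFunctor A) : CubeFunctor A where
  obj x := F.hull.obj x ⧸ (F.toHull.app x).range
  grp x := inferInstanceAs (AddCommGroup (F.hull.obj x ⧸ (F.toHull.app x).range))
  map {x y} h := QuotientAddGroup.map _ _ (F.hull.map h) (by
    rintro _ ⟨r, rfl⟩
    exact ⟨F.map h r, F.toHull.naturality h r⟩)
  map_self _ r := by
    obtain ⟨r, rfl⟩ := QuotientAddGroup.mk_surjective r
    rfl
  map_map _ _ r := by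
    obtain ⟨r, rfl⟩ := QuotientAddGroup.mk_surjective r
    rfl

/-- The short exact sequence of a cube functor, its hull and the quotient. -/
def hullSequence (F : CubeFunctor A) : ShortExact F F.hull F.cohull where
  ι := F.toHull
  π :=
    { app := fun _ => QuotientAddGroup.mk' _
      naturality := fun _ _ => rfl }
  injective := F.toHull_injective
  surjective _ := QuotientAddGroup.mk'_surjective _
  exact _ r := QuotientAddGroup.eq_zero_iff r

end CubeFunctor
end Khovanov

/-! ### The complex of relative cochains on the nerves of Q above x -/

namespace Khovanov
namespace CubeFunctor

open Augmented

variable {A : Type}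

/-- The poset of the elements of `Q` above `x`, in reverse order, times `{0, …, k}`. -/
abbrev Cell (x : Finset A) (k : ℕ) : Type :=
  { q : (Augmented A)ᵒᵈ // cell x ≤ OrderDual.ofDual q } × Fin (k + 1)

theorem cell_le_cell {x y : Finset A} (h : x ⊆ y) : (cell y : Augmented A) ≤ cell x := h

/-- The inclusion of posets given by `x ⊆ y`. -/
def Cell.incl {x y : Finset A} (h : x ⊆ y) (k : ℕ) : Cell x k →o Cell y k where
  toFun p := (⟨p.1.1, (cell_le_cell h).trans p.1.2⟩, p.2)
  monotone' _ _ h' := ⟨h'.1, h'.2⟩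

/-- The map of posets given by a monotone map in the second coordinate. -/
def Cell.push (x : Finset A) {k l : ℕ} (β : Fin (k + 1) →o Fin (l + 1)) : Cell x k →o Cell x l where
  toFun p := (p.1, β p.2)
  monotone' _ _ h' := ⟨h'.1, β.monotone h'.2⟩

/-- The greatest element. -/
def Cell.top (x : Finset A) (k : ℕ) : Cell x k :=
  (⟨OrderDual.toDual (cell x), le_rfl⟩, Fin.last k)

theorem Cell.le_top {x : Finset A} {k : ℕ} (p : Cell x k) : p ≤ Cell.top x k :=
  ⟨p.1.2, Fin.le_last _⟩

/-- The retraction to the part over the additional element of `Q`. -/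
def Cell.toExtra {x : Finset A} (h : x ≠ ∅) (k : ℕ) : Cell x k →o Cell x k where
  toFun p := (⟨OrderDual.toDual extra, h⟩, p.2)
  monotone' _ _ h' := ⟨le_rfl, h'.2⟩

variable (F : CubeFunctor A)

/-- Families of functions on the chains of the posets `Cell x k`. -/
abbrev Fam (m k : ℕ) : Type := ∀ x, (Fin (m + 1) →o Cell x k) → F.obj x

/-- The simplicial coboundary, for all `x` at once. -/
def δ (m k : ℕ) : F.Fam m k →+ F.Fam (m + 1) k where
  toFun z x w := altSum (z x) w
  map_zero' := funext fun _ => funext fun w => altSum_zero w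
  map_add' z z' := funext fun x => funext fun w => altSum_add (z x) (z' x) w

theorem δ_apply {m k : ℕ} (z : F.Fam m k) (x : Finset A) (w : Fin (m + 2) →o Cell x k) :
    F.δ m k z x w = altSum (z x) w := rfl

theorem δ_δ {m k : ℕ} (z : F.Fam m k) : F.δ (m + 1) k (F.δ m k z) = 0 :=
  funext fun x => funext fun w => altSum_altSum (z x) w

/-- The normalised cochains of degree `m` of the diagram `x ↦ N(Q_{≥ x}) × Δ[k]`, relative to the
additional element of `Q`. -/
def nerveCochains (m k : ℕ) : AddSubgroup (F.Fam m k) where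
  carrier := {z |
    (∀ x y (h : x ⊆ y) (w : Fin (m + 1) →o Cell x k),
      F.map h (z x w) = z y ((Cell.incl h k).comp w)) ∧
    (∀ x (w : Fin (m + 1) →o Cell x k), (∀ i, (w i).1.1 = OrderDual.toDual extra) → z x w = 0) ∧
    (∀ x (w : Fin (m + 1) →o Cell x k), ¬ Function.Injective w → z x w = 0)}
  zero_mem' := ⟨fun _ _ _ _ => map_zero _, fun _ _ _ => rfl, fun _ _ _ => rfl⟩
  add_mem' := fun {z z'} ⟨h1, h2, h3⟩ ⟨h1', h2', h3'⟩ =>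
    ⟨fun x y h w => by simp [h1, h1'], fun x w h => by simp [h2 x w h, h2' x w h],
      fun x w h => by simp [h3 x w h, h3' x w h]⟩
  neg_mem' := fun {z} ⟨h1, h2, h3⟩ =>
    ⟨fun x y h w => by simp [h1], fun x w h => by simp [h2 x w h], fun x w h => by simp [h3 x w h]⟩

variable {F}

theorem δ_mem {m k : ℕ} {z : F.Fam m k} (hz : z ∈ F.nerveCochains m k) :
    F.δ m k z ∈ F.nerveCochains (m + 1) k := by
  obtain ⟨h1, h2, h3⟩ := hz
  refine ⟨fun x y h w => ?_, fun x w h => ?_, fun x w h => ?_⟩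
  · rw [δ_apply, δ_apply, map_altSum, altSum_comp]
    simp only [h1]
  · refine (δ_apply F z x w).trans (Finset.sum_eq_zero fun i _ => ?_)
    rw [h2 _ _ (fun j => h _), smul_zero]
  · exact altSum_eq_zero_of_not_injective (h3 x) h

/-- Restriction of cochains along a monotone map in the second coordinate. -/
def res (F : CubeFunctor A) (m : ℕ) {k l : ℕ} (β : Fin (k + 1) →o Fin (l + 1)) :
    F.Fam m l →+ F.Fam m k where
  toFun z x w := z x ((Cell.push x β).comp w)
  map_zero' := rfl
  map_add' _ _ := rfl

theorem res_mem {m k l : ℕ} (β : Fin (k + 1) →o Fin (l + 1)) {z : F.Fam m l}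
    (hz : z ∈ F.nerveCochains m l) : F.res m β z ∈ F.nerveCochains m k :=
  ⟨fun x y h _ => hz.1 x y h _, fun x _ h => hz.2.1 x _ h, fun x _ h => hz.2.2 x _ (fun h' =>
    h (Function.Injective.of_comp (f := Cell.push x β) h'))⟩

theorem res_δ {m k l : ℕ} (β : Fin (k + 1) →o Fin (l + 1)) (z : F.Fam m l) :
    F.res (m + 1) β (F.δ m l z) = F.δ m k (F.res m β z) := rfl

theorem res_res {m j k l : ℕ} (α : Fin (j + 1) →o Fin (k + 1)) (β : Fin (k + 1) →o Fin (l + 1))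
    (z : F.Fam m l) : F.res m α (F.res m β z) = F.res m (β.comp α) z := rfl

variable {I G : CubeFunctor A}

/-- The effect of a natural transformation on cochains. -/
def Hom.famMap (φ : F.Hom G) (m k : ℕ) : F.Fam m k →+ G.Fam m k where
  toFun z x w := φ.app x (z x w)
  map_zero' := funext fun _ => funext fun _ => map_zero _
  map_add' _ _ := funext fun _ => funext fun _ => map_add _ _ _

theorem Hom.famMap_mem (φ : F.Hom G) {m k : ℕ} {z : F.Fam m k} (hz : z ∈ F.nerveCochains m k) :
    φ.famMap m k z ∈ G.nerveCochains m k := by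
  refine ⟨fun x y h w => ?_, fun x w h => ?_, fun x w h => ?_⟩
  · change G.map h (φ.app _ _) = φ.app _ _
    rw [← hz.1 x y h, φ.naturality]
  · change φ.app _ _ = 0
    rw [hz.2.1 x w h, map_zero]
  · change φ.app _ _ = 0
    rw [hz.2.2 x w h, map_zero]

theorem Hom.famMap_δ (φ : F.Hom G) {m k : ℕ} (z : F.Fam m k) :
    φ.famMap (m + 1) k (F.δ m k z) = G.δ m k (φ.famMap m k z) :=
  funext fun x => funext fun w => map_altSum (φ.app x) (z x) w

theorem Hom.famMap_res (φ : F.Hom G) {m k l : ℕ} (β : Fin (k + 1) →o Fin (l + 1)) (z : F.Fam m l) :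
    φ.famMap m k (F.res m β z) = G.res m β (φ.famMap m l z) := rfl

theorem ShortExact.famMap_injective (E : ShortExact F I G) (m k : ℕ) :
    Function.Injective (E.ι.famMap m k) := fun _ _ h =>
  funext fun x => funext fun w => E.injective x (congrFun (congrFun h x) w)

theorem ShortExact.famMap_comp (E : ShortExact F I G) {m k : ℕ} (z : F.Fam m k) :
    E.π.famMap m k (E.ι.famMap m k z) = 0 :=
  funext fun x => funext fun _ => (E.exact x _).2 ⟨_, rfl⟩

theorem ShortExact.fam_descend (E : ShortExact F I G) {m k : ℕ} {z : I.Fam m k}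
    (hz : z ∈ I.nerveCochains m k) (h : E.π.famMap m k z = 0) :
    ∃ v ∈ F.nerveCochains m k, E.ι.famMap m k v = z := by
  choose v hv using fun x w => (E.exact x (z x w)).1 (congrFun (congrFun h x) w)
  refine ⟨v, ⟨fun x y h w => E.injective y ?_, fun x w h => E.injective x ?_,
    fun x w h => E.injective x ?_⟩, funext fun x => funext fun w => hv x w⟩
  · rw [E.ι.naturality, hv, hv, hz.1 x y h]
  · rw [hv, map_zero, hz.2.1 x w h]
  · rw [hv, map_zero, hz.2.2 x w h]

/-- Every chain in `Cell x k` whose last element is not over the additional element of `Q` comes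
from a unique smallest `x`. -/
theorem Cell.exists_root {x : Finset A} {m k : ℕ} (w : Fin (m + 1) →o Cell x k)
    (h : ∃ i, (w i).1.1 ≠ OrderDual.toDual extra) :
    ∃ y, (w (Fin.last m)).1.1 = OrderDual.toDual (cell y) ∧ y ⊆ x ∧
      ∀ i, cell y ≤ OrderDual.ofDual (w i).1.1 := by
  have hl : ∀ i, (w i).1 ≤ (w (Fin.last m)).1 := fun i => (w.monotone (Fin.le_last i)).1
  rcases hw : OrderDual.ofDual (w (Fin.last m)).1.1 with y | _
  · refine ⟨y, hw, ?_, fun i => ?_⟩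
    · have := (w (Fin.last m)).1.2
      rw [hw] at this
      exact this
    · rw [← hw]
      exact hl i
  · obtain ⟨i, hi⟩ := h
    refine absurd ?_ hi
    have h2 : OrderDual.ofDual (w (Fin.last m)).1.1 ≤ OrderDual.ofDual (w i).1.1 := hl i
    rw [hw] at h2
    rcases h3 : OrderDual.ofDual (w i).1.1 with y | _
    · rw [h3] at h2
      exact h2.elim
    · exact h3

-- Values cannot be lifted independently, as the lift has to be natural in x. But a chain that is
-- not entirely over the additional element is the image of a chain at a unique smallest set, which
-- is read off from its last entry. The value is lifted there and transported; chains over the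
-- additional element get the value 0.
open Classical in
theorem ShortExact.fam_lift (E : ShortExact F I G) {m k : ℕ} {z : G.Fam m k}
    (hz : z ∈ G.nerveCochains m k) : ∃ v ∈ I.nerveCochains m k, E.π.famMap m k v = z := by
  -- Zero is lifted to zero, which keeps the lift normalised.
  have hex : ∀ x (w : Fin (m + 1) →o Cell x k), ∃ r, E.π.app x r = z x w ∧ (z x w = 0 → r = 0) :=
    fun x w => by
      by_cases h : z x w = 0
      · exact ⟨0, by rw [map_zero, h], fun _ => rfl⟩
      · obtain ⟨r, hr⟩ := E.surjective x (z x w)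
        exact ⟨r, hr, fun h' => absurd h' h⟩
  choose r hr hr0 using hex
  let core : ∀ {x : Finset A} (w : Fin (m + 1) →o Cell x k) (y : Finset A)
      (_ : ∀ i, cell y ≤ OrderDual.ofDual (w i).1.1), Fin (m + 1) →o Cell y k :=
    fun w y hy => ⟨fun i => (⟨(w i).1.1, hy i⟩, (w i).2), fun a b h => ⟨(w.monotone h).1, (w.monotone h).2⟩⟩
  choose y hy1 hy2 hy3 using fun x (w : Fin (m + 1) →o Cell x k) => Cell.exists_root w
  have hcore : ∀ x w h, (Cell.incl (hy2 x w h) k).comp (core w _ (hy3 x w h)) = w := fun x w h => rfl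
  let v : I.Fam m k := fun x w =>
    if h : ∃ i, (w i).1.1 ≠ OrderDual.toDual extra then
      I.map (hy2 x w h) (r _ (core w _ (hy3 x w h))) else 0
  have hroot : ∀ x w h y' (e : (w (Fin.last m)).1.1 = OrderDual.toDual (cell y')) h2 h3,
      I.map (hy2 x w h) (r _ (core w _ (hy3 x w h))) = I.map h2 (r y' (core w y' h3)) := by
    intro x w h y' e h2 h3
    have : y x w h = y' := by
      have := (hy1 x w h).symm.trans e
      injection this
    subst this
    rfl
  refine ⟨v, ⟨fun x x' hx w => ?_, fun x w h => ?_, fun x w h => ?_⟩, ?_⟩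
  · by_cases h : ∃ i, (w i).1.1 ≠ OrderDual.toDual extra
    · have h' : ∃ i, ((Cell.incl hx k).comp w i).1.1 ≠ OrderDual.toDual extra := h
      simp only [v, dif_pos h, dif_pos h']
      rw [I.map_map]
      exact (hroot x' _ h' _ (hy1 x w h) ((hy2 x w h).trans hx) (hy3 x w h)).symm
    · have h' : ¬ ∃ i, ((Cell.incl hx k).comp w i).1.1 ≠ OrderDual.toDual extra := h
      simp only [v, dif_neg h, dif_neg h', map_zero]
  · have h' : ¬ ∃ i, (w i).1.1 ≠ OrderDual.toDual extra := by simpa using h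
    simp only [v, dif_neg h']
  · simp only [v]
    split_ifs with h'
    · rw [hr0, map_zero]
      refine hz.2.2 _ _ fun hi => h ?_
      intro a b hab
      refine hi ?_
      have h1 := congrArg (fun q : Cell x k => q.1.1) hab
      have h2 := congrArg Prod.snd hab
      exact Prod.ext (Subtype.ext h1) h2
    · rfl
  · funext x w
    change E.π.app x (v x w) = _
    simp only [v]
    split_ifs with h'
    · rw [E.π.naturality, hr, hz.1 _ _ (hy2 x w h')]
      rfl
    · rw [map_zero, hz.2.1 x w (by simpa using h')]

/-- The complex of cochains of the nerve of `Cell y k`, relative to the part over the additional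
element of `Q`, is exact in positive degrees. -/
theorem exists_altSum_eq {M : Type} [AddCommGroup M] {y : Finset A} {m k : ℕ}
    (φ : (Fin (m + 2) →o Cell y k) → M)
    (hx : ∀ w, (∀ i, (w i).1.1 = OrderDual.toDual extra) → φ w = 0)
    (hn : ∀ w : Fin (m + 2) →o Cell y k, ¬ Function.Injective w → φ w = 0)
    (hφ : ∀ w, altSum φ w = 0) :
    ∃ γ : (Fin (m + 1) →o Cell y k) → M,
      (∀ w, (∀ i, (w i).1.1 = OrderDual.toDual extra) → γ w = 0) ∧
      (∀ w : Fin (m + 1) →o Cell y k, ¬ Function.Injective w → γ w = 0) ∧ ∀ w, altSum γ w = φ w := by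
  -- The cone construction: the poset has a greatest element, which is appended to every chain. The
  -- sign cancels the one with which the last face enters the coboundary.
  set γ₀ : (Fin (m + 1) →o Cell y k) → M :=
    fun v => (-1 : ℤ) ^ (m + 1) • φ (snoc v (Cell.top y k) (Cell.le_top _)) with hγ₀
  have h0 : ∀ w, altSum γ₀ w = φ w := by
    intro w
    have h1 := altSum_snoc φ (Cell.top y k) Cell.le_top w
    rw [hφ] at h1
    have h2 : altSum γ₀ w = (-1 : ℤ) ^ (m + 1) •
        altSum (fun v => φ (snoc v (Cell.top y k) (Cell.le_top _))) w :=
      (map_altSum (zsmulAddGroupHom ((-1 : ℤ) ^ (m + 1)) : M →+ M)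
        (fun v => φ (snoc v (Cell.top y k) (Cell.le_top _))) w).symm
    rw [h2, eq_neg_of_add_eq_zero_left h1.symm, smul_neg, smul_smul, ← neg_smul, ← pow_add]
    have : -(-1 : ℤ) ^ (m + 1 + (m + 2)) = 1 := by
      rw [show m + 1 + (m + 2) = 2 * (m + 1) + 1 by ring, pow_succ, pow_mul]
      simp
    rw [this, one_smul]
  have hn0 : ∀ w : Fin (m + 1) →o Cell y k, ¬ Function.Injective w → γ₀ w = 0 := fun w hw => by
    rw [hγ₀]
    simp only
    rw [hn _ (snoc_not_injective hw _ _), smul_zero]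
  -- `γ₀` need not vanish on the chains over the additional element. For y = ∅ there are none.
  -- Otherwise its pullback along the retraction to that part is subtracted; the coboundary of the
  -- pullback is `φ` on a chain over the additional element, which is 0.
  by_cases hy : y = ∅
  · refine ⟨γ₀, fun w hw => ?_, hn0, h0⟩
    have := (w 0).1.2
    rw [hw 0, hy] at this
    exact absurd rfl this
  · refine ⟨fun w => γ₀ w - γ₀ ((Cell.toExtra hy k).comp w), fun w hw => ?_, fun w hw => ?_,
      fun w => ?_⟩
    · have : (Cell.toExtra hy k).comp w = w :=
        OrderHom.ext _ _ (funext fun i => Prod.ext (Subtype.ext (hw i).symm) rfl)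
      simp only [this, sub_self]
    · have h1 : ¬ Function.Injective ((Cell.toExtra hy k).comp w) := fun h =>
        hw (Function.Injective.of_comp (f := Cell.toExtra hy k) h)
      simp only [hn0 w hw, hn0 _ h1, sub_self]
    · refine (altSum_sub γ₀ (fun w => γ₀ ((Cell.toExtra hy k).comp w)) w).trans ?_
      rw [← altSum_comp, h0, h0, hx ((Cell.toExtra hy k).comp w) (fun _ => rfl), sub_zero]

/-- The hull of a cube functor has no cohomology in positive degrees. -/
theorem hull_exact (F : CubeFunctor A) {m k : ℕ} {z : F.hull.Fam (m + 1) k}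
    (hz : z ∈ F.hull.nerveCochains (m + 1) k) (hd : F.hull.δ (m + 1) k z = 0) :
    ∃ v ∈ F.hull.nerveCochains m k, F.hull.δ m k v = z := by
  let ev : ∀ y : Finset A, F.hull.obj y →+ F.obj y := fun y =>
    { toFun := fun f => f ⟨y, subset_rfl⟩, map_zero' := rfl, map_add' := fun _ _ => rfl }
  -- A natural cochain with values in the hull is the same as one cochain with values in F(y) on the
  -- chains of `Cell y k` for each y, without any compatibility; it is recovered by evaluating the
  -- hull of y at y itself. So the problem splits into one for each y.
  have hex := fun y => exists_altSum_eq (fun w => ev y (z y w))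
    (fun w h => by rw [hz.2.1 y w h, map_zero]) (fun w h => by rw [hz.2.2 y w h, map_zero])
    (fun w => by
      rw [← map_altSum]
      have := congrFun (congrFun hd y) w
      rw [δ_apply] at this
      rw [this]
      exact map_zero _)
  choose γ h1 h2 h3 using hex
  refine ⟨fun x v y => γ y ((Cell.incl y.2 k).comp v), ⟨fun _ _ _ _ => rfl, fun x w h => ?_,
    fun x w h => ?_⟩, ?_⟩
  · exact funext fun y => h1 y _ h
  · refine funext fun y => h2 y _ fun hi => h ?_
    exact Function.Injective.of_comp (f := Cell.incl y.2 k) hi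
  · funext x w y
    have e : ∀ f : F.hull.obj x, f y = (ev y.1) (F.hull.map y.2 f) := fun f => rfl
    let evy : F.hull.obj x →+ F.obj y :=
      { toFun := fun f => f y, map_zero' := rfl, map_add' := fun _ _ => rfl }
    have h4 := map_altSum evy (fun v : Fin (m + 1) →o Cell x k =>
      (fun y : { y : Finset A // x ⊆ y } => γ y ((Cell.incl y.2 k).comp v) : F.hull.obj x)) w
    have h5 := h3 y ((Cell.incl y.2 k).comp w)
    rw [altSum_comp, ← hz.1 _ _ y.2] at h5
    exact h4.trans h5

end CubeFunctor
end Khovanov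

/-! ### Comparison of the nerve complex with the cube complex -/

namespace Khovanov
namespace CubeFunctor

open Augmented

variable {A : Type}

/-- The map to a point. -/
def toPoint (k : ℕ) : Fin (k + 1) →o Fin (0 + 1) := ⟨fun _ => 0, fun _ _ _ => le_rfl⟩

/-- A one-element chain. -/
def Cell.point {x : Finset A} {k : ℕ} (p : Cell x k) : Fin (0 + 1) →o Cell x k :=
  ⟨fun _ => p, fun _ _ _ => le_rfl⟩

/-- A chain with two elements. -/
def Cell.edge {x : Finset A} {k : ℕ} {p q : Cell x k} (h : p ≤ q) : Fin (1 + 1) →o Cell x k where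
  toFun := ![p, q]
  monotone' := by
    intro a b hab
    fin_cases a <;> fin_cases b <;> simp_all

theorem altSum_edge {M : Type} [AddCommGroup M] {x : Finset A} {k : ℕ} {p q : Cell x k} (h : p ≤ q)
    (f : (Fin (0 + 1) →o Cell x k) → M) :
    altSum f (Cell.edge h) = f (Cell.point q) - f (Cell.point p) := by
  have h0 : (Cell.edge h).comp (faceMap 0) = Cell.point q :=
    OrderHom.ext _ _ (funext fun a => by fin_cases a; rfl)
  have h1 : (Cell.edge h).comp (faceMap 1) = Cell.point p :=
    OrderHom.ext _ _ (funext fun a => by fin_cases a; rfl)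
  rw [altSum]
  refine (Fin.sum_univ_two _).trans ?_
  rw [h0, h1]
  simp [sub_eq_add_neg]

variable {F : CubeFunctor A}

theorem eq_of_le {k : ℕ} {z : F.Fam 0 k} (hz : F.δ 0 k z = 0) {x : Finset A} {p q : Cell x k}
    (h : p ≤ q) : z x (Cell.point p) = z x (Cell.point q) := by
  have := congrFun (congrFun hz x) (Cell.edge h)
  rw [δ_apply, altSum_edge] at this
  exact (sub_eq_zero.1 this).symm

theorem eq_point {x : Finset A} {k : ℕ} (w : Fin (0 + 1) →o Cell x k) : w = Cell.point (w 0) :=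
  OrderHom.ext _ _ (funext fun a => by fin_cases a; rfl)

/-- The normalised cocycles. -/
def nerveCocycles (F : CubeFunctor A) (m k : ℕ) : AddSubgroup (F.Fam m k) :=
  F.nerveCochains m k ⊓ (F.δ m k).ker

/-- The coboundaries of normalised cochains. -/
def nerveCoboundaries (F : CubeFunctor A) : (m k : ℕ) → AddSubgroup (F.Fam m k)
  | 0, _ => ⊥
  | m + 1, k => (F.nerveCochains m k).map (F.δ m k)

theorem mem_nerveCocycles {m k : ℕ} {z : F.Fam m k} :
    z ∈ F.nerveCocycles m k ↔ z ∈ F.nerveCochains m k ∧ F.δ m k z = 0 := Iff.rfl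

theorem nerveCoboundaries_le (m k : ℕ) : F.nerveCoboundaries m k ≤ F.nerveCocycles m k := by
  rcases m with _ | m
  · exact bot_le
  · rintro _ ⟨v, hv, rfl⟩
    exact ⟨δ_mem hv, F.δ_δ v⟩

variable {I G : CubeFunctor A}

theorem Hom.famMap_mem_cocycles (φ : F.Hom G) {m k : ℕ} {z : F.Fam m k}
    (hz : z ∈ F.nerveCocycles m k) : φ.famMap m k z ∈ G.nerveCocycles m k :=
  mem_nerveCocycles.2 ⟨φ.famMap_mem hz.1, by
    rw [← φ.famMap_δ, (mem_nerveCocycles.1 hz).2, map_zero]⟩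

theorem ShortExact.lift_coboundaries (E : ShortExact F I G) {m k : ℕ} {z : G.Fam m k}
    (hz : z ∈ G.nerveCoboundaries m k) :
    ∃ v ∈ I.nerveCoboundaries m k, E.π.famMap m k v = z := by
  rcases m with _ | m
  · obtain rfl : z = 0 := hz
    exact ⟨0, zero_mem _, map_zero _⟩
  · obtain ⟨b, hb, rfl⟩ := hz
    obtain ⟨v, hv, rfl⟩ := E.fam_lift hb
    exact ⟨_, ⟨v, hv, rfl⟩, E.π.famMap_δ v⟩

/-- A cocycle of the middle term which vanishes in the quotient is a cocycle of the first term. -/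
theorem ShortExact.descend_δ (E : ShortExact F I G) {m k : ℕ} {v : I.Fam m k}
    (hv : v ∈ I.nerveCochains m k) (h : G.δ m k (E.π.famMap m k v) = 0) :
    ∃ z ∈ F.nerveCocycles (m + 1) k, E.ι.famMap (m + 1) k z = I.δ m k v := by
  obtain ⟨z, hz, hzv⟩ := E.fam_descend (δ_mem hv) (by rw [E.π.famMap_δ, h])
  refine ⟨z, ⟨hz, E.famMap_injective _ _ ?_⟩, hzv⟩
  rw [E.ι.famMap_δ, hzv, δ_δ, map_zero]

/-- The cochain complexes of `N(Q_{≥ x}) × Δ[k]` and `N(Q_{≥ x})` have the same cohomology. -/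
theorem exists_sub_res_mem (m k : ℕ) : ∀ (F : CubeFunctor A) (z : F.Fam m k),
    z ∈ F.nerveCocycles m k → ∃ v ∈ F.nerveCocycles m 0,
      z - F.res m (toPoint k) v ∈ F.nerveCoboundaries m k := by
  induction m with
  | zero =>
    intro F z hz
    let β : Fin (0 + 1) →o Fin (k + 1) := ⟨fun _ => 0, fun _ _ _ => le_rfl⟩
    refine ⟨F.res 0 β z, mem_nerveCocycles.2 ⟨res_mem β hz.1, ?_⟩, ?_⟩
    · rw [← res_δ, (mem_nerveCocycles.1 hz).2, map_zero]
    · change z - F.res 0 (toPoint k) (F.res 0 β z) = 0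
      rw [sub_eq_zero]
      funext x w
      rw [eq_point w]
      -- A cocycle of degree 0 takes equal values at comparable elements, and (q, 0) ≤ (q, j): so it
      -- is pulled back from its restriction to the vertex 0.
      exact (eq_of_le (mem_nerveCocycles.1 hz).2
        (p := (Cell.push x (β.comp (toPoint k))) (w 0)) (q := w 0)
        ⟨le_rfl, Fin.zero_le _⟩).symm
  | succ m ih =>
    intro F z hz
    -- Dimension shifting: in the hull the cocycle becomes the coboundary of some w, whose image in
    -- the quotient is a cocycle of degree m to which the induction applies. The resulting cocycle
    -- and coboundary are lifted back to the hull, and what remains of w comes from F.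
    let E := F.hullSequence
    have hz' := mem_nerveCocycles.1 (E.ι.famMap_mem_cocycles hz)
    obtain ⟨w, hw, hwz⟩ := F.hull_exact hz'.1 hz'.2
    obtain ⟨v, hv, hve⟩ := ih F.cohull (E.π.famMap m k w) (mem_nerveCocycles.2 ⟨E.π.famMap_mem hw, by
      rw [← E.π.famMap_δ, hwz, E.famMap_comp]⟩)
    obtain ⟨v, hv', rfl⟩ := E.fam_lift hv.1
    obtain ⟨e, he, hee⟩ := E.lift_coboundaries hve
    obtain ⟨v', hv'', hvv⟩ := E.descend_δ hv' (mem_nerveCocycles.1 hv).2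
    obtain ⟨f, hf, hff⟩ := E.fam_descend (z := w - F.hull.res m (toPoint k) v - e)
      (sub_mem (sub_mem hw (res_mem _ hv')) (nerveCoboundaries_le _ _ he).1) (by
        rw [map_sub, map_sub, hee, E.π.famMap_res, sub_self])
    refine ⟨v', hv'', f, hf, E.famMap_injective _ _ ?_⟩
    rw [E.ι.famMap_δ, hff, map_sub, map_sub, map_sub, hwz,
      (mem_nerveCocycles.1 (nerveCoboundaries_le _ _ he)).2, sub_zero, ← res_δ, ← hvv]
    rfl

section Comparison

/-- The functor with value `M` at all subsets of `y`, and `0` elsewhere. -/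
def below (y : Finset A) (M : Type) [AddCommGroup M] : CubeFunctor A where
  obj x := PLift (x ⊆ y) → M
  grp x := inferInstanceAs (AddCommGroup (PLift (x ⊆ y) → M))
  map h :=
    { toFun := fun f hy => f ⟨h.trans hy.down⟩
      map_zero' := rfl
      map_add' := fun _ _ => rfl }
  map_self _ _ := rfl
  map_map _ _ _ := rfl

section

variable [LinearOrder A]

/-- The cube complex of the hull is exact in positive degrees. -/
theorem hull_cocycles_le (F : CubeFunctor A) {i : ℤ} (hi : 0 < i) :
    F.hull.cocycles i ≤ F.hull.coboundaries i := by
  intro f hf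
  let ev : ∀ y : Finset A, F.hull.Hom (below y (F.obj y)) := fun y =>
    { app := fun x =>
        { toFun := fun f hy => f ⟨y, hy.down⟩
          map_zero' := rfl
          map_add' := fun _ _ => rfl }
      naturality := fun _ _ => rfl }
  have hex : ∀ y : Finset A, ∃ g ∈ (below y (F.obj y)).cochains (i - 1),
      (below y (F.obj y)).d g = fun x => (ev y).app x (f x) := by
    intro y
    -- The hull is the product over y of functors which are constant on the subsets of y and zero
    -- elsewhere. For y = ∅ such a functor lives in degree 0 only. For c ∈ y, a set x lies in y
    -- exactly if x ∪ {c} does, so that the direction `c` consists of isomorphisms.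
    rcases Finset.eq_empty_or_nonempty y with rfl | ⟨c, hc⟩
    · refine ⟨0, zero_mem _, ?_⟩
      rw [map_zero]
      funext x
      rcases Finset.eq_empty_or_nonempty x with rfl | hx
      · rw [hf.1 ∅ (by simp; omega), map_zero]
        rfl
      · funext h
        exact absurd (Finset.subset_empty.1 h.down) hx.ne_empty
    · refine exact_of_bijective (below y (F.obj y)) c (fun x _ => ⟨fun a b h => ?_, fun b => ?_⟩)
        ⟨(ev y).map_mem hf.1, ?_⟩
      · funext hy
        exact congrFun h ⟨Finset.insert_subset hc hy.down⟩
      · exact ⟨fun hy => b ⟨Finset.insert_subset hc hy.down⟩, rfl⟩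
      · refine funext fun x => ?_
        rw [← (ev y).map_d, (AddMonoidHom.mem_ker).1 hf.2]
        rfl
  choose g hg hgf using hex
  refine ⟨fun x y => g y x ⟨y.2⟩, fun x hx => funext fun y => ?_, funext fun x => funext fun y => ?_⟩
  · exact congrFun (hg y x hx) ⟨y.2⟩
  · have h1 := congrFun (congrFun (hgf y) x) ⟨y.2⟩
    have h2 := congrFun ((ev y).map_d (fun x y => g y x ⟨y.2⟩) x) ⟨y.2⟩
    exact h2.trans h1

end

theorem hull_nerveCocycles_le (F : CubeFunctor A) (m k : ℕ) :
    F.hull.nerveCocycles (m + 1) k ≤ F.hull.nerveCoboundaries (m + 1) k := fun _ h =>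
  F.hull_exact h.1 (mem_nerveCocycles.1 h).2

theorem ne_empty_of_extra {x : Finset A} {k : ℕ} {p : Cell x k}
    (h : p.1.1 = OrderDual.toDual extra) : x ≠ ∅ := by
  have := p.1.2
  rw [h] at this
  exact this

/-- This is the effect of the additional element of Q: for x ≠ ∅ every element above x is linked by
comparisons to the additional one, where the cocycle vanishes. The cell of ∅, which is not
comparable to the additional element, is reached through the cell of x. -/
theorem nerveCocycle_eq_zero {k : ℕ} {z : F.Fam 0 k} (hz : z ∈ F.nerveCocycles 0 k) {x : Finset A}
    (hx : x ≠ ∅) (p : Cell x k) : z x (Cell.point p) = 0 := by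
  have h0 : ∀ j, z x (Cell.point (⟨OrderDual.toDual extra, hx⟩, j)) = 0 := fun j =>
    hz.1.2.1 x _ (fun _ => rfl)
  have h1 : ∀ (y : Finset A) (hy : y ≠ ∅) (h : cell x ≤ cell y) j,
      z x (Cell.point (⟨OrderDual.toDual (cell y), h⟩, j)) = 0 := fun y hy h j =>
    (eq_of_le (mem_nerveCocycles.1 hz).2 (p := (⟨OrderDual.toDual extra, hx⟩, j))
      (q := (⟨OrderDual.toDual (cell y), h⟩, j)) ⟨hy, le_rfl⟩).symm.trans (h0 j)
  obtain ⟨⟨q, hq⟩, j⟩ := p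
  rcases hy : OrderDual.ofDual q with y | _
  · obtain rfl : q = OrderDual.toDual (cell y) := hy
    by_cases h : y = ∅
    · refine (eq_of_le (mem_nerveCocycles.1 hz).2 (p := (⟨OrderDual.toDual (cell y), hq⟩, j))
        (q := (⟨OrderDual.toDual (cell x), le_rfl⟩, j)) ⟨hq, le_rfl⟩).trans (h1 x hx le_rfl j)
    · exact h1 y h hq j
  · obtain rfl : q = OrderDual.toDual extra := hy
    exact h0 j

variable [LinearOrder A]

theorem d_single (F : CubeFunctor A) (r : F.obj ∅)
    (hr : ∀ c, F.map (Finset.empty_subset {c}) r = 0) : F.d (Pi.single ∅ r) = 0 := by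
  funext y
  refine Finset.sum_eq_zero fun c hc => ?_
  by_cases h : y.erase c = ∅
  · have hy : y = {c} := by
      rw [← Finset.insert_erase hc, h]
      rfl
    subst hy
    rw [F.map_congr h _ (Finset.empty_subset {c}), Pi.single_eq_same, hr, smul_zero]
  · rw [Pi.single_eq_of_ne h, map_zero, smul_zero]

/-- Corresponding cocycles of the nerve complex and of the cube complex, defined by dimension
shifting. -/
def corr : (m : ℕ) → (F : CubeFunctor A) → AddSubgroup (F.Fam m 0 × (∀ x, F.obj x))
  | 0, F =>
    { carrier := {p | p.1 ∅ (Cell.point (Cell.top ∅ 0)) = p.2 ∅}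
      zero_mem' := rfl
      add_mem' := fun {a b} ha hb => congrArg₂ (· + ·) ha hb
      neg_mem' := fun {a} ha => congrArg (- ·) ha }
  | m + 1, F =>
    { carrier := {p | ∃ w ∈ F.hull.nerveCochains m 0, ∃ w' ∈ F.hull.cochains m,
        F.hull.δ m 0 w = F.toHull.famMap _ _ p.1 ∧
        F.hull.d w' = (fun x => F.toHull.app x (p.2 x)) ∧
        (F.hullSequence.π.famMap m 0 w, fun x => F.hullSequence.π.app x (w' x)) ∈ corr m F.cohull}
      zero_mem' := ⟨0, zero_mem _, 0, zero_mem _, by simp, by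
        rw [map_zero]
        exact funext fun x => (map_zero _).symm, by
        convert (corr m F.cohull).zero_mem
        · exact map_zero _
        · rename_i x
          exact map_zero (F.hullSequence.π.app x)⟩
      add_mem' := by
        rintro a b ⟨w, h1, w', h2, h3, h4, h5⟩ ⟨v, k1, v', k2, k3, k4, k5⟩
        refine ⟨w + v, add_mem h1 k1, w' + v', add_mem h2 k2, ?_, ?_, ?_⟩
        · rw [map_add, h3, k3, Prod.fst_add, map_add]
        · rw [map_add, h4, k4]
          exact funext fun x => (map_add _ _ _).symm
        · convert (corr m F.cohull).add_mem h5 k5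
          · exact map_add _ _ _
          · rename_i x
            exact map_add (F.hullSequence.π.app x) _ _
      neg_mem' := by
        rintro a ⟨w, h1, w', h2, h3, h4, h5⟩
        refine ⟨-w, neg_mem h1, -w', neg_mem h2, ?_, ?_, ?_⟩
        · rw [map_neg, h3, Prod.fst_neg, map_neg]
        · rw [map_neg, h4]
          exact funext fun x => (map_neg _ _).symm
        · convert (corr m F.cohull).neg_mem h5
          · exact map_neg _ _
          · rename_i x
            exact map_neg (F.hullSequence.π.app x) _ }

theorem corr_zero_map (φ : F.Hom G) {z : F.Fam 0 0} {f : ∀ x, F.obj x} (h : (z, f) ∈ corr 0 F) :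
    (φ.famMap 0 0 z, fun x => φ.app x (f x)) ∈ corr 0 G :=
  congrArg (φ.app ∅) h

/-- In degree 0 both kinds of cocycles amount to the elements of F(∅) which become 0 in F(x) for all
x ≠ ∅; for this it is enough to consider singletons. In both complexes 0 is the only coboundary. -/
theorem corr_zero (F : CubeFunctor A) :
    (∀ z ∈ F.nerveCocycles 0 0, ∃ f ∈ F.cocycles 0, (z, f) ∈ corr 0 F) ∧
    (∀ f ∈ F.cocycles 0, ∃ z ∈ F.nerveCocycles 0 0, (z, f) ∈ corr 0 F) ∧
    (∀ z ∈ F.nerveCocycles 0 0, ∀ f ∈ F.cocycles 0, (z, f) ∈ corr 0 F →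
      (z ∈ F.nerveCoboundaries 0 0 ↔ f ∈ F.coboundaries 0)) := by
  refine ⟨fun z hz => ?_, fun f hf => ?_, fun z hz f hf h => ⟨fun h0 => ?_, fun h0 => ?_⟩⟩
  · refine ⟨Pi.single ∅ (z ∅ (Cell.point (Cell.top ∅ 0))), ⟨fun x hx => ?_, ?_⟩, ?_⟩
    · exact Pi.single_eq_of_ne (by rintro rfl; simp at hx) _
    · refine d_single F _ fun c => ?_
      rw [hz.1.1 ∅ {c} _]
      exact nerveCocycle_eq_zero hz (Finset.singleton_ne_empty c) (Cell.incl _ 0 (Cell.top ∅ 0))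
    · exact (Pi.single_eq_same (M := F.obj) ∅ _).symm
  · have h1 : ∀ c, F.map (Finset.empty_subset {c}) (f ∅) = 0 := by
      intro c
      have := congrFun ((AddMonoidHom.mem_ker).1 hf.2) {c}
      rw [d_apply, Finset.sum_singleton, F.map_congr (x' := ∅) (by simp) _ (Finset.empty_subset {c})]
        at this
      simpa [sign, Finset.filter_singleton] using this
    have h2 : ∀ x : Finset A, x ≠ ∅ → F.map (Finset.empty_subset x) (f ∅) = 0 := by
      intro x hx
      obtain ⟨c, hc⟩ := Finset.nonempty_iff_ne_empty.2 hx
      rw [← F.map_map (Finset.empty_subset {c}) (Finset.singleton_subset_iff.2 hc), h1, map_zero]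
    refine ⟨fun x _ => F.map (Finset.empty_subset x) (f ∅), ⟨⟨?_, ?_, ?_⟩, ?_⟩, ?_⟩
    · exact fun x y h w => F.map_map _ _ _
    · exact fun x w h => h2 x (ne_empty_of_extra (h 0))
    · refine fun x w h => absurd (fun a b _ => ?_) h
      fin_cases a
      fin_cases b
      rfl
    · refine funext fun x => funext fun w => ?_
      rw [δ_apply, altSum]
      refine (Fin.sum_univ_two _).trans ?_
      simp
    · exact F.map_self _ _
  · obtain rfl : z = 0 := h0
    have hf0 : f = 0 := by
      funext x
      by_cases hx : x = ∅
      · subst hx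
        exact h.symm
      · exact hf.1 x (by simpa using hx)
    rw [hf0]
    exact zero_mem _
  · obtain ⟨g, hg, rfl⟩ := h0
    have hg0 : g = 0 := funext fun x => hg x (by omega)
    rw [hg0, map_zero] at h
    change z = 0
    funext x w
    rw [eq_point w]
    by_cases hx : x = ∅
    · subst hx
      have : w 0 = Cell.top ∅ 0 := by
        refine Prod.ext (Subtype.ext ?_) (Subsingleton.elim (α := Fin 1) _ _)
        have h1 := (w 0).1.2
        rcases hq : OrderDual.ofDual (w 0).1.1 with y | _
        · rw [hq] at h1
          exact hq.trans (congrArg cell (Finset.subset_empty.1 h1))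
        · rw [hq] at h1
          exact absurd rfl h1
      rw [this]
      exact h
    · exact nerveCocycle_eq_zero hz hx _

/-- Both complexes take the sequence F → hull → cohull to short exact sequences, and in both of them
the hull has no cohomology in positive degrees. Hence degree m + 1 for F reduces to degree m for the
cohull. -/
theorem corr_spec (m : ℕ) : ∀ F : CubeFunctor A,
    (∀ z ∈ F.nerveCocycles m 0, ∃ f ∈ F.cocycles m, (z, f) ∈ corr m F) ∧
    (∀ f ∈ F.cocycles m, ∃ z ∈ F.nerveCocycles m 0, (z, f) ∈ corr m F) ∧
    (∀ z ∈ F.nerveCocycles m 0, ∀ f ∈ F.cocycles m, (z, f) ∈ corr m F →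
      (z ∈ F.nerveCoboundaries m 0 ↔ f ∈ F.coboundaries m)) := by
  induction m with
  | zero => exact corr_zero
  | succ m ih =>
    intro F
    let E := F.hullSequence
    have hcast : ((m + 1 : ℕ) : ℤ) - 1 = m := by push_cast; ring
    have hcast' : (m : ℤ) + 1 = (m + 1 : ℕ) := by push_cast; ring
    -- an element of degree `m` of the hull whose coboundary comes from `F`
    have hdesc : ∀ w' ∈ F.hull.cochains m, F.cohull.d (fun x => E.π.app x (w' x)) = 0 →
        ∃ f ∈ F.cocycles (m + 1 : ℕ), F.hull.d w' = fun x => E.ι.app x (f x) := by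
      intro w' hw' h
      obtain ⟨f, hf, hff⟩ := E.descend (F.hull.d_mem hcast' hw') (fun x => by
        rw [E.π.map_d, h]
        rfl)
      refine ⟨f, ⟨hf, funext fun y => E.injective y ?_⟩, hff.symm⟩
      rw [E.ι.map_d, hff, d_d]
      exact (map_zero _).symm
    refine ⟨fun z hz => ?_, fun f hf => ?_, ?_⟩
    · obtain ⟨w, hw, hwz⟩ := F.hull_nerveCocycles_le m 0 (E.ι.famMap_mem_cocycles hz)
      obtain ⟨f', hf', hR⟩ := (ih F.cohull).1 (E.π.famMap m 0 w) (mem_nerveCocycles.2 ⟨E.π.famMap_mem hw, by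
        rw [← E.π.famMap_δ, hwz, E.famMap_comp]⟩)
      obtain ⟨w', hw', rfl⟩ := E.lift hf'.1
      obtain ⟨f, hf, hff⟩ := hdesc w' hw' ((AddMonoidHom.mem_ker).1 hf'.2)
      exact ⟨f, hf, w, hw, w', hw', hwz, hff, hR⟩
    · obtain ⟨w', hw', hwf⟩ := F.hull_cocycles_le (by positivity : (0 : ℤ) < (m + 1 : ℕ))
        (x := fun x => E.ι.app x (f x)) ⟨E.ι.map_mem hf.1, by
          refine funext fun y => ?_
          rw [← E.ι.map_d, (AddMonoidHom.mem_ker).1 hf.2]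
          exact map_zero _⟩
      rw [hcast] at hw'
      obtain ⟨z', hz', hR⟩ := (ih F.cohull).2.1 (fun x => E.π.app x (w' x)) ⟨E.π.map_mem hw', by
        refine funext fun y => ?_
        rw [← E.π.map_d, hwf]
        exact (E.exact _ _).2 ⟨_, rfl⟩⟩
      obtain ⟨w, hw, rfl⟩ := E.fam_lift hz'.1
      obtain ⟨z, hz, hzw⟩ := E.descend_δ hw (mem_nerveCocycles.1 hz').2
      exact ⟨z, hz, w, hw, w', hw', hzw.symm, hwf, hR⟩
    · rintro z hz f hf ⟨w, hw, w', hw', hwz, hwf, hR⟩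
      have hπw : E.π.famMap m 0 w ∈ F.cohull.nerveCocycles m 0 := mem_nerveCocycles.2 ⟨E.π.famMap_mem hw, by
        rw [← E.π.famMap_δ, hwz]
        exact E.famMap_comp z⟩
      have hπw' : (fun x => E.π.app x (w' x)) ∈ F.cohull.cocycles m := ⟨E.π.map_mem hw', by
        refine funext fun y => ?_
        rw [← E.π.map_d, hwf]
        exact (E.exact _ _).2 ⟨_, rfl⟩⟩
      constructor
      · rintro ⟨v, hv, rfl⟩
        set t := w - E.ι.famMap m 0 v
        have ht : t ∈ F.hull.nerveCocycles m 0 := mem_nerveCocycles.2 ⟨sub_mem hw (E.ι.famMap_mem hv), by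
          rw [map_sub, hwz, ← E.ι.famMap_δ, sub_eq_zero]
          rfl⟩
        have hπt : E.π.famMap m 0 t = E.π.famMap m 0 w := by
          rw [map_sub, E.famMap_comp, sub_zero]
        -- For m > 0 the hull is exact and t' = 0 will do. For m = 0 the hull does have cohomology:
        -- the cocycle t of its nerve complex has to be replaced by a corresponding cocycle t' of
        -- its cube complex.
        have : ∃ t' ∈ F.hull.cocycles m,
            (fun x => E.π.app x (w' x - t' x)) ∈ F.cohull.coboundaries m := by
          rcases m with _ | m
          · obtain ⟨t', ht', hRt⟩ := (ih F.hull).1 t ht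
            refine ⟨t', ht', ?_⟩
            have h1 := corr_zero_map E.π hRt
            rw [hπt] at h1
            have h2 := sub_mem hR h1
            have h3 := ((ih F.cohull).2.2 _ (sub_mem hπw hπw) _ (sub_mem hπw' (by
              refine ⟨E.π.map_mem ht'.1, funext fun y => ?_⟩
              rw [← E.π.map_d, (AddMonoidHom.mem_ker).1 ht'.2]
              exact map_zero _)) h2).1 (by rw [sub_self]; exact zero_mem _)
            convert h3 using 1
            exact funext fun x => map_sub _ _ _
          · refine ⟨0, zero_mem _, ?_⟩
            have h1 : E.π.famMap (m + 1) 0 w ∈ F.cohull.nerveCoboundaries (m + 1) 0 := by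
              obtain ⟨e, he, het⟩ := F.hull_nerveCocycles_le m 0 ht
              rw [← hπt, ← het]
              exact ⟨_, E.π.famMap_mem he, (E.π.famMap_δ e).symm⟩
            have h3 := ((ih F.cohull).2.2 _ hπw _ hπw' hR).1 h1
            convert h3 using 3
            exact sub_zero _
        obtain ⟨t', ht', e, he, het⟩ := this
        obtain ⟨e, he', rfl⟩ := E.lift he
        obtain ⟨v', hv', hvv⟩ := E.descend (i := m) (f := w' - t' - F.hull.d e)
          (sub_mem (sub_mem hw' ht'.1) (F.hull.d_mem (by ring) he')) (fun x => by
            rw [Pi.sub_apply, map_sub, E.π.map_d, het, Pi.sub_apply, sub_self])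
        refine ⟨v', by rw [hcast]; exact hv', funext fun y => E.injective y ?_⟩
        rw [E.ι.map_d, hvv, map_sub, map_sub, d_d, (AddMonoidHom.mem_ker).1 ht'.2, hwf, sub_zero,
          sub_zero]
        rfl
      · rintro ⟨v', hv', rfl⟩
        rw [hcast] at hv'
        set t' : ∀ x, F.hull.obj x := w' - fun x => E.ι.app x (v' x)
        have ht' : t' ∈ F.hull.cocycles m := AddSubgroup.mem_inf.2
          ⟨sub_mem hw' (E.ι.map_mem hv'), by
          rw [AddMonoidHom.mem_ker, map_sub, hwf, sub_eq_zero]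
          exact funext fun y => E.ι.map_d v' y⟩
        have hπt : (fun x => E.π.app x (t' x)) = fun x => E.π.app x (w' x) := by
          funext x
          have : E.π.app x (E.ι.app x (v' x)) = 0 := (E.exact _ _).2 ⟨_, rfl⟩
          simp only [t', Pi.sub_apply, map_sub, this, sub_zero]
        have : ∃ t ∈ F.hull.nerveCocycles m 0,
            E.π.famMap m 0 (w - t) ∈ F.cohull.nerveCoboundaries m 0 := by
          rcases m with _ | m
          · obtain ⟨t, ht, hRt⟩ := (ih F.hull).2.1 t' ht'
            refine ⟨t, ht, ?_⟩
            have h1 := corr_zero_map E.π hRt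
            rw [hπt] at h1
            have h2 := sub_mem hR h1
            rw [map_sub]
            exact ((ih F.cohull).2.2 _ (sub_mem hπw (E.π.famMap_mem_cocycles ht)) _
              (sub_mem hπw' hπw') h2).2 (by rw [sub_self]; exact zero_mem _)
          · refine ⟨0, zero_mem _, ?_⟩
            rw [sub_zero]
            refine ((ih F.cohull).2.2 _ hπw _ hπw' hR).2 ?_
            obtain ⟨e, he, het⟩ := F.hull_cocycles_le (by positivity : (0 : ℤ) < (m + 1 : ℕ)) ht'
            rw [← hπt, ← het]
            exact ⟨_, E.π.map_mem he, funext fun y => (E.π.map_d e y).symm⟩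
        obtain ⟨t, ht, hte⟩ := this
        obtain ⟨e, he, hee⟩ := E.lift_coboundaries hte
        obtain ⟨v, hv, hvv⟩ := E.fam_descend (z := w - t - e)
          (sub_mem (sub_mem hw ht.1) (nerveCoboundaries_le _ _ he).1) (by
            rw [map_sub, hee, sub_self])
        refine ⟨v, hv, E.famMap_injective _ _ ?_⟩
        rw [E.ι.famMap_δ, hvv, map_sub, map_sub, (mem_nerveCocycles.1 ht).2,
          (mem_nerveCocycles.1 (nerveCoboundaries_le _ _ he)).2, hwz, sub_zero, sub_zero]
        rfl

/-- The cohomology of the nerve complex is the cohomology of the cube complex. -/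
theorem nonempty_nerve_equiv (F : CubeFunctor A) (m : ℕ) :
    Nonempty ((F.nerveCocycles m 0 ⧸ (F.nerveCoboundaries m 0).addSubgroupOf (F.nerveCocycles m 0))
      ≃+ F.H m) :=
  nonempty_quotient_equiv (corr m F) (corr_spec m F).1 (corr_spec m F).2.1 (corr_spec m F).2.2

end Comparison

end CubeFunctor
end Khovanov

/-! ### Homotopy groups of simplicial abelian groups -/

namespace Khovanov

open CategoryTheory Opposite

namespace SimplicialGroup

/-- The simplicial abelian group with given groups of simplices and given restriction maps. -/
def mk (G : ℕ → Type) [∀ k, AddCommGroup (G k)]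
    (r : ∀ {k l : ℕ}, (Fin (k + 1) →o Fin (l + 1)) → G l →+ G k)
    (hid : ∀ k (z : G k), r OrderHom.id z = z)
    (hcomp : ∀ {j k l : ℕ} (α : Fin (j + 1) →o Fin (k + 1)) (β : Fin (k + 1) →o Fin (l + 1))
      (z : G l), r α (r β z) = r (β.comp α) z) :
    SimplicialObject AddCommGrpCat.{0} where
  obj κ := AddCommGrpCat.of (G κ.unop.len)
  map f := AddCommGrpCat.ofHom (r f.unop.toOrderHom)
  map_id κ := by
    ext z
    exact hid _ z
  map_comp f g := by
    ext z
    exact (hcomp g.unop.toOrderHom f.unop.toOrderHom z).symm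

/-- The face maps. -/
def face (X : SimplicialObject AddCommGrpCat.{0}) {n : ℕ} (i : Fin (n + 2)) :
    X.obj (op (SimplexCategory.mk (n + 1))) →+ X.obj (op (SimplexCategory.mk n)) := (X.δ i).hom

/-- The simplices all of whose faces except possibly the first one are `0`. -/
def normal (X : SimplicialObject AddCommGrpCat.{0}) :
    (n : ℕ) → AddSubgroup (X.obj (op (SimplexCategory.mk n)))
  | 0 => ⊤
  | _ + 1 => ⨅ i : Fin _, (face X i.succ).ker

/-- The simplices all of whose faces are `0`. -/
def cycles (X : SimplicialObject AddCommGrpCat.{0}) :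
    (n : ℕ) → AddSubgroup (X.obj (op (SimplexCategory.mk n)))
  | 0 => ⊤
  | _ + 1 => ⨅ i : Fin _, (face X i).ker

open scoped Simplicial

theorem face_face_zero (X : SimplicialObject AddCommGrpCat.{0}) {n : ℕ} (i : Fin (n + 2))
    (x : X _⦋n + 2⦌) : face X i (face X 0 x) = face X 0 (face X i.succ x) :=
  (ConcreteCategory.congr_hom (X.δ_comp_δ (Fin.zero_le i)) x).symm

theorem map_face {X Y : SimplicialObject AddCommGrpCat.{0}} (f : X ⟶ Y) {n : ℕ} (i : Fin (n + 2))
    (x : X _⦋n + 1⦌) : (f.app _).hom (face X i x) = face Y i ((f.app _).hom x) :=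
  ConcreteCategory.congr_hom (f.naturality (SimplexCategory.δ i).op) x

/-- The simplices which are the first face of a simplex whose other faces are `0`. -/
def boundaries (X : SimplicialObject AddCommGrpCat.{0}) (n : ℕ) : AddSubgroup (X _⦋n⦌) :=
  (normal X (n + 1)).map (face X 0)

/-- The homotopy groups. -/
abbrev π (X : SimplicialObject AddCommGrpCat.{0}) (n : ℕ) : Type :=
  cycles X n ⧸ (boundaries X n).addSubgroupOf (cycles X n)

section

variable {X Y : SimplicialObject AddCommGrpCat.{0}}

theorem mem_normal {n : ℕ} {x : X _⦋n + 1⦌} : x ∈ normal X (n + 1) ↔ ∀ i : Fin (n + 1), face X i.succ x = 0 := by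
  simp [normal, AddSubgroup.mem_iInf]

theorem mem_cycles {n : ℕ} {x : X _⦋n + 1⦌} : x ∈ cycles X (n + 1) ↔ ∀ i, face X i x = 0 := by
  simp [cycles, AddSubgroup.mem_iInf]

theorem mem_cycles_iff {n : ℕ} {x : X _⦋n + 1⦌} :
    x ∈ cycles X (n + 1) ↔ x ∈ normal X (n + 1) ∧ face X 0 x = 0 := by
  rw [mem_cycles, mem_normal, Fin.forall_fin_succ, and_comm]

theorem cycles_le_normal (n : ℕ) : cycles X n ≤ normal X n := by
  cases n with
  | zero => exact le_rfl
  | succ n => exact fun x hx => (mem_cycles_iff.1 hx).1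

theorem face_zero_mem {n : ℕ} {x : X _⦋n + 1⦌} (hx : x ∈ normal X (n + 1)) :
    face X 0 x ∈ cycles X n := by
  cases n with
  | zero => trivial
  | succ n => exact mem_cycles.2 fun i => by rw [face_face_zero, mem_normal.1 hx, map_zero]

theorem map_mem_normal (f : X ⟶ Y) {n : ℕ} {x : X _⦋n⦌} (hx : x ∈ normal X n) :
    (f.app _).hom x ∈ normal Y n := by
  cases n with
  | zero => trivial
  | succ n => exact mem_normal.2 fun i => by rw [← map_face, mem_normal.1 hx, map_zero]

open AlgebraicTopology.DoldKan in
/-- Every normal simplex which lifts along a simplicial map has a normal lift. -/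
theorem exists_normal_lift (f : X ⟶ Y) {n : ℕ} {x : X _⦋n⦌} (h : (f.app _).hom x ∈ normal Y n) :
    ∃ x' ∈ normal X n, (f.app _).hom x' = (f.app _).hom x := by
  cases n with
  | zero => exact ⟨x, trivial, rfl⟩
  | succ n =>
    -- The projector `PInfty` is natural, has normal values in positive degrees and fixes normal
    -- simplices. Applied to an arbitrary lift it gives a normal one over the same simplex.
    refine ⟨((PInfty (X := X)).f (n + 1)).hom x, mem_normal.2 fun i => ?_, ?_⟩
    · exact ConcreteCategory.congr_hom (HigherFacesVanish.of_P (X := X) (n + 1) n i (by omega)) x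
    · refine (ConcreteCategory.congr_hom (PInfty_f_naturality (n + 1) f).symm x).trans ?_
      let φ : AddCommGrpCat.of (normal Y (n + 1)) ⟶ Y _⦋n + 1⦌ :=
        AddCommGrpCat.ofHom (normal Y (n + 1)).subtype
      have hφ : HigherFacesVanish (n + 1) φ := fun j _ => by
        ext y
        exact mem_normal.1 y.2 j
      exact ConcreteCategory.congr_hom hφ.comp_P_eq_self
        (⟨_, h⟩ : normal Y (n + 1))

end

/-- A simplicial map `ι` is the kernel of a simplicial map `f` which is surjective on normal
simplices of positive degree, and the homotopy groups of the source of `f` vanish. -/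
structure PathSequence {Z C W : SimplicialObject AddCommGrpCat.{0}} (ι : Z ⟶ C) (f : C ⟶ W) :
    Prop where
  injective : ∀ n, Function.Injective (ι.app (op ⦋n⦌)).hom
  exact : ∀ n x, (f.app (op ⦋n⦌)).hom x = 0 ↔ ∃ z, (ι.app (op ⦋n⦌)).hom z = x
  surjective : ∀ n, ∀ x ∈ normal W (n + 1), ∃ y, (f.app (op ⦋n + 1⦌)).hom y = x
  acyclic : ∀ n, ∀ x ∈ cycles C n, ∃ y ∈ normal C (n + 1), face C 0 y = x

namespace PathSequence

variable {Z C W : SimplicialObject AddCommGrpCat.{0}} {ι : Z ⟶ C} {f : C ⟶ W}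
  (E : PathSequence ι f)

include E

theorem ι_mem_cycles {n : ℕ} {x : Z _⦋n⦌} : (ι.app _).hom x ∈ cycles C n ↔ x ∈ cycles Z n := by
  cases n with
  | zero => exact Iff.rfl
  | succ n =>
    simp only [mem_cycles, ← map_face]
    exact forall_congr' fun i => map_eq_zero_iff _ (E.injective n)

theorem ι_mem_normal {n : ℕ} {x : Z _⦋n⦌} : (ι.app _).hom x ∈ normal C n ↔ x ∈ normal Z n := by
  cases n with
  | zero => exact Iff.rfl
  | succ n =>
    simp only [mem_normal, ← map_face]
    exact forall_congr' fun i => map_eq_zero_iff _ (E.injective n)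

theorem exists_lift {n : ℕ} {x : W _⦋n + 1⦌} (hx : x ∈ normal W (n + 1)) :
    ∃ y ∈ normal C (n + 1), (f.app _).hom y = x := by
  obtain ⟨y, rfl⟩ := E.surjective n x hx
  exact exists_normal_lift f hx

/-- The boundary isomorphism of the long exact sequence. -/
theorem nonempty_π_equiv (n : ℕ) : Nonempty (π W (n + 1) ≃+ π Z n) := by
  have hfι : ∀ {n} (z : Z _⦋n⦌), (f.app _).hom ((ι.app _).hom z) = 0 := fun z =>
    (E.exact _ _).2 ⟨z, rfl⟩
  -- The connecting homomorphism as a relation: a normal simplex h of C lies over x, and its first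
  -- face is z.
  let R : AddSubgroup (W _⦋n + 1⦌ × Z _⦋n⦌) :=
    { carrier := {p | ∃ h ∈ normal C (n + 1), (f.app _).hom h = p.1 ∧ face C 0 h = (ι.app _).hom p.2}
      zero_mem' := ⟨0, zero_mem _, map_zero _, (map_zero _).trans (map_zero _).symm⟩
      add_mem' := fun {p q} ⟨h, h1, h2, h3⟩ ⟨h', h1', h2', h3'⟩ => ⟨h + h', add_mem h1 h1', by
        rw [map_add, h2, h2', Prod.fst_add], by rw [map_add, h3, h3', Prod.snd_add, map_add]⟩
      neg_mem' := fun {p} ⟨h, h1, h2, h3⟩ => ⟨-h, neg_mem h1, by rw [map_neg, h2, Prod.fst_neg], by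
        rw [map_neg, h3, Prod.snd_neg, map_neg]⟩ }
  refine nonempty_quotient_equiv R (fun x hx => ?_) (fun z hz => ?_) ?_
  · obtain ⟨h, h1, rfl⟩ := E.exists_lift (cycles_le_normal _ hx)
    obtain ⟨z, hz⟩ := (E.exact n (face C 0 h)).1 (by rw [map_face, mem_cycles.1 hx])
    exact ⟨z, E.ι_mem_cycles.1 (hz ▸ face_zero_mem h1), h, h1, rfl, hz.symm⟩
  · obtain ⟨y, hy, hyz⟩ := E.acyclic n _ (E.ι_mem_cycles.2 hz)
    refine ⟨_, mem_cycles_iff.2 ⟨map_mem_normal f hy, ?_⟩, y, hy, rfl, hyz⟩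
    rw [← map_face, hyz, hfι]
  · rintro x hx z hz ⟨h, h1, h2, h3⟩
    dsimp only at h2 h3
    constructor
    · rintro ⟨y, hy, rfl⟩
      obtain ⟨y, hy', rfl⟩ := E.exists_lift hy
      obtain ⟨w, hw⟩ := (E.exact _ (h - face C 0 y)).1 (by rw [map_sub, h2, map_face, sub_self])
      refine ⟨w, E.ι_mem_normal.1 ?_, E.injective n ?_⟩
      · rw [hw]
        exact sub_mem h1 (cycles_le_normal _ (face_zero_mem hy'))
      · rw [map_face, hw, map_sub, h3, mem_cycles.1 (face_zero_mem hy'), sub_zero]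
    · rintro ⟨w, hw, rfl⟩
      have hc : h - (ι.app _).hom w ∈ cycles C (n + 1) := mem_cycles_iff.2
        ⟨sub_mem h1 (map_mem_normal ι hw), by rw [map_sub, h3, map_face, sub_self]⟩
      obtain ⟨y, hy, hyh⟩ := E.acyclic _ _ hc
      exact ⟨(f.app _).hom y, map_mem_normal f hy, by rw [← map_face, hyh, map_sub, h2, hfι, sub_zero]⟩

end PathSequence

end SimplicialGroup
end Khovanov

/-! ### The homotopy groups of the simplicial group of cocycles -/

namespace Khovanov

open CategoryTheory Opposite

theorem subsingleton_quotient {G : Type*} [AddCommGroup G] {Z B : AddSubgroup G} (h : Z ≤ B) :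
    Subsingleton (Z ⧸ B.addSubgroupOf Z) := by
  rw [AddSubgroup.addSubgroupOf_eq_top.2 h]
  exact QuotientAddGroup.subsingleton_quotient_top

namespace CubeFunctor

open Augmented SimplicialGroup

variable {A : Type} (F : CubeFunctor A)

/-- The simplicial abelian group of the cochains of degree `m`. -/
def cochainObject (m : ℕ) : SimplicialObject AddCommGrpCat.{0} :=
  SimplicialGroup.mk (fun k => F.nerveCochains m k)
    (fun {k l} β => ((F.res m β).comp (F.nerveCochains m l).subtype).codRestrict
      (F.nerveCochains m k) fun z => res_mem β z.2)
    (fun _ _ => rfl) (fun _ _ _ => rfl)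

theorem res_mem_cocycles {m k l : ℕ} (β : Fin (k + 1) →o Fin (l + 1)) {z : F.Fam m l}
    (hz : z ∈ F.nerveCocycles m l) : F.res m β z ∈ F.nerveCocycles m k :=
  mem_nerveCocycles.2 ⟨res_mem β (mem_nerveCocycles.1 hz).1, by
    rw [← res_δ, (mem_nerveCocycles.1 hz).2, map_zero]⟩

/-- The simplicial abelian group of the cocycles of degree `m`. -/
def cocycleObject (m : ℕ) : SimplicialObject AddCommGrpCat.{0} :=
  SimplicialGroup.mk (fun k => F.nerveCocycles m k)
    (fun {k l} β => ((F.res m β).comp (F.nerveCocycles m l).subtype).codRestrict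
      (F.nerveCocycles m k) fun z => F.res_mem_cocycles β z.2)
    (fun _ _ => rfl) (fun _ _ _ => rfl)

/-- The inclusion of the cocycles. -/
def cocycleInclusion (m : ℕ) : F.cocycleObject m ⟶ F.cochainObject m where
  app κ := AddCommGrpCat.ofHom (AddSubgroup.inclusion inf_le_left :
    F.nerveCocycles m κ.unop.len →+ F.nerveCochains m κ.unop.len)
  naturality _ _ _ := rfl

/-- The coboundary. -/
def coboundary (m : ℕ) : F.cochainObject m ⟶ F.cocycleObject (m + 1) where
  app κ := AddCommGrpCat.ofHom (((F.δ m κ.unop.len).comp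
    (F.nerveCochains m κ.unop.len).subtype).codRestrict (F.nerveCocycles (m + 1) κ.unop.len)
    fun z => mem_nerveCocycles.2 ⟨δ_mem z.2, F.δ_δ _⟩)
  naturality _ _ _ := rfl

/-- The monotone map `0 ↦ 0`, `i + 1 ↦ i`. -/
def contract (k : ℕ) : Fin (k + 2) →o Fin (k + 1) := Fin.predAboveOrderHom 0

open Classical in
/-- The extra degeneracy. -/
def extraDegeneracy (m k : ℕ) : F.Fam m k →+ F.Fam m (k + 1) where
  toFun z x w := if ∀ i, (w i).2 ≠ 0 then z x ((Cell.push x (contract k)).comp w) else 0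
  map_zero' := funext fun _ => funext fun _ => ite_self _
  map_add' z z' := funext fun x => funext fun w => by
    simp only [Pi.add_apply]
    split_ifs <;> simp

variable {F}

theorem extraDegeneracy_mem {m k : ℕ} {z : F.Fam m k} (hz : z ∈ F.nerveCochains m k) :
    F.extraDegeneracy m k z ∈ F.nerveCochains m (k + 1) := by
  refine ⟨fun x y h w => ?_, fun x w h => ?_, fun x w h => ?_⟩
  · change F.map h (if _ then _ else _) = if _ then _ else _
    rw [apply_ite (F.map h), map_zero, hz.1 x y h]
    rfl
  · refine ite_eq_right_iff.2 fun _ => hz.2.1 x _ h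
  · refine ite_eq_right_iff.2 fun h0 => hz.2.2 x _ fun hi => h fun i j hij => ?_
    exact hi (congrArg (Cell.push x (contract k)) hij)

theorem res_zero_extraDegeneracy {m k : ℕ} (z : F.Fam m k) :
    F.res m (faceMap 0) (F.extraDegeneracy m k z) = z := by
  funext x w
  have h : ∀ i, ((Cell.push x (faceMap 0)).comp w i).2 ≠ 0 := fun i => Fin.succ_ne_zero _
  refine (if_pos h).trans (congrArg (z x) ?_)
  refine OrderHom.ext _ _ (funext fun i => Prod.ext rfl ?_)
  change Fin.predAbove 0 (Fin.succAbove 0 (w i).2) = (w i).2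
  simp

/-- Together with `res_zero_extraDegeneracy` and `res_one_extraDegeneracy` this is the identity of
an extra degeneracy. It holds because `extraDegeneracy` extends a cochain from the face opposite the
vertex 0 by the value 0 on all chains that meet that vertex. -/
theorem res_succ_extraDegeneracy {m k : ℕ} (i : Fin (k + 2)) (z : F.Fam m (k + 1)) :
    F.res m (faceMap i.succ) (F.extraDegeneracy m (k + 1) z) =
      F.extraDegeneracy m k (F.res m (faceMap i) z) := by
  funext x w
  have h0 : (∀ j, ((Cell.push x (faceMap i.succ)).comp w j).2 ≠ 0) ↔ ∀ j, (w j).2 ≠ 0 :=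
    forall_congr' fun j => not_congr (Fin.succAbove_eq_zero_iff (Fin.succ_ne_zero i))
  by_cases h : ∀ j, (w j).2 ≠ 0
  · refine (if_pos (h0.2 h)).trans (Eq.trans (congrArg (z x) ?_) (if_pos h).symm)
    refine OrderHom.ext _ _ (funext fun j => Prod.ext rfl ?_)
    change Fin.predAbove 0 (i.succ.succAbove (w j).2) = i.succAbove (Fin.predAbove 0 (w j).2)
    obtain ⟨b, hb⟩ := Fin.exists_succ_eq.2 (h j)
    rw [← hb, Fin.succ_succAbove_succ]
    simp
  · exact (if_neg (h0.not.2 h)).trans (if_neg h).symm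

theorem res_one_extraDegeneracy {m : ℕ} (z : F.Fam m 0) :
    F.res m (faceMap 1) (F.extraDegeneracy m 0 z) = 0 := by
  funext x w
  refine if_neg fun h => h 0 ?_
  change Fin.succAbove 1 (w 0).2 = 0
  have : (w 0).2 = 0 := Subsingleton.elim (α := Fin 1) _ _
  rw [this]
  rfl

theorem res_mem_nerveCoboundaries {m k l : ℕ} (β : Fin (k + 1) →o Fin (l + 1)) {z : F.Fam m l}
    (hz : z ∈ F.nerveCoboundaries m l) : F.res m β z ∈ F.nerveCoboundaries m k := by
  rcases m with _ | m
  · obtain rfl : z = 0 := hz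
    exact zero_mem _
  · obtain ⟨w, hw, rfl⟩ := hz
    exact ⟨_, res_mem β hw, rfl⟩

/-- A cocycle is a coboundary if its restriction to some vertex is one. -/
theorem mem_nerveCoboundaries_of_res {m k : ℕ} {z : F.Fam m k} (hz : z ∈ F.nerveCocycles m k)
    (β : Fin (0 + 1) →o Fin (k + 1)) (h : F.res m β z ∈ F.nerveCoboundaries m 0) :
    z ∈ F.nerveCoboundaries m k := by
  obtain ⟨v, -, hb⟩ := exists_sub_res_mem m k F z hz
  have h1 := res_mem_nerveCoboundaries β hb
  rw [map_sub, res_res, show (toPoint k).comp β = OrderHom.id from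
    OrderHom.ext _ _ (funext fun a => Subsingleton.elim (α := Fin 1) _ _)] at h1
  have h2 : v ∈ F.nerveCoboundaries m 0 := by
    have := sub_mem h h1
    rwa [sub_sub_cancel] at this
  have := add_mem hb (res_mem_nerveCoboundaries (toPoint k) h2)
  rwa [sub_add_cancel] at this

/-- Every face contains a vertex, and the class of a cocycle is determined by its restriction to any
vertex of the simplex. -/
theorem mem_nerveCoboundaries_of_face {m k : ℕ} {z : F.Fam m (k + 1)}
    (hz : z ∈ F.nerveCocycles m (k + 1)) (i : Fin (k + 2)) (h : F.res m (faceMap i) z = 0) :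
    z ∈ F.nerveCoboundaries m (k + 1) := by
  refine mem_nerveCoboundaries_of_res hz ((faceMap i).comp ⟨fun _ => 0, fun _ _ _ => le_rfl⟩) ?_
  rw [← res_res, h, map_zero]
  exact zero_mem _

/-- The path sequence of the cocycles and cochains. -/
theorem pathSequence (m : ℕ) : PathSequence (F.cocycleInclusion m) (F.coboundary m) where
  injective n x y h := Subtype.ext (congrArg (Subtype.val : F.nerveCochains m n → _) h)
  exact n x := ⟨fun h => ⟨⟨x.1, mem_nerveCocycles.2 ⟨x.2,
    congrArg (Subtype.val : F.nerveCocycles (m + 1) n → _) h⟩⟩, rfl⟩, by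
    rintro ⟨z, rfl⟩
    exact Subtype.ext (mem_nerveCocycles.1 (Subtype.prop (p := (· ∈ F.nerveCocycles m n)) z)).2⟩
  surjective n x hx := by
    -- A normal simplex of positive dimension has a vanishing face number 1, so as a cocycle it is a
    -- coboundary. In dimension 0 this fails: there the cohomology appears.
    obtain ⟨w, hw, h⟩ := mem_nerveCoboundaries_of_face (F := F) (m := m + 1) (z := x.1) x.2 1
      (congrArg (Subtype.val : F.nerveCocycles (m + 1) n → _) (mem_normal.1 hx 0))
    exact ⟨⟨w, hw⟩, Subtype.ext h⟩
  acyclic n x hx := by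
    refine ⟨⟨F.extraDegeneracy m n x.1, extraDegeneracy_mem x.2⟩, mem_normal.2 fun i => Subtype.ext ?_,
      Subtype.ext (res_zero_extraDegeneracy x.1)⟩
    cases n with
    | zero =>
      obtain rfl : i = 0 := Subsingleton.elim (α := Fin 1) _ _
      exact res_one_extraDegeneracy x.1
    | succ n =>
      have h : F.res m (faceMap i) x.1 = 0 :=
        congrArg (Subtype.val : F.nerveCochains m n → _) (mem_cycles.1 hx i)
      refine (res_succ_extraDegeneracy i x.1).trans ?_
      rw [h, map_zero]
      rfl

/-- An edge from 0 forces its other end to be a coboundary. Conversely, for z = δw the coboundary of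
the extra degeneracy of w is an edge with first face z and second face 0. -/
theorem mem_boundaries_iff {m : ℕ} (z : F.nerveCocycles m 0) :
    z ∈ boundaries (F.cocycleObject m) 0 ↔ z.1 ∈ F.nerveCoboundaries m 0 := by
  constructor
  · rintro ⟨y, hy, rfl⟩
    exact res_mem_nerveCoboundaries (F := F) (m := m) (faceMap 0)
      (mem_nerveCoboundaries_of_face (z := y.1) y.2 1
        (congrArg (Subtype.val : F.nerveCocycles m 0 → _) (mem_normal.1 hy 0)))
  · rintro h
    rcases m with _ | m
    · obtain rfl : z = 0 := Subtype.ext h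
      exact zero_mem _
    · obtain ⟨w, hw, h⟩ := h
      refine ⟨⟨F.δ m 1 (F.extraDegeneracy m 0 w), mem_nerveCocycles.2
        ⟨δ_mem (extraDegeneracy_mem hw), F.δ_δ _⟩⟩, mem_normal.2 fun i => Subtype.ext ?_,
        Subtype.ext ?_⟩
      · obtain rfl : i = 0 := Subsingleton.elim (α := Fin 1) _ _
        change F.res (m + 1) (faceMap 1) (F.δ m 1 (F.extraDegeneracy m 0 w)) = 0
        rw [res_δ, res_one_extraDegeneracy, map_zero]
      · change F.res (m + 1) (faceMap 0) (F.δ m 1 (F.extraDegeneracy m 0 w)) = z.1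
        rw [res_δ, res_zero_extraDegeneracy, h]

theorem cochains_eq_bot {i : ℤ} (hi : i < 0) : F.cochains i = ⊥ := by
  refine (AddSubgroup.eq_bot_iff_forall _).2 fun f hf => funext fun x => hf x ?_
  omega

/-- In degree 0 the only coboundary is 0, so a cocycle over a simplex of positive dimension with a
vanishing face is 0. -/
theorem subsingleton_π_zero (j : ℕ) : Subsingleton (π (F.cocycleObject 0) (j + 1)) := by
  refine subsingleton_quotient fun z hz => ?_
  have : z = 0 := Subtype.ext (mem_nerveCoboundaries_of_face (F := F) (m := 0) (z := z.1) z.2 0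
    (congrArg (Subtype.val : F.nerveCocycles 0 j → _) (mem_cycles.1 hz 0)))
  rw [this]
  exact zero_mem _

theorem nonempty_π_zero_equiv [LinearOrder A] (n : ℕ) :
    Nonempty (π (F.cocycleObject n) 0 ≃+ F.H n) := by
  obtain ⟨e⟩ := F.nonempty_nerve_equiv n
  obtain ⟨e'⟩ : Nonempty (π (F.cocycleObject n) 0 ≃+
      F.nerveCocycles n 0 ⧸ (F.nerveCoboundaries n 0).addSubgroupOf (F.nerveCocycles n 0)) := by
    refine nonempty_quotient_equiv (AddMonoidHom.graph (F.nerveCocycles n 0).subtype)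
      (fun z _ => ⟨z.1, z.2, rfl⟩) (fun z hz => ⟨⟨z, hz⟩, trivial, rfl⟩) ?_
    rintro z - z' - h
    obtain rfl : z.1 = z' := h
    exact mem_boundaries_iff z
  exact ⟨e'.trans e⟩

/-- The homotopy groups of the simplicial group of cocycles. -/
theorem nonempty_π_equiv [LinearOrder A] (n j : ℕ) :
    Nonempty (π (F.cocycleObject n) j ≃+ F.H ((n : ℤ) - j)) := by
  -- Each path sequence lowers n and j by one simultaneously, so n − j stays the same. The descent
  -- ends with j = 0, where the cohomology of degree n − j is found, or with n = 0 < j, where both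
  -- groups vanish.
  induction j generalizing n with
  | zero =>
    rw [Nat.cast_zero, sub_zero]
    exact nonempty_π_zero_equiv n
  | succ j ih =>
    cases n with
    | zero =>
      have := subsingleton_π_zero (F := F) j
      have : Subsingleton (F.H ((0 : ℕ) - (j + 1 : ℕ))) := by
        refine subsingleton_quotient fun f hf => ?_
        have h := hf.1
        rw [cochains_eq_bot (by omega)] at h
        obtain rfl : f = 0 := h
        exact zero_mem _
      exact ⟨⟨⟨0, 0, fun _ => Subsingleton.elim _ _, fun _ => Subsingleton.elim _ _⟩,
        fun _ _ => Subsingleton.elim _ _⟩⟩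
    | succ n =>
      obtain ⟨e⟩ := (pathSequence (F := F) n).nonempty_π_equiv j
      obtain ⟨e'⟩ := ih n
      have h : ((n + 1 : ℕ) : ℤ) - (j + 1 : ℕ) = n - j := by push_cast; ring
      rw [h]
      exact ⟨e.trans e'⟩

end CubeFunctor
end Khovanov

/-! ### An explicit form of the Dold–Kan correspondence -/

namespace Khovanov

open CategoryTheory Opposite

/-- The families of elements of a chain complex, one for each simplex of a standard simplex, which
amount to chain maps from the normalised chains. -/
def chainFamilies (A : ChainComplex AddCommGrpCat.{0} ℕ) (k : ℕ) :
    AddSubgroup (∀ m, (Fin (m + 1) →o Fin (k + 1)) → A.X m) where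
  carrier := {φ | (∀ m (σ : Fin (m + 1) →o Fin (k + 1)), ¬ Function.Injective σ → φ m σ = 0) ∧
    ∀ m (σ : Fin (m + 2) →o Fin (k + 1)), (A.d (m + 1) m).hom (φ (m + 1) σ) = altSum (φ m) σ}
  zero_mem' := ⟨fun _ _ _ => rfl, fun m σ => (map_zero _).trans (altSum_zero σ).symm⟩
  add_mem' := fun {φ ψ} h h' => ⟨fun m σ hσ => by simp [h.1 m σ hσ, h'.1 m σ hσ], fun m σ => by
    rw [Pi.add_apply, Pi.add_apply, map_add, h.2, h'.2]
    exact (altSum_add _ _ σ).symm⟩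
  neg_mem' := fun {φ} h => ⟨fun m σ hσ => by simp [h.1 m σ hσ], fun m σ => by
    rw [Pi.neg_apply, Pi.neg_apply, map_neg, h.2]
    exact (altSum_neg _ σ).symm⟩

/-- The simplicial abelian group of a chain complex, described by chain maps from the normalised
chains of the standard simplices. -/
def dold : ChainComplex AddCommGrpCat.{0} ℕ ⥤ SimplicialObject AddCommGrpCat.{0} where
  obj A := SimplicialGroup.mk (fun k => chainFamilies A k)
    (fun {k l} β =>
      { toFun := fun φ => ⟨fun m σ => φ.1 m (β.comp σ), And.intro (fun m σ h => φ.2.1 m _ fun h' =>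
          h (Function.Injective.of_comp (f := β) h')) fun m σ =>
          (φ.2.2 m (β.comp σ)).trans (altSum_comp β (φ.1 m) σ)⟩
        map_zero' := rfl
        map_add' := fun _ _ => rfl })
    (fun _ _ => rfl) (fun _ _ _ => rfl)
  map {A B} a :=
    { app := fun κ => AddCommGrpCat.ofHom
        { toFun := fun φ : chainFamilies A κ.unop.len =>
            (⟨fun m σ => (a.f m).hom (φ.1 m σ), And.intro (fun m σ h => (congrArg _ (φ.2.1 m σ h)).trans (map_zero _))
              fun m σ => by
                refine Eq.trans ?_ (map_altSum (a.f m).hom (φ.1 m) σ)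
                rw [← φ.2.2]
                exact ConcreteCategory.congr_hom (a.comm (m + 1) m) _⟩ :
              chainFamilies B κ.unop.len)
          map_zero' := Subtype.ext (funext fun m => funext fun σ => map_zero _)
          map_add' := fun φ ψ => Subtype.ext (funext fun m => funext fun σ => map_add _ _ _) }
      naturality := fun _ _ _ => rfl }
  map_id A := rfl
  map_comp a b := rfl

/-- The simplicial operator of a monotone map. -/
def simplexHom {k l : ℕ} (β : Fin (k + 1) →o Fin (l + 1)) :
    SimplexCategory.mk k ⟶ SimplexCategory.mk l := SimplexCategory.mkHom β

open AlgebraicTopology AlgebraicTopology.DoldKan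

namespace SimplicialGroup

/-- The differential of the unnormalised chain complex. -/
def faceSum (X : SimplicialObject AddCommGrpCat.{0}) (m : ℕ) :
    X.obj (op (SimplexCategory.mk (m + 1))) →+ X.obj (op (SimplexCategory.mk m)) :=
  ∑ i : Fin (m + 2), (-1 : ℤ) ^ (i : ℕ) • face X i

theorem faceSum_apply (X : SimplicialObject AddCommGrpCat.{0}) {m : ℕ}
    (x : X.obj (op (SimplexCategory.mk (m + 1)))) :
    faceSum X m x = ∑ i : Fin (m + 2), (-1 : ℤ) ^ (i : ℕ) • face X i x := by
  simp [faceSum, AddMonoidHom.finsetSum_apply]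

theorem hom_objD (X : SimplicialObject AddCommGrpCat.{0}) (m : ℕ) :
    (AlternatingFaceMapComplex.objD X m).hom = faceSum X m := by
  change AddCommGrpCat.homAddEquiv (∑ i : Fin (m + 2), (-1 : ℤ) ^ (i : ℕ) • X.δ i) = _
  rw [map_sum, faceSum]
  exact Finset.sum_congr rfl fun i _ => map_zsmul _ _ _

noncomputable section

/-- The inclusion of the normalised Moore complex. -/
def inc (X : SimplicialObject AddCommGrpCat.{0}) (m : ℕ) :
    ((normalizedMooreComplex AddCommGrpCat.{0}).obj X).X m →+ X.obj (op (SimplexCategory.mk m)) :=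
  ((inclusionOfMooreComplexMap X).f m).hom

/-- The projection to the normalised Moore complex. -/
def ret (X : SimplicialObject AddCommGrpCat.{0}) (m : ℕ) :
    X.obj (op (SimplexCategory.mk m)) →+ ((normalizedMooreComplex AddCommGrpCat.{0}).obj X).X m :=
  ((PInftyToNormalizedMooreComplex X).f m).hom

section

variable {X Y : SimplicialObject AddCommGrpCat.{0}} {m : ℕ}

theorem ret_inc (z) : ret X m (inc X m z) = z :=
  ConcreteCategory.congr_hom (HomologicalComplex.congr_hom
    (splitMonoInclusionOfMooreComplexMap X).id m) z

theorem ret_faceSum (x) : ret X m (faceSum X m x) =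
    (((normalizedMooreComplex _).obj X).d (m + 1) m).hom (ret X (m + 1) x) := by
  have := (PInftyToNormalizedMooreComplex X).comm (m + 1) m
  rw [AlternatingFaceMapComplex.obj_d_eq] at this
  rw [← hom_objD]
  exact (ConcreteCategory.congr_hom this x).symm

theorem inc_d (z) : inc X m ((((normalizedMooreComplex _).obj X).d (m + 1) m).hom z) =
    faceSum X m (inc X (m + 1) z) := by
  have := (inclusionOfMooreComplexMap X).comm (m + 1) m
  rw [alternatingFaceMapComplex_obj_d] at this
  rw [← hom_objD]
  exact (ConcreteCategory.congr_hom this z).symm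

theorem map_inc (f : X ⟶ Y) (z) : (f.app _).hom (inc X m z) =
    inc Y m ((((normalizedMooreComplex _).map f).f m).hom z) := by
  have : ((normalizedMooreComplex _).map f).f m ≫ (inclusionOfMooreComplexMap Y).f m =
      (inclusionOfMooreComplexMap X).f m ≫ f.app _ := by
    simp only [inclusionOfMooreComplexMap, NormalizedMooreComplex.map, normalizedMooreComplex]
    exact Subobject.factorThru_arrow _ _ _
  exact (ConcreteCategory.congr_hom this z).symm

theorem inc_injective : Function.Injective (inc X m) := Function.LeftInverse.injective ret_inc

/-- A non-injective operator factors through a degeneracy, and `PInfty` kills degenerate simplices.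
-/
theorem ret_map_of_not_injective {k : ℕ} (σ : Fin (m + 1) →o Fin (k + 1))
    (h : ¬ Function.Injective σ) (x : X.obj (op (SimplexCategory.mk k))) :
    ret X m ((X.map (simplexHom σ).op).hom x) = 0 := by
  have := degeneracy_comp_PInfty X m (simplexHom σ) (by
    rw [SimplexCategory.mono_iff_injective]
    exact h)
  apply inc_injective
  rw [map_zero]
  refine Eq.trans ?_ (ConcreteCategory.congr_hom this x)
  exact ConcreteCategory.congr_hom (HomologicalComplex.congr_hom
    (PInftyToNormalizedMooreComplex_comp_inclusionOfMooreComplexMap X) m) _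

/-- A homomorphism which vanishes on degenerate simplices factors through the normalised Moore
complex. -/
theorem map_inc_ret {M : Type} [AddCommGroup M] (f : X.obj (op (SimplexCategory.mk m)) →+ M)
    (h : ∀ k (σ : Fin (m + 1) →o Fin (k + 1)) (_ : ¬ Function.Injective σ) x,
      f ((X.map (simplexHom σ).op).hom x) = 0) (x) : f (inc X m (ret X m x)) = f x := by
  have h1 : DegeneraciesVanish (X := X) (n := m) (AddCommGrpCat.ofHom f) := by
    cases m with
    | zero => trivial
    | succ m =>
      intro i
      ext x
      exact h m _ (fun h' => by
        have := @h' i.castSucc i.succ (by simp)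
        exact absurd this (Fin.castSucc_lt_succ).ne) x
  -- `PInfty` and `QInfty` are complementary projectors, and a map that vanishes on degenerate
  -- simplices vanishes on the image of `QInfty`.
  have h2 := (degeneraciesVanish_iff_QInfty_f_comp _).1 h1
  have h3 := PInfty_f_add_QInfty_f (X := X) m =≫ AddCommGrpCat.ofHom f
  rw [Preadditive.add_comp, h2, add_zero, Category.id_comp] at h3
  refine Eq.trans (congrArg f ?_) (ConcreteCategory.congr_hom h3 x)
  exact ConcreteCategory.congr_hom (HomologicalComplex.congr_hom
    (PInftyToNormalizedMooreComplex_comp_inclusionOfMooreComplexMap X) m) _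

end

variable {A B : ChainComplex AddCommGrpCat.{0} ℕ}

/-- The value of a simplicial map to `dold.obj A`. -/
def eval (f : X ⟶ dold.obj A) (k : ℕ) : X.obj (op (SimplexCategory.mk k)) →+ chainFamilies A k :=
  (f.app (op (SimplexCategory.mk k))).hom

theorem eval_map (f : X ⟶ dold.obj A) {k l : ℕ} (β : Fin (k + 1) →o Fin (l + 1)) (x) (m : ℕ)
    (σ : Fin (m + 1) →o Fin (k + 1)) :
    (eval f k ((X.map (simplexHom β).op).hom x)).1 m σ = (eval f l x).1 m (β.comp σ) :=
  congrArg (fun φ : chainFamilies A k => φ.1 m σ)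
    (ConcreteCategory.congr_hom (f.naturality (simplexHom β).op) x)

/-- The member of a family at a simplex. -/
def _root_.Khovanov.chainFamilies.at (A : ChainComplex AddCommGrpCat.{0} ℕ) {k m : ℕ}
    (σ : Fin (m + 1) →o Fin (k + 1)) : chainFamilies A k →+ A.X m where
  toFun φ := φ.1 m σ
  map_zero' := rfl
  map_add' _ _ := rfl

/-- The value on the top simplex of a simplicial map to `dold.obj A`. -/
def topValue (f : X ⟶ dold.obj A) (m : ℕ) : X.obj (op (SimplexCategory.mk m)) →+ A.X m :=
  (chainFamilies.at A OrderHom.id).comp (eval f m)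

theorem topValue_map (f : X ⟶ dold.obj A) {k m : ℕ} (σ : Fin (m + 1) →o Fin (k + 1)) (x) :
    topValue f m ((X.map (simplexHom σ).op).hom x) = (eval f k x).1 m σ :=
  eval_map f σ x m OrderHom.id

theorem topValue_faceSum (f : X ⟶ dold.obj A) (m : ℕ) (x) :
    topValue f m (faceSum X m x) = (A.d (m + 1) m).hom (topValue f (m + 1) x) := by
  rw [faceSum_apply, map_sum]
  refine Eq.trans ?_ ((eval f (m + 1) x).2.2 m OrderHom.id).symm
  refine Finset.sum_congr rfl fun i _ => ?_
  rw [map_zsmul]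
  exact congrArg _ (topValue_map f (faceMap i) x)

/-- The simplicial map that corresponds to a chain map from the normalised Moore complex. -/
def ofChainMap (ψ : (normalizedMooreComplex _).obj X ⟶ A) : X ⟶ dold.obj A where
  app κ := AddCommGrpCat.ofHom
    { toFun := fun x => (⟨fun m σ => (ψ.f m).hom (ret X m ((X.map (simplexHom σ).op).hom x)),
        And.intro
          (fun m σ h => (congrArg _ (ret_map_of_not_injective σ h x)).trans (map_zero _))
          fun m σ => by
            refine (ConcreteCategory.congr_hom (ψ.comm (m + 1) m) _).trans ?_
            refine (congrArg (ψ.f m).hom (ret_faceSum _).symm).trans ?_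
            rw [faceSum_apply, map_sum, map_sum]
            refine Finset.sum_congr rfl fun i _ => ?_
            rw [map_zsmul, map_zsmul]
            congr 3
            exact (ConcreteCategory.congr_hom (X.map_comp (simplexHom σ).op
              (simplexHom (faceMap i)).op) x).symm⟩ : chainFamilies A κ.unop.len)
      map_zero' := Subtype.ext (funext fun m => funext fun σ => by simp)
      map_add' := fun x y => Subtype.ext (funext fun m => funext fun σ => by simp) }
  naturality κ μ g := by
    ext x
    refine Subtype.ext (funext fun m => funext fun σ => ?_)
    refine congrArg (fun y => (ψ.f m).hom (ret X m y)) ?_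
    exact (ConcreteCategory.congr_hom (X.map_comp g (simplexHom σ).op) x).symm

/-- The chain map that corresponds to a simplicial map to `dold.obj A`. -/
def toChainMap (f : X ⟶ dold.obj A) : (normalizedMooreComplex _).obj X ⟶ A where
  f m := AddCommGrpCat.ofHom ((topValue f m).comp (inc X m))
  comm' i j h := by
    obtain rfl : j + 1 = i := h
    ext z
    refine (topValue_faceSum f j _).symm.trans ?_
    exact congrArg (topValue f j) (inc_d z).symm

theorem toChainMap_ofChainMap (ψ : (normalizedMooreComplex _).obj X ⟶ A) :
    toChainMap (ofChainMap ψ) = ψ := by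
  ext m z
  change (ψ.f m).hom (ret X m ((X.map (simplexHom OrderHom.id).op).hom (inc X m z))) = _
  have : (X.map (simplexHom OrderHom.id).op).hom (inc X m z) = inc X m z :=
    ConcreteCategory.congr_hom (X.map_id _) _
  rw [this, ret_inc]

/-- A simplicial map to `dold.obj A` is determined by its values on top simplices. These vanish on
degenerate simplices, as the families in `chainFamilies` are normalised, so they are determined on
the Moore complex. -/
theorem ofChainMap_toChainMap (f : X ⟶ dold.obj A) : ofChainMap (toChainMap f) = f := by
  ext κ x
  refine Subtype.ext (funext fun m => funext fun σ => ?_)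
  refine (map_inc_ret (topValue f m) (fun k σ h x => ?_) _).trans (topValue_map f σ x)
  rw [topValue_map]
  exact (eval f k x).2.1 m σ h

/-- The functor `dold` is right adjoint to the normalised Moore complex. -/
def doldAdjunction : normalizedMooreComplex AddCommGrpCat.{0} ⊣ dold :=
  Adjunction.mkOfHomEquiv
    { homEquiv := fun X A => ⟨ofChainMap, toChainMap, toChainMap_ofChainMap, ofChainMap_toChainMap⟩
      homEquiv_naturality_left_symm := fun {X Y A} g f => by
        ext m z
        exact congrArg (topValue f m) (map_inc g z)
      homEquiv_naturality_right := fun ψ a => rfl }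

/-- The Dold–Kan correspondence is given by `dold`. -/
def gammaIso : CategoryTheory.Abelian.DoldKan.Γ (A := AddCommGrpCat.{0}) ≅ dold :=
  -- As an inverse equivalence, `Γ` is also a right adjoint of the normalised Moore complex, and
  -- right adjoints are unique.
  (CategoryTheory.Abelian.DoldKan.equivalence (A := AddCommGrpCat.{0})).toAdjunction.rightAdjointUniq
    doldAdjunction

/-- Every simplicial abelian group comes from its normalised Moore complex. -/
def unitIso (X : SimplicialObject AddCommGrpCat.{0}) :
    X ≅ dold.obj ((normalizedMooreComplex _).obj X) := by
  have := (CategoryTheory.Abelian.DoldKan.equivalence (A := AddCommGrpCat.{0})).isEquivalence_functor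
  have : (normalizedMooreComplex AddCommGrpCat.{0}).IsEquivalence := this
  exact asIso (doldAdjunction.unit.app X)

end

end SimplicialGroup

end Khovanov

/-! ### Chain homotopies induce simplicial homotopies -/

namespace Khovanov

open CategoryTheory Opposite MonoidalCategory

/-- A chain homotopy between two chain maps. -/
structure ChainHomotopy {A B : ChainComplex AddCommGrpCat.{0} ℕ} (a b : A ⟶ B) where
  h : ∀ m, A.X m →+ B.X (m + 1)
  zero : ∀ x, (a.f 0).hom x = (B.d 1 0).hom (h 0 x) + (b.f 0).hom x
  succ : ∀ m x, (a.f (m + 1)).hom x =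
    (B.d (m + 2) (m + 1)).hom (h (m + 1) x) + h m ((A.d (m + 1) m).hom x) + (b.f (m + 1)).hom x

namespace ChainHomotopy

variable {A B : ChainComplex AddCommGrpCat.{0} ℕ} {a b : A ⟶ B} (H : ChainHomotopy a b) {k : ℕ}

section

variable (t : Fin (k + 1) →o Fin 2) (φ : ∀ m, (Fin (m + 1) →o Fin (k + 1)) → A.X m)

/-- The first part of the homotopy: the value under `a` or `b`, depending on the last vertex. -/
def endPart (a b : A ⟶ B) (m : ℕ) (σ : Fin (m + 1) →o Fin (k + 1)) : B.X m :=
  if t (σ (Fin.last m)) = 0 then (a.f m).hom (φ m σ) else (b.f m).hom (φ m σ)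

/-- The simplices whose last edge is not mapped to a vertex. -/
def Crosses {m : ℕ} (σ : Fin (m + 2) →o Fin (k + 1)) : Prop :=
  t (σ (Fin.last m).castSucc) = 0 ∧ t (σ (Fin.last (m + 1))) ≠ 0

instance {m : ℕ} (σ : Fin (m + 2) →o Fin (k + 1)) : Decidable (Crosses t σ) :=
  inferInstanceAs (Decidable (_ ∧ _))

/-- The second part of the homotopy. -/
def crossPart : (m : ℕ) → (Fin (m + 1) →o Fin (k + 1)) → B.X m
  | 0, _ => 0
  | m + 1, σ => if Crosses t σ then (-1 : ℤ) ^ (m + 1) • H.h m (φ m (σ.comp (faceMap (Fin.last _))))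
      else 0

variable {φ} (hφ : φ ∈ chainFamilies A k)

include hφ

/-- All faces except the last one have the same last vertex as `σ` and are therefore evaluated with
the same chain map. The last face switches from b to a exactly if `σ` crosses, which gives the
correction term. -/
theorem altSum_endPart {m : ℕ} (σ : Fin (m + 2) →o Fin (k + 1)) :
    altSum (endPart t φ a b m) σ = (B.d (m + 1) m).hom (endPart t φ a b (m + 1) σ) +
      if Crosses t σ then (-1 : ℤ) ^ (m + 1) • ((a.f m).hom (φ m (σ.comp (faceMap (Fin.last _)))) -
        (b.f m).hom (φ m (σ.comp (faceMap (Fin.last _))))) else 0 := by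
  have hd : ∀ c : A ⟶ B, (B.d (m + 1) m).hom ((c.f (m + 1)).hom (φ (m + 1) σ)) =
      altSum (fun w => (c.f m).hom (φ m w)) σ := fun c => by
    refine (ConcreteCategory.congr_hom (c.comm (m + 1) m) _).trans ?_
    refine Eq.trans (congrArg (c.f m).hom (hφ.2 m σ)) ?_
    exact map_altSum (c.f m).hom (φ m) σ
  have hlast : ∀ i : Fin (m + 1), (faceMap i.castSucc (Fin.last m) : Fin (m + 2)) = Fin.last (m + 1) := by
    intro i
    simp
  have hcast : (faceMap (Fin.last (m + 1)) (Fin.last m) : Fin (m + 2)) = (Fin.last m).castSucc := by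
    simp
  have hle : t (σ (Fin.last m).castSucc) ≤ t (σ (Fin.last (m + 1))) :=
    t.monotone (σ.monotone (Fin.le_last _))
  have hkey : ∀ c : A ⟶ B, (∀ i : Fin (m + 1), endPart t φ a b m (σ.comp (faceMap i.castSucc)) =
      (c.f m).hom (φ m (σ.comp (faceMap i.castSucc)))) →
      altSum (endPart t φ a b m) σ = altSum (fun w => (c.f m).hom (φ m w)) σ +
        (-1 : ℤ) ^ (m + 1) • (endPart t φ a b m (σ.comp (faceMap (Fin.last _))) -
          (c.f m).hom (φ m (σ.comp (faceMap (Fin.last _))))) := by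
    intro c hc
    simp only [altSum, Fin.sum_univ_castSucc (n := m + 1), hc, Fin.val_last, smul_sub]
    abel
  have hend : ∀ i : Fin (m + 1), t ((σ.comp (faceMap i.castSucc)) (Fin.last m)) = t (σ (Fin.last (m + 1))) :=
    fun i => by rw [OrderHom.comp_coe, Function.comp_apply, hlast]
  have hend' : t ((σ.comp (faceMap (Fin.last _))) (Fin.last m)) = t (σ (Fin.last m).castSucc) := by
    rw [OrderHom.comp_coe, Function.comp_apply, hcast]
  by_cases h1 : t (σ (Fin.last (m + 1))) = 0
  · have h0 : t (σ (Fin.last m).castSucc) = 0 := le_antisymm (h1 ▸ hle) (Fin.zero_le _)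
    rw [hkey a (fun i => if_pos ((hend i).trans h1)), if_neg fun h => h.2 h1,
      endPart, if_pos (hend'.trans h0), endPart, if_pos h1, hd]
    simp
  · rw [hkey b (fun i => if_neg ((hend i).trans_ne h1)), show endPart t φ a b (m + 1) σ = _ from if_neg h1, hd]
    by_cases h0 : t (σ (Fin.last m).castSucc) = 0
    · rw [if_pos ⟨h0, h1⟩, endPart, if_pos (hend'.trans h0)]
    · rw [if_neg fun h => h0 h.1, endPart, if_neg (hend'.trans_ne h0)]
      simp

/-- Let e0 ≤ e1 ≤ e2 be the values of `t` at the last three vertices. If only e2 = 1, all faces but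
the last one cross, and they add up to the coboundary on the last face of `σ`. If e0 = 0 and e1 = e2
= 1, exactly the last two faces cross, and their terms cancel. In the other cases no face crosses.
-/
theorem altSum_crossPart {m : ℕ} (σ : Fin (m + 3) →o Fin (k + 1)) :
    altSum (H.crossPart t φ (m + 1)) σ = if Crosses t σ then (-1 : ℤ) ^ (m + 1) •
      H.h m ((A.d (m + 1) m).hom (φ (m + 1) (σ.comp (faceMap (Fin.last _))))) else 0 := by
  set τ := σ.comp (faceMap (Fin.last _))
  have hface : ∀ j : Fin (m + 2), (σ.comp (faceMap j.castSucc)).comp (faceMap (Fin.last (m + 1))) =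
      τ.comp (faceMap j) := fun j => by
    rw [OrderHom.comp_assoc, faceMap_comp_faceMap (by simp; omega)]
    rfl
  have hval : ∀ (j : Fin (m + 2)), H.crossPart t φ (m + 1) (σ.comp (faceMap j.castSucc)) =
      if Crosses t (σ.comp (faceMap j.castSucc)) then
        (-1 : ℤ) ^ (m + 1) • H.h m (φ m (τ.comp (faceMap j))) else 0 := fun j => by
    rw [← hface]
    rfl
  have h1 : ∀ j : Fin (m + 1), Crosses t (σ.comp (faceMap j.castSucc.castSucc)) ↔ Crosses t σ := by
    intro j
    have e1 : faceMap j.castSucc.castSucc (Fin.last m).castSucc = (Fin.last (m + 1)).castSucc := by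
      refine Fin.ext ?_
      simp only [OrderEmbedding.toOrderHom_coe, Fin.succAboveOrderEmb_apply, Fin.succAbove,
        Fin.lt_def]
      split_ifs <;> simp at *
      omega
    have e2 : faceMap j.castSucc.castSucc (Fin.last (m + 1)) = Fin.last (m + 2) := by
      refine Fin.ext ?_
      simp only [OrderEmbedding.toOrderHom_coe, Fin.succAboveOrderEmb_apply, Fin.succAbove,
        Fin.lt_def]
      split_ifs <;> simp at *
      omega
    simp only [Crosses, OrderHom.comp_coe, Function.comp_apply, e1, e2]
  have h2 : Crosses t (σ.comp (faceMap (Fin.last (m + 1)).castSucc)) ↔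
      t (σ (Fin.last m).castSucc.castSucc) = 0 ∧ t (σ (Fin.last (m + 2))) ≠ 0 := by
    have e1 : faceMap (Fin.last (m + 1)).castSucc (Fin.last m).castSucc = (Fin.last m).castSucc.castSucc := by
      refine Fin.ext ?_
      simp [Fin.succAbove, Fin.lt_def]
    have e2 : faceMap (Fin.last (m + 1)).castSucc (Fin.last (m + 1)) = Fin.last (m + 2) := by
      refine Fin.ext ?_
      simp [Fin.succAbove]
    simp only [Crosses, OrderHom.comp_coe, Function.comp_apply, e1, e2]
  have h3 : Crosses t τ ↔
      t (σ (Fin.last m).castSucc.castSucc) = 0 ∧ t (σ (Fin.last (m + 1)).castSucc) ≠ 0 := by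
    simp only [Crosses, τ, OrderHom.comp_coe, Function.comp_apply, OrderEmbedding.toOrderHom_coe,
      Fin.succAboveOrderEmb_apply, Fin.succAbove_last]
  have l1 : t (σ (Fin.last m).castSucc.castSucc) ≤ t (σ (Fin.last (m + 1)).castSucc) :=
    t.monotone (σ.monotone (by simp [Fin.le_def]))
  have l2 : t (σ (Fin.last (m + 1)).castSucc) ≤ t (σ (Fin.last (m + 2))) :=
    t.monotone (σ.monotone (by simp [Fin.le_def]))
  have hlast : H.crossPart t φ (m + 1) τ = if Crosses t τ then
      (-1 : ℤ) ^ (m + 1) • H.h m (φ m (τ.comp (faceMap (Fin.last _)))) else 0 := rfl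
  rw [hφ.2, altSum, altSum, Fin.sum_univ_castSucc, Fin.sum_univ_castSucc, Fin.sum_univ_castSucc (n := m + 1)]
  simp only [hval, h1, h2]
  rw [hlast]
  simp only [h3]
  simp only [map_add, map_sum, map_zsmul, Fin.val_castSucc, Fin.val_last]
  have h0 : Crosses t σ ↔ t (σ (Fin.last (m + 1)).castSucc) = 0 ∧ t (σ (Fin.last (m + 2))) ≠ 0 :=
    Iff.rfl
  simp only [h0]
  generalize t (σ (Fin.last m).castSucc.castSucc) = e0 at *
  generalize t (σ (Fin.last (m + 1)).castSucc) = e1 at *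
  generalize t (σ (Fin.last (m + 2))) = e2 at *
  generalize H.h m (φ m (τ.comp (faceMap (Fin.last _)))) = y
  have hs : ∀ s : ℤ, ∑ x : Fin (m + 1), (-1 : ℤ) ^ (x : ℕ) • s • H.h m (φ m (τ.comp (faceMap x.castSucc))) =
      s • ∑ x : Fin (m + 1), (-1 : ℤ) ^ (x : ℕ) • H.h m (φ m (τ.comp (faceMap x.castSucc))) := by
    intro s
    rw [Finset.smul_sum]
    exact Finset.sum_congr rfl fun x _ => smul_comm _ _ _
  fin_cases e0 <;> fin_cases e1 <;> fin_cases e2 <;> simp_all [pow_succ]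

/-- The formula is the Alexander–Whitney map followed by the chain homotopy, which is a chain map
from the tensor product with the chains of Δ[1]. The back faces of `t` which are not degenerate are
its last vertex and, if it crosses, its last edge; this explains the two summands. -/
theorem prism_mem : (fun m σ => endPart t φ a b m σ + H.crossPart t φ m σ) ∈ chainFamilies B k := by
  refine ⟨fun m σ h => ?_, fun m σ => ?_⟩
  · have h1 : endPart t φ a b m σ = 0 := by
      rw [endPart, hφ.1 m σ h, map_zero, map_zero, ite_self]
    have h2 : H.crossPart t φ m σ = 0 := by
      cases m with
      | zero => rfl
      | succ m =>
        refine ite_eq_right_iff.2 fun hc => ?_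
        rw [hφ.1, map_zero, smul_zero]
        intro hi
        have h' : StrictMono (σ.comp (faceMap (Fin.last _))) :=
          (OrderHom.monotone _).strictMono_of_injective hi
        refine h (StrictMono.injective (Fin.strictMono_iff_lt_succ.2 fun i => ?_))
        -- If the last face is injective and the last edge crosses, then `σ` is injective: the last
        -- edge joins different vertices because `t` separates them.
        refine Fin.lastCases ?_ (fun j => ?_) i
        · refine lt_of_le_of_ne (σ.monotone (Fin.castSucc_lt_succ).le) fun e => hc.2 ?_
          rw [← Fin.succ_last, ← e]
          exact hc.1
        · have := @h' j.castSucc j.succ Fin.castSucc_lt_succ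
          simpa only [OrderHom.comp_coe, Function.comp_apply, OrderEmbedding.toOrderHom_coe,
            Fin.succAboveOrderEmb_apply, Fin.succAbove_last, Fin.succ_castSucc] using this
    exact (congrArg₂ (· + ·) h1 h2).trans (add_zero _)
  · rw [map_add]
    refine Eq.trans ?_ (altSum_add (endPart t φ a b m) (H.crossPart t φ m) σ).symm
    rw [altSum_endPart t hφ, add_assoc]
    congr 1
    cases m with
    | zero =>
      have : altSum (H.crossPart t φ 0) σ = 0 := altSum_zero σ
      rw [this, add_zero]
      change (B.d 1 0).hom (if _ then _ else _) = _
      by_cases hc : Crosses t σ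
      · rw [if_pos hc, if_pos hc, H.zero, map_zsmul, add_sub_cancel_right]
      · rw [if_neg hc, if_neg hc, map_zero]
    | succ m =>
      rw [H.altSum_crossPart t hφ]
      change (B.d (m + 2) (m + 1)).hom (if _ then _ else _) = _
      by_cases hc : Crosses t σ
      · rw [if_pos hc, if_pos hc, if_pos hc, H.succ, map_zsmul, add_sub_cancel_right, smul_add]
        generalize H.h m _ = y
        have : (-1 : ℤ) ^ (m + 1 + 1) • y + (-1 : ℤ) ^ (m + 1) • y = 0 := by
          rw [← add_smul, pow_succ _ (m + 1)]
          simp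
        refine Eq.symm ((add_assoc _ _ _).trans ?_)
        rw [this, add_zero]
      · rw [if_neg hc, if_neg hc, if_neg hc, map_zero, add_zero]

end

theorem prism_zero (m : ℕ) (σ) (t : Fin (k + 1) →o Fin 2) (φ : chainFamilies A k) (h : ∀ i, t i = 0) :
    endPart t φ.1 a b m σ + H.crossPart t φ.1 m σ = (a.f m).hom (φ.1 m σ) := by
  have h2 : H.crossPart t φ.1 m σ = 0 := by
    cases m with
    | zero => rfl
    | succ m => exact if_neg fun hc => hc.2 (h _)
  rw [h2, add_zero, endPart, if_pos (h _)]

theorem prism_one (m : ℕ) (σ) (t : Fin (k + 1) →o Fin 2) (φ : chainFamilies A k) (h : ∀ i, t i = 1) :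
    endPart t φ.1 a b m σ + H.crossPart t φ.1 m σ = (b.f m).hom (φ.1 m σ) := by
  have h2 : H.crossPart t φ.1 m σ = 0 := by
    cases m with
    | zero => rfl
    | succ m => exact if_neg fun hc => absurd (hc.1.symm.trans (h _)) (by decide)
  rw [h2, add_zero, endPart, if_neg fun h' => absurd (h'.symm.trans (h _)) (by decide)]

theorem prism_base (m : ℕ) (σ) (t : Fin (k + 1) →o Fin 2) :
    endPart t (0 : chainFamilies A k).1 a b m σ + H.crossPart t (0 : chainFamilies A k).1 m σ = 0 := by
  have h2 : H.crossPart t (0 : chainFamilies A k).1 m σ = 0 := by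
    cases m with
    | zero => rfl
    | succ m => exact ite_eq_right_iff.2 fun hc => (congrArg _ (map_zero _)).trans (smul_zero _)
  rw [h2, add_zero]
  exact (ite_congr rfl (fun _ => map_zero _) (fun _ => map_zero _)).trans (ite_self _)

include H in
/-- Chain homotopic maps induce homotopic maps. -/
theorem homotopic : Sp.Homotopic (Sp.ofSimplicialGroup.map (dold.map a))
    (Sp.ofSimplicialGroup.map (dold.map b)) := by
  let t : ∀ {κ : SimplexCategoryᵒᵖ}, (SSet.stdSimplex.obj (SimplexCategory.mk 1)).obj κ →
      (Fin (κ.unop.len + 1) →o Fin 2) := fun x => SSet.stdSimplex.asOrderHom x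
  refine ⟨{ app := fun κ => TypeCat.ofHom fun p : chainFamilies A κ.unop.len ×
      (SSet.stdSimplex.obj (SimplexCategory.mk 1)).obj κ =>
        (⟨_, H.prism_mem (t p.2) p.1.2⟩ : chainFamilies B κ.unop.len), naturality := ?_ }, ?_, ?_, ?_⟩
  · intro κ μ g
    refine ConcreteCategory.hom_ext _ _ fun p => ?_
    refine Subtype.ext (funext fun m => funext fun σ => ?_)
    cases m <;> rfl
  · ext κ x
    exact Subtype.ext (funext fun m => funext fun σ => H.prism_zero m σ _ _ fun _ => rfl)
  · ext κ x
    exact Subtype.ext (funext fun m => funext fun σ => H.prism_one m σ _ _ fun _ => rfl)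
  · ext κ x
    exact Subtype.ext (funext fun m => funext fun σ => H.prism_base m σ _)

end ChainHomotopy
end Khovanov

/-! ### Chain maps between complexes of finitely generated free groups -/

namespace Khovanov

open CategoryTheory Opposite

/-- Finitely generated free abelian groups. -/
def FiniteFree (G : Type) [AddCommGroup G] : Prop := Module.Finite ℤ G ∧ Module.Free ℤ G

/-- ℤ is Noetherian, and finitely generated torsion-free groups are free. -/
theorem FiniteFree.of_injective {G G' : Type} [AddCommGroup G] [AddCommGroup G'] (f : G →+ G')
    (hf : Function.Injective f) (h : FiniteFree G') : FiniteFree G := by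
  obtain ⟨_, _⟩ := h
  have h1 : Module.Finite ℤ G := Module.Finite.of_injective f.toIntLinearMap hf
  have h2 : Module.IsTorsionFree ℤ G := Function.Injective.moduleIsTorsionFree f hf (fun n x => map_zsmul f n x)
  exact ⟨h1, Module.free_of_finite_type_torsion_free'⟩

theorem FiniteFree.addSubgroup {G : Type} [AddCommGroup G] (h : FiniteFree G) (S : AddSubgroup G) :
    FiniteFree S := .of_injective S.subtype Subtype.val_injective h

theorem FiniteFree.pi {ι : Type} [Finite ι] {G : ι → Type} [∀ i, AddCommGroup (G i)]
    (h : ∀ i, FiniteFree (G i)) : FiniteFree (∀ i, G i) := by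
  have := fun i => (h i).1
  have := fun i => (h i).2
  exact ⟨inferInstance, inferInstance⟩

theorem FiniteFree.exists_lift {P M N : Type} [AddCommGroup P] [AddCommGroup M] [AddCommGroup N]
    (h : FiniteFree P) (f : M →+ N) (hf : Function.Surjective f) (g : P →+ N) :
    ∃ l : P →+ M, ∀ p, f (l p) = g p := by
  have := h.2
  obtain ⟨l, hl⟩ := Module.projective_lifting_property f.toIntLinearMap g.toIntLinearMap hf
  exact ⟨l.toAddMonoidHom, fun p => LinearMap.congr_fun hl p⟩

namespace Complex

/-- The differential of a chain complex. -/
def d (A : ChainComplex AddCommGrpCat.{0} ℕ) (m : ℕ) : A.X (m + 1) →+ A.X m := (A.d (m + 1) m).hom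

/-- The cycles. -/
def cycles (A : ChainComplex AddCommGrpCat.{0} ℕ) : (m : ℕ) → AddSubgroup (A.X m)
  | 0 => ⊤
  | m + 1 => (d A m).ker

/-- The boundaries. -/
def boundaries (A : ChainComplex AddCommGrpCat.{0} ℕ) (m : ℕ) : AddSubgroup (A.X m) := (d A m).range

/-- The differential, as a map to the boundaries. -/
def dB (A : ChainComplex AddCommGrpCat.{0} ℕ) (m : ℕ) : A.X (m + 1) →+ boundaries A m :=
  (d A m).rangeRestrict

theorem d_d (A : ChainComplex AddCommGrpCat.{0} ℕ) {m : ℕ} (x) : d A m (d A (m + 1) x) = 0 :=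
  ConcreteCategory.congr_hom (A.d_comp_d (m + 2) (m + 1) m) x

theorem boundaries_le (A : ChainComplex AddCommGrpCat.{0} ℕ) (m : ℕ) : boundaries A m ≤ cycles A m := by
  rintro _ ⟨x, rfl⟩
  cases m with
  | zero => trivial
  | succ m => exact d_d A x

/-- A choice of preimages of the boundaries. -/
structure Splitting (A : ChainComplex AddCommGrpCat.{0} ℕ) where
  s : ∀ m, boundaries A m →+ A.X (m + 1)
  d_s : ∀ m b, d A m (s m b) = b.1

/-- Boundaries form a subgroup of a finitely generated free group, so they are free, and the
differential onto them has a section. -/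
theorem nonempty_splitting {A : ChainComplex AddCommGrpCat.{0} ℕ} (h : ∀ m, FiniteFree (A.X m)) :
    Nonempty (Splitting A) := by
  choose s hs using fun m => ((h m).addSubgroup (boundaries A m)).exists_lift
    (dB A m) (d A m).rangeRestrict_surjective (AddMonoidHom.id _)
  exact ⟨⟨s, fun m b => congrArg Subtype.val (hs m b)⟩⟩

variable {A B C : ChainComplex AddCommGrpCat.{0} ℕ}

/-- The projection to the cycles. -/
def Splitting.proj (S : Splitting A) : (m : ℕ) → A.X m →+ A.X m
  | 0 => AddMonoidHom.id _
  | m + 1 => AddMonoidHom.id _ - (S.s m).comp (dB A m)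

theorem Splitting.proj_mem (S : Splitting A) (m : ℕ) (x : A.X m) : S.proj m x ∈ cycles A m := by
  cases m with
  | zero => trivial
  | succ m =>
    change d A m (x - S.s m ⟨d A m x, _⟩) = 0
    rw [map_sub, S.d_s, sub_self]

theorem Splitting.proj_of_mem (S : Splitting A) {m : ℕ} {x : A.X m} (hx : x ∈ cycles A m) :
    S.proj m x = x := by
  cases m with
  | zero => rfl
  | succ m =>
    have : (⟨d A m x, ⟨x, rfl⟩⟩ : boundaries A m) = 0 := Subtype.ext hx
    change x - S.s m ⟨d A m x, ⟨x, rfl⟩⟩ = x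
    rw [this, map_zero, sub_zero]

theorem Splitting.proj_s (S : Splitting A) {m : ℕ} (b : boundaries A m) : S.proj (m + 1) (S.s m b) = 0 := by
  have : (⟨d A m (S.s m b), ⟨_, rfl⟩⟩ : boundaries A m) = b := Subtype.ext (S.d_s m b)
  change S.s m b - S.s m ⟨d A m (S.s m b), ⟨_, rfl⟩⟩ = 0
  rw [this, sub_self]

/-- Homomorphisms on cycles which map boundaries to boundaries. -/
structure CycleMap (A B : ChainComplex AddCommGrpCat.{0} ℕ) where
  app : ∀ m, cycles A m →+ cycles B m
  mem : ∀ m z, z.1 ∈ boundaries A m → (app m z).1 ∈ boundaries B m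

namespace CycleMap

/-- The map on boundaries. -/
def bd (α : CycleMap A B) (m : ℕ) : boundaries A m →+ boundaries B m :=
  ((cycles B m).subtype.comp ((α.app m).comp (AddSubgroup.inclusion (boundaries_le A m)))).codRestrict
    (boundaries B m) fun b => α.mem m _ b.2

/-- The part on cycles of the chain map extending `α`. -/
def extCycle (α : CycleMap A B) (S : Splitting A) (m : ℕ) : A.X m →+ B.X m :=
  (cycles B m).subtype.comp ((α.app m).comp ((S.proj m).codRestrict _ (S.proj_mem m)))

/-- The chain map extending `α`. -/
def extFun (α : CycleMap A B) (S : Splitting A) (T : Splitting B) : (m : ℕ) → A.X m →+ B.X m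
  | 0 => α.extCycle S 0
  | m + 1 => α.extCycle S (m + 1) + (T.s m).comp ((α.bd m).comp (dB A m))

variable (α : CycleMap A B) (S : Splitting A) (T : Splitting B)

theorem extCycle_of_mem {m : ℕ} {x : A.X m} (hx : x ∈ cycles A m) :
    α.extCycle S m x = (α.app m ⟨x, hx⟩).1 :=
  congrArg (fun z => (α.app m z).1) (Subtype.ext (S.proj_of_mem hx))

theorem extFun_of_mem {m : ℕ} {x : A.X m} (hx : x ∈ cycles A m) :
    α.extFun S T m x = (α.app m ⟨x, hx⟩).1 := by
  cases m with
  | zero => exact α.extCycle_of_mem S hx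
  | succ m =>
    have : dB A m x = 0 := Subtype.ext hx
    change α.extCycle S (m + 1) x + T.s m (α.bd m (dB A m x)) = _
    rw [this, map_zero, map_zero, add_zero, extCycle_of_mem]

theorem extCycle_mem {m : ℕ} (x : A.X m) : α.extCycle S m x ∈ cycles B m := Subtype.prop _

theorem d_extFun {m : ℕ} (x : A.X (m + 1)) :
    d B m (α.extFun S T (m + 1) x) = (α.bd m (dB A m x)).1 := by
  change d B m (α.extCycle S (m + 1) x + T.s m _) = _
  rw [map_add, T.d_s, show d B m (α.extCycle S (m + 1) x) = 0 from α.extCycle_mem S x, zero_add]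
  rfl

/-- The chain map extending `α`. -/
def ext : A ⟶ B where
  f m := AddCommGrpCat.ofHom (α.extFun S T m)
  comm' i j h := by
    obtain rfl : j + 1 = i := h
    refine AddCommGrpCat.hom_ext (AddMonoidHom.ext fun x => ?_)
    exact (α.d_extFun S T x).trans (α.extFun_of_mem S T (boundaries_le A j ⟨x, rfl⟩)).symm

/-- The composition. -/
def comp (β : CycleMap B C) : CycleMap A C :=
  ⟨fun m => (β.app m).comp (α.app m), fun m _ h => β.mem m _ (α.mem m _ h)⟩

/-- The identity. -/
def id (A : ChainComplex AddCommGrpCat.{0} ℕ) : CycleMap A A := ⟨fun _ => AddMonoidHom.id _, fun _ _ h => h⟩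

/-- Extension is strictly functorial, not only up to homotopy, because the projection of the second
splitting kills the preimages chosen by the first extension (`proj_s`). -/
theorem ext_comp (β : CycleMap B C) (U : Splitting C) :
    α.ext S T ≫ β.ext T U = (α.comp β).ext S U := by
  ext m x
  change β.extFun T U m (α.extFun S T m x) = (α.comp β).extFun S U m x
  cases m with
  | zero => rfl
  | succ m =>
    have h1 : dB B m (α.extFun S T (m + 1) x) = α.bd m (dB A m x) :=
      Subtype.ext (α.d_extFun S T x)
    change β.extCycle T (m + 1) (α.extFun S T (m + 1) x) + U.s m (β.bd m (dB B m _)) =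
      (α.comp β).extCycle S (m + 1) x + U.s m (β.bd m (α.bd m (dB A m x)))
    rw [h1]
    congr 1
    change (β.app (m + 1) ⟨T.proj (m + 1) (α.extCycle S (m + 1) x + T.s m _), _⟩).1 =
      (β.app (m + 1) (α.app (m + 1) _)).1
    congr 2
    refine Subtype.ext ?_
    change T.proj (m + 1) (α.extCycle S (m + 1) x + T.s m _) = _
    rw [map_add, T.proj_s, add_zero, T.proj_of_mem (α.extCycle_mem S x)]
    rfl

theorem ext_id : (id A).ext S S = 𝟙 A := by
  ext m x
  cases m with
  | zero => rfl
  | succ m => exact sub_add_cancel x _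

/-- Two extensions are chain homotopic if they agree modulo boundaries. -/
def homotopy (β : CycleMap A B) (h : ∀ m z, (α.app m z - β.app m z).1 ∈ boundaries B m) :
    ChainHomotopy (α.ext S T) (β.ext S T) :=
  -- The difference of the two maps on cycles consists of boundaries; following it by the section of
  -- the differential gives the homotopy.
  let k (m : ℕ) : A.X m →+ boundaries B m :=
    (α.extCycle S m - β.extCycle S m).codRestrict _ fun _ => h m _
  { h := fun m => (T.s m).comp (k m)
    zero := fun x => by
      change α.extCycle S 0 x = d B 0 (T.s 0 (k 0 x)) + β.extCycle S 0 x
      rw [T.d_s]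
      exact (sub_add_cancel _ _).symm
    succ := fun m x => by
      change α.extCycle S (m + 1) x + T.s m (α.bd m (dB A m x)) =
        d B (m + 1) (T.s (m + 1) (k (m + 1) x)) + T.s m (k m (d A m x)) +
          (β.extCycle S (m + 1) x + T.s m (β.bd m (dB A m x)))
      have h1 : k m (d A m x) = α.bd m (dB A m x) - β.bd m (dB A m x) :=
        Subtype.ext (congrArg₂ (· - ·) (α.extCycle_of_mem S (boundaries_le A m ⟨x, rfl⟩))
          (β.extCycle_of_mem S (boundaries_le A m ⟨x, rfl⟩)))
      have h2 : (k (m + 1) x).1 = α.extCycle S (m + 1) x - β.extCycle S (m + 1) x := rfl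
      rw [T.d_s, h1, h2, map_sub]
      abel }

end CycleMap

end Complex
end Khovanov

/-! ### Classification of degreewise free simplicial abelian groups -/

namespace Khovanov

open CategoryTheory Opposite MonoidalCategory

namespace Complex

variable {A B : ChainComplex AddCommGrpCat.{0} ℕ}

/-- The homology groups. -/
abbrev Homology (A : ChainComplex AddCommGrpCat.{0} ℕ) (m : ℕ) : Type :=
  cycles A m ⧸ (boundaries A m).addSubgroupOf (cycles A m)

theorem exists_lift_homology (h : ∀ m, FiniteFree (A.X m)) {m : ℕ}
    (φ : Homology A m →+ Homology B m) :
    ∃ α : cycles A m →+ cycles B m, ∀ z, (α z : Homology B m) = φ z :=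
  ((h m).addSubgroup (cycles A m)).exists_lift (QuotientAddGroup.mk' _)
    (QuotientAddGroup.mk'_surjective _) (φ.comp (QuotientAddGroup.mk' _))

theorem mk_eq_zero {m : ℕ} (z : cycles A m) : (z : Homology A m) = 0 ↔ z.1 ∈ boundaries A m := by
  rw [QuotientAddGroup.eq_zero_iff, AddSubgroup.mem_addSubgroupOf]

/-- Degreewise finitely generated free chain complexes with isomorphic homology give homotopy
equivalent spaces. -/
theorem homotopyEquivalent_dold (hA : ∀ m, FiniteFree (A.X m)) (hB : ∀ m, FiniteFree (B.X m))
    (h : ∀ m, Nonempty (Homology A m ≃+ Homology B m)) :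
    Sp.HomotopyEquivalent (Sp.ofSimplicialGroup.obj (dold.obj A))
      (Sp.ofSimplicialGroup.obj (dold.obj B)) := by
  have φ := fun m => (h m).some
  -- The groups of cycles are free, so the isomorphism on homology and its inverse lift to
  -- homomorphisms between cycles. The composites of the lifts agree with the identity modulo
  -- boundaries, which is all that a chain homotopy needs.
  choose f hf using fun m => exists_lift_homology hA (φ m).toAddMonoidHom
  choose g hg using fun m => exists_lift_homology hB (φ m).symm.toAddMonoidHom
  obtain ⟨S⟩ := nonempty_splitting hA
  obtain ⟨T⟩ := nonempty_splitting hB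
  let α : CycleMap A B := ⟨f, fun m z hz => by
    rw [← mk_eq_zero] at hz ⊢
    rw [hf, hz, map_zero]⟩
  let β : CycleMap B A := ⟨g, fun m z hz => by
    rw [← mk_eq_zero] at hz ⊢
    rw [hg, hz, map_zero]⟩
  have h1 := ((α.comp β).homotopy S S (CycleMap.id A) fun m z => by
    rw [← mk_eq_zero, QuotientAddGroup.mk_sub, sub_eq_zero]
    exact (hg m _).trans ((congrArg (φ m).symm (hf m z)).trans ((φ m).symm_apply_apply _))).homotopic
  have h2 := ((β.comp α).homotopy T T (CycleMap.id B) fun m z => by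
    rw [← mk_eq_zero, QuotientAddGroup.mk_sub, sub_eq_zero]
    exact (hf m _).trans ((congrArg (φ m) (hg m z)).trans ((φ m).apply_symm_apply _))).homotopic
  refine ⟨Sp.ofSimplicialGroup.map (dold.map (α.ext S T)),
    Sp.ofSimplicialGroup.map (dold.map (β.ext T S)), ?_, ?_⟩
  · rw [← Functor.map_comp, ← Functor.map_comp, CycleMap.ext_comp]
    rw [CycleMap.ext_id, CategoryTheory.Functor.map_id, CategoryTheory.Functor.map_id] at h1
    exact h1
  · rw [← Functor.map_comp, ← Functor.map_comp, CycleMap.ext_comp]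
    rw [CycleMap.ext_id, CategoryTheory.Functor.map_id, CategoryTheory.Functor.map_id] at h2
    exact h2

end Complex

namespace Sp

theorem Homotopic.comp_left {X Y Z : Sp} (u : X ⟶ Y) {f g : Y ⟶ Z} (h : Homotopic f g) :
    Homotopic (u ≫ f) (u ≫ g) := by
  obtain ⟨H, h0, h1, h2⟩ := h
  refine ⟨(u.right ▷ _) ≫ H, ?_, ?_, ?_⟩
  · rw [SSet.ι₀_comp_assoc, h0]
    rfl
  · rw [SSet.ι₁_comp_assoc, h1]
    rfl
  · rw [← Category.assoc, ← MonoidalCategory.comp_whiskerRight]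
    have : X.hom ≫ u.right = Y.hom := Under.w u
    rw [this, h2]

theorem Homotopic.comp_right {X Y Z : Sp} {f g : X ⟶ Y} (h : Homotopic f g) (u : Y ⟶ Z) :
    Homotopic (f ≫ u) (g ≫ u) := by
  obtain ⟨H, h0, h1, h2⟩ := h
  refine ⟨H ≫ u.right, ?_, ?_, ?_⟩
  · rw [← Category.assoc, h0]
    rfl
  · rw [← Category.assoc, h1]
    rfl
  · rw [← Category.assoc, h2, base_comp]

theorem HomotopyEquivalent.of_iso {X Y X' Y' : Sp} (e : X ≅ X') (e' : Y ≅ Y')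
    (h : HomotopyEquivalent X' Y') : HomotopyEquivalent X Y := by
  obtain ⟨f, g, hf, hg⟩ := h
  refine ⟨e.hom ≫ f ≫ e'.inv, e'.hom ≫ g ≫ e.inv, ?_, ?_⟩
  · have := (hf.comp_right e.inv).comp_left e.hom
    simpa using this
  · have := (hg.comp_right e'.inv).comp_left e'.hom
    simpa using this

end Sp

namespace SimplicialGroup

variable {X Y : SimplicialObject AddCommGrpCat.{0}}

/-- All the groups of simplices are finitely generated and free. -/
def DegreewiseFree (X : SimplicialObject AddCommGrpCat.{0}) : Prop :=
  ∀ k, FiniteFree (X.obj (op (SimplexCategory.mk k)))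

theorem mem_range_inc {m : ℕ} (x : X.obj (op (SimplexCategory.mk m))) :
    x ∈ (inc X m).range ↔ x ∈ normal X m := by
  constructor
  · rintro ⟨z, rfl⟩
    cases m with
    | zero => trivial
    | succ m =>
      refine mem_normal.2 fun i => ?_
      exact ConcreteCategory.congr_hom
        (AlgebraicTopology.DoldKan.HigherFacesVanish.inclusionOfMooreComplexMap m i (by omega)) z
  · intro hx
    refine ⟨ret X m x, ?_⟩
    have h1 : inc X m (ret X m x) = ((AlgebraicTopology.DoldKan.PInfty (X := X)).f m).hom x :=
      ConcreteCategory.congr_hom (HomologicalComplex.congr_hom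
        (AlgebraicTopology.DoldKan.PInftyToNormalizedMooreComplex_comp_inclusionOfMooreComplexMap X) m) x
    rw [h1]
    cases m with
    | zero => rfl
    | succ m =>
      let φ : AddCommGrpCat.of (normal X (m + 1)) ⟶ X.obj (op (SimplexCategory.mk (m + 1))) :=
        AddCommGrpCat.ofHom (normal X (m + 1)).subtype
      have hφ : AlgebraicTopology.DoldKan.HigherFacesVanish (m + 1) φ := fun j _ => by
        ext y
        exact mem_normal.1 y.2 j
      exact ConcreteCategory.congr_hom hφ.comp_P_eq_self (⟨_, hx⟩ : normal X (m + 1))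

/-- On normal simplices only the face number 0 survives in the alternating sum, so the homology of
the Moore complex is described by `cycles` and `boundaries`. -/
theorem inc_d_eq_face {m : ℕ} (z) :
    inc X m (Complex.d ((AlgebraicTopology.normalizedMooreComplex _).obj X) m z) =
      face X 0 (inc X (m + 1) z) := by
  refine (inc_d z).trans ?_
  have h := mem_normal.1 ((mem_range_inc _).1 ⟨z, rfl⟩)
  rw [faceSum_apply, Fin.sum_univ_succ, Finset.sum_eq_zero fun i _ => by rw [h i, smul_zero]]
  simp

/-- The homotopy groups are the homology groups of the normalised Moore complex. -/
theorem nonempty_homology_equiv (X : SimplicialObject AddCommGrpCat.{0}) (m : ℕ) :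
    Nonempty (Complex.Homology ((AlgebraicTopology.normalizedMooreComplex _).obj X) m ≃+ π X m) := by
  have hc : ∀ m z, z ∈ Complex.cycles ((AlgebraicTopology.normalizedMooreComplex _).obj X) m ↔
      inc X m z ∈ cycles X m := by
    intro m z
    cases m with
    | zero => exact Iff.rfl
    | succ m =>
      rw [mem_cycles_iff, ← inc_d_eq_face, map_eq_zero_iff _ inc_injective]
      exact ⟨fun h => ⟨(mem_range_inc _).1 ⟨z, rfl⟩, h⟩, fun h => h.2⟩
  refine nonempty_quotient_equiv (AddMonoidHom.graph (inc X m)) (fun z hz => ⟨_, (hc m z).1 hz, rfl⟩)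
    (fun x hx => ?_) ?_
  · obtain ⟨z, rfl⟩ := (mem_range_inc x).2 (cycles_le_normal m hx)
    exact ⟨z, (hc m z).2 hx, rfl⟩
  · rintro z - x - h
    obtain rfl : inc X m z = x := h
    constructor
    · rintro ⟨y, rfl⟩
      exact ⟨inc X (m + 1) y, (mem_range_inc _).1 ⟨y, rfl⟩, (inc_d_eq_face y).symm⟩
    · rintro ⟨y, hy, h⟩
      obtain ⟨y, rfl⟩ := (mem_range_inc y).2 hy
      exact ⟨y, inc_injective ((inc_d_eq_face y).trans h)⟩

/-- Degreewise finitely generated free simplicial abelian groups are classified up to homotopy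
equivalence by their homotopy groups. -/
theorem homotopyEquivalent (hX : DegreewiseFree X) (hY : DegreewiseFree Y)
    (h : ∀ n, Nonempty (π X n ≃+ π Y n)) :
    Sp.HomotopyEquivalent (Sp.ofSimplicialGroup.obj X) (Sp.ofSimplicialGroup.obj Y) := by
  refine Sp.HomotopyEquivalent.of_iso (Sp.ofSimplicialGroup.mapIso (unitIso X))
    (Sp.ofSimplicialGroup.mapIso (unitIso Y)) (Complex.homotopyEquivalent_dold
      (fun m => .of_injective (inc X m) inc_injective (hX m))
      (fun m => .of_injective (inc Y m) inc_injective (hY m)) fun m => ?_)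
  obtain ⟨e⟩ := nonempty_homology_equiv X m
  obtain ⟨e'⟩ := nonempty_homology_equiv Y m
  obtain ⟨e''⟩ := h m
  exact ⟨e.trans (e''.trans e'.symm)⟩

end SimplicialGroup
end Khovanov

/-! ### Loop groups of simplicial abelian groups -/

namespace Khovanov

open CategoryTheory Opposite

namespace SimplicialGroup

/-- The poset whose nerve is `Δ[k] × Δ[1]`. -/
abbrev Cyl (k : ℕ) : Type := Fin (k + 1) × Fin 2

variable (M : SimplicialObject AddCommGrpCat.{0})

/-- The families of elements of `M`, one for each simplex of `Δ[k] × Δ[1]`. -/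
abbrev CylFam (k : ℕ) : Type :=
  ∀ m, (Fin (m + 1) →o Cyl k) → M.obj (op (SimplexCategory.mk m))

/-- The simplicial maps from `Δ[k] × Δ[1]` that are `0` on `Δ[k] × {e}` for all `e ∈ E`. -/
def paths (E : Set (Fin 2)) (k : ℕ) : AddSubgroup (CylFam M k) where
  carrier := {h | (∀ m l (β : Fin (m + 1) →o Fin (l + 1)) (w : Fin (l + 1) →o Cyl k),
      (M.map (simplexHom β).op).hom (h l w) = h m (w.comp β)) ∧
    ∀ e ∈ E, ∀ m (w : Fin (m + 1) →o Cyl k), (∀ i, (w i).2 = e) → h m w = 0}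
  zero_mem' := ⟨fun _ _ _ _ => map_zero _, fun _ _ _ _ _ => rfl⟩
  add_mem' := fun {h h'} ⟨h1, h2⟩ ⟨h1', h2'⟩ => ⟨fun m l β w => by simp [h1, h1'],
    fun e he m w hw => by simp [h2 e he m w hw, h2' e he m w hw]⟩
  neg_mem' := fun {h} ⟨h1, h2⟩ => ⟨fun m l β w => by simp [h1],
    fun e he m w hw => by simp [h2 e he m w hw]⟩

variable {M}

/-- Composition with a monotone map. -/
def pull {k l : ℕ} (κ : Cyl k →o Cyl l) : CylFam M l →+ CylFam M k where
  toFun h m w := h m (κ.comp w)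
  map_zero' := rfl
  map_add' _ _ := rfl

theorem pull_mem {E : Set (Fin 2)} {k l : ℕ} {κ : Cyl k →o Cyl l}
    (hκ : ∀ e ∈ E, ∀ p, p.2 = e → (κ p).2 = e) {h : CylFam M l} (hh : h ∈ paths M E l) :
    pull κ h ∈ paths M E k :=
  ⟨fun m l β w => hh.1 m l β (κ.comp w), fun e he m w hw => hh.2 e he m _ fun i => hκ e he _ (hw i)⟩

/-- The map of cylinders given by a monotone map in the first coordinate. -/
def Cyl.push {k l : ℕ} (β : Fin (k + 1) →o Fin (l + 1)) : Cyl k →o Cyl l where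
  toFun p := (β p.1, p.2)
  monotone' _ _ h := ⟨β.monotone h.1, h.2⟩

variable (M)

/-- The simplicial abelian group of paths in `M`. -/
def pathObject (E : Set (Fin 2)) : SimplicialObject AddCommGrpCat.{0} :=
  SimplicialGroup.mk (fun k => paths M E k)
    (fun {k l} β => ((pull (Cyl.push β)).comp (paths M E l).subtype).codRestrict (paths M E k)
      fun h => pull_mem (fun _ _ _ hp => hp) h.2)
    (fun _ _ => rfl) (fun _ _ _ => rfl)

variable {M}

/-- The inclusion of the loops in the paths. -/
def pathInclusion {E E' : Set (Fin 2)} (h : E' ⊆ E) : pathObject M E ⟶ pathObject M E' where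
  app κ := AddCommGrpCat.ofHom (AddSubgroup.inclusion fun _ hx => ⟨hx.1, fun e he => hx.2 e (h he)⟩ :
    paths M E κ.unop.len →+ paths M E' κ.unop.len)
  naturality _ _ _ := rfl

/-- The simplex `Δ[k] × {1}`. -/
def Cyl.top (k : ℕ) : Fin (k + 1) →o Cyl k := ⟨fun i => (i, 1), fun _ _ h => ⟨h, le_rfl⟩⟩

/-- The end point of a path. -/
def endPoint (E : Set (Fin 2)) : pathObject M E ⟶ M where
  app κ := AddCommGrpCat.ofHom
    { toFun := fun h : paths M E κ.unop.len => h.1 κ.unop.len (Cyl.top _)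
      map_zero' := rfl
      map_add' := fun _ _ => rfl }
  naturality κ μ g := by
    ext h
    exact ((Subtype.prop (p := (· ∈ paths M E κ.unop.len)) h).1 _ _ g.unop.toOrderHom
      (Cyl.top _)).symm

/-- The monotone map `(i, 0) ↦ 0`, `(i, 1) ↦ i`. -/
def Cyl.contract (k : ℕ) : Cyl k →o Fin (k + 1) where
  toFun p := if p.2 = 0 then 0 else p.1
  monotone' p q h := by
    obtain ⟨h1, h2⟩ := Prod.le_def.1 h
    by_cases hp : p.2 = 0
    · simp [hp]
    · have hq : q.2 ≠ 0 := fun hq => hp (le_antisymm (hq ▸ h2) (Fin.zero_le _))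
      simpa [hp, hq] using h1

/-- The cylinder map of the minimum homotopy, restricted to a prism. -/
def Cyl.prism {k l : ℕ} (β : Fin (k + 1) →o Fin (l + 1)) (n : ℕ) : Cyl k →o Cyl l where
  toFun p := (β p.1, if n ≤ p.1 then p.2 else 0)
  monotone' p q h := by
    obtain ⟨h1, h2⟩ := Prod.le_def.1 h
    refine ⟨β.monotone h1, ?_⟩
    have h1' : (p.1 : ℕ) ≤ q.1 := h1
    dsimp only
    split_ifs
    · exact h2
    · omega
    · exact Fin.zero_le _
    · exact le_rfl

theorem pull_prism_mem {k l : ℕ} (β : Fin (k + 1) →o Fin (l + 1)) (n : ℕ) {h : CylFam M l}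
    (hh : h ∈ paths M {0} l) : pull (Cyl.prism β n) h ∈ paths M {0} k :=
  pull_mem (fun e he p hp => by
    obtain rfl : e = 0 := he
    exact (ite_congr rfl (fun _ => hp) fun _ => rfl).trans (ite_self _)) hh

/-- A map whose first coordinate misses j factors through the face opposite j. -/
theorem pull_eq_zero {k l : ℕ} (j : Fin (l + 2)) {h : CylFam M (l + 1)}
    (hj : pull (Cyl.push (faceMap j)) h = 0) (κ : Cyl k →o Cyl (l + 1)) (hκ : ∀ p, (κ p).1 ≠ j) :
    pull κ h = 0 := by
  choose b hb using fun p => Fin.exists_succAbove_eq (hκ p)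
  let κ' : Cyl k →o Cyl l := ⟨fun p => (b p, (κ p).2), fun p q hpq =>
    ⟨(Fin.succAboveOrderEmb j).le_iff_le.1 (by simpa [hb] using (κ.monotone hpq).1),
      (κ.monotone hpq).2⟩⟩
  have hκ' : κ = (Cyl.push (faceMap j)).comp κ' :=
    OrderHom.ext _ _ (funext fun p => Prod.ext (hb p).symm rfl)
  rw [hκ']
  exact (congrArg (pull κ') hj).trans (map_zero _)

/-- The degeneracy maps. -/
def degMap {k : ℕ} (i : Fin (k + 1)) : Fin (k + 2) →o Fin (k + 1) := Fin.predAboveOrderHom i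

theorem prism_last {k : ℕ} {h : CylFam M k} (hh : h ∈ paths M {0} k) :
    pull (Cyl.prism OrderHom.id (k + 1)) h = 0 :=
  funext fun m => funext fun w => hh.2 0 rfl m _ fun i => if_neg (by have := (w i).1.2; omega)

theorem prism_zero (k : ℕ) (h : CylFam M k) : pull (Cyl.prism OrderHom.id 0) h = h := by
  have : Cyl.prism (OrderHom.id : Fin (k + 1) →o Fin (k + 1)) 0 = OrderHom.id :=
    OrderHom.ext _ _ (funext fun p => Prod.ext rfl (by simp [Cyl.prism]))
  rw [this]
  rfl

/-- The threshold i + 1 refers to the numbering of the vertices before `j` is removed; removing a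
vertex below it lowers it by one. -/
theorem prism_face {k : ℕ} (i : Fin (k + 1)) (j : Fin (k + 2)) :
    (Cyl.prism (degMap i) (i + 1)).comp (Cyl.push (faceMap j)) =
      Cyl.prism ((degMap i).comp (faceMap j)) (if (j : ℕ) ≤ i then i else i + 1) := by
  refine OrderHom.ext _ _ (funext fun p => Prod.ext rfl (if_congr ?_ rfl rfl))
  change (i : ℕ) + 1 ≤ (j.succAbove p.1 : Fin (k + 2)) ↔ _
  simp only [Fin.succAbove, Fin.lt_def, Fin.val_castSucc]
  split_ifs <;> simp <;> omega

theorem degMap_comp_faceMap {k : ℕ} (i : Fin (k + 1)) (j : Fin (k + 2))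
    (h : j = i.castSucc ∨ j = i.succ) : (degMap i).comp (faceMap j) = OrderHom.id := by
  refine OrderHom.ext _ _ (funext fun p => ?_)
  rcases h with rfl | rfl
  · exact Fin.predAbove_succAbove i p
  · refine Fin.ext ?_
    change ((i.predAbove (i.succ.succAbove p) : Fin (k + 1)) : ℕ) = p
    have h1 : ((i.succ.succAbove p : Fin (k + 2)) : ℕ) = if (p : ℕ) < i + 1 then (p : ℕ) else p + 1 := by
      simp only [Fin.succAbove, Fin.lt_def, Fin.val_castSucc, Fin.val_succ]
      split_ifs <;> rfl
    have h2 : ∀ q : Fin (k + 2), ((i.predAbove q : Fin (k + 1)) : ℕ) =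
        if (i : ℕ) < q then (q : ℕ) - 1 else q := fun q => by
      simp only [Fin.predAbove, Fin.lt_def, Fin.val_castSucc]
      split_ifs <;> rfl
    rw [h2, h1]
    split_ifs <;> omega

/-- If `j` is i or i + 1, the face of the prism is the graph of the cut at `j` over the identity.
For any other `j` the first coordinate misses a vertex, and the face vanishes because all faces of
`x` do. The cast in the hypothesis is needed because faces exist only for positive k. -/
theorem pull_prism_face {k : ℕ} {x : CylFam M k} (i : Fin (k + 1)) (j : Fin (k + 2))
    (hx : ∀ (l : ℕ) (e : k = l + 1) (a : Fin (l + 2)),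
      pull (Cyl.push (faceMap a)) (cast (congrArg (CylFam M) e) x) = 0) :
    pull (Cyl.push (faceMap j)) (pull (Cyl.prism (degMap i) (i + 1)) x) =
      (if j = i.castSucc then pull (Cyl.prism OrderHom.id j) x else 0) +
        if j = i.succ then pull (Cyl.prism OrderHom.id j) x else 0 := by
  change pull ((Cyl.prism (degMap i) (i + 1)).comp (Cyl.push (faceMap j))) x = _
  rw [prism_face]
  by_cases h1 : j = i.castSucc
  · have h2 : j ≠ i.succ := h1 ▸ (Fin.castSucc_lt_succ).ne
    rw [if_pos h1, if_neg h2, add_zero, degMap_comp_faceMap i j (Or.inl h1)]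
    subst h1
    simp
  · by_cases h2 : j = i.succ
    · rw [if_neg h1, if_pos h2, zero_add, degMap_comp_faceMap i j (Or.inr h2)]
      subst h2
      simp
    · rw [if_neg h1, if_neg h2, add_zero]
      rw [Fin.ext_iff] at h1 h2
      simp only [Fin.val_castSucc, Fin.val_succ] at h1 h2
      cases k with
      | zero => omega
      | succ k =>
        have hv : ∀ p, (((degMap i).comp (faceMap j) p : Fin (k + 2)) : ℕ) =
            if (i : ℕ) < j.succAbove p then (j.succAbove p : ℕ) - 1 else j.succAbove p := fun p => by
          change ((Fin.predAbove i (j.succAbove p) : Fin (k + 2)) : ℕ) = _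
          simp only [Fin.predAbove, Fin.lt_def, Fin.val_castSucc]
          split_ifs <;> rfl
        refine pull_eq_zero ⟨if (j : ℕ) < i then j else j - 1, by split_ifs <;> omega⟩
          (hx k rfl _) _ fun p hp => ?_
        have hp' := congrArg Fin.val hp
        change (((degMap i).comp (faceMap j) p.1 : Fin (k + 2)) : ℕ) = _ at hp'
        rw [hv] at hp'
        simp only [Fin.succAbove, Fin.lt_def, Fin.val_castSucc] at hp'
        split_ifs at hp' <;> simp at * <;> omega

/-- A path starting at 0 is contracted to its starting point by shortening it, one vertex of Δ[k]
after the other. The prisms of this homotopy, taken with alternating signs, form a simplex y. In its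
face j the prisms number j − 1 and j contribute the same partly shortened path with opposite signs;
face 0 is the whole path, and the last face is the constant path 0. -/
theorem paths_acyclic (k : ℕ) (x) (hx : x ∈ cycles (pathObject M {0}) k) :
    ∃ y ∈ normal (pathObject M {0}) (k + 1), face (pathObject M {0}) 0 y = x := by
  let x' : paths M {0} k := x
  have hx' : ∀ (l : ℕ) (e : k = l + 1) (a : Fin (l + 2)),
      pull (Cyl.push (faceMap a)) (cast (congrArg (CylFam M) e) x'.1) = 0 := by
    rintro l rfl a
    exact congrArg (Subtype.val : paths M {0} l → _) (mem_cycles.1 hx a)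
  let W : Fin (k + 1) → paths M {0} (k + 1) := fun i =>
    ⟨pull (Cyl.prism (degMap i) (i + 1)) x'.1, pull_prism_mem _ _ x'.2⟩
  let y : paths M {0} (k + 1) := ∑ i : Fin (k + 1), (-1 : ℤ) ^ (i : ℕ) • W i
  have hy : ∀ j : Fin (k + 2), pull (Cyl.push (faceMap j)) y.1 =
      (∑ i : Fin (k + 1), (-1 : ℤ) ^ (i : ℕ) •
        (if j = i.castSucc then pull (Cyl.prism OrderHom.id j) x'.1 else 0)) +
      ∑ i : Fin (k + 1), (-1 : ℤ) ^ (i : ℕ) •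
        (if j = i.succ then pull (Cyl.prism OrderHom.id j) x'.1 else 0) := fun j => by
    simp only [y, AddSubgroup.val_finsetSum, AddSubgroup.coe_zsmul, map_sum, map_zsmul, W]
    rw [← Finset.sum_add_distrib]
    exact Finset.sum_congr rfl fun i _ => by rw [pull_prism_face i j hx', smul_add]
  refine ⟨y, mem_normal.2 fun j => Subtype.ext ((hy j.succ).trans ?_), Subtype.ext ((hy 0).trans ?_)⟩
  · have h2 : ∑ i : Fin (k + 1), (-1 : ℤ) ^ (i : ℕ) • (if j.succ = i.succ then
        pull (Cyl.prism OrderHom.id j.succ) x'.1 else 0) =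
        (-1 : ℤ) ^ (j : ℕ) • pull (Cyl.prism OrderHom.id j.succ) x'.1 := by
      simp [Fin.succ_inj]
    rw [h2]
    cases j using Fin.lastCases with
    | last =>
      rw [show pull (Cyl.prism OrderHom.id ((Fin.last k).succ : ℕ)) x'.1 = 0 from prism_last x'.2]
      simp only [smul_zero, ite_self, Finset.sum_const_zero, add_zero]
      rfl
    | cast j =>
      have h1 : ∑ i : Fin (k + 1), (-1 : ℤ) ^ (i : ℕ) • (if j.castSucc.succ = i.castSucc then
          pull (Cyl.prism OrderHom.id (j.castSucc.succ : ℕ)) x'.1 else 0) =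
          (-1 : ℤ) ^ ((j : ℕ) + 1) • pull (Cyl.prism OrderHom.id (j.castSucc.succ : ℕ)) x'.1 := by
        simp only [← Fin.castSucc_succ, Fin.castSucc_inj]
        simp
      rw [h1, ← add_smul, Fin.val_castSucc, pow_succ]
      simp only [mul_neg, mul_one, neg_add_cancel, zero_smul]
      rfl
  · have h1 : ∑ i : Fin (k + 1), (-1 : ℤ) ^ (i : ℕ) • (if 0 = i.castSucc then
        pull (Cyl.prism OrderHom.id ((0 : Fin (k + 2)) : ℕ)) x'.1 else 0) =
        pull (Cyl.prism OrderHom.id ((0 : Fin (k + 2)) : ℕ)) x'.1 := by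
      rw [Fin.sum_univ_succ, Finset.sum_eq_zero fun i _ => by
        rw [if_neg, smul_zero]
        simp [Fin.ext_iff]]
      simp
    have h2 : ∑ i : Fin (k + 1), (-1 : ℤ) ^ (i : ℕ) • (if 0 = i.succ then
        pull (Cyl.prism OrderHom.id ((0 : Fin (k + 2)) : ℕ)) x'.1 else 0) = 0 :=
      Finset.sum_eq_zero fun i _ => by rw [if_neg (Fin.succ_ne_zero i).symm, smul_zero]
    rw [h1, h2, add_zero]
    exact prism_zero k x'.1

/-- In positive dimension the vertex 0 lies in the face opposite the last vertex, and that face is 0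
for a normal simplex. -/
theorem constMap_eq {k m : ℕ} : (⟨fun _ => 0, fun _ _ _ => le_rfl⟩ : Fin (m + 1) →o Fin (k + 2)) =
    (faceMap (Fin.last (k + 1))).comp ⟨fun _ => 0, fun _ _ _ => le_rfl⟩ := by
  refine OrderHom.ext _ _ (funext fun i => Fin.ext ?_)
  change _ = ((Fin.last (k + 1)).succAbove (0 : Fin (k + 1)) : ℕ)
  simp
  rfl

/-- The sequence of the loops in `M`, the paths in `M` and `M`. -/
theorem loopSequence :
    PathSequence (pathInclusion (M := M) (Set.subset_univ {0})) (endPoint (M := M) {0}) where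
  injective n x y h := Subtype.ext (congrArg (Subtype.val : paths M {0} n → _) h)
  exact n x := by
    let x' : paths M {0} n := x
    constructor
    · intro h
      refine ⟨(⟨x'.1, x'.2.1, fun e _ m w hw => ?_⟩ : paths M Set.univ n), rfl⟩
      fin_cases e
      · exact x'.2.2 0 rfl m w hw
      -- Every simplex of Δ[n] × {1} is obtained from the top one by a simplicial operator, so the
      -- vanishing of the end point implies that of the path on all of Δ[n] × {1}.
      · have hw' : w = (Cyl.top n).comp ((OrderHom.fst).comp w) :=
          OrderHom.ext _ _ (funext fun i => Prod.ext rfl (hw i))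
        rw [hw', ← x'.2.1]
        exact (congrArg _ h).trans (map_zero _)
    · rintro ⟨z, rfl⟩
      exact (Subtype.prop (p := (· ∈ paths M Set.univ n)) z).2 1 trivial n _ fun _ => rfl
  surjective n x hx := by
    -- The simplex is pulled back along the contraction of Δ[n + 1] × {0} to the vertex 0. The path
    -- starts at 0 because that vertex is 0.
    refine ⟨(⟨fun m w => (M.map (simplexHom ((Cyl.contract _).comp w)).op).hom x,
      fun m l β w => ?_, fun e he m w hw => ?_⟩ : paths M {0} (n + 1)), ?_⟩
    · exact (ConcreteCategory.congr_hom (M.map_comp (simplexHom ((Cyl.contract _).comp w)).op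
        (simplexHom β).op) x).symm
    · obtain rfl : e = 0 := he
      have h1 : (Cyl.contract (n + 1)).comp w =
          (faceMap (Fin.last (n + 1))).comp ⟨fun _ => 0, fun _ _ _ => le_rfl⟩ := by
        rw [← constMap_eq]
        exact OrderHom.ext _ _ (funext fun i => if_pos (hw i))
      change (M.map (simplexHom ((Cyl.contract _).comp w)).op).hom x = 0
      rw [h1]
      refine (ConcreteCategory.congr_hom (M.map_comp (simplexHom (faceMap (Fin.last (n + 1)))).op
        (simplexHom _).op) x).trans ?_
      have h2 : face M (Fin.last n).succ x = 0 := mem_normal.1 hx (Fin.last n)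
      exact (congrArg (M.map (simplexHom _).op).hom h2).trans (map_zero (M.map _).hom)
    · have h1 : (Cyl.contract (n + 1)).comp (Cyl.top (n + 1)) = OrderHom.id := rfl
      exact ConcreteCategory.congr_hom (M.map_id _) x
  acyclic := paths_acyclic

/-- The simplicial abelian group of loops. -/
def loopObject (M : SimplicialObject AddCommGrpCat.{0}) : SimplicialObject AddCommGrpCat.{0} :=
  pathObject M Set.univ

theorem nonempty_π_loopObject (M : SimplicialObject AddCommGrpCat.{0}) (n : ℕ) :
    Nonempty (π M (n + 1) ≃+ π (loopObject M) n) := loopSequence.nonempty_π_equiv n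

/-- The sum of the coordinates. -/
def Cyl.rank {k : ℕ} (p : Cyl k) : Fin (k + 2) := ⟨p.1 + p.2, by omega⟩

theorem Cyl.rank_strictMono {k : ℕ} : StrictMono (Cyl.rank (k := k)) := by
  rintro ⟨a, b⟩ ⟨c, d⟩ h
  obtain ⟨h1, h2⟩ := Prod.le_def.1 h.le
  have h3 := h.ne
  have h1' : (a : ℕ) ≤ c := h1
  have h2' : (b : ℕ) ≤ d := h2
  rw [ne_eq, Prod.ext_iff, Fin.ext_iff, Fin.ext_iff] at h3
  change (a : ℕ) + b < c + d
  dsimp only at h3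
  omega

/-- The sum of the coordinates is strictly monotone with k + 2 values, so a chain is indexed by its
ranks, and every simplex of Δ[k] × Δ[1] is obtained from one of dimension k + 1. -/
theorem Cyl.exists_factorization {k m : ℕ} (w : Fin (m + 1) →o Cyl k) :
    ∃ (τ : Fin (k + 2) →o Cyl k) (β : Fin (m + 1) →o Fin (k + 2)), τ.comp β = w := by
  classical
  -- At a rank r that the chain may skip, τ takes the largest entry of rank at most r.
  refine ⟨⟨fun r => (Finset.univ.filter fun a => Cyl.rank (w a) ≤ r).sup w, fun r s h =>
    Finset.sup_mono fun a ha => ?_⟩, ⟨fun a => Cyl.rank (w a), fun a b h =>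
      Cyl.rank_strictMono.monotone (w.monotone h)⟩, OrderHom.ext _ _ (funext fun a => ?_)⟩
  · rw [Finset.mem_filter] at ha ⊢
    exact ⟨ha.1, ha.2.trans h⟩
  · change (Finset.univ.filter fun b => Cyl.rank (w b) ≤ Cyl.rank (w a)).sup w = w a
    refine le_antisymm (Finset.sup_le fun b hb => ?_) (Finset.le_sup (f := w)
      (Finset.mem_filter.2 ⟨Finset.mem_univ a, le_rfl⟩))
    rcases le_total b a with h | h
    · exact w.monotone h
    · refine (w.monotone h).eq_or_lt.elim (fun e => e.ge) fun e => ?_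
      exact absurd (Finset.mem_filter.1 hb).2 (Cyl.rank_strictMono e).not_ge

/-- By the factorisation a loop of dimension k is determined by its values on the finitely many (k +
1)-simplices of the cylinder, so loops embed in a finite power of a free group. -/
theorem DegreewiseFree.loopObject (h : DegreewiseFree M) : DegreewiseFree (loopObject M) := by
  intro k
  have : Finite (Fin (k + 2) →o Cyl k) := Finite.of_injective _ DFunLike.coe_injective
  let f : CylFam M k →+ ((Fin (k + 2) →o Cyl k) → M.obj (op (SimplexCategory.mk (k + 1)))) :=
    { toFun := fun x w => x _ w
      map_zero' := rfl
      map_add' := fun _ _ => rfl }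
  refine .of_injective (G := paths M Set.univ k) (f.comp (paths M Set.univ k).subtype)
    ((injective_iff_map_eq_zero _).2 fun x hx => Subtype.ext (funext fun m => funext fun w => ?_))
    (.pi fun _ => h _)
  obtain ⟨τ, β, rfl⟩ := Cyl.exists_factorization w
  rw [← x.2.1]
  exact (congrArg _ (congrFun hx τ)).trans (map_zero _)

end SimplicialGroup
end Khovanov

/-! ### Isomorphisms of pointed spaces, loop spaces and products -/

namespace Khovanov

open CategoryTheory Opposite MonoidalCategory SimplicialGroup

namespace Sp

/-- An isomorphism of pointed simplicial sets, given by bijections in each degree. -/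
def mkIso {X Y : Sp} (e : ∀ κ : SimplexCategoryᵒᵖ, X.right.obj κ ≃ Y.right.obj κ)
    (he : ∀ {κ μ : SimplexCategoryᵒᵖ} (g : κ ⟶ μ) (x : X.right.obj κ),
      e μ (X.right.map g x) = Y.right.map g (e κ x))
    (he' : ∀ κ p, e κ (X.hom.app κ p) = Y.hom.app κ p) : X ≅ Y :=
  Under.isoMk (NatIso.ofComponents (fun κ => (e κ).toIso) fun g =>
    ConcreteCategory.hom_ext _ _ fun x => he g x) (by
      ext κ p
      exact he' κ p)

/-- Loops are compatible with isomorphisms. -/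
def loopIso {X Y : Sp} (e : X ≅ Y) : loop X ≅ loop Y :=
  mkIso (fun κ =>
    { toFun := fun h => ⟨h.1 ≫ e.hom.right, by
        rw [← Category.assoc, h.2.1, base_comp], by rw [← Category.assoc, h.2.2, base_comp]⟩
      invFun := fun h => ⟨h.1 ≫ e.inv.right, by
        rw [← Category.assoc, h.2.1, base_comp], by rw [← Category.assoc, h.2.2, base_comp]⟩
      left_inv := fun h => Subtype.ext (by
        change (h.1 ≫ e.hom.right) ≫ e.inv.right = h.1
        rw [Category.assoc, ← Under.comp_right, e.hom_inv_id, Under.id_right, Category.comp_id])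
      right_inv := fun h => Subtype.ext (by
        change (h.1 ≫ e.inv.right) ≫ e.hom.right = h.1
        rw [Category.assoc, ← Under.comp_right, e.inv_hom_id, Under.id_right, Category.comp_id]) })
    (fun g h => Subtype.ext (Category.assoc _ _ _))
    (fun κ p => Subtype.ext (base_comp _ _))

/-- The degreewise bijection of an isomorphism. -/
def degree {X Y : Sp} (e : X ≅ Y) (κ : SimplexCategoryᵒᵖ) :
    X.right.obj κ ≃ Y.right.obj κ where
  toFun := e.hom.right.app κ
  invFun := e.inv.right.app κ
  left_inv x := ConcreteCategory.congr_hom (NatTrans.congr_app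
    (congrArg (fun f => f.right) e.hom_inv_id) κ) x
  right_inv x := ConcreteCategory.congr_hom (NatTrans.congr_app
    (congrArg (fun f => f.right) e.inv_hom_id) κ) x

/-- Products are compatible with isomorphisms. -/
def prodIso {X X' Y Y' : Sp} (e : X ≅ X') (e' : Y ≅ Y') : prod X Y ≅ prod X' Y' :=
  mkIso (fun κ => (degree e κ).prodCongr (degree e' κ))
    (fun g x => congrArg₂ Prod.mk (ConcreteCategory.congr_hom (e.hom.right.naturality g) x.1)
      (ConcreteCategory.congr_hom (e'.hom.right.naturality g) x.2))
    (fun κ p => congrArg₂ Prod.mk (ConcreteCategory.congr_hom (NatTrans.congr_app (Under.w e.hom) κ) p)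
      (ConcreteCategory.congr_hom (NatTrans.congr_app (Under.w e'.hom) κ) p))

/-- Homotopy limits are compatible with isomorphisms of diagrams. -/
def holimIso {C : Type} [SmallCategory C] {X Y : C ⥤ Sp} (e : X ≅ Y) : holim X ≅ holim Y :=
  mkIso (fun κ => ((Functor.isoWhiskerRight e (Under.forget _)).homToEquiv :
      ((overNerve C ⊗ (Functor.const C).obj (simplex.obj κ.unop)) ⟶ (X ⋙ Under.forget _)) ≃
        ((overNerve C ⊗ (Functor.const C).obj (simplex.obj κ.unop)) ⟶ (Y ⋙ Under.forget _))))
    (fun {κ μ} g (h : (overNerve C ⊗ (Functor.const C).obj (simplex.obj κ.unop)) ⟶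
        (X ⋙ Under.forget _)) => Category.assoc
      (overNerve C ◁ (Functor.const C).map (simplex.map g.unop)) h
      (Functor.isoWhiskerRight e (Under.forget _)).hom)
    (fun κ p => NatTrans.ext (funext fun c => base_comp _ _))

end Sp

namespace SimplicialGroup

/-- The product of simplicial abelian groups. -/
def prodObject (X Y : SimplicialObject AddCommGrpCat.{0}) : SimplicialObject AddCommGrpCat.{0} where
  obj κ := AddCommGrpCat.of (X.obj κ × Y.obj κ)
  map g := AddCommGrpCat.ofHom ((X.map g).hom.prodMap (Y.map g).hom)
  map_id κ := by
    refine AddCommGrpCat.hom_ext (AddMonoidHom.ext fun x => ?_)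
    exact congrArg₂ Prod.mk (ConcreteCategory.congr_hom (X.map_id κ) x.1)
      (ConcreteCategory.congr_hom (Y.map_id κ) x.2)
  map_comp f g := by
    refine AddCommGrpCat.hom_ext (AddMonoidHom.ext fun x => ?_)
    exact congrArg₂ Prod.mk (ConcreteCategory.congr_hom (X.map_comp f g) x.1)
      (ConcreteCategory.congr_hom (Y.map_comp f g) x.2)

variable (X Y : SimplicialObject AddCommGrpCat.{0})

/-- The space of a product. -/
def prodIso : Sp.prod (Sp.ofSimplicialGroup.obj X) (Sp.ofSimplicialGroup.obj Y) ≅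
    Sp.ofSimplicialGroup.obj (prodObject X Y) :=
  Sp.mkIso (fun κ => Equiv.refl (X.obj κ × Y.obj κ)) (fun _ _ => rfl) (fun _ _ => rfl)

/-- The space of the loop group is the loop space. -/
def loopIso : Sp.loop (Sp.ofSimplicialGroup.obj X) ≅ Sp.ofSimplicialGroup.obj (loopObject X) :=
  Sp.mkIso (fun κ => 
    { toFun := fun h => (⟨fun m w => h.1.app (op (SimplexCategory.mk m))
        (SSet.stdSimplex.objEquiv.symm (simplexHom (OrderHom.fst.comp w)),
          SSet.stdSimplex.objEquiv.symm (simplexHom (OrderHom.snd.comp w))), by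
            refine And.intro (fun m l β w => ?_) fun e _ m w hw => ?_
            · exact (ConcreteCategory.congr_hom (h.1.naturality (simplexHom β).op) _).symm
            · have hs : OrderHom.snd.comp w = ⟨fun _ => e, fun _ _ _ => le_rfl⟩ :=
                OrderHom.ext _ _ (funext hw)
              refine (congrArg (fun t => h.1.app (op (SimplexCategory.mk m))
                (SSet.stdSimplex.objEquiv.symm (simplexHom (OrderHom.fst.comp w)),
                  SSet.stdSimplex.objEquiv.symm (simplexHom t))) hs).trans ?_
              fin_cases e
              · exact ConcreteCategory.congr_hom (NatTrans.congr_app h.2.1 (op (SimplexCategory.mk m)))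
                  (SSet.stdSimplex.objEquiv.symm (simplexHom (OrderHom.fst.comp w)))
              · exact ConcreteCategory.congr_hom (NatTrans.congr_app h.2.2 (op (SimplexCategory.mk m)))
                  (SSet.stdSimplex.objEquiv.symm (simplexHom (OrderHom.fst.comp w)))⟩ :
            paths X Set.univ κ.unop.len)
      invFun := fun z : paths X Set.univ κ.unop.len => ⟨{
        app := fun μ => TypeCat.ofHom fun p => z.1 μ.unop.len
          ((SSet.stdSimplex.objEquiv p.1).toOrderHom.prod (SSet.stdSimplex.objEquiv p.2).toOrderHom)
        naturality := fun μ ν g => ConcreteCategory.hom_ext _ _ fun p =>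
          (z.2.1 _ _ g.unop.toOrderHom ((SSet.stdSimplex.objEquiv p.1).toOrderHom.prod
            (SSet.stdSimplex.objEquiv p.2).toOrderHom)).symm }, by
          ext μ p
          exact z.2.2 0 trivial _ _ fun _ => rfl, by
          ext μ p
          exact z.2.2 1 trivial _ _ fun _ => rfl⟩
      left_inv := fun h => Subtype.ext (NatTrans.ext (funext fun μ =>
        ConcreteCategory.hom_ext _ _ fun p => by
          obtain ⟨a, b⟩ : (SSet.stdSimplex.obj κ.unop).obj μ ×
            (SSet.stdSimplex.obj (SimplexCategory.mk 1)).obj μ := p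
          change h.1.app μ (SSet.stdSimplex.objEquiv.symm _, SSet.stdSimplex.objEquiv.symm _) =
            h.1.app μ (a, b)
          congr 1
          refine congrArg₂ Prod.mk ?_ ?_
          · refine Eq.trans (b := SSet.stdSimplex.objEquiv.symm
              (simplexHom (SSet.stdSimplex.objEquiv a).toOrderHom)) ?_ rfl
            refine congrArg (fun t => SSet.stdSimplex.objEquiv.symm (simplexHom t))
              (OrderHom.ext _ _ (funext fun i => ?_))
            rfl
          · refine Eq.trans (b := SSet.stdSimplex.objEquiv.symm
              (simplexHom (SSet.stdSimplex.objEquiv b).toOrderHom)) ?_ rfl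
            refine congrArg (fun t => SSet.stdSimplex.objEquiv.symm (simplexHom t))
              (OrderHom.ext _ _ (funext fun i => ?_))
            rfl))
      right_inv := fun z => rfl }) (fun _ _ => rfl) (fun _ _ => rfl)

variable {X Y}

theorem mem_cycles_prodObject {n : ℕ} {p : X.obj (op (SimplexCategory.mk n)) ×
    Y.obj (op (SimplexCategory.mk n))} :
    p ∈ cycles (prodObject X Y) n ↔ p.1 ∈ cycles X n ∧ p.2 ∈ cycles Y n := by
  cases n with
  | zero => exact ⟨fun _ => ⟨trivial, trivial⟩, fun _ => trivial⟩
  | succ n =>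
    rw [mem_cycles, mem_cycles, ← forall_and]
    exact (mem_cycles (X := prodObject X Y)).trans (forall_congr' fun i => Prod.ext_iff)

theorem mem_normal_prodObject {n : ℕ} {p : X.obj (op (SimplexCategory.mk (n + 1))) ×
    Y.obj (op (SimplexCategory.mk (n + 1)))} :
    p ∈ normal (prodObject X Y) (n + 1) ↔ p.1 ∈ normal X (n + 1) ∧ p.2 ∈ normal Y (n + 1) := by
  rw [mem_normal, mem_normal, ← forall_and]
  exact (mem_normal (X := prodObject X Y)).trans (forall_congr' fun i => Prod.ext_iff)

theorem mem_boundaries_prodObject {n : ℕ} {p : X.obj (op (SimplexCategory.mk n)) ×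
    Y.obj (op (SimplexCategory.mk n))} :
    p ∈ boundaries (prodObject X Y) n ↔ p.1 ∈ boundaries X n ∧ p.2 ∈ boundaries Y n := by
  constructor
  · rintro ⟨y, hy, rfl⟩
    obtain ⟨h1, h2⟩ := mem_normal_prodObject.1 hy
    exact ⟨⟨_, h1, rfl⟩, ⟨_, h2, rfl⟩⟩
  · rintro ⟨⟨y, hy, h⟩, ⟨z, hz, h'⟩⟩
    exact ⟨(y, z), mem_normal_prodObject.2 ⟨hy, hz⟩, Prod.ext h h'⟩

theorem nonempty_π_prodObject (n : ℕ) : Nonempty (π (prodObject X Y) n ≃+ π X n × π Y n) := by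
  let f : cycles (prodObject X Y) n →+ π X n × π Y n :=
    ((QuotientAddGroup.mk' _).comp (((AddMonoidHom.fst (X.obj (op (SimplexCategory.mk n)))
      (Y.obj (op (SimplexCategory.mk n)))).comp
        (cycles (prodObject X Y) n).subtype).codRestrict (cycles X n)
          fun p => (mem_cycles_prodObject.1 p.2).1)).prod
    ((QuotientAddGroup.mk' _).comp (((AddMonoidHom.snd (X.obj (op (SimplexCategory.mk n)))
      (Y.obj (op (SimplexCategory.mk n)))).comp
        (cycles (prodObject X Y) n).subtype).codRestrict (cycles Y n)
          fun p => (mem_cycles_prodObject.1 p.2).2))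
  have hf : Function.Surjective f := by
    rintro ⟨a, b⟩
    obtain ⟨x, rfl⟩ := QuotientAddGroup.mk_surjective a
    obtain ⟨y, rfl⟩ := QuotientAddGroup.mk_surjective b
    exact ⟨⟨(x.1, y.1), mem_cycles_prodObject.2 ⟨x.2, y.2⟩⟩, rfl⟩
  have hk : f.ker = (boundaries (prodObject X Y) n).addSubgroupOf (cycles (prodObject X Y) n) := by
    ext p
    refine (AddMonoidHom.mem_ker).trans (Prod.ext_iff.trans ?_)
    refine (and_congr (QuotientAddGroup.eq_zero_iff _) (QuotientAddGroup.eq_zero_iff _)).trans ?_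
    exact (mem_boundaries_prodObject (X := X) (Y := Y)).symm
  exact ⟨(QuotientAddGroup.quotientAddEquivOfEq hk.symm).trans
    (QuotientAddGroup.quotientKerEquivOfSurjective f hf)⟩

theorem DegreewiseFree.prodObject (hX : DegreewiseFree X) (hY : DegreewiseFree Y) :
    DegreewiseFree (prodObject X Y) := fun k => by
  have := (hX k).1
  have := (hX k).2
  have := (hY k).1
  have := (hY k).2
  exact (⟨inferInstance, inferInstance⟩ : FiniteFree (X.obj (op (SimplexCategory.mk k)) ×
    Y.obj (op (SimplexCategory.mk k))))

end SimplicialGroup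
end Khovanov

/-! ### Homotopy limits of Eilenberg–Mac Lane spaces as groups of cocycles -/

namespace Khovanov

open CategoryTheory Opposite MonoidalCategory SimplicialGroup Augmented

/-- The normalised cocycles of degree `n` of a standard simplex. -/
def chainCocycles (M : Type) [AddCommGroup M] (n k : ℕ) :
    AddSubgroup ((Fin (n + 1) →o Fin (k + 1)) → M) where
  carrier := {f | (∀ σ : Fin (n + 1) →o Fin (k + 1), ¬ Function.Injective σ → f σ = 0) ∧ ∀ σ, altSum f σ = 0}
  zero_mem' := ⟨fun _ _ => rfl, fun σ => altSum_zero σ⟩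
  add_mem' := fun {f g} h h' => ⟨fun σ hσ => by simp [h.1 σ hσ, h'.1 σ hσ], fun σ => by
    rw [altSum_add, h.2, h'.2, add_zero]⟩
  neg_mem' := fun {f} h => ⟨fun σ hσ => by simp [h.1 σ hσ], fun σ => by
    rw [altSum_neg, h.2, neg_zero]⟩

/-- The simplicial abelian groups `K(M, n)`. -/
def cocycleFunctor (n : ℕ) : AddCommGrpCat.{0} ⥤ SimplicialObject AddCommGrpCat.{0} where
  obj M := SimplicialGroup.mk (fun k => chainCocycles M n k)
    (fun {k l} β =>
      { toFun := fun f => ⟨fun σ => f.1 (β.comp σ), And.intro (fun σ h => f.2.1 _ fun h' =>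
          h (Function.Injective.of_comp (f := β) h')) fun σ =>
          (altSum_comp β f.1 σ).symm.trans (f.2.2 (β.comp σ))⟩
        map_zero' := rfl
        map_add' := fun _ _ => rfl })
    (fun _ _ => rfl) (fun _ _ _ => rfl)
  map {M N} a :=
    { app := fun κ => AddCommGrpCat.ofHom
        { toFun := fun f : chainCocycles M n κ.unop.len =>
            (⟨fun σ => a.hom (f.1 σ), And.intro (fun σ h => (congrArg _ (f.2.1 σ h)).trans (map_zero _))
              fun σ => (map_altSum a.hom f.1 σ).symm.trans
                ((congrArg _ (f.2.2 σ)).trans (map_zero a.hom))⟩ : chainCocycles N n κ.unop.len)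
          map_zero' := Subtype.ext (funext fun σ => map_zero _)
          map_add' := fun f g => Subtype.ext (funext fun σ => map_add _ _ _) }
      naturality := fun _ _ _ => rfl }
  map_id M := rfl
  map_comp a b := rfl

/-- The Dold–Kan correspondence applied to complexes concentrated in one degree. -/
noncomputable def singleHom (n : ℕ) : HomologicalComplex.single AddCommGrpCat.{0} (ComplexShape.down ℕ) n ⋙ dold ⟶
    cocycleFunctor n where
  app M :=
    { app := fun κ => AddCommGrpCat.ofHom
        { toFun := fun φ : chainFamilies ((HomologicalComplex.single _ _ n).obj M) κ.unop.len =>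
            (⟨fun σ => (HomologicalComplex.singleObjXSelf (ComplexShape.down ℕ) n M).hom.hom (φ.1 n σ),
              And.intro (fun σ h => (congrArg _ (φ.2.1 n σ h)).trans (map_zero _)) fun σ =>
                (map_altSum _ (φ.1 n) σ).symm.trans ((congrArg _ ((φ.2.2 n σ).symm.trans (by
                  rw [HomologicalComplex.single_obj_d]
                  rfl))).trans (map_zero _))⟩ : chainCocycles M n κ.unop.len)
          map_zero' := Subtype.ext (funext fun σ => map_zero _)
          map_add' := fun f g => Subtype.ext (funext fun σ => map_add _ _ _) }
      naturality := fun _ _ _ => rfl }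
  naturality M N a := by
    ext κ φ
    refine Subtype.ext (funext fun σ => ?_)
    have h := HomologicalComplex.single_map_f_self (ComplexShape.down ℕ) n a =≫
      (HomologicalComplex.singleObjXSelf (ComplexShape.down ℕ) n N).hom
    simp only [Category.assoc, Iso.inv_hom_id, Category.comp_id] at h
    exact ConcreteCategory.congr_hom h _

/-- In a complex concentrated in degree n only the degree n part of a family survives. The equation
in degree n says that it is a cocycle, and the one in degree n − 1 holds trivially. -/
theorem singleHom_bijective (n : ℕ) (M : AddCommGrpCat.{0}) (κ : SimplexCategoryᵒᵖ) :
    Function.Bijective (((singleHom n).app M).app κ).hom := by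
  have hs : ∀ m, m ≠ n → Subsingleton
      (((HomologicalComplex.single AddCommGrpCat.{0} (ComplexShape.down ℕ) n).obj M).X m) :=
    fun m hm => AddCommGrpCat.subsingleton_of_isZero
      (HomologicalComplex.isZero_single_obj_X (ComplexShape.down ℕ) n M m hm)
  set e := HomologicalComplex.singleObjXSelf (ComplexShape.down ℕ) n M
  have he : ∀ x, e.inv.hom (e.hom.hom x) = x := fun x => ConcreteCategory.congr_hom e.hom_inv_id x
  have he' : ∀ x, e.hom.hom (e.inv.hom x) = x := fun x => ConcreteCategory.congr_hom e.inv_hom_id x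
  constructor
  · intro φ ψ h
    refine Subtype.ext (funext fun m => funext fun σ => ?_)
    by_cases hm : m = n
    · subst hm
      have h' := congrFun (congrArg (Subtype.val : chainCocycles M m κ.unop.len → _) h) σ
      exact (he _).symm.trans ((congrArg e.inv.hom h').trans (he _))
    · have := hs m hm
      exact Subsingleton.elim _ _
  · intro f
    let f' : chainCocycles M n κ.unop.len := f
    let φ : ∀ m, (Fin (m + 1) →o Fin (κ.unop.len + 1)) →
        ((HomologicalComplex.single AddCommGrpCat.{0} (ComplexShape.down ℕ) n).obj M).X m :=
      fun m σ => if h : m = n then h ▸ e.inv.hom (f'.1 (h ▸ σ)) else 0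
    have hφ : φ n = fun σ => e.inv.hom (f'.1 σ) := funext fun σ => dif_pos rfl
    have hφ' : ∀ m, m ≠ n → φ m = 0 := fun m hm => funext fun σ => dif_neg hm
    refine ⟨(⟨φ, And.intro (fun m σ h => ?_) fun m σ => ?_⟩ : chainFamilies _ κ.unop.len),
      Subtype.ext (funext fun σ => ?_)⟩
    · by_cases hm : m = n
      · subst hm
        rw [hφ]
        exact (congrArg e.inv.hom (f'.2.1 σ h)).trans (map_zero _)
      · rw [hφ' m hm]
        rfl
    · rw [HomologicalComplex.single_obj_d]
      by_cases hm : m = n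
      · subst hm
        rw [hφ]
        exact ((map_altSum e.inv.hom f'.1 σ).symm.trans ((congrArg _ (f'.2.2 σ)).trans (map_zero _))).symm
      · rw [hφ' m hm]
        exact (altSum_zero σ).symm
    · exact (congrArg e.hom.hom (congrFun hφ σ)).trans (he' _)

instance (n : ℕ) : IsIso (singleHom n) := by
  have : ∀ M, IsIso ((singleHom n).app M) := fun M => by
    have : ∀ κ, IsIso (((singleHom n).app M).app κ) := fun κ =>
      (ConcreteCategory.isIso_iff_bijective _).2 (singleHom_bijective n M κ)
    exact NatIso.isIso_of_isIso_app _
  exact NatIso.isIso_of_isIso_app _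

/-- Eilenberg–Mac Lane spaces in terms of cocycles. -/
noncomputable def eilenbergMacLaneIso (n : ℕ) : Sp.eilenbergMacLane n ≅ cocycleFunctor n ⋙ Sp.ofSimplicialGroup :=
  Functor.isoWhiskerLeft _ (Functor.isoWhiskerRight gammaIso _) ≪≫
    Functor.isoWhiskerRight (asIso (singleHom n)) Sp.ofSimplicialGroup

variable {A : Type}

/-- The restriction of a presheaf on `Q` to the cube. -/
def cubeFunctor (F : (Augmented A)ᵒᵖ ⥤ AddCommGrpCat.{0}) : CubeFunctor A where
  obj x := F.obj (op (cell x))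
  map {x y} h := (F.map (homOfLE (show (cell y : Augmented A) ≤ cell x from h)).op).hom
  map_self {x} h r := ConcreteCategory.congr_hom (F.map_id (op (cell x))) r
  map_map {x y z} h h' r := (ConcreteCategory.congr_hom (F.map_comp
    (homOfLE (show (cell y : Augmented A) ≤ cell x from h)).op
    (homOfLE (show (cell z : Augmented A) ≤ cell y from h')).op) r).symm

/-- The poset of the elements above `q`, in reverse order. -/
abbrev Above (q : Augmented A) : Type := { r : (Augmented A)ᵒᵈ // q ≤ OrderDual.ofDual r }

/-- The inclusion of posets. -/
def Above.incl {q r : Augmented A} (h : q ≤ r) : Above r →o Above q where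
  toFun s := ⟨s.1, h.trans s.2⟩
  monotone' _ _ h := h

theorem eq_of_above_extra (r : Above (extra : Augmented A)) : r.1 = OrderDual.toDual extra := by
  obtain ⟨r | _, h⟩ := r
  · exact h.elim
  · rfl

/-- The simplices of the nerve of an over category. -/
def overChain (q : Augmented A) (m : ℕ) :
    ((Sp.overNerve (Augmented A)ᵒᵖ).obj (op q)).obj (op (SimplexCategory.mk m)) ≃
      (Fin (m + 1) →o Above q) where
  toFun a :=
    { toFun := fun i => ⟨OrderDual.toDual (a.obj i).left.unop, leOfHom (a.obj i).hom.unop⟩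
      monotone' := fun i j h => leOfHom (a.map (homOfLE h)).left.unop }
  invFun w :=
    { obj := fun i => Over.mk (homOfLE (w i).2).op
      map := fun {i j} h => Over.homMk (homOfLE (show OrderDual.ofDual (w j).1 ≤ OrderDual.ofDual (w i).1
        from w.monotone (leOfHom h))).op rfl
      map_id := fun _ => rfl
      map_comp := fun _ _ => rfl }
  left_inv a := rfl
  right_inv w := rfl


section

variable {F : (Augmented A)ᵒᵖ ⥤ AddCommGrpCat.{0}} {n k : ℕ}

/-- The cochain on the chains of the posets `Above q × {0, …, k}` given by a family, extended by
`0` to the additional element. -/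
def extendFam (z : (cubeFunctor F).Fam n k) :
    (q : Augmented A) → (Fin (n + 1) →o Above q × Fin (k + 1)) → F.obj (op q)
  | cell x => z x
  | extra => 0

/-- Naturality with respect to the additional element, where F vanishes, is precisely the condition
that cochains are 0 on chains over that element. -/
theorem map_extendFam {z : (cubeFunctor F).Fam n k} (hz : z ∈ (cubeFunctor F).nerveCocycles n k)
    {q r : Augmented A} (h : q ≤ r) (w : Fin (n + 1) →o Above r × Fin (k + 1)) :
    (F.map (homOfLE h).op).hom (extendFam z r w) =
      extendFam z q (((Above.incl h).prodMap OrderHom.id).comp w) := by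
  obtain ⟨hz, -⟩ := CubeFunctor.mem_nerveCocycles.1 hz
  rcases q with y | _ <;> rcases r with x | _
  · exact hz.1 x y h w
  · refine (map_zero _).trans (hz.2.1 y _ fun i => ?_).symm
    exact (eq_of_above_extra (w i).1)
  · exact h.elim
  · exact map_zero _

/-- The diagram whose homotopy limit is considered. -/
abbrev cocycleDiagram (F : (Augmented A)ᵒᵖ ⥤ AddCommGrpCat.{0}) (n : ℕ) : (Augmented A)ᵒᵖ ⥤ SSet.{0} :=
  (F ⋙ cocycleFunctor n ⋙ Sp.ofSimplicialGroup) ⋙ Under.forget _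

/-- The simplices of the homotopy limit. -/
abbrev HolimSimplex (F : (Augmented A)ᵒᵖ ⥤ AddCommGrpCat.{0}) (n k : ℕ) : Type :=
  (Sp.overNerve (Augmented A)ᵒᵖ ⊗ (Functor.const _).obj (Sp.simplex.obj (SimplexCategory.mk k))) ⟶
    cocycleDiagram F n

/-- A simplex of the domain of a simplex of the homotopy limit. -/
def pairSimplex (q : Augmented A) {k m : ℕ} (w : Fin (m + 1) →o Above q × Fin (k + 1)) :
    ((Sp.overNerve (Augmented A)ᵒᵖ ⊗
      (Functor.const _).obj (Sp.simplex.obj (SimplexCategory.mk k))).obj (op q)).obj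
        (op (SimplexCategory.mk m)) :=
  ((overChain q m).symm (OrderHom.fst.comp w),
    SSet.stdSimplex.objEquiv.symm (simplexHom (OrderHom.snd.comp w)))

theorem map_pairSimplex {q r : Augmented A} (h : q ≤ r) {m : ℕ}
    (w : Fin (m + 1) →o Above r × Fin (k + 1)) :
    (((Sp.overNerve (Augmented A)ᵒᵖ ⊗ (Functor.const _).obj (Sp.simplex.obj (SimplexCategory.mk k))).map
      (homOfLE h).op).app (op (SimplexCategory.mk m))) (pairSimplex r w) =
      pairSimplex q (((Above.incl h).prodMap OrderHom.id).comp w) := by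
  refine congrArg₂ Prod.mk ?_ ?_
  · rfl
  · rfl

theorem pairSimplex_prod {q : Augmented A} {μ : SimplexCategoryᵒᵖ}
    (p : ((Sp.overNerve (Augmented A)ᵒᵖ ⊗
      (Functor.const _).obj (Sp.simplex.obj (SimplexCategory.mk k))).obj (op q)).obj μ) :
    pairSimplex q ((overChain q μ.unop.len p.1).prod (SSet.stdSimplex.objEquiv p.2).toOrderHom) = p := by
  obtain ⟨a, b⟩ : ((Sp.overNerve (Augmented A)ᵒᵖ).obj (op q)).obj μ ×
    (SSet.stdSimplex.obj (SimplexCategory.mk k)).obj μ := p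
  refine congrArg₂ Prod.mk ?_ ?_
  · rfl
  · refine Eq.trans (b := SSet.stdSimplex.objEquiv.symm
      (simplexHom (SSet.stdSimplex.objEquiv b).toOrderHom)) ?_ rfl
    refine congrArg (fun t => SSet.stdSimplex.objEquiv.symm (simplexHom t))
      (OrderHom.ext _ _ (funext fun i => ?_))
    rfl

/-- The value of a simplex of the homotopy limit. -/
def valueAt (Φ : HolimSimplex F n k) (q : Augmented A) (m : ℕ)
    (w : Fin (m + 1) →o Above q × Fin (k + 1)) : chainCocycles (F.obj (op q)) n m :=
  (Φ.app (op q)).app (op (SimplexCategory.mk m)) (pairSimplex q w)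

theorem valueAt_comp (Φ : HolimSimplex F n k) (q : Augmented A) {m l : ℕ}
    (β : Fin (m + 1) →o Fin (l + 1)) (w : Fin (l + 1) →o Above q × Fin (k + 1))
    (σ : Fin (n + 1) →o Fin (m + 1)) :
    (valueAt Φ q m (w.comp β)).1 σ = (valueAt Φ q l w).1 (β.comp σ) :=
  congrArg (fun f : chainCocycles (F.obj (op q)) n m => f.1 σ)
    (ConcreteCategory.congr_hom ((Φ.app (op q)).naturality (simplexHom β).op) (pairSimplex q w))

theorem map_valueAt (Φ : HolimSimplex F n k) {q r : Augmented A} (h : q ≤ r) {m : ℕ}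
    (w : Fin (m + 1) →o Above r × Fin (k + 1)) (σ : Fin (n + 1) →o Fin (m + 1)) :
    (F.map (homOfLE h).op).hom ((valueAt Φ r m w).1 σ) =
      (valueAt Φ q m (((Above.incl h).prodMap OrderHom.id).comp w)).1 σ := by
  rw [valueAt, valueAt, ← map_pairSimplex h]
  exact congrArg (fun f : chainCocycles (F.obj (op q)) n m => f.1 σ)
    (ConcreteCategory.congr_hom (NatTrans.congr_app (Φ.naturality (homOfLE h).op)
      (op (SimplexCategory.mk m))) (pairSimplex r w)).symm

/-- A non-injective chain has two equal neighbours; the map ρ which sends the upper index to the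
lower one and fixes all others does not change the chain. So such a chain is degenerate in the sense
of simplicial operators. -/
theorem exists_comp_eq {J : Type} [PartialOrder J] (w : Fin (n + 1) →o J) (h : ¬ Function.Injective w) :
    ∃ ρ : Fin (n + 1) →o Fin (n + 1), ¬ Function.Injective ρ ∧ w.comp ρ = w := by
  have : ¬ StrictMono w := fun h' => h h'.injective
  cases n with
  | zero => exact absurd (fun i j _ => Subsingleton.elim (α := Fin 1) i j) h
  | succ n =>
    rw [Fin.strictMono_iff_lt_succ] at this
    push Not at this
    obtain ⟨i, hi⟩ := this
    have hi' : w i.castSucc = w i.succ := by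
      by_contra hne
      exact hi (lt_of_le_of_ne (w.monotone Fin.castSucc_lt_succ.le) hne)
    refine ⟨(Fin.succAboveOrderEmb i.succ).toOrderHom.comp (Fin.predAboveOrderHom i), fun hinj => ?_,
      OrderHom.ext _ _ (funext fun j => ?_)⟩
    · have := @hinj i.castSucc i.succ (by simp)
      exact absurd this Fin.castSucc_lt_succ.ne
    · change w (i.succ.succAbove (i.predAbove j)) = w j
      rcases eq_or_ne j i.succ with rfl | hj
      · simpa using hi'
      · rw [Fin.succ_succAbove_predAbove hj]

/-- By naturality in the simplices a simplex of the homotopy limit is determined by its values on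
n-dimensional chains, and the cocycle condition is read off on (n + 1)-dimensional ones. A chain
over the additional element is the image of a chain at that element, where the values are trivial.
-/
theorem valueAt_mem [Subsingleton (F.obj (op extra))] (Φ : HolimSimplex F n k) :
    (fun x w => (valueAt Φ (cell x) n w).1 OrderHom.id : (cubeFunctor F).Fam n k) ∈
      (cubeFunctor F).nerveCocycles n k := by
  refine CubeFunctor.mem_nerveCocycles.2 ⟨⟨fun x y h w => ?_, fun x w h => ?_, fun x w h => ?_⟩,
    funext fun x => funext fun w => ?_⟩
  · exact map_valueAt Φ _ w OrderHom.id
  · have h0 : (cell x : Augmented A) ≤ extra := by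
      have := (w 0).1.2
      rwa [h 0] at this
    let w' : Fin (n + 1) →o Above (extra : Augmented A) × Fin (k + 1) :=
      ⟨fun i => (⟨OrderDual.toDual extra, le_rfl⟩, (w i).2), fun i j hij => ⟨le_rfl, (w.monotone hij).2⟩⟩
    have hw : w = ((Above.incl h0).prodMap OrderHom.id).comp w' :=
      OrderHom.ext _ _ (funext fun i => Prod.ext (Subtype.ext (h i)) rfl)
    change (valueAt Φ (cell x) n w).1 OrderHom.id = 0
    rw [hw, ← map_valueAt, Subsingleton.elim ((valueAt Φ extra n w').1 OrderHom.id) 0, map_zero]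
  · obtain ⟨ρ, hρ, hw⟩ := exists_comp_eq w h
    change (valueAt Φ (cell x) n w).1 OrderHom.id = 0
    rw [← hw, valueAt_comp]
    exact (valueAt Φ (cell x) n w).2.1 _ hρ
  · refine (altSum_comp w (fun v => (valueAt Φ (cell x) n v).1 OrderHom.id) OrderHom.id).trans ?_
    refine Eq.trans ?_ ((valueAt Φ (cell x) (n + 1) w).2.2 OrderHom.id)
    refine congrArg (fun f => altSum f (OrderHom.id : Fin (n + 2) →o Fin (n + 2))) (funext fun σ => ?_)
    exact valueAt_comp Φ (cell x) σ w OrderHom.id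

theorem extendFam_mem {z : (cubeFunctor F).Fam n k} (hz : z ∈ (cubeFunctor F).nerveCocycles n k)
    (q : Augmented A) (m : ℕ) (w : Fin (m + 1) →o Above q × Fin (k + 1)) :
    (fun σ => extendFam z q (w.comp σ)) ∈ chainCocycles (F.obj (op q)) n m := by
  obtain ⟨h1, h2⟩ := CubeFunctor.mem_nerveCocycles.1 hz
  rcases q with x | _
  · refine ⟨fun σ h => h1.2.2 x _ fun h' => h (Function.Injective.of_comp (f := w) h'), fun σ => ?_⟩
    · exact (altSum_comp w (z x) σ).symm.trans (congrFun (congrFun h2 x) _)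
  · exact ⟨fun _ _ => rfl, fun σ => altSum_zero σ⟩

/-- The simplex of the homotopy limit given by a cocycle. -/
def ofFam (z : (cubeFunctor F).nerveCocycles n k) : HolimSimplex F n k where
  app c :=
    { app := fun μ => TypeCat.ofHom fun p => (⟨_, extendFam_mem z.2 c.unop μ.unop.len
        ((overChain c.unop _ p.1).prod (SSet.stdSimplex.objEquiv p.2).toOrderHom)⟩ :
          chainCocycles (F.obj c) n μ.unop.len)
      naturality := fun μ ν g => ConcreteCategory.hom_ext _ _ fun p => rfl }
  naturality c d g := by
    refine NatTrans.ext (funext fun μ => ConcreteCategory.hom_ext _ _ fun p =>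
      Subtype.ext (funext fun σ => ?_))
    exact (map_extendFam z.2 (leOfHom g.unop) (((overChain c.unop _ p.1).prod
      (SSet.stdSimplex.objEquiv p.2).toOrderHom).comp σ)).symm

end

/-- The homotopy limit as a simplicial abelian group. -/
def holimCocycleIso (F : (Augmented A)ᵒᵖ ⥤ AddCommGrpCat.{0}) [Subsingleton (F.obj (op extra))] (n : ℕ) :
    Sp.holim (F ⋙ cocycleFunctor n ⋙ Sp.ofSimplicialGroup) ≅
      Sp.ofSimplicialGroup.obj ((cubeFunctor F).cocycleObject n) :=
  Sp.mkIso (fun κ =>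
    { toFun := fun Φ : HolimSimplex F n κ.unop.len => (⟨_, valueAt_mem Φ⟩ :
        (cubeFunctor F).nerveCocycles n κ.unop.len)
      invFun := fun z : (cubeFunctor F).nerveCocycles n κ.unop.len => ofFam z
      left_inv := fun Φ => by
        refine NatTrans.ext (funext fun c => NatTrans.ext (funext fun μ =>
          ConcreteCategory.hom_ext _ _ fun p => Subtype.ext (funext fun σ => ?_)))
        rcases c with ⟨x | _⟩
        · refine (valueAt_comp Φ (cell x) σ ((overChain _ _ p.1).prod
            (SSet.stdSimplex.objEquiv p.2).toOrderHom) OrderHom.id).trans ?_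
          exact congrArg (fun p' => (show chainCocycles (F.obj (op (cell x))) n μ.unop.len from
            (Φ.app (op (cell x))).app μ p').1 σ) (pairSimplex_prod p)
        · exact Subsingleton.elim (α := F.obj (op extra)) _ _
      right_inv := fun z => rfl }) (fun _ _ => rfl) (fun _ _ => rfl)

/-- The homotopy limit of Eilenberg–Mac Lane spaces as a simplicial abelian group. -/
noncomputable def holimIso (F : (Augmented A)ᵒᵖ ⥤ AddCommGrpCat.{0}) [Subsingleton (F.obj (op extra))] (n : ℕ) :
    Sp.holim (F ⋙ Sp.eilenbergMacLane n) ≅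
      Sp.ofSimplicialGroup.obj ((cubeFunctor F).cocycleObject n) :=
  Sp.holimIso (Functor.isoWhiskerLeft F (eilenbergMacLaneIso n)) ≪≫ holimCocycleIso F n

/-- For finite A there are finitely many sets x and chains of the given length, so cocycles form a
subgroup of a finite product of free groups. -/
theorem CubeFunctor.degreewiseFree [Finite A] (F : CubeFunctor A) (h : ∀ x, FiniteFree (F.obj x)) (n : ℕ) :
    DegreewiseFree (F.cocycleObject n) := by
  classical
  have : Finite (Augmented A) := Finite.of_injective
    (fun q : Augmented A => match q with | cell x => some x | extra => none) (by
      rintro (x | _) (y | _) h <;> simp_all)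
  have : Finite (Augmented A)ᵒᵈ := this
  intro k
  have : ∀ x : Finset A, Finite (Fin (n + 1) →o Cell x k) := fun x =>
    Finite.of_injective _ DFunLike.coe_injective
  exact FiniteFree.addSubgroup (.pi fun x => .pi fun w => h x) (F.nerveCocycles n k)

end Khovanov

/-! ### Reduction of both statements to the cohomology of the Khovanov cubes -/

namespace Khovanov

open CategoryTheory Opposite SimplicialGroup Augmented

theorem finiteFree_V : FiniteFree V :=
  ⟨inferInstanceAs (Module.Finite ℤ (ℤ × ℤ)), inferInstanceAs (Module.Free ℤ (ℤ × ℤ))⟩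

theorem finiteFree_tensor (S : Type) [Finite S] : FiniteFree (Tensor S) := by
  have := finiteFree_V.1
  have := finiteFree_V.2
  let b := Basis.piTensorProduct (ι := S) fun _ => Module.Free.chooseBasis ℤ V
  exact ⟨Module.Finite.of_basis b, Module.Free.of_basis b⟩

namespace Tangle

variable (D : Tangle 0 0)

/-- The Khovanov cube. -/
noncomputable def cube : CubeFunctor D.Crossing where
  obj x := Tensor (D.Circle x)
  map {x y} _ := D.cubeMap x y
  map_self _ r := D.cubeMap_self _ r
  map_map h h' r := D.cubeMap_cubeMap h h' r

/-- The space of a diagram as a simplicial abelian group. -/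
noncomputable def spaceIso (n : ℕ) :
    D.space n ≅ Sp.ofSimplicialGroup.obj (D.cube.cocycleObject n) :=
  have : Subsingleton (D.khovanovPresheaf.obj (op extra)) := inferInstanceAs (Subsingleton PUnit)
  holimIso D.khovanovPresheaf n

theorem degreewiseFree_cube (n : ℕ) : DegreewiseFree (D.cube.cocycleObject n) :=
  D.cube.degreewiseFree (fun x => finiteFree_tensor (D.Circle x)) n

theorem d_cube_apply {i j : ℤ} (h : i + 1 = j) {f : ∀ x, D.cube.obj x} {a : D.Cochain i}
    (hf : ∀ x, a x = f x.1) (y) : D.differential i j h a y = D.cube.d f y.1 := by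
  refine Eq.trans ?_ (Finset.sum_attach y.1 _)
  refine Finset.sum_congr rfl fun c _ => ?_
  rw [hf]
  rfl

/-- The two complexes differ only in form: families on all subsets which vanish outside one
cardinality, against families on the subsets of that cardinality. -/
theorem nonempty_H_cube_equiv (i : ℤ) : Nonempty (D.cube.H i ≃+ D.UnnormalisedKH i) := by
  let R : AddSubgroup ((∀ x, D.cube.obj x) × D.Cochain i) :=
    { carrier := {p | ∀ x, p.2 x = p.1 x.1}
      zero_mem' := fun _ => rfl
      add_mem' := fun h h' x => congrArg₂ (· + ·) (h x) (h' x)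
      neg_mem' := fun h x => congrArg _ (h x) }
  have hext : ∀ (j : ℤ) (a : D.Cochain j), ∃ f ∈ D.cube.cochains j, ∀ x, a x = f x.1 := by
    intro j a
    classical
    exact ⟨fun x => if h : (x.card : ℤ) = j then a ⟨x, h⟩ else 0, fun x h => dif_neg h,
      fun x =>
      (dif_pos x.2 : (if h : (x.1.card : ℤ) = j then a ⟨x.1, h⟩ else 0) = a x).symm⟩
  have hker : ∀ f ∈ D.cube.cochains i, ∀ a : D.Cochain i, (∀ x, a x = f x.1) →
      (f ∈ D.cube.cocycles i ↔ a ∈ (D.differential i (i + 1) rfl).ker) := by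
    intro f hf a h
    constructor
    · intro hc
      refine funext fun y => (D.d_cube_apply rfl h y).trans ?_
      exact congrFun hc.2 y.1
    · intro ha
      refine ⟨hf, funext fun y => ?_⟩
      by_cases hy : (y.card : ℤ) = i + 1
      · exact (D.d_cube_apply rfl h ⟨y, hy⟩).symm.trans (congrFun ha ⟨y, hy⟩)
      · exact D.cube.d_mem rfl hf y hy
  refine nonempty_quotient_equiv R (fun f hf => ?_) (fun a ha => ?_) ?_
  · exact ⟨fun x => f x.1, (hker f hf.1 _ fun _ => rfl).1 hf, fun _ => rfl⟩
  · obtain ⟨f, hf, h⟩ := hext i a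
    exact ⟨f, (hker f hf a h).2 ha, h⟩
  · intro f hf a ha h
    constructor
    · rintro ⟨g, hg, rfl⟩
      refine ⟨fun x => g x.1, funext fun y => (D.d_cube_apply _ (fun _ => rfl) y).trans (h y).symm⟩
    · rintro ⟨b, rfl⟩
      obtain ⟨g, hg, hb⟩ := hext _ b
      refine ⟨g, hg, funext fun y => ?_⟩
      by_cases hy : (y.card : ℤ) = i
      · exact (D.d_cube_apply _ hb ⟨y, hy⟩).symm.trans (h ⟨y, hy⟩)
      · exact (D.cube.d_mem (by omega) hg y hy).trans (hf.1 y hy).symm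

/-- All the spaces involved are degreewise free simplicial abelian groups, so it suffices to compare
homotopy groups: the j-th one is the cohomology in degree n − j, and looping twice replaces j by j +
2. -/
theorem space_homotopyEquivalent {D S : Tangle 0 0}
    (h : ∀ i : ℤ, Nonempty (D.cube.H i ≃+ S.cube.H i × S.cube.H (i - 2))) (n : ℕ) :
    Sp.HomotopyEquivalent (D.space n) (Sp.prod (S.space n) (Sp.loop (Sp.loop (S.space n)))) := by
  refine Sp.HomotopyEquivalent.of_iso (D.spaceIso n)
    (Sp.prodIso (S.spaceIso n) (Sp.loopIso (Sp.loopIso (S.spaceIso n) ≪≫ SimplicialGroup.loopIso _) ≪≫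
      SimplicialGroup.loopIso _) ≪≫ SimplicialGroup.prodIso _ _)
    (SimplicialGroup.homotopyEquivalent (D.degreewiseFree_cube n) ((S.degreewiseFree_cube n).prodObject
      (S.degreewiseFree_cube n).loopObject.loopObject) fun j => ?_)
  obtain ⟨e⟩ := D.cube.nonempty_π_equiv n j
  obtain ⟨e1⟩ := S.cube.nonempty_π_equiv n j
  obtain ⟨e2⟩ := S.cube.nonempty_π_equiv n (j + 2)
  obtain ⟨e3⟩ := nonempty_π_loopObject (S.cube.cocycleObject n) (j + 1)
  obtain ⟨e4⟩ := nonempty_π_loopObject (loopObject (S.cube.cocycleObject n)) j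
  obtain ⟨e5⟩ := nonempty_π_prodObject (X := S.cube.cocycleObject n)
    (Y := loopObject (loopObject (S.cube.cocycleObject n))) j
  obtain ⟨e6⟩ := h (n - j)
  rw [show (n : ℤ) - (j + 2 : ℕ) = n - j - 2 by push_cast; ring] at e2
  exact ⟨e.trans (e6.trans ((e1.symm.prodCongr (e2.symm.trans (e3.trans e4))).trans e5.symm))⟩

theorem nonempty_unnormalisedKH_equiv {D S : Tangle 0 0}
    (h : ∀ i : ℤ, Nonempty (D.cube.H i ≃+ S.cube.H i × S.cube.H (i - 2))) (i : ℤ) :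
    Nonempty (D.UnnormalisedKH i ≃+ S.UnnormalisedKH i × S.UnnormalisedKH (i - 2)) := by
  obtain ⟨e⟩ := D.nonempty_H_cube_equiv i
  obtain ⟨e1⟩ := S.nonempty_H_cube_equiv i
  obtain ⟨e2⟩ := S.nonempty_H_cube_equiv (i - 2)
  obtain ⟨e3⟩ := h i
  exact ⟨e.symm.trans (e3.trans (e1.prodCongr e2))⟩

end Tangle
end Khovanov

/-! ### Maps between tensor powers of V -/

namespace Khovanov

noncomputable section

section Tensor

variable {R : Type} [CommRing R]

/-- The ring homomorphism with a given value at `u`. -/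
def evalV (w : R) (hw : w * w = 0) : V →+* R :=
  show DualNumber ℤ →+* R from
  { toFun := fun v => (v.fst : R) + (v.snd : R) * w
    map_one' := by simp
    map_mul' := fun a b => by
      rw [TrivSqZeroExt.fst_mul, TrivSqZeroExt.snd_mul]
      simp only [smul_eq_mul, MulOpposite.smul_eq_mul_unop, MulOpposite.unop_op]
      push_cast
      linear_combination (-(a.snd : R) * b.snd) * hw
    map_zero' := by simp
    map_add' := fun a b => by
      rw [TrivSqZeroExt.fst_add, TrivSqZeroExt.snd_add]
      push_cast
      ring }

theorem evalV_u (w : R) (hw : w * w = 0) : evalV w hw u = w := by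
  change ((0 : ℤ) : R) + ((1 : ℤ) : R) * w = w
  simp

variable {S : Type} [Finite S]

/-- The ring homomorphism from a tensor power with given values at the generators. -/
def evalTensor (w : S → R) (hw : ∀ s, w s * w s = 0) : Tensor S →ₐ[ℤ] R :=
  letI := Fintype.ofFinite S
  PiTensorProduct.liftAlgHom
    ((MultilinearMap.mkPiAlgebra ℤ S R).compLinearMap fun s =>
      (evalV (w s) (hw s)).toIntAlgHom.toLinearMap)
    (by simp) (by intro v w; simp [Finset.prod_mul_distrib])

theorem evalTensor_u (w : S → R) (hw : ∀ s, w s * w s = 0) (s : S) :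
    evalTensor w hw (factor s u) = w s := by
  classical
  let _ := Fintype.ofFinite S
  have h : ∀ v : S → V, evalTensor w hw (PiTensorProduct.tprod ℤ v) = ∏ s, evalV (w s) (hw s) (v s) :=
    fun v => PiTensorProduct.lift.tprod v
  simp only [factor, PiTensorProduct.singleAlgHom_apply]
  rw [h, Finset.prod_eq_single s]
  · simp [evalV_u]
  · intro b _ hb
    simp [Pi.mulSingle_eq_of_ne hb]
  · simp

/-- Induction over the tensor powers. -/
theorem tensor_induction (K : AddSubgroup (Tensor S)) (h1 : 1 ∈ K)
    (hu : ∀ s r, r ∈ K → factor s u * r ∈ K) (r : Tensor S) : r ∈ K := by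
  let _ := Fintype.ofFinite S
  have h : (QuotientAddGroup.mk' K : Tensor S →+ _) = 0 := by
    refine tensor_ext fun v => (QuotientAddGroup.eq_zero_iff _).2 ?_
    have := pushforward_tprod (fun s : S => s) v
    rw [pushforward_id] at this
    rw [this]
    induction (Finset.univ : Finset S) using Finset.cons_induction with
    | empty => exact h1
    | cons s t _ ih =>
      rw [Finset.prod_cons]
      obtain ⟨a, b, hv⟩ := V_eq (v s)
      rw [hv, map_add, map_mul, map_intCast, map_intCast, add_mul, mul_assoc, ← zsmul_eq_mul,
        ← zsmul_eq_mul]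
      exact K.add_mem (K.zsmul_mem ih _) (K.zsmul_mem (hu _ _ ih) _)
  exact (QuotientAddGroup.eq_zero_iff r).1 (congrArg (fun f : Tensor S →+ _ => f r) h)

/-- Additive maps which are compatible with the multiplication by the generators are determined by
their value at `1`. -/
theorem tensor_addHom_ext {f g : Tensor S →+ R} (w : S → R)
    (hf : ∀ s r, f (factor s u * r) = w s * f r) (hg : ∀ s r, g (factor s u * r) = w s * g r)
    (h : f 1 = g 1) (r : Tensor S) : f r = g r :=
  tensor_induction (f.eqLocus g) h (fun s r hr => by
    change f _ = g _
    rw [hf, hg, show f r = g r from hr]) r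

end Tensor

theorem factor_u_mul_self {S : Type} (s : S) : factor s u * factor s u = 0 := by
  rw [← map_mul, u_mul_u, map_zero]

namespace Tangle

variable (D : Tangle 0 0)

/-- The generator of the Khovanov cube at the circle through a point. -/
def gen (x : Finset D.Crossing) (p : D.Point) : Tensor (D.Circle x) := factor (D.circle x p) u

variable {D} {x y : Finset D.Crossing}

theorem gen_mul_self (p : D.Point) : D.gen x p * D.gen x p = 0 := factor_u_mul_self _

theorem gen_eq {p q : D.Point} (h : D.circle x p = D.circle x q) : D.gen x p = D.gen x q :=
  congrArg (fun C => factor C u) h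

/-- The maps of the cube are linear over the generators at points of the diagram. With `addHom_ext`,
identities between such maps need to be checked only at 1, where `cubeMap_insert_one` gives the
value. -/
theorem cubeMap_gen_mul (h : x ⊆ y) (p : D.Point) (r : Tensor (D.Circle x)) :
    D.cubeMap x y (D.gen x p * r) = D.gen y p * D.cubeMap x y r := by
  change pushforward _ (_ * r) * _ = _ * (pushforward _ r * _)
  rw [map_mul, gen, pushforward_factor, mul_right_comm, mul_comm, mul_left_comm _ (pushforward _ r),
    D.factor_mul_comulFactor y x _ (Finset.sort_nodup _ _)
      (fun c hc => (Finset.mem_sdiff.1 ((Finset.mem_sort _).1 hc)).2)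
      (by rw [Finset.sort_toFinset, Finset.union_sdiff_of_subset h]) (Quot.out_eq _) u]
  rfl

theorem cubeMap_insert_one {c : D.Crossing} (h : c ∉ x) [Decidable (D.Bifurcates x c)] :
    D.cubeMap x (insert c x) 1 = if D.Bifurcates x c then
      D.gen (insert c x) (D.lowerLeft c) + D.gen (insert c x) (D.upperRight c) else 1 := by
  change pushforward _ 1 * D.comulFactor _ _ = _
  have : insert c x \ x = {c} := by
    ext a
    simp only [Finset.mem_sdiff, Finset.mem_insert, Finset.mem_singleton]
    refine ⟨fun h' => h'.1.resolve_right h'.2, ?_⟩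
    rintro rfl
    exact ⟨Or.inl rfl, h⟩
  rw [map_one, one_mul, this, Finset.sort_singleton, splits]
  split_ifs
  · simp [splits, comulOne, gen]
  · simp [splits]

/-- The ring homomorphism with given values at the circles through the points. -/
def evalCircles {R : Type} [CommRing R] (w : D.Point → R)
    (hw : ∀ p q, D.Joined x p q → w p = w q) (hw' : ∀ p, w p * w p = 0) :
    Tensor (D.Circle x) →+* R :=
  (evalTensor (Quot.lift w hw) fun C => Quot.inductionOn C hw').toRingHom

theorem evalCircles_gen {R : Type} [CommRing R] (w : D.Point → R)
    (hw : ∀ p q, D.Joined x p q → w p = w q) (hw' : ∀ p, w p * w p = 0) (p : D.Point) :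
    evalCircles w hw hw' (D.gen x p) = w p := evalTensor_u _ _ _

theorem addHom_ext {R : Type} [CommRing R] {f g : Tensor (D.Circle x) →+ R} (w : D.Point → R)
    (hf : ∀ p r, f (D.gen x p * r) = w p * f r) (hg : ∀ p r, g (D.gen x p * r) = w p * g r)
    (h : f 1 = g 1) (r : Tensor (D.Circle x)) : f r = g r := by
  have ho : ∀ C : D.Circle x, D.gen x C.out = factor C u := fun C =>
    congrArg (fun C => factor C u) (Quot.out_eq C)
  exact tensor_addHom_ext (fun C => w C.out) (fun C r => by rw [← hf, ho])
    (fun C r => by rw [← hg, ho]) h r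

theorem ringHom_ext {R : Type} [CommRing R] {f g : Tensor (D.Circle x) →+* R}
    (h : ∀ p, f (D.gen x p) = g (D.gen x p)) (r : Tensor (D.Circle x)) : f r = g r :=
  addHom_ext (f := f.toAddMonoidHom) (g := g.toAddMonoidHom) (fun p => f (D.gen x p))
    (fun p r => map_mul f _ _) (fun p r => (map_mul g _ _).trans (by rw [h]; rfl))
    ((map_one f).trans (map_one g).symm) r

end Tangle

end

end Khovanov

/-! ### Cubes that double another cube up to an exact part -/

namespace Khovanov
namespace CubeFunctor

variable {A B : Type} [LinearOrder A] [LinearOrder B]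

/-- The situation in which the cube complex of `F` is, up to an acyclic part, the sum of the cube
complex of `G` and of its shift by `2`: there are two more elements `c` and `d` of `B`. -/
structure Doubling (F : CubeFunctor B) (G : CubeFunctor A) where
  incl : A ↪o B
  c : B
  d : B
  ne : c ≠ d
  c_ne : ∀ a, incl a ≠ c
  d_ne : ∀ a, incl a ≠ d
  cover : ∀ b, b = c ∨ b = d ∨ b ∈ Set.range incl
  lt_iff : ∀ a, c < incl a ↔ d < incl a
  /-- The map on the part of the cube where `c` and `d` are missing. -/
  α : ∀ x : Finset A, F.obj (x.map incl.toEmbedding) →+ G.obj x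
  /-- The map on the part of the cube where `c` and `d` are present. -/
  β : ∀ x : Finset A, F.obj (insert c (insert d (x.map incl.toEmbedding))) →+ G.obj x
  α_map : ∀ {x y : Finset A} (h : x ⊆ y) (h' : x.map incl.toEmbedding ⊆ y.map incl.toEmbedding) (r),
    α y (F.map h' r) = G.map h (α x r)
  β_map : ∀ {x y : Finset A} (h : x ⊆ y) (h' : insert c (insert d (x.map incl.toEmbedding)) ⊆
    insert c (insert d (y.map incl.toEmbedding))) (r), β y (F.map h' r) = G.map h (β x r)
  β_map_c : ∀ (x : Finset A) (r : F.obj (insert d (x.map incl.toEmbedding))),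
    β x (F.map (Finset.subset_insert c _) r) = 0
  β_map_d : ∀ (x : Finset A) (h : insert c (x.map incl.toEmbedding) ⊆
    insert c (insert d (x.map incl.toEmbedding))) (r), β x (F.map h r) = 0
  α_surjective : ∀ x : Finset A, Function.Surjective (α x)
  β_surjective : ∀ x : Finset A, Function.Surjective (β x)
  map_injective : ∀ (x : Finset A) (r : F.obj (x.map incl.toEmbedding)), α x r = 0 → F.map (Finset.subset_insert c _) r = 0 → r = 0
  map_surjective : ∀ (x : Finset A) (s : F.obj (insert c (x.map incl.toEmbedding))),
    ∃ r, α x r = 0 ∧ F.map (Finset.subset_insert c _) r = s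
  map_injective' : ∀ x : Finset A, Function.Injective
    (F.map (Finset.subset_insert c (insert d (x.map incl.toEmbedding))))
  map_surjective' : ∀ (x : Finset A) r, β x r = 0 → ∃ s, F.map (Finset.subset_insert c _) s = r

namespace Doubling

variable {F : CubeFunctor B} {G : CubeFunctor A} (E : F.Doubling G)

/-- The part of the cube where `c` and `d` are missing. -/
abbrev low (x : Finset A) : Finset B := x.map E.incl.toEmbedding

/-- The part of the cube where `c` and `d` are present. -/
abbrev high (x : Finset A) : Finset B := insert E.c (insert E.d (x.map E.incl.toEmbedding))

theorem c_notMem (x : Finset A) : E.c ∉ x.map E.incl.toEmbedding := fun h => by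
  obtain ⟨a, -, h⟩ := Finset.mem_map.1 h
  exact E.c_ne a h

theorem d_notMem (x : Finset A) : E.d ∉ x.map E.incl.toEmbedding := fun h => by
  obtain ⟨a, -, h⟩ := Finset.mem_map.1 h
  exact E.d_ne a h

theorem c_notMem' (x : Finset A) : E.c ∉ insert E.d (x.map E.incl.toEmbedding) := fun h =>
  (Finset.mem_insert.1 h).elim E.ne (E.c_notMem x)

theorem card_high (x : Finset A) : (E.high x).card = x.card + 2 := by
  rw [high, Finset.card_insert_of_notMem (E.c_notMem' x), Finset.card_insert_of_notMem (E.d_notMem x),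
    Finset.card_map]

theorem sign_low (x : Finset A) (a : A) : sign (E.low x) (E.incl a) = sign x a := by
  unfold sign low
  rw [Finset.filter_map, Finset.card_map]
  congr 3
  ext b
  simp

/-- The elements `c` and `d` lie on the same side of every other element, so together they change
the exponent by 0 or 2. -/
theorem sign_high (x : Finset A) (a : A) : sign (E.high x) (E.incl a) = sign x a := by
  rw [← E.sign_low x a]
  unfold sign high low
  rw [Finset.filter_insert, Finset.filter_insert]
  by_cases h : E.c < E.incl a
  · rw [if_pos h, if_pos ((E.lt_iff a).1 h), Finset.card_insert_of_notMem, Finset.card_insert_of_notMem,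
      pow_succ, pow_succ]
    · ring
    · exact fun h' => E.d_notMem x (Finset.mem_of_mem_filter _ h')
    · exact fun h' => (Finset.mem_insert.1 h').elim E.ne
        fun h' => E.c_notMem x (Finset.mem_of_mem_filter _ h')
  · rw [if_neg h, if_neg fun h' => h ((E.lt_iff a).2 h')]

theorem low_erase (x : Finset A) (a : A) : E.low (x.erase a) = (E.low x).erase (E.incl a) :=
  Finset.map_erase _ _ _

theorem high_erase (x : Finset A) (a : A) : E.high (x.erase a) = (E.high x).erase (E.incl a) := by
  rw [high, high, Finset.erase_insert_of_ne (E.c_ne a).symm, Finset.erase_insert_of_ne (E.d_ne a).symm,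
    Finset.map_erase]
  rfl

theorem low_mono {x y : Finset A} (h : x ⊆ y) : E.low x ⊆ E.low y := Finset.map_subset_map.2 h

theorem high_mono {x y : Finset A} (h : x ⊆ y) : E.high x ⊆ E.high y :=
  Finset.insert_subset_insert _ (Finset.insert_subset_insert _ (Finset.map_subset_map.2 h))

/-- Every element of the cube that contains neither `c` nor `d` is in the low part. -/
theorem exists_low {y : Finset B} (hc : E.c ∉ y) (hd : E.d ∉ y) : ∃ x, y = E.low x := by
  classical
  refine ⟨y.preimage E.incl E.incl.injective.injOn, ?_⟩
  ext b
  rw [low, Finset.mem_map]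
  constructor
  · intro hb
    rcases E.cover b with rfl | rfl | ⟨a, rfl⟩
    · exact absurd hb hc
    · exact absurd hb hd
    · exact ⟨a, Finset.mem_preimage.2 hb, rfl⟩
  · rintro ⟨a, ha, rfl⟩
    exact Finset.mem_preimage.1 ha

theorem exists_high {y : Finset B} (hc : E.c ∈ y) (hd : E.d ∈ y) : ∃ x, y = E.high x := by
  obtain ⟨x, hx⟩ := E.exists_low (y := (y.erase E.c).erase E.d) (by simp) (by simp)
  refine ⟨x, ?_⟩
  rw [high]
  change y = insert E.c (insert E.d (E.low x))
  rw [← hx, Finset.insert_erase (Finset.mem_erase.2 ⟨E.ne.symm, hd⟩), Finset.insert_erase hc]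

theorem low_injective {x y : Finset A} (h : E.low x = E.low y) : x = y := Finset.map_injective _ h

theorem high_injective {x y : Finset A} (h : E.high x = E.high y) : x = y := by
  apply E.low_injective
  have h' := congrArg (fun z => (z.erase E.c).erase E.d) h
  simpa only [high, Finset.erase_insert (E.c_notMem' _), Finset.erase_insert (E.d_notMem _)] using h'

/-- The low part of a cochain. -/
def lowPart (f : ∀ y, F.obj y) (x : Finset A) : G.obj x := E.α x (f (E.low x))

/-- The high part of a cochain. -/
def highPart (f : ∀ y, F.obj y) (x : Finset A) : G.obj x := E.β x (f (E.high x))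

theorem lowPart_d (f : ∀ y, F.obj y) : E.lowPart (F.d f) = G.d (E.lowPart f) := by
  funext y
  change E.α y (F.d f (y.map E.incl.toEmbedding)) = _
  rw [d_apply, d_apply, Finset.sum_map, map_sum]
  refine Finset.sum_congr rfl fun a _ => ?_
  rw [map_zsmul]
  refine congrArg₂ (· • ·) (E.sign_low y a) ?_
  have := F.map_congr (E.low_erase y a).symm (Finset.erase_subset _ _) (E.low_mono (y.erase_subset a)) f
  exact (congrArg _ this).trans (E.α_map (y.erase_subset a) _ _)

/-- Of the edges into the high part, those in the directions `c` and `d` are killed by `β`; the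
remaining ones are the edges of G with the same signs. -/
theorem highPart_d (f : ∀ y, F.obj y) : E.highPart (F.d f) = G.d (E.highPart f) := by
  funext y
  change E.β y (F.d f (insert E.c (insert E.d (y.map E.incl.toEmbedding)))) = _
  rw [d_apply, d_apply, Finset.sum_insert (E.c_notMem' y), Finset.sum_insert (E.d_notMem y),
    Finset.sum_map, map_add, map_add, map_sum, map_zsmul, map_zsmul]
  have h1 : E.β y (F.map (Finset.erase_subset E.c _) (f ((E.high y).erase E.c))) = 0 := by
    rw [F.map_congr (Finset.erase_insert (E.c_notMem' y)) _ (Finset.subset_insert E.c _)]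
    exact E.β_map_c y _
  have hd : (E.high y).erase E.d = insert E.c (y.map E.incl.toEmbedding) := by
    rw [high, Finset.erase_insert_of_ne E.ne, Finset.erase_insert (E.d_notMem y)]
  have h2 : E.β y (F.map (Finset.erase_subset E.d _) (f ((E.high y).erase E.d))) = 0 := by
    rw [F.map_congr hd _ (hd ▸ Finset.erase_subset E.d _)]
    exact E.β_map_d y _ _
  refine (congrArg₂ (· + ·) (congrArg _ h1) (congrArg₂ (· + ·) (congrArg _ h2) rfl)).trans ?_
  rw [smul_zero, smul_zero, zero_add, zero_add]
  refine Finset.sum_congr rfl fun a _ => ?_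
  rw [map_zsmul]
  refine congrArg₂ (· • ·) (E.sign_high y a) ?_
  have := F.map_congr (E.high_erase y a).symm (Finset.erase_subset _ _) (E.high_mono (y.erase_subset a)) f
  exact (congrArg _ this).trans (E.β_map (y.erase_subset a) _ _)

/-- The part of `F` that is killed by the two maps. -/
def kernel (y : Finset B) : AddSubgroup (F.obj y) where
  carrier := {r | (∀ x (h : y = E.low x), E.α x (F.map h.subset r) = 0) ∧
    ∀ x (h : y = E.high x), E.β x (F.map h.subset r) = 0}
  zero_mem' := ⟨fun x h => by simp, fun x h => by simp⟩
  add_mem' := fun {r s} h h' => ⟨fun x e => by rw [map_add, map_add, h.1 x e, h'.1 x e, add_zero],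
    fun x e => by rw [map_add, map_add, h.2 x e, h'.2 x e, add_zero]⟩
  neg_mem' := fun {r} h => ⟨fun x e => by rw [map_neg, map_neg, h.1 x e, neg_zero],
    fun x e => by rw [map_neg, map_neg, h.2 x e, neg_zero]⟩

theorem c_mem_high (x : Finset A) : E.c ∈ E.high x := Finset.mem_insert_self _ _

theorem d_mem_high (x : Finset A) : E.d ∈ E.high x := Finset.mem_insert_of_mem (Finset.mem_insert_self _ _)

theorem low_ne_high (x x' : Finset A) : E.low x ≠ E.high x' := fun h =>
  E.c_notMem x (h.symm.subset (E.c_mem_high x'))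

theorem mem_kernel_low {x : Finset A} {r : F.obj (E.low x)} : r ∈ E.kernel (E.low x) ↔ E.α x r = 0 := by
  constructor
  · intro h
    simpa only [F.map_self] using h.1 x rfl
  · intro h
    refine ⟨fun x' e => ?_, fun x' e => ?_⟩
    · obtain rfl := E.low_injective e
      rwa [F.map_self]
    · exact absurd e (E.low_ne_high x x')

theorem mem_kernel_high {x : Finset A} {r : F.obj (E.high x)} : r ∈ E.kernel (E.high x) ↔ E.β x r = 0 := by
  constructor
  · intro h
    simpa only [F.map_self] using h.2 x rfl
  · intro h
    refine ⟨fun x' e => ?_, fun x' e => ?_⟩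
    · exact absurd e.symm (E.low_ne_high x' x)
    · obtain rfl := E.high_injective e
      rwa [F.map_self]

theorem mem_kernel_of {y : Finset B} (h : (E.c ∈ y ↔ E.d ∉ y)) (r : F.obj y) : r ∈ E.kernel y := by
  refine ⟨fun x e => ?_, fun x e => ?_⟩
  · rw [e] at h
    exact absurd (h.2 (E.d_notMem x)) (E.c_notMem x)
  · rw [e] at h
    exact absurd (E.d_mem_high x) (h.1 (E.c_mem_high x))

/-- The only case that is not naturality of `α` or `β` is a map into the high part from outside it.
It factors through a set containing exactly one of `c` and `d`, and `β` kills what comes from there.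
-/
theorem map_mem_kernel {y z : Finset B} (h : y ⊆ z) {r : F.obj y} (hr : r ∈ E.kernel y) :
    F.map h r ∈ E.kernel z := by
  by_cases hz : E.c ∈ z ↔ E.d ∉ z
  · exact E.mem_kernel_of hz _
  by_cases hc : E.c ∈ z
  · have hd : E.d ∈ z := by tauto
    obtain ⟨x, rfl⟩ := E.exists_high hc hd
    rw [mem_kernel_high]
    by_cases hcy : E.c ∈ y
    · by_cases hdy : E.d ∈ y
      · obtain ⟨x', rfl⟩ := E.exists_high hcy hdy
        have hx : x' ⊆ x := fun a ha => by
          have := h (Finset.mem_insert_of_mem (Finset.mem_insert_of_mem (Finset.mem_map_of_mem E.incl.toEmbedding ha)))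
          rcases Finset.mem_insert.1 this with h' | h'
          · exact absurd h' (E.c_ne a)
          · rcases Finset.mem_insert.1 h' with h' | h'
            · exact absurd h' (E.d_ne a)
            · exact (Finset.mem_map' _).1 h'
        exact (E.β_map hx h r).trans (by rw [E.mem_kernel_high.1 hr, map_zero])
      · have h1 : y ⊆ insert E.c (x.map E.incl.toEmbedding) := fun b hb => by
          have := h hb
          simp only [high, Finset.mem_insert] at this ⊢
          rcases this with h' | rfl | h'
          · exact Or.inl h'
          · exact absurd hb hdy
          · exact Or.inr h'
        rw [← F.map_map h1 (Finset.insert_subset_insert _ (Finset.subset_insert _ _))]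
        exact E.β_map_d x _ _
    · have h1 : y ⊆ insert E.d (x.map E.incl.toEmbedding) := fun b hb => by
        rcases Finset.mem_insert.1 (h hb) with rfl | h'
        · exact absurd hb hcy
        · exact h'
      rw [← F.map_map h1 (Finset.subset_insert _ _)]
      exact E.β_map_c x _
  · have hd : E.d ∉ z := by tauto
    obtain ⟨x, rfl⟩ := E.exists_low hc hd
    obtain ⟨x', rfl⟩ := E.exists_low (fun h' => hc (h h')) (fun h' => hd (h h'))
    rw [mem_kernel_low, E.α_map (Finset.map_subset_map.1 h) h r, E.mem_kernel_low.1 hr, map_zero]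

/-- The part of `F` that is killed by the two maps, as a cube functor. -/
def kernelFunctor : CubeFunctor B where
  obj y := E.kernel y
  map {y z} h := ((F.map h).comp (E.kernel y).subtype).codRestrict (E.kernel z)
    fun r => E.map_mem_kernel h r.2
  map_self h r := Subtype.ext (F.map_self h r.1)
  map_map h h' r := Subtype.ext (F.map_map h h' r.1)

/-- Without `d`, the map in direction `c` identifies the kernel of `α` with the corner where only
`c` is present. With `d`, it identifies the corner where only `d` is present with the kernel of `β`.
-/
theorem kernel_bijective (y : Finset B) (hy : E.c ∉ y) :
    Function.Bijective (E.kernelFunctor.map (Finset.subset_insert E.c y)) := by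
  by_cases hd : E.d ∈ y
  · obtain ⟨x, hx⟩ := E.exists_low (y := y.erase E.d) (fun h => hy (Finset.mem_of_mem_erase h)) (by simp)
    obtain rfl : y = insert E.d (x.map E.incl.toEmbedding) := by
      rw [← Finset.insert_erase hd, hx]
    refine ⟨fun r s h => Subtype.ext (E.map_injective' x (congrArg Subtype.val h)), fun r => ?_⟩
    obtain ⟨s, hs⟩ := E.map_surjective' x r.1 (E.mem_kernel_high.1 r.2)
    refine ⟨⟨s, E.mem_kernel_of ?_ s⟩, Subtype.ext hs⟩
    simp [hy]
  · obtain ⟨x, rfl⟩ := E.exists_low hy hd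
    refine ⟨(injective_iff_map_eq_zero _).2 fun r hr => Subtype.ext ?_, fun s => ?_⟩
    · exact E.map_injective x r.1 (E.mem_kernel_low.1 r.2) (congrArg Subtype.val hr)
    · obtain ⟨r, h1, h2⟩ := E.map_surjective x s.1
      exact ⟨⟨r, E.mem_kernel_low.2 h1⟩, Subtype.ext h2⟩

/-- A cocycle both of whose parts vanish is a cocycle of `kernelFunctor`, whose complex is exact
because the direction `c` consists of isomorphisms. -/
theorem exists_of_parts {f : ∀ y, F.obj y} {i : ℤ} (hf : f ∈ F.cocycles i) (h : E.lowPart f = 0)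
    (h' : E.highPart f = 0) :
    ∃ g ∈ F.cochains (i - 1), F.d g = f ∧ E.lowPart g = 0 ∧ E.highPart g = 0 := by
  have hk : ∀ y, f y ∈ E.kernel y := fun y => by
    by_cases hz : E.c ∈ y ↔ E.d ∉ y
    · exact E.mem_kernel_of hz _
    by_cases hc : E.c ∈ y
    · obtain ⟨x, rfl⟩ := E.exists_high hc (by tauto)
      exact E.mem_kernel_high.2 (congrFun h' x)
    · obtain ⟨x, rfl⟩ := E.exists_low hc (by tauto)
      exact E.mem_kernel_low.2 (congrFun h x)
  have hd : ∀ g : ∀ y, E.kernelFunctor.obj y, ∀ y,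
      (E.kernelFunctor.d g y).1 = F.d (fun y => (g y).1) y := fun g y => by
    rw [d_apply, d_apply]
    refine (AddSubgroup.val_finsetSum (E.kernel y) _ _).trans ?_
    exact Finset.sum_congr rfl fun c _ => AddSubgroup.coe_zsmul _ _ _
  obtain ⟨g, hg, hgf⟩ := E.kernelFunctor.exact_of_bijective E.c E.kernel_bijective (i := i)
    (f := fun y => ⟨f y, hk y⟩) ⟨fun y hy => Subtype.ext (hf.1 y hy), funext fun y => Subtype.ext
      ((hd _ y).trans (congrFun hf.2 y))⟩
  exact ⟨fun y => (g y).1, fun y hy => congrArg Subtype.val (hg y hy), funext fun y =>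
    (hd g y).symm.trans (congrArg Subtype.val (congrFun hgf y)),
    funext fun x => E.mem_kernel_low.1 (g (E.low x)).2, funext fun x => E.mem_kernel_high.1 (g (E.high x)).2⟩

theorem exists_parts {i : ℤ} {g g' : ∀ x, G.obj x} (hg : g ∈ G.cochains i) (hg' : g' ∈ G.cochains (i - 2)) :
    ∃ f ∈ F.cochains i, E.lowPart f = g ∧ E.highPart f = g' := by
  have key : ∀ y : Finset B, ∃ r : F.obj y, ((y.card : ℤ) ≠ i → r = 0) ∧
      (∀ x (h : y = E.low x), E.α x (F.map h.subset r) = g x) ∧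
      ∀ x (h : y = E.high x), E.β x (F.map h.subset r) = g' x := by
    intro y
    by_cases hi : (y.card : ℤ) = i
    · by_cases hc : E.c ∈ y
      · by_cases hd : E.d ∈ y
        · obtain ⟨x, rfl⟩ := E.exists_high hc hd
          obtain ⟨r, hr⟩ := E.β_surjective x (g' x)
          refine ⟨r, fun h => absurd hi h, fun x' e => ?_, fun x' e => ?_⟩
          · exact absurd e.symm (E.low_ne_high x' x)
          · obtain rfl := E.high_injective e
            rw [F.map_self]
            exact hr
        · refine ⟨0, fun _ => rfl, fun x e => ?_, fun x e => ?_⟩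
          · exact absurd (e.subset hc) (E.c_notMem x)
          · exact absurd (e.symm.subset (E.d_mem_high x)) hd
      · by_cases hd : E.d ∈ y
        · refine ⟨0, fun _ => rfl, fun x e => ?_, fun x e => ?_⟩
          · exact absurd (e.subset hd) (E.d_notMem x)
          · exact absurd (e.symm.subset (E.c_mem_high x)) hc
        · obtain ⟨x, rfl⟩ := E.exists_low hc hd
          obtain ⟨r, hr⟩ := E.α_surjective x (g x)
          refine ⟨r, fun h => absurd hi h, fun x' e => ?_, fun x' e => ?_⟩
          · obtain rfl := E.low_injective e
            rw [F.map_self]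
            exact hr
          · exact absurd (e.symm.subset (E.c_mem_high x')) hc
    · refine ⟨0, fun _ => rfl, fun x e => ?_, fun x e => ?_⟩
      · subst e
        rw [hg x (by rwa [low, Finset.card_map] at hi), map_zero, map_zero]
      · subst e
        rw [hg' x (by rw [card_high] at hi; push_cast at hi; omega), map_zero, map_zero]
  choose f h1 h2 h3 using key
  exact ⟨f, h1, funext fun x => (congrArg _ (F.map_self _ _).symm).trans (h2 _ x rfl),
    funext fun x => (congrArg _ (F.map_self _ _).symm).trans (h3 _ x rfl)⟩

theorem lowPart_mem {i : ℤ} {f : ∀ y, F.obj y} (hf : f ∈ F.cochains i) : E.lowPart f ∈ G.cochains i :=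
  fun x hx => (congrArg _ (hf _ (by rwa [low, Finset.card_map]))).trans (map_zero _)

theorem highPart_mem {i : ℤ} {f : ∀ y, F.obj y} (hf : f ∈ F.cochains i) : E.highPart f ∈ G.cochains (i - 2) :=
  fun x hx => (congrArg _ (hf _ (by rw [card_high]; push_cast; omega))).trans (map_zero _)

theorem lowPart_mem_cocycles {i : ℤ} {f : ∀ y, F.obj y} (hf : f ∈ F.cocycles i) :
    E.lowPart f ∈ G.cocycles i :=
  ⟨E.lowPart_mem hf.1, (E.lowPart_d f).symm.trans
    (funext fun x => (congrArg (E.α x) (congrFun hf.2 _)).trans (map_zero _))⟩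

theorem highPart_mem_cocycles {i : ℤ} {f : ∀ y, F.obj y} (hf : f ∈ F.cocycles i) :
    E.highPart f ∈ G.cocycles (i - 2) :=
  ⟨E.highPart_mem hf.1, (E.highPart_d f).symm.trans
    (funext fun x => (congrArg (E.β x) (congrFun hf.2 _)).trans (map_zero _))⟩

/-- If both parts are coboundaries, primitives of them are the parts of a cochain k; the difference
of f and the differential of k has vanishing parts and is a coboundary by `exists_of_parts`. -/
theorem mem_coboundaries_iff {i : ℤ} {f : ∀ y, F.obj y} (hf : f ∈ F.cocycles i) :
    f ∈ F.coboundaries i ↔ E.lowPart f ∈ G.coboundaries i ∧ E.highPart f ∈ G.coboundaries (i - 2) := by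
  constructor
  · rintro ⟨k, hk, rfl⟩
    refine ⟨⟨_, E.lowPart_mem hk, (E.lowPart_d k).symm⟩, ⟨_, ?_, (E.highPart_d k).symm⟩⟩
    rw [show i - 2 - 1 = i - 1 - 2 by ring]
    exact E.highPart_mem hk
  · rintro ⟨⟨g, hg, h⟩, ⟨g', hg', h'⟩⟩
    rw [show i - 2 - 1 = i - 1 - 2 by ring] at hg'
    obtain ⟨k, hk, rfl, rfl⟩ := E.exists_parts hg hg'
    have hdk : F.d k ∈ F.cocycles i := ⟨F.d_mem (by ring) hk, F.d_d k⟩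
    obtain ⟨m, hm, hmf, -, -⟩ := E.exists_of_parts (sub_mem hf hdk)
      (funext fun x => (map_sub (E.α x) _ _).trans (sub_eq_zero.2
        (congrFun (h.symm.trans (E.lowPart_d k).symm) x)))
      (funext fun x => (map_sub (E.β x) _ _).trans (sub_eq_zero.2
        (congrFun (h'.symm.trans (E.highPart_d k).symm) x)))
    have h2 := add_mem (show f - F.d k ∈ F.coboundaries i from ⟨m, hm, hmf⟩) (show F.d k ∈ F.coboundaries i from ⟨k, hk, rfl⟩)
    rwa [sub_add_cancel] at h2

theorem nonempty_H_equiv (E : F.Doubling G) (i : ℤ) : Nonempty (F.H i ≃+ G.H i × G.H (i - 2)) := by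
  let f : F.cocycles i →+ G.H i × G.H (i - 2) :=
    { toFun := fun z => (QuotientAddGroup.mk ⟨_, E.lowPart_mem_cocycles z.2⟩,
        QuotientAddGroup.mk ⟨_, E.highPart_mem_cocycles z.2⟩)
      map_zero' := congrArg₂ Prod.mk
        (congrArg QuotientAddGroup.mk (Subtype.ext (funext fun x => map_zero (E.α x))))
        (congrArg QuotientAddGroup.mk (Subtype.ext (funext fun x => map_zero (E.β x))))
      map_add' := fun z w => congrArg₂ Prod.mk
        (congrArg QuotientAddGroup.mk (Subtype.ext (funext fun x => map_add (E.α x) _ _)))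
        (congrArg QuotientAddGroup.mk (Subtype.ext (funext fun x => map_add (E.β x) _ _))) }
  have hf : Function.Surjective f := by
    rintro ⟨a, b⟩
    obtain ⟨⟨g, hg⟩, rfl⟩ := QuotientAddGroup.mk_surjective a
    obtain ⟨⟨g', hg'⟩, rfl⟩ := QuotientAddGroup.mk_surjective b
    obtain ⟨k, hk, rfl, rfl⟩ := E.exists_parts hg.1 hg'.1
    -- The lift k need not be a cocycle, but its differential has vanishing parts and so bounds a
    -- cochain m with vanishing parts; k − m is a cocycle with the prescribed parts.
    obtain ⟨m, hm, hmk, h1, h2⟩ := E.exists_of_parts (f := F.d k) (i := i + 1)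
      ⟨F.d_mem rfl hk, F.d_d k⟩ ((E.lowPart_d k).trans hg.2) ((E.highPart_d k).trans hg'.2)
    rw [add_sub_cancel_right] at hm
    refine ⟨⟨k - m, (F.cochains i).sub_mem hk hm, ?_⟩, congrArg₂ Prod.mk
      (congrArg QuotientAddGroup.mk (Subtype.ext (funext fun x => ?_)))
      (congrArg QuotientAddGroup.mk (Subtype.ext (funext fun x => ?_)))⟩
    · exact (map_sub F.d k m).trans (by rw [hmk, sub_self])
    · exact (map_sub (E.α x) _ _).trans ((congrArg _ (congrFun h1 x)).trans (sub_zero _))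
    · exact (map_sub (E.β x) _ _).trans ((congrArg _ (congrFun h2 x)).trans (sub_zero _))
  have hk : f.ker = (F.coboundaries i).addSubgroupOf (F.cocycles i) := by
    ext p
    refine (AddMonoidHom.mem_ker).trans (Prod.ext_iff.trans ?_)
    refine (and_congr (QuotientAddGroup.eq_zero_iff _) (QuotientAddGroup.eq_zero_iff _)).trans ?_
    exact (E.mem_coboundaries_iff p.2).symm
  exact ⟨(QuotientAddGroup.quotientAddEquivOfEq hk.symm).trans
    (QuotientAddGroup.quotientKerEquivOfSurjective f hf)⟩

end Doubling
end CubeFunctor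
end Khovanov

/-! ### Points of the diagram with and without the clasp -/

namespace Khovanov
namespace Tangle

section

variable {m n : ℕ} {T : Tangle m n}

/-- Is the crossing in slice number `k` a member of `x`? -/
def resolves (T : Tangle m n) (x : Finset T.Crossing) (k : ℕ) : Bool := decide (∃ c ∈ x, c.1.1 = k)

theorem resolution_eq (x : Finset T.Crossing) (k : Fin T.height) :
    T.resolution x k = T.resolves x k := by
  simp [resolution, resolves, Fin.ext_iff]

theorem joined_iff {x : Finset T.Crossing} {p q : T.Point} : T.Joined x p q ↔
    ∃ k s a, T.slices[k]? = some s ∧ p.1 = place k a ∧ q.1 = place k (s.mate (T.resolves x k) a) := by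
  constructor
  · rintro ⟨k, a, hp, hq⟩
    exact ⟨k, T.slice k, a, List.getElem?_eq_getElem k.2, hp, by rw [hq, resolution_eq]⟩
  · rintro ⟨k, s, a, hs, hp, hq⟩
    obtain ⟨hk, rfl⟩ := List.getElem?_eq_some_iff.1 hs
    exact ⟨⟨k, hk⟩, a, hp, by rw [hq, resolution_eq]; rfl⟩

theorem width_succ_of_getElem? {k : ℕ} {s : Slice} (h : T.slices[k]? = some s) :
    width m T.slices (k + 1) = s.top (width m T.slices k) := by
  obtain ⟨hk, rfl⟩ := List.getElem?_eq_some_iff.1 h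
  exact Khovanov.width_succ _ _ _ hk

theorem circle_eq {x : Finset T.Crossing} {p q : T.Point} (h : T.Joined x p q) :
    T.circle x p = T.circle x q := Quot.sound h

/-- A function which is constant along the arcs is constant along the circles. -/
theorem eq_of_circle_eq {Z : Sort*} {x : Finset T.Crossing} {φ : T.Point → Z}
    (hφ : ∀ p q, T.Joined x p q → φ p = φ q) {p q : T.Point} (h : T.circle x p = T.circle x q) :
    φ p = φ q :=
  congrArg (Quot.lift φ hφ) h

end

/-- The two points of a level of width `2` are on the same circle. -/
theorem circle_eq_of_width_two {S : Tangle 0 0} (x : Finset S.Crossing) {h : ℕ}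
    (hw : width 0 S.slices h = 2) {p q : S.Point} (hp : p.1.1 = h) (hq : q.1.1 = h) :
    S.circle x p = S.circle x q := by
  have hlt : ∀ r : S.Point, r.1.1 = h → r.1.2 < 2 := fun r hr => by
    have := r.2.2
    rwa [hr, hw] at this
  have key : ∀ p q : S.Point, p.1 = (h, 0) → q.1 = (h, 1) → S.circle x p = S.circle x q := by
    intro p q hp hq
    by_contra hne
    -- In the checkerboard orientation with parameter 1, the strand at (h, 1) points up and the one
    -- at (h, 0) points down. A circle through (h, 0) that avoids (h, 1) could never leave the
    -- region at or below level h, so W is stable under `next`.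
    let W := {r : S.Point // S.circle x p = S.circle x r ∧ r.1.1 ≤ h}
    have hW : ∀ r : W, (S.next x 1 r.1).1.1 ≤ h := by
      rintro ⟨r, hr, hrh⟩
      obtain ⟨k, a, ha, -, hra⟩ := exists_place 1 r
      have hk : k.1 < h := by
        have h1 : r.1.1 = k + a.1.toNat := congrArg Prod.fst hra
        by_contra hk
        have h2 : a.1 = false := by
          cases h : a.1
          · rfl
          · rw [h, Bool.toNat_true] at h1
            omega
        rw [h2, Bool.toNat_false] at h1
        have h3 : r.1.2 = a.2 := congrArg Prod.snd hra
        have h4 := hlt r (by omega)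
        have h5 : r.1.2 = 1 := by
          unfold Slice.Inward at ha
          rw [h2, Bool.toNat_false] at ha
          omega
        exact hne (hr.trans (congrArg (S.circle x) (Subtype.ext (Prod.ext
          ((show r.1.1 = h by omega).trans (congrArg Prod.fst hq).symm)
          (h5.trans (congrArg Prod.snd hq).symm)))))
      rw [S.next_eq x ha hra]
      have := Bool.toNat_le ((S.slice k).mate (S.resolution x k) a).1
      change k.1 + _ ≤ h
      omega
    let σ : W → W := fun r => ⟨S.next x 1 r.1, r.2.1.trans (Quot.sound (S.joined_next x 1 r.1)), hW r⟩
    have hσ : Function.Injective σ := fun r r' h =>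
      Subtype.ext ((S.nextPerm x 1).injective (congrArg Subtype.val h))
    -- An injective self-map of a finite set is surjective, so p has a predecessor in W.
    obtain ⟨⟨z, hz, hzh⟩, hzp⟩ := Finite.surjective_of_injective hσ ⟨p, rfl, (congrArg Prod.fst hp).le⟩
    have hzp' : S.next x 1 z = p := congrArg Subtype.val hzp
    have hz' : S.next x 2 p = z := by rw [← hzp', S.next_next x (by omega)]
    have hh : h < S.height := by
      rcases lt_or_ge h S.height with h' | h'
      · exact h'
      · have := p.2.1
        rw [hp] at this
        obtain rfl : h = S.height := by simp only at this; omega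
        rw [S.top] at hw
        omega
    -- The predecessor is found by following the opposite orientation from p, that is, through the
    -- slice above level h. As it lies at or below h, it is on the same side of that slice, and by
    -- parity it is the point (h, 1).
    have h6 := S.next_eq x (ε := 2) (k := ⟨h, hh⟩) (a := (false, 0)) (by simp [Slice.Inward]) hp
    rw [hz'] at h6
    have h7 := (S.slice ⟨h, hh⟩).mate_parity (S.resolution x ⟨h, hh⟩) (false, 0)
    have h8 : z.1.1 = h + ((S.slice ⟨h, hh⟩).mate (S.resolution x ⟨h, hh⟩) (false, 0)).1.toNat :=
      congrArg Prod.fst h6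
    have h9 : ((S.slice ⟨h, hh⟩).mate (S.resolution x ⟨h, hh⟩) (false, 0)).1 = false := by
      cases h' : ((S.slice ⟨h, hh⟩).mate (S.resolution x ⟨h, hh⟩) (false, 0)).1
      · rfl
      · rw [h', Bool.toNat_true] at h8
        omega
    rw [h9, Bool.toNat_false] at h8
    have h10 : z.1.2 = ((S.slice ⟨h, hh⟩).mate (S.resolution x ⟨h, hh⟩) (false, 0)).2 :=
      congrArg Prod.snd h6
    have h11 := h7.1 h9
    have h12 := hlt z h8
    exact hne (hz.trans (congrArg (S.circle x) (Subtype.ext (Prod.ext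
      (h8.trans (congrArg Prod.fst hq).symm)
      ((show z.1.2 = 1 by omega).trans (congrArg Prod.snd hq).symm)))))
  have h1 := hlt p hp
  have h2 := hlt q hq
  by_cases h3 : p.1.2 = 0 <;> by_cases h4 : q.1.2 = 0
  · rw [show p = q from Subtype.ext (Prod.ext (hp.trans hq.symm) (h3.trans h4.symm))]
  · exact key p q (Prod.ext hp h3) (Prod.ext hq (by omega))
  · exact (key q p (Prod.ext hq h4) (Prod.ext hp (by omega))).symm
  · rw [show p = q from Subtype.ext (Prod.ext (hp.trans hq.symm) (by omega))]

/-- The diagram `D` arises from the diagram `S` by hooking the two strands at the level `h` of `S`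
into each other. -/
structure IsClasp (S D : Tangle 0 0) (h : ℕ) : Prop where
  height_eq : D.height = S.height + 4
  slice_low : ∀ k < h, D.slices[k]? = S.slices[k]?
  slice_high : ∀ k, h ≤ k → D.slices[k + 4]? = S.slices[k]?
  slice_zero : D.slices[h]? = some (.cup 1)
  slice_one : D.slices[h + 1]? = some (.cross 0 true)
  slice_two : D.slices[h + 2]? = some (.cross 2 true)
  slice_three : D.slices[h + 3]? = some (.cap 1)
  le_height : h ≤ S.height
  width_eq : width 0 S.slices h = 2
  width_low : ∀ k ≤ h, width 0 D.slices k = width 0 S.slices k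
  width_high : ∀ k, h ≤ k → width 0 D.slices (k + 4) = width 0 S.slices k

theorem isClasp_claspSum (D₁ : Tangle 0 2) (D₂ : Tangle 2 0) :
    IsClasp (D₁.sum D₂) (D₁.claspSum D₂) D₁.height where
  height_eq := by
    change (D₁.slices ++ (claspTangle.slices ++ D₂.slices)).length = (D₁.slices ++ D₂.slices).length + 4
    simp [claspTangle]
    omega
  slice_low k hk := by
    change (D₁.slices ++ (claspTangle.slices ++ D₂.slices))[k]? = (D₁.slices ++ D₂.slices)[k]?
    rw [List.getElem?_append_left hk, List.getElem?_append_left hk]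
  slice_high k hk := by
    change D₁.slices.length ≤ k at hk
    change (D₁.slices ++ (claspTangle.slices ++ D₂.slices))[k + 4]? = (D₁.slices ++ D₂.slices)[k]?
    rw [List.getElem?_append_right hk, List.getElem?_append_right (by omega),
      List.getElem?_append_right (by change 4 ≤ _; omega)]
    congr 1
    change k + 4 - D₁.slices.length - 4 = _
    omega
  slice_zero := by
    have : D₁.height = D₁.slices.length := rfl
    change (D₁.slices ++ (claspTangle.slices ++ D₂.slices))[_]? = _
    rw [List.getElem?_append_right (by omega)]
    simp [claspTangle]
  slice_one := by
    have : D₁.height = D₁.slices.length := rfl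
    change (D₁.slices ++ (claspTangle.slices ++ D₂.slices))[_]? = _
    rw [List.getElem?_append_right (by omega)]
    simp [claspTangle]
  slice_two := by
    have : D₁.height = D₁.slices.length := rfl
    change (D₁.slices ++ (claspTangle.slices ++ D₂.slices))[_]? = _
    rw [List.getElem?_append_right (by omega)]
    simp [claspTangle]
  slice_three := by
    have : D₁.height = D₁.slices.length := rfl
    change (D₁.slices ++ (claspTangle.slices ++ D₂.slices))[_]? = _
    rw [List.getElem?_append_right (by omega)]
    simp [claspTangle]
  le_height := by
    change _ ≤ (D₁.slices ++ D₂.slices).length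
    simp
  width_eq := (width_append_left _ _ _ _ le_rfl).trans D₁.top
  width_low k hk := (width_append_left _ _ _ _ hk).trans (width_append_left _ _ _ _ hk).symm
  width_high k hk := by
    obtain ⟨j, rfl⟩ := Nat.exists_eq_add_of_le hk
    refine Eq.trans ?_ (width_append_right _ _ _ _ D₁.top j).symm
    rw [show D₁.height + j + 4 = D₁.height + (4 + j) by ring]
    refine (width_append_right _ _ _ _ D₁.top _).trans ?_
    exact width_append_right _ _ _ _ claspTangle.top j

namespace IsClasp

variable {S D : Tangle 0 0} {h : ℕ} (E : IsClasp S D h)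

include E

theorem lt_height : h < S.height := by
  rcases E.le_height.eq_or_lt with h' | h'
  · have := E.width_eq
    rw [h', S.top] at this
    omega
  · exact h'

theorem width_one : width 0 D.slices (h + 1) = 4 := by
  rw [width_succ_of_getElem? E.slice_zero, E.width_low h le_rfl, E.width_eq, Slice.top]

theorem width_two : width 0 D.slices (h + 2) = 4 := by
  rw [width_succ_of_getElem? E.slice_one, E.width_one, Slice.top]

theorem width_three : width 0 D.slices (h + 3) = 4 := by
  rw [width_succ_of_getElem? E.slice_two, E.width_two, Slice.top]

theorem width_four : width 0 D.slices (h + 4) = 2 := by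
  rw [E.width_high h le_rfl, E.width_eq]

theorem width_zero : width 0 D.slices h = 2 := by
  rw [E.width_low h le_rfl, E.width_eq]

theorem width_mid {k : ℕ} (h1 : h < k) (h2 : k < h + 4) : width 0 D.slices k = 4 := by
  obtain rfl | rfl | rfl : k = h + 1 ∨ k = h + 2 ∨ k = h + 3 := by omega
  · exact E.width_one
  · exact E.width_two
  · exact E.width_three

theorem slice_cases {k : ℕ} {s : Slice} (hs : D.slices[k]? = some s) :
    (k < h ∧ S.slices[k]? = some s) ∨ (∃ l, h ≤ l ∧ k = l + 4 ∧ S.slices[l]? = some s) ∨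
      (k = h ∧ s = .cup 1) ∨ (k = h + 1 ∧ s = .cross 0 true) ∨ (k = h + 2 ∧ s = .cross 2 true) ∨
      (k = h + 3 ∧ s = .cap 1) := by
  rcases lt_or_ge k h with hk | hk
  · exact Or.inl ⟨hk, (E.slice_low k hk).symm.trans hs⟩
  rcases lt_or_ge k (h + 4) with hk' | hk'
  · obtain rfl | rfl | rfl | rfl : k = h ∨ k = h + 1 ∨ k = h + 2 ∨ k = h + 3 := by omega
    · exact Or.inr (Or.inr (Or.inl ⟨rfl, Option.some.inj (hs.symm.trans E.slice_zero)⟩))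
    · exact Or.inr (Or.inr (Or.inr (Or.inl ⟨rfl, Option.some.inj (hs.symm.trans E.slice_one)⟩)))
    · exact Or.inr (Or.inr (Or.inr (Or.inr (Or.inl
        ⟨rfl, Option.some.inj (hs.symm.trans E.slice_two)⟩))))
    · exact Or.inr (Or.inr (Or.inr (Or.inr (Or.inr
        ⟨rfl, Option.some.inj (hs.symm.trans E.slice_three)⟩))))
  · obtain ⟨l, rfl⟩ := Nat.exists_eq_add_of_le' (show 4 ≤ k by omega)
    exact Or.inr (Or.inl ⟨l, by omega, rfl, (E.slice_high l (by omega)).symm.trans hs⟩)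

/-- The map of the points of `D` to those of `S` that shrinks the clasp to the level `h`. -/
def collapse (p : D.Point) : S.Point :=
  ⟨if p.1.1 ≤ h then p.1 else if p.1.1 < h + 4 then (h, p.1.2 / 2) else (p.1.1 - 4, p.1.2), by
    obtain ⟨⟨k, j⟩, hk, hj⟩ := p
    have := E.lt_height
    have := E.height_eq
    simp only at hk hj ⊢
    split_ifs with h1 h2
    · exact ⟨by simp only; omega, by rwa [← E.width_low k h1]⟩
    · refine ⟨by simp only; omega, ?_⟩
      rw [E.width_mid (by omega) h2] at hj
      simp only [E.width_eq]
      omega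
    · refine ⟨by simp only; omega, ?_⟩
      obtain ⟨l, rfl⟩ := Nat.exists_eq_add_of_le' (show 4 ≤ k by omega)
      simpa [← E.width_high l (by omega)] using hj⟩

/-- The map of the points of `S` to those of `D` for which the level `h` is at the bottom of the
clasp. -/
def expand (q : S.Point) : D.Point :=
  ⟨if q.1.1 ≤ h then q.1 else (q.1.1 + 4, q.1.2), by
    obtain ⟨⟨k, j⟩, hk, hj⟩ := q
    have := E.lt_height
    have := E.height_eq
    simp only at hk hj ⊢
    split_ifs with h1
    · exact ⟨by simp only; omega, by rwa [E.width_low k h1]⟩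
    · exact ⟨by simp only; omega, by rwa [E.width_high k (by omega)]⟩⟩

/-- The same for the top of the clasp. -/
def expandTop (q : S.Point) : D.Point :=
  ⟨if q.1.1 < h then q.1 else (q.1.1 + 4, q.1.2), by
    obtain ⟨⟨k, j⟩, hk, hj⟩ := q
    have := E.lt_height
    have := E.height_eq
    simp only at hk hj ⊢
    split_ifs with h1
    · exact ⟨by simp only; omega, by rwa [E.width_low k h1.le]⟩
    · exact ⟨by simp only; omega, by rwa [E.width_high k (by omega)]⟩⟩

theorem collapse_expand (q : S.Point) : E.collapse (E.expand q) = q := by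
  apply Subtype.ext
  obtain ⟨⟨k, j⟩, hk, hj⟩ := q
  simp only [collapse, expand]
  split_ifs <;> simp_all <;> omega

theorem collapse_of_le {p : D.Point} (hp : p.1.1 ≤ h) : (E.collapse p).1 = p.1 := if_pos hp

theorem collapse_of_ge {p : D.Point} (hp : h + 4 ≤ p.1.1) :
    (E.collapse p).1 = (p.1.1 - 4, p.1.2) :=
  (if_neg (by omega)).trans (if_neg (by omega))

theorem collapse_fst {p : D.Point} (h1 : h ≤ p.1.1) (h2 : p.1.1 ≤ h + 4) :
    (E.collapse p).1.1 = h := by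
  simp only [collapse]
  split_ifs <;> omega

theorem expand_of_le {q : S.Point} (hq : q.1.1 ≤ h) : (E.expand q).1 = q.1 := if_pos hq

theorem expand_of_gt {q : S.Point} (hq : h < q.1.1) : (E.expand q).1 = (q.1.1 + 4, q.1.2) :=
  if_neg (by omega)

theorem expandTop_of_ge {q : S.Point} (hq : h ≤ q.1.1) : (E.expandTop q).1 = (q.1.1 + 4, q.1.2) :=
  if_neg (by omega)

theorem expand_eq_or (q : S.Point) (hq : h ≤ q.1.1) :
    E.expand q = E.expandTop q ∨ (E.expand q).1 = (h, q.1.2) ∧ (E.expandTop q).1 = (h + 4, q.1.2) := by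
  rcases hq.eq_or_lt with h' | h'
  · right
    rw [E.expand_of_le h'.symm.le, E.expandTop_of_ge h'.le]
    exact ⟨Prod.ext h'.symm rfl, Prod.ext (by simp only; omega) rfl⟩
  · left
    exact Subtype.ext ((E.expand_of_gt h').trans (E.expandTop_of_ge h'.le).symm)

end IsClasp

end Tangle
end Khovanov

/-! ### Circles of the two diagrams -/

namespace Khovanov
namespace Tangle

section

variable {m n : ℕ} {T : Tangle m n}

open Classical in
/-- The circle through a point, for a pair of numbers which may fail to be a point. -/
noncomputable def circleAt (T : Tangle m n) (x : Finset T.Crossing) (z : ℕ × ℕ) : Option (T.Circle x) :=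
  if hz : z.1 ≤ T.height ∧ z.2 < width m T.slices z.1 then some (T.circle x ⟨z, hz⟩) else none

theorem circleAt_val (x : Finset T.Crossing) (p : T.Point) : T.circleAt x p.1 = some (T.circle x p) :=
  dif_pos p.2

theorem circle_eq_iff_circleAt {x : Finset T.Crossing} {p q : T.Point} :
    T.circle x p = T.circle x q ↔ T.circleAt x p.1 = T.circleAt x q.1 := by
  rw [circleAt_val, circleAt_val, Option.some_inj]

theorem circleAt_mate (x : Finset T.Crossing) {k : ℕ} {s : Slice} (hs : T.slices[k]? = some s)
    (a : Bool × ℕ) (ha : a.2 < width m T.slices (place k a).1) :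
    T.circleAt x (place k a) = T.circleAt x (place k (s.mate (T.resolves x k) a)) := by
  obtain ⟨hk, hs'⟩ := List.getElem?_eq_some_iff.1 hs
  have hle : ∀ b : Bool × ℕ, (place k b).1 ≤ T.height := fun b => by
    have := Bool.toNat_le b.1
    change k + _ ≤ T.slices.length
    omega
  have hv := valid_place (k := ⟨k, hk⟩).2 ha
  have hv' := Slice.mate_valid (T.slice_fits ⟨k, hk⟩) (T.resolves x k) hv
  have hb := valid_place.1 hv'
  rw [show T.slice ⟨k, hk⟩ = s from hs'] at hb
  exact (circle_eq_iff_circleAt (p := ⟨_, hle a, ha⟩) (q := ⟨_, hle _, hb⟩)).1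
    (circle_eq (joined_iff.2 ⟨k, s, a, hs, rfl, rfl⟩))

end

namespace IsClasp

variable {S D : Tangle 0 0} {h : ℕ}

/-- The smoothings `X` of `D` and `x` of `S` agree outside the clasp. -/
structure Matches (h : ℕ) (X : Finset D.Crossing) (x : Finset S.Crossing) : Prop where
  low : ∀ k < h, D.resolves X k = S.resolves x k
  high : ∀ k, h ≤ k → D.resolves X (k + 4) = S.resolves x k

variable (E : IsClasp S D h) {X : Finset D.Crossing} {x : Finset S.Crossing}

/-- Arcs outside the clasp are arcs of `S`. Inside the clasp all points collapse to the level h,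
whose two points are on one circle. -/
theorem collapse_joined (M : Matches h X x) {p q : D.Point} (hpq : D.Joined X p q) :
    S.circle x (E.collapse p) = S.circle x (E.collapse q) := by
  obtain ⟨k, s, a, hs, hp, hq⟩ := joined_iff.1 hpq
  have h1 := Bool.toNat_le a.1
  have h2 := Bool.toNat_le (s.mate (D.resolves X k) a).1
  have hp1 : p.1.1 = k + a.1.toNat := congrArg Prod.fst hp
  have hq1 : q.1.1 = k + (s.mate (D.resolves X k) a).1.toNat := congrArg Prod.fst hq
  have mid : h ≤ k → k < h + 4 → S.circle x (E.collapse p) = S.circle x (E.collapse q) := fun _ _ =>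
    circle_eq_of_width_two x E.width_eq (E.collapse_fst (by omega) (by omega))
      (E.collapse_fst (by omega) (by omega))
  rcases E.slice_cases hs with ⟨hk, hs'⟩ | ⟨l, hl, rfl, hs'⟩ | h' | h' | h' | h'
  · refine circle_eq (joined_iff.2 ⟨k, s, a, hs', ?_, ?_⟩)
    · rw [E.collapse_of_le (by omega), hp]
    · rw [E.collapse_of_le (by omega), hq, M.low k hk]
  · refine circle_eq (joined_iff.2 ⟨l, s, a, hs', ?_, ?_⟩)
    · rw [E.collapse_of_ge (by omega), hp]
      exact Prod.ext (by simp only [place]; omega) rfl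
    · rw [E.collapse_of_ge (by omega), hq, M.high l hl]
      exact Prod.ext (by simp only [place]; omega) rfl
  all_goals exact mid (by omega) (by omega)

theorem circle_collapse (M : Matches h X x) {p q : D.Point} (hpq : D.circle X p = D.circle X q) :
    S.circle x (E.collapse p) = S.circle x (E.collapse q) :=
  eq_of_circle_eq (fun _ _ => E.collapse_joined M) hpq

/-- Functions on the circles of `D` give functions on the circles of `S`. -/
theorem expand_eq {Z : Sort*} {φ : D.Point → Z} (M : Matches h X x)
    (hφ : ∀ p q, D.Joined X p q → φ p = φ q)
    (hh : ∀ j (p q : D.Point), p.1 = (h, j) → q.1 = (h + 4, j) → φ p = φ q) {q q' : S.Point}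
    (hq : S.circle x q = S.circle x q') : φ (E.expand q) = φ (E.expand q') := by
  refine eq_of_circle_eq (φ := fun q => φ (E.expand q)) (fun q q' hq => ?_) hq
  obtain ⟨k, s, a, hs, hp, hq⟩ := joined_iff.1 hq
  have h1 := Bool.toNat_le a.1
  have h2 := Bool.toNat_le (s.mate (S.resolves x k) a).1
  have hp1 : q.1.1 = k + a.1.toNat := congrArg Prod.fst hp
  have hq1 : q'.1.1 = k + (s.mate (S.resolves x k) a).1.toNat := congrArg Prod.fst hq
  rcases lt_or_ge k h with hk | hk
  · refine hφ _ _ (joined_iff.2 ⟨k, s, a, (E.slice_low k hk).trans hs, ?_, ?_⟩)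
    · rw [E.expand_of_le (by omega), hp]
    · rw [E.expand_of_le (by omega), hq, M.low k hk]
  · have key : ∀ r : S.Point, h ≤ r.1.1 → φ (E.expand r) = φ (E.expandTop r) := fun r hr => by
      rcases E.expand_eq_or r hr with h' | ⟨h', h''⟩
      · rw [h']
      · exact hh _ _ _ h' h''
    simp only [key q (by omega), key q' (by omega)]
    refine hφ _ _ (joined_iff.2 ⟨k + 4, s, a, (E.slice_high k hk).trans hs, ?_, ?_⟩)
    · rw [E.expandTop_of_ge (by omega), hp]
      exact Prod.ext (by simp only [place]; omega) rfl
    · rw [E.expandTop_of_ge (by omega), hq, M.high k hk]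
      exact Prod.ext (by simp only [place]; omega) rfl

theorem expand_collapse_of_le {p : D.Point} (hp : p.1.1 ≤ h) : E.expand (E.collapse p) = p :=
  Subtype.ext ((E.expand_of_le (by rwa [E.collapse_of_le hp])).trans (E.collapse_of_le hp))

theorem expand_collapse_of_gt {p : D.Point} (hp : h + 4 < p.1.1) : E.expand (E.collapse p) = p := by
  have h1 := E.collapse_of_ge hp.le
  refine Subtype.ext ((E.expand_of_gt ?_).trans ?_)
  · rw [h1]
    simp only
    omega
  · rw [h1]
    exact Prod.ext (by simp only; omega) rfl

include E in
theorem snd_lt {p : D.Point} (h1 : h < p.1.1) (h2 : p.1.1 < h + 4) : p.1.2 < 4 := by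
  have := p.2.2
  rwa [E.width_mid h1 h2] at this

include E in
theorem snd_lt_two {p : D.Point} (h1 : p.1.1 = h ∨ p.1.1 = h + 4) : p.1.2 < 2 := by
  have := p.2.2
  rcases h1 with h1 | h1
  · rwa [h1, E.width_zero] at this
  · rwa [h1, E.width_four] at this

include E in
/-- The arcs of the cup and the cap and those arcs at the two crossings of the clasp that do not
depend on the smoothing. -/
theorem circleAt_clasp (X : Finset D.Crossing) :
    (D.circleAt X (h, 0) = D.circleAt X (h + 1, 0) ∧ D.circleAt X (h, 1) = D.circleAt X (h + 1, 3) ∧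
      D.circleAt X (h + 1, 1) = D.circleAt X (h + 1, 2)) ∧
    (D.circleAt X (h + 4, 0) = D.circleAt X (h + 3, 0) ∧
      D.circleAt X (h + 4, 1) = D.circleAt X (h + 3, 3) ∧
      D.circleAt X (h + 3, 1) = D.circleAt X (h + 3, 2)) ∧
    (D.circleAt X (h + 1, 2) = D.circleAt X (h + 2, 2) ∧
      D.circleAt X (h + 1, 3) = D.circleAt X (h + 2, 3)) ∧
    D.circleAt X (h + 2, 0) = D.circleAt X (h + 3, 0) ∧
      D.circleAt X (h + 2, 1) = D.circleAt X (h + 3, 1) := by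
  have h0 := E.width_zero
  have h1 := E.width_one
  have h2 := E.width_two
  have h3 := E.width_three
  have h4 := E.width_four
  refine ⟨⟨?_, ?_, ?_⟩, ⟨?_, ?_, ?_⟩, ⟨?_, ?_⟩, ?_, ?_⟩
  · exact circleAt_mate X E.slice_zero (false, 0) (by simp [place, h0])
  · exact circleAt_mate X E.slice_zero (false, 1) (by simp [place, h0])
  · exact circleAt_mate X E.slice_zero (true, 1) (by simp [place, h1])
  · exact circleAt_mate X E.slice_three (true, 0) (by simp [place, h4])
  · exact circleAt_mate X E.slice_three (true, 1) (by simp [place, h4])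
  · exact circleAt_mate X E.slice_three (false, 1) (by simp [place, h3])
  · simpa [Slice.mate, place] using circleAt_mate X E.slice_one (false, 2) (by simp [place, h1])
  · simpa [Slice.mate, place] using circleAt_mate X E.slice_one (false, 3) (by simp [place, h1])
  · simpa [Slice.mate, place] using circleAt_mate X E.slice_two (false, 0) (by simp [place, h2])
  · simpa [Slice.mate, place] using circleAt_mate X E.slice_two (false, 1) (by simp [place, h2])

include E in
theorem circleAt_one_false (hX : D.resolves X (h + 1) = false) :
    D.circleAt X (h + 1, 0) = D.circleAt X (h + 2, 0) ∧
      D.circleAt X (h + 1, 1) = D.circleAt X (h + 2, 1) := by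
  have h1 := E.width_one
  constructor
  · simpa [Slice.mate, place, hX] using circleAt_mate X E.slice_one (false, 0) (by simp [place, h1])
  · simpa [Slice.mate, place, hX] using circleAt_mate X E.slice_one (false, 1) (by simp [place, h1])

include E in
theorem circleAt_one_true (hX : D.resolves X (h + 1) = true) :
    D.circleAt X (h + 1, 0) = D.circleAt X (h + 1, 1) ∧
      D.circleAt X (h + 2, 0) = D.circleAt X (h + 2, 1) := by
  have h1 := E.width_one
  have h2 := E.width_two
  constructor
  · simpa [Slice.mate, place, hX] using circleAt_mate X E.slice_one (false, 0) (by simp [place, h1])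
  · simpa [Slice.mate, place, hX] using circleAt_mate X E.slice_one (true, 0) (by simp [place, h2])

include E in
theorem circleAt_two_false (hX : D.resolves X (h + 2) = false) :
    D.circleAt X (h + 2, 2) = D.circleAt X (h + 3, 2) ∧
      D.circleAt X (h + 2, 3) = D.circleAt X (h + 3, 3) := by
  have h2 := E.width_two
  constructor
  · simpa [Slice.mate, place, hX] using circleAt_mate X E.slice_two (false, 2) (by simp [place, h2])
  · simpa [Slice.mate, place, hX] using circleAt_mate X E.slice_two (false, 3) (by simp [place, h2])

include E in
theorem circleAt_two_true (hX : D.resolves X (h + 2) = true) :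
    D.circleAt X (h + 2, 2) = D.circleAt X (h + 2, 3) ∧
      D.circleAt X (h + 3, 2) = D.circleAt X (h + 3, 3) := by
  have h2 := E.width_two
  have h3 := E.width_three
  constructor
  · simpa [Slice.mate, place, hX] using circleAt_mate X E.slice_two (false, 2) (by simp [place, h2])
  · simpa [Slice.mate, place, hX] using circleAt_mate X E.slice_two (true, 2) (by simp [place, h3])

/-- The points strictly inside the clasp that are not on the two outer strands. -/
def Inner (h : ℕ) (p : D.Point) : Prop :=
  h < p.1.1 ∧ p.1.1 < h + 4 ∧ (p.1.2 = 1 ∨ p.1.2 = 2)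

/-- The points above the line along which the clasp is cut if both its crossings are
`1`-smoothed. -/
def Upper (h : ℕ) (p : D.Point) : Prop := h + 3 ≤ p.1.1 ∨ p.1.1 = h + 2 ∧ p.1.2 < 2

-- If both crossings are 0-smoothed, the two middle strands close up to a circle of their own
-- between the cup and the cap.
include E in
theorem inner_joined (h1 : D.resolves X (h + 1) = false) (h2 : D.resolves X (h + 2) = false)
    (p q : D.Point) (hpq : D.Joined X p q) : Inner h p = Inner h q := by
  apply propext
  obtain ⟨k, s, a, hs, hp, hq⟩ := joined_iff.1 hpq
  have h3 := Bool.toNat_le a.1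
  have h4 := Bool.toNat_le (s.mate (D.resolves X k) a).1
  have hp1 : p.1.1 = k + a.1.toNat := congrArg Prod.fst hp
  have hq1 : q.1.1 = k + (s.mate (D.resolves X k) a).1.toNat := congrArg Prod.fst hq
  have hp2 : p.1.2 = a.2 := congrArg Prod.snd hp
  have hq2 : q.1.2 = (s.mate (D.resolves X k) a).2 := congrArg Prod.snd hq
  have hlt := snd_lt E (p := p)
  have hlt' := snd_lt_two E (p := p)
  unfold Inner
  obtain ⟨e, j⟩ := a
  rcases E.slice_cases hs with ⟨hk, hs'⟩ | ⟨l, hl, rfl, hs'⟩ | ⟨rfl, rfl⟩ | ⟨rfl, rfl⟩ | ⟨rfl, rfl⟩ | ⟨rfl, rfl⟩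
  · omega
  · omega
  · cases e <;> simp only [Slice.mate] at hq1 hq2 <;> split_ifs at hq1 hq2 <;>
      simp only [Bool.toNat_true, Bool.toNat_false] at hp1 hq1 <;> omega
  · simp only [h1, Slice.mate, Bool.false_eq_true, if_false] at hq1 hq2
    cases e <;>
      simp only [Bool.toNat_true, Bool.toNat_false, Bool.not_false, Bool.not_true] at hp1 hq1 <;> omega
  · simp only [h2, Slice.mate, Bool.false_eq_true, if_false] at hq1 hq2
    cases e <;>
      simp only [Bool.toNat_true, Bool.toNat_false, Bool.not_false, Bool.not_true] at hp1 hq1 <;> omega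
  · cases e <;> simp only [Slice.mate] at hq1 hq2 <;> split_ifs at hq1 hq2 <;>
      simp only [Bool.toNat_true, Bool.toNat_false] at hp1 hq1 <;> omega

-- If both crossings are 1-smoothed, no arc joins the two sides of the cut. The cut runs through the
-- first crossing at the left and the second one at the right, which lie in different slices; this
-- is why level h + 2 is divided between the sides.
include E in
theorem upper_joined (h1 : D.resolves X (h + 1) = true) (h2 : D.resolves X (h + 2) = true)
    (p q : D.Point) (hpq : D.Joined X p q) : Upper h p = Upper h q := by
  apply propext
  obtain ⟨k, s, a, hs, hp, hq⟩ := joined_iff.1 hpq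
  have h3 := Bool.toNat_le a.1
  have h4 := Bool.toNat_le (s.mate (D.resolves X k) a).1
  have hp1 : p.1.1 = k + a.1.toNat := congrArg Prod.fst hp
  have hq1 : q.1.1 = k + (s.mate (D.resolves X k) a).1.toNat := congrArg Prod.fst hq
  have hp2 : p.1.2 = a.2 := congrArg Prod.snd hp
  have hq2 : q.1.2 = (s.mate (D.resolves X k) a).2 := congrArg Prod.snd hq
  have hlt := snd_lt E (p := p)
  have hlt' := snd_lt_two E (p := p)
  unfold Upper
  obtain ⟨e, j⟩ := a
  rcases E.slice_cases hs with ⟨hk, hs'⟩ | ⟨l, hl, rfl, hs'⟩ | ⟨rfl, rfl⟩ | ⟨rfl, rfl⟩ | ⟨rfl, rfl⟩ | ⟨rfl, rfl⟩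
  · omega
  · omega
  · omega
  · simp only [h1, Slice.mate, if_true] at hq1 hq2
    cases e <;> split_ifs at hq1 hq2 <;>
      simp only [Bool.toNat_true, Bool.toNat_false, Bool.not_false, Bool.not_true] at hp1 hq1 <;> omega
  · simp only [h2, Slice.mate, if_true] at hq1 hq2
    cases e <;> split_ifs at hq1 hq2 <;>
      simp only [Bool.toNat_true, Bool.toNat_false, Bool.not_false, Bool.not_true] at hp1 hq1 <;> omega
  · omega

end IsClasp

end Tangle
end Khovanov

/-! ### The four smoothings of the clasp -/

namespace Khovanov
namespace Tangle

theorem resolves_insert {m n : ℕ} {T : Tangle m n} (x : Finset T.Crossing) (c : T.Crossing) (k : ℕ) :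
    T.resolves (insert c x) k = (decide (c.1.1 = k) || T.resolves x k) := by
  simp [resolves]

namespace IsClasp

variable {S D : Tangle 0 0} {h : ℕ} (E : IsClasp S D h)

/-- The left point of `S` at the level of the clasp. -/
def base : S.Point := ⟨(h, 0), E.le_height, by simp [E.width_eq]⟩

/-- The left point at the bottom of the clasp. -/
def bottom : D.Point := ⟨(h, 0), by have := E.height_eq; have := E.le_height; simp only; omega, by
  simp [E.width_zero]⟩

/-- The left point at the top of the clasp. -/
def top : D.Point := ⟨(h + 4, 0), by have := E.height_eq; have := E.le_height; simp only; omega, by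
  simp [E.width_four]⟩

/-- A point inside the clasp. -/
def inside : D.Point := ⟨(h + 1, 1), by have := E.height_eq; have := E.le_height; simp only; omega, by
  simp [E.width_one]⟩

theorem inner_inside : Inner h E.inside := by simp [Inner, inside]

theorem upper_top : Upper h E.top := by simp [Upper, top]

theorem not_upper_bottom : ¬ Upper h E.bottom := by simp [Upper, bottom]

theorem collapse_mid {p : D.Point} (h1 : h < p.1.1) (h2 : p.1.1 < h + 4) :
    (E.collapse p).1 = (h, p.1.2 / 2) := (if_neg (by omega)).trans (if_pos h2)

theorem collapse_bottom : E.collapse E.bottom = E.base := Subtype.ext (E.collapse_of_le le_rfl)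

theorem collapse_top : E.collapse E.top = E.base :=
  Subtype.ext ((E.collapse_of_ge le_rfl).trans (by simp [top, base]))

theorem expand_base : E.expand E.base = E.bottom := Subtype.ext (E.expand_of_le le_rfl)

variable {X : Finset D.Crossing} {x : Finset S.Crossing}

section NoneResolved

variable (h1 : D.resolves X (h + 1) = false) (h2 : D.resolves X (h + 2) = false)

include E h1 h2

theorem circle_inner {p : D.Point} (hp : Inner h p) : D.circle X p = D.circle X E.inside := by
  obtain ⟨⟨a1, a2, a3⟩, ⟨b1, b2, b3⟩, ⟨c1, c2⟩, c3, c4⟩ := E.circleAt_clasp X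
  obtain ⟨d1, d2⟩ := E.circleAt_one_false h1
  obtain ⟨e1, e2⟩ := E.circleAt_two_false h2
  rw [circle_eq_iff_circleAt]
  obtain ⟨⟨k, j⟩, hk⟩ := p
  obtain ⟨hp1, hp2, hp3⟩ := hp
  simp only [inside] at hp1 hp2 hp3 ⊢
  obtain rfl | rfl | rfl : k = h + 1 ∨ k = h + 2 ∨ k = h + 3 := by omega
  all_goals
    rcases hp3 with rfl | rfl
    all_goals simp [*]

theorem circle_ends {j : ℕ} {p q : D.Point} (hp : p.1 = (h, j)) (hq : q.1 = (h + 4, j)) :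
    D.circle X p = D.circle X q := by
  obtain ⟨⟨a1, a2, a3⟩, ⟨b1, b2, b3⟩, ⟨c1, c2⟩, c3, c4⟩ := E.circleAt_clasp X
  obtain ⟨d1, d2⟩ := E.circleAt_one_false h1
  obtain ⟨e1, e2⟩ := E.circleAt_two_false h2
  have hj := E.snd_lt_two (p := p) (Or.inl (congrArg Prod.fst hp))
  rw [circle_eq_iff_circleAt, hp, hq]
  rw [hp] at hj
  simp only at hj
  obtain rfl | rfl : j = 0 ∨ j = 1 := by omega
  · simp [*]
  · simp [*]

theorem circle_outer {p : D.Point} (hp : ¬ Inner h p) :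
    D.circle X (E.expand (E.collapse p)) = D.circle X p := by
  obtain ⟨⟨a1, a2, a3⟩, ⟨b1, b2, b3⟩, ⟨c1, c2⟩, c3, c4⟩ := E.circleAt_clasp X
  obtain ⟨d1, d2⟩ := E.circleAt_one_false h1
  obtain ⟨e1, e2⟩ := E.circleAt_two_false h2
  rcases le_or_gt p.1.1 h with h3 | h3
  · rw [E.expand_collapse_of_le h3]
  rcases lt_or_ge p.1.1 (h + 4) with h4 | h4
  · have hc := E.collapse_mid h3 h4
    have he := (E.expand_of_le (q := E.collapse p) (by rw [hc])).trans hc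
    rw [circle_eq_iff_circleAt, he]
    have hj := E.snd_lt h3 h4
    obtain ⟨⟨k, j⟩, hk⟩ := p
    unfold Inner at hp
    simp only at hp h3 h4 hj ⊢
    obtain rfl | rfl : j = 0 ∨ j = 3 := by omega
    all_goals
      obtain rfl | rfl | rfl : k = h + 1 ∨ k = h + 2 ∨ k = h + 3 := by omega
      all_goals simp [*]
  · rcases h4.eq_or_lt with h5 | h5
    · have hc := E.collapse_of_ge h4
      refine E.circle_ends h1 h2 (j := p.1.2) ?_ (Prod.ext h5.symm rfl)
      rw [E.expand_of_le (by rw [hc]; simp only; omega), hc]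
      exact Prod.ext (by simp only; omega) rfl
    · rw [E.expand_collapse_of_gt h5]

end NoneResolved

section OneResolved

include E

/-- With one crossing of each kind, one strand passes straight through and the other one makes a
detour over the cup and the cap. So the clasp connects the ends as two parallel strands do and
contains no further circle. -/
theorem circle_mixed (M : Matches h X x)
    (hX : D.resolves X (h + 1) = true ∧ D.resolves X (h + 2) = false ∨
      D.resolves X (h + 1) = false ∧ D.resolves X (h + 2) = true) :
    (∀ p : D.Point, h ≤ p.1.1 → p.1.1 ≤ h + 4 → D.circle X p = D.circle X E.bottom) ∧
      ∀ p : D.Point, D.circle X (E.expand (E.collapse p)) = D.circle X p := by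
  obtain ⟨⟨a1, a2, a3⟩, ⟨b1, b2, b3⟩, ⟨c1, c2⟩, c3, c4⟩ := E.circleAt_clasp X
  have hends : D.circleAt X (h, 0) = D.circleAt X (h + 4, 0) ∧
      D.circleAt X (h, 1) = D.circleAt X (h + 4, 1) := by
    rcases hX with ⟨h1, h2⟩ | ⟨h1, h2⟩
    · obtain ⟨d1, d2⟩ := E.circleAt_one_true h1
      obtain ⟨e1, e2⟩ := E.circleAt_two_false h2
      exact ⟨by rw [a1, d1, a3, c1, e1, ← b3, ← c4, ← d2, c3, b1], by rw [a2, c2, e2, b2]⟩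
    · obtain ⟨d1, d2⟩ := E.circleAt_one_false h1
      obtain ⟨e1, e2⟩ := E.circleAt_two_true h2
      exact ⟨by rw [a1, d1, c3, b1], by rw [a2, c2, ← e1, ← c1, ← a3, d2, c4, b3, e2, b2]⟩
  have hends' : ∀ j (p q : D.Point), p.1 = (h, j) → q.1 = (h + 4, j) →
      D.circle X p = D.circle X q := by
    intro j p q hp hq
    have hj := E.snd_lt_two (p := p) (Or.inl (congrArg Prod.fst hp))
    rw [circle_eq_iff_circleAt, hp, hq]
    rw [hp] at hj
    simp only at hj
    obtain rfl | rfl : j = 0 ∨ j = 1 := by omega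
    · exact hends.1
    · exact hends.2
  -- The two strands are joined outside the clasp; this is transported from `S`, where it is
  -- `circle_eq_of_width_two`.
  have h01 : D.circleAt X (h, 1) = D.circleAt X (h, 0) := by
    let q : S.Point := ⟨(h, 1), E.le_height, by simp [E.width_eq]⟩
    have := E.expand_eq M (fun p q => circle_eq) hends'
      (circle_eq_of_width_two x E.width_eq (p := q) (q := E.base) rfl rfl)
    rw [circle_eq_iff_circleAt] at this
    rwa [E.expand_of_le (q := q) le_rfl, E.expand_of_le (q := E.base) le_rfl] at this
  have hmid : ∀ p : D.Point, h ≤ p.1.1 → p.1.1 ≤ h + 4 → D.circle X p = D.circle X E.bottom := by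
    intro p h3 h4
    clear hends' M
    rw [circle_eq_iff_circleAt]
    change _ = D.circleAt X (h, 0)
    have hj := E.snd_lt (p := p)
    have hj' := E.snd_lt_two (p := p)
    obtain ⟨⟨k, j⟩, hk⟩ := p
    simp only at h3 h4 hj hj' ⊢
    have hk : k = h ∨ k = h + 1 ∨ k = h + 2 ∨ k = h + 3 ∨ k = h + 4 := by omega
    rcases hX with ⟨h1, h2⟩ | ⟨h1, h2⟩
    · obtain ⟨d1, d2⟩ := E.circleAt_one_true h1
      obtain ⟨e1, e2⟩ := E.circleAt_two_false h2
      rcases hk with rfl | rfl | rfl | rfl | rfl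
      · obtain rfl | rfl : j = 0 ∨ j = 1 := by omega
        all_goals grind
      · obtain rfl | rfl | rfl | rfl : j = 0 ∨ j = 1 ∨ j = 2 ∨ j = 3 := by omega
        all_goals grind
      · obtain rfl | rfl | rfl | rfl : j = 0 ∨ j = 1 ∨ j = 2 ∨ j = 3 := by omega
        all_goals grind
      · obtain rfl | rfl | rfl | rfl : j = 0 ∨ j = 1 ∨ j = 2 ∨ j = 3 := by omega
        all_goals grind
      · obtain rfl | rfl : j = 0 ∨ j = 1 := by omega
        all_goals grind
    · obtain ⟨d1, d2⟩ := E.circleAt_one_false h1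
      obtain ⟨e1, e2⟩ := E.circleAt_two_true h2
      rcases hk with rfl | rfl | rfl | rfl | rfl
      · obtain rfl | rfl : j = 0 ∨ j = 1 := by omega
        all_goals grind
      · obtain rfl | rfl | rfl | rfl : j = 0 ∨ j = 1 ∨ j = 2 ∨ j = 3 := by omega
        all_goals grind
      · obtain rfl | rfl | rfl | rfl : j = 0 ∨ j = 1 ∨ j = 2 ∨ j = 3 := by omega
        all_goals grind
      · obtain rfl | rfl | rfl | rfl : j = 0 ∨ j = 1 ∨ j = 2 ∨ j = 3 := by omega
        all_goals grind
      · obtain rfl | rfl : j = 0 ∨ j = 1 := by omega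
        all_goals grind
  refine ⟨hmid, fun p => ?_⟩
  rcases lt_or_ge p.1.1 h with h3 | h3
  · rw [E.expand_collapse_of_le h3.le]
  rcases le_or_gt p.1.1 (h + 4) with h4 | h4
  · rw [hmid p h3 h4]
    have hc := E.collapse_fst h3 h4
    have he := E.expand_of_le (q := E.collapse p) hc.le
    exact hmid _ (by rw [he, hc]) (by rw [he, hc]; omega)
  · rw [E.expand_collapse_of_gt h4]

end OneResolved

section BothResolved

variable (h1 : D.resolves X (h + 1) = true) (h2 : D.resolves X (h + 2) = true)

open Classical in
/-- The circle through a point, where the two circles through the clasp are considered as equal. -/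
noncomputable def glue (X : Finset D.Crossing) (p : D.Point) : D.Circle X :=
  if D.circle X p = D.circle X E.top then D.circle X E.bottom else D.circle X p

include E h1 h2

theorem upper_iff {p q : D.Point} (hpq : D.circle X p = D.circle X q) : Upper h p ↔ Upper h q :=
  iff_of_eq (eq_of_circle_eq (E.upper_joined h1 h2) hpq)

theorem circle_bottom_ne_top : D.circle X E.bottom ≠ D.circle X E.top := fun h' =>
  E.not_upper_bottom ((E.upper_iff h1 h2 h').2 E.upper_top)

theorem circle_clasp {p : D.Point} (h3 : h ≤ p.1.1) (h4 : p.1.1 ≤ h + 4) :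
    D.circle X p = D.circle X E.bottom ∨ D.circle X p = D.circle X E.top := by
  obtain ⟨⟨a1, a2, a3⟩, ⟨b1, b2, b3⟩, ⟨c1, c2⟩, c3, c4⟩ := E.circleAt_clasp X
  obtain ⟨d1, d2⟩ := E.circleAt_one_true h1
  obtain ⟨e1, e2⟩ := E.circleAt_two_true h2
  rw [circle_eq_iff_circleAt, circle_eq_iff_circleAt]
  change _ = D.circleAt X (h, 0) ∨ _ = D.circleAt X (h + 4, 0)
  have hj := E.snd_lt (p := p)
  have hj' := E.snd_lt_two (p := p)
  obtain ⟨⟨k, j⟩, hk⟩ := p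
  simp only at h3 h4 hj hj' ⊢
  have hk : k = h ∨ k = h + 1 ∨ k = h + 2 ∨ k = h + 3 ∨ k = h + 4 := by omega
  rcases hk with rfl | rfl | rfl | rfl | rfl
  · left
    obtain rfl | rfl : j = 0 ∨ j = 1 := by omega
    all_goals simp_all
  · left
    obtain rfl | rfl | rfl | rfl : j = 0 ∨ j = 1 ∨ j = 2 ∨ j = 3 := by omega
    all_goals simp_all
  · obtain rfl | rfl | rfl | rfl : j = 0 ∨ j = 1 ∨ j = 2 ∨ j = 3 := by omega
    all_goals simp_all
  · right
    obtain rfl | rfl | rfl | rfl : j = 0 ∨ j = 1 ∨ j = 2 ∨ j = 3 := by omega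
    all_goals simp_all
  · right
    obtain rfl | rfl : j = 0 ∨ j = 1 := by omega
    all_goals simp_all

theorem glue_clasp {p : D.Point} (h3 : h ≤ p.1.1) (h4 : p.1.1 ≤ h + 4) :
    E.glue X p = D.circle X E.bottom := by
  unfold glue
  split_ifs with h5
  · rfl
  · exact (E.circle_clasp h1 h2 h3 h4).resolve_right h5

theorem glue_expand_collapse (p : D.Point) : E.glue X (E.expand (E.collapse p)) = E.glue X p := by
  rcases lt_or_ge p.1.1 h with h3 | h3
  · rw [E.expand_collapse_of_le h3.le]
  rcases le_or_gt p.1.1 (h + 4) with h4 | h4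
  · have hc := E.collapse_fst h3 h4
    have he := E.expand_of_le (q := E.collapse p) hc.le
    rw [E.glue_clasp h1 h2 h3 h4, E.glue_clasp h1 h2 (by rw [he, hc]) (by rw [he, hc]; omega)]
  · rw [E.expand_collapse_of_gt h4]

/-- Cutting at the clasp divides only the circle of `S` that passes through it. Once the two pieces
are considered as equal, the circles of `S` and of `D` correspond. -/
theorem glue_expand_eq (M : Matches h X x) {q q' : S.Point} (hq : S.circle x q = S.circle x q') :
    E.glue X (E.expand q) = E.glue X (E.expand q') := by
  refine E.expand_eq M (fun p q hpq => ?_) (fun j p q hp hq => ?_) hq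
  · unfold glue
    rw [circle_eq hpq]
  · rw [E.glue_clasp h1 h2 (by rw [hp]) (by rw [hp]; simp), E.glue_clasp h1 h2 (by rw [hq]; simp)
      (by rw [hq])]

/-- Gluing identifies only the two circles through the clasp, and these are on different sides of
the cut. -/
theorem circle_eq_of_glue {p q : D.Point} (hpq : Upper h p ↔ Upper h q) (hg : E.glue X p = E.glue X q) :
    D.circle X p = D.circle X q := by
  have key : ∀ p q : D.Point, (Upper h p ↔ Upper h q) → D.circle X p = D.circle X E.top →
      D.circle X q = D.circle X E.bottom → False := fun p q hpq hp hq =>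
    E.not_upper_bottom ((E.upper_iff h1 h2 hq).1 (hpq.1 ((E.upper_iff h1 h2 hp).2 E.upper_top)))
  unfold glue at hg
  split_ifs at hg with h3 h4 h4
  · exact h3.trans h4.symm
  · exact (key p q hpq h3 hg.symm).elim
  · exact (key q p hpq.symm h4 hg).elim
  · exact hg

end BothResolved

end IsClasp

end Tangle
end Khovanov

/-! ### Crossings and smoothings of the two diagrams -/

namespace Khovanov
namespace Tangle

theorem slice_eq_of_getElem? {m n : ℕ} {T : Tangle m n} {k : ℕ} {s : Slice}
    (hs : T.slices[k]? = some s) (hk : k < T.height) : T.slice ⟨k, hk⟩ = s :=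
  (List.getElem?_eq_some_iff.1 hs).2

namespace IsClasp

variable {S D : Tangle 0 0} {h : ℕ} (E : IsClasp S D h)

/-- The level in `D` of the slice of `S` with a given level. -/
def shift (h k : ℕ) : ℕ := if k < h then k else k + 4

theorem shift_of_lt {k : ℕ} (hk : k < h) : shift h k = k := if_pos hk

theorem shift_of_ge {k : ℕ} (hk : h ≤ k) : shift h k = k + 4 := if_neg (by omega)

theorem shift_injective {k l : ℕ} (hkl : shift h k = shift h l) : k = l := by
  unfold shift at hkl
  split_ifs at hkl <;> omega

include E in
theorem slice_shift (k : ℕ) : D.slices[shift h k]? = S.slices[k]? := by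
  rcases lt_or_ge k h with hk | hk
  · rw [shift_of_lt hk, E.slice_low k hk]
  · rw [shift_of_ge hk, E.slice_high k hk]

include E in
theorem shift_lt (k : Fin S.height) : shift h k < D.height := by
  have := E.height_eq
  have := k.2
  unfold shift
  split_ifs <;> omega

include E in
theorem slice_shift_eq (k : Fin S.height) : D.slice ⟨shift h k, E.shift_lt k⟩ = S.slice k :=
  slice_eq_of_getElem? ((E.slice_shift k).trans (List.getElem?_eq_getElem k.2)) _

/-- The crossings of `S` as crossings of `D`. -/
def incl : S.Crossing ↪ D.Crossing where
  toFun a := ⟨⟨shift h a.1, E.shift_lt a.1⟩, by rw [E.slice_shift_eq]; exact a.2⟩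
  inj' a b hab := Subtype.ext (Fin.ext (shift_injective
    (congrArg (fun c : D.Crossing => c.1.1) hab)))

/-- The lower crossing of the clasp. -/
def first : D.Crossing := ⟨⟨h + 1, by have := E.height_eq; have := E.le_height; omega⟩, by
  rw [slice_eq_of_getElem? E.slice_one]
  rfl⟩

/-- The upper crossing of the clasp. -/
def second : D.Crossing := ⟨⟨h + 2, by have := E.height_eq; have := E.le_height; omega⟩, by
  rw [slice_eq_of_getElem? E.slice_two]
  rfl⟩

theorem slice_incl (a : S.Crossing) : D.slice (E.incl a).1 = S.slice a.1 := E.slice_shift_eq a.1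

theorem slice_first : D.slice E.first.1 = .cross 0 true := slice_eq_of_getElem? E.slice_one _

theorem slice_second : D.slice E.second.1 = .cross 2 true := slice_eq_of_getElem? E.slice_two _

theorem first_ne_second : E.first ≠ E.second := fun h' => by
  have := congrArg (fun c : D.Crossing => c.1.1) h'
  simp [first, second] at this

theorem incl_ne_first (a : S.Crossing) : E.incl a ≠ E.first := fun h' => by
  have : shift h a.1 = h + 1 := congrArg (fun c : D.Crossing => c.1.1) h'
  unfold shift at this
  split_ifs at this <;> omega

theorem incl_ne_second (a : S.Crossing) : E.incl a ≠ E.second := fun h' => by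
  have : shift h a.1 = h + 2 := congrArg (fun c : D.Crossing => c.1.1) h'
  unfold shift at this
  split_ifs at this <;> omega

theorem crossing_cover (b : D.Crossing) : b = E.first ∨ b = E.second ∨ b ∈ Set.range E.incl := by
  obtain ⟨⟨k, hk⟩, hb⟩ := b
  have hs : D.slices[k]? = some (D.slice ⟨k, hk⟩) := List.getElem?_eq_getElem hk
  have key : ∀ l, S.slices[l]? = some (D.slice ⟨k, hk⟩) → k = shift h l →
      (⟨⟨k, hk⟩, hb⟩ : D.Crossing) ∈ Set.range E.incl := by
    intro l hl hkl
    obtain ⟨h1, h2⟩ := List.getElem?_eq_some_iff.1 hl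
    refine ⟨⟨⟨l, h1⟩, ?_⟩, Subtype.ext (Fin.ext hkl.symm)⟩
    rw [show S.slice ⟨l, h1⟩ = _ from h2]
    exact hb
  rcases E.slice_cases hs with ⟨h1, h2⟩ | ⟨l, h1, h2, h3⟩ | ⟨h1, h2⟩ | ⟨h1, h2⟩ | ⟨h1, h2⟩ | ⟨h1, h2⟩
  · exact Or.inr (Or.inr (key k h2 (shift_of_lt h1).symm))
  · exact Or.inr (Or.inr (key l h3 (h2.trans (shift_of_ge h1).symm)))
  · rw [h2] at hb
    simp [Slice.isCrossing] at hb
  · exact Or.inl (Subtype.ext (Fin.ext h1))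
  · exact Or.inr (Or.inl (Subtype.ext (Fin.ext h1)))
  · rw [h2] at hb
    simp [Slice.isCrossing] at hb

theorem first_lt_iff (a : S.Crossing) : E.first < E.incl a ↔ E.second < E.incl a := by
  change h + 1 < shift h a.1 ↔ h + 2 < shift h a.1
  unfold shift
  split_ifs <;> omega

theorem incl_lt_iff (a b : S.Crossing) : E.incl a < E.incl b ↔ a < b := by
  change shift h a.1 < shift h b.1 ↔ a.1.1 < b.1.1
  unfold shift
  split_ifs <;> omega

theorem resolves_map (x : Finset S.Crossing) (k : ℕ) :
    D.resolves (x.map E.incl) k = true ↔ ∃ a ∈ x, shift h a.1 = k := by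
  simp only [resolves, decide_eq_true_eq]
  constructor
  · rintro ⟨c, hc, h'⟩
    obtain ⟨a, ha, rfl⟩ := Finset.mem_map.1 hc
    exact ⟨a, ha, h'⟩
  · rintro ⟨a, ha, h'⟩
    exact ⟨E.incl a, Finset.mem_map_of_mem _ ha, h'⟩

theorem resolves_map_shift (x : Finset S.Crossing) (k : ℕ) :
    D.resolves (x.map E.incl) (shift h k) = S.resolves x k := by
  rw [Bool.eq_iff_iff, resolves_map]
  simp only [resolves, decide_eq_true_eq]
  exact exists_congr fun a => and_congr_right fun _ => ⟨shift_injective, congrArg _⟩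

theorem resolves_map_mid (x : Finset S.Crossing) {k : ℕ} (h1 : h ≤ k) (h2 : k < h + 4) :
    D.resolves (x.map E.incl) k = false := by
  rw [← Bool.not_eq_true, resolves_map]
  rintro ⟨a, -, h'⟩
  unfold shift at h'
  split_ifs at h' <;> omega

theorem matches_map (x : Finset S.Crossing) : Matches h (x.map E.incl) x :=
  ⟨fun k hk => by rw [← E.resolves_map_shift x k, shift_of_lt hk],
    fun k hk => by rw [← E.resolves_map_shift x k, shift_of_ge hk]⟩

variable {X : Finset D.Crossing} {x : Finset S.Crossing}

theorem Matches.insert_first (M : Matches h X x) : Matches h (insert E.first X) x :=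
  ⟨fun k hk => by rw [resolves_insert, M.low k hk, decide_eq_false (by simp [first]; omega),
      Bool.false_or],
    fun k hk => by rw [resolves_insert, M.high k hk, decide_eq_false (by simp [first]; omega),
      Bool.false_or]⟩

theorem Matches.insert_second (M : Matches h X x) : Matches h (insert E.second X) x :=
  ⟨fun k hk => by rw [resolves_insert, M.low k hk, decide_eq_false (by simp [second]; omega),
      Bool.false_or],
    fun k hk => by rw [resolves_insert, M.high k hk, decide_eq_false (by simp [second]; omega),
      Bool.false_or]⟩

theorem resolves_insert_first (X : Finset D.Crossing) :
    D.resolves (insert E.first X) (h + 1) = true ∧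
      D.resolves (insert E.first X) (h + 2) = D.resolves X (h + 2) := by
  constructor
  · rw [resolves_insert, decide_eq_true (by rfl), Bool.true_or]
  · rw [resolves_insert, decide_eq_false (by simp [first]), Bool.false_or]

theorem resolves_insert_second (X : Finset D.Crossing) :
    D.resolves (insert E.second X) (h + 2) = true ∧
      D.resolves (insert E.second X) (h + 1) = D.resolves X (h + 1) := by
  constructor
  · rw [resolves_insert, decide_eq_true (by rfl), Bool.true_or]
  · rw [resolves_insert, decide_eq_false (by simp [second]), Bool.false_or]

theorem lowerLeft_incl (a : S.Crossing) : (D.lowerLeft (E.incl a)).1 = (shift h a.1, (S.lowerLeft a).1.2) :=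
  Prod.ext rfl (congrArg Slice.pos (E.slice_incl a))

theorem upperRight_incl (a : S.Crossing) :
    (D.upperRight (E.incl a)).1 = (shift h a.1 + 1, (S.upperRight a).1.2) :=
  Prod.ext rfl (congrArg (fun s => Slice.pos s + 1) (E.slice_incl a))

theorem collapse_lowerLeft (a : S.Crossing) : E.collapse (D.lowerLeft (E.incl a)) = S.lowerLeft a := by
  have h1 := E.lowerLeft_incl a
  apply Subtype.ext
  rcases lt_or_ge a.1.1 h with hk | hk
  · rw [shift_of_lt hk] at h1
    rw [E.collapse_of_le (by rw [h1]; exact hk.le), h1]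
    rfl
  · rw [shift_of_ge hk] at h1
    rw [E.collapse_of_ge (by rw [h1]; simp only; omega), h1]
    rfl

theorem collapse_upperRight (a : S.Crossing) : E.collapse (D.upperRight (E.incl a)) = S.upperRight a := by
  have h1 := E.upperRight_incl a
  apply Subtype.ext
  rcases lt_or_ge a.1.1 h with hk | hk
  · rw [shift_of_lt hk] at h1
    rw [E.collapse_of_le (by rw [h1]; exact hk), h1]
    rfl
  · rw [shift_of_ge hk] at h1
    rw [E.collapse_of_ge (by rw [h1]; simp only; omega), h1]
    exact Prod.ext (by simp only [upperRight]; omega) rfl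

theorem not_inner_lowerLeft (a : S.Crossing) : ¬ Inner h (D.lowerLeft (E.incl a)) := by
  unfold Inner
  rw [E.lowerLeft_incl a]
  unfold shift
  split_ifs <;> simp only <;> omega

theorem not_inner_upperRight (a : S.Crossing) : ¬ Inner h (D.upperRight (E.incl a)) := by
  unfold Inner
  rw [E.upperRight_incl a]
  unfold shift
  split_ifs <;> simp only <;> omega

theorem upper_lowerLeft (a : S.Crossing) : Upper h (D.lowerLeft (E.incl a)) ↔ h ≤ a.1.1 := by
  unfold Upper
  rw [E.lowerLeft_incl a]
  unfold shift
  split_ifs <;> simp only <;> omega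

theorem upper_upperRight (a : S.Crossing) : Upper h (D.upperRight (E.incl a)) ↔ h ≤ a.1.1 := by
  unfold Upper
  rw [E.upperRight_incl a]
  unfold shift
  split_ifs <;> simp only <;> omega

/-- The smoothing of `D` with none of the crossings of the clasp `1`-smoothed. -/
abbrev low (x : Finset S.Crossing) : Finset D.Crossing := x.map E.incl

/-- The smoothing of `D` with both crossings of the clasp `1`-smoothed. -/
abbrev high (x : Finset S.Crossing) : Finset D.Crossing := insert E.first (insert E.second (x.map E.incl))

theorem matches_high (x : Finset S.Crossing) : Matches h (E.high x) x :=
  ((E.matches_map x).insert_second E).insert_first E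

theorem low_one (x : Finset S.Crossing) : D.resolves (E.low x) (h + 1) = false :=
  E.resolves_map_mid x (by omega) (by omega)

theorem low_two (x : Finset S.Crossing) : D.resolves (E.low x) (h + 2) = false :=
  E.resolves_map_mid x (by omega) (by omega)

theorem high_one (x : Finset S.Crossing) : D.resolves (E.high x) (h + 1) = true :=
  (E.resolves_insert_first _).1

theorem high_two (x : Finset S.Crossing) : D.resolves (E.high x) (h + 2) = true :=
  (E.resolves_insert_first _).2.trans (E.resolves_insert_second _).1

theorem circle_expand_low {q q' : S.Point} (hq : S.circle x q = S.circle x q') :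
    D.circle (E.low x) (E.expand q) = D.circle (E.low x) (E.expand q') :=
  E.expand_eq (E.matches_map x) (fun _ _ => circle_eq)
    (fun _ _ _ => E.circle_ends (E.low_one x) (E.low_two x)) hq

/-- The small circle meets no crossing of `S`, so it has no influence on whether circles split
there. -/
theorem bifurcates_low (x : Finset S.Crossing) (a : S.Crossing) :
    D.Bifurcates (E.low x) (E.incl a) ↔ S.Bifurcates x a := by
  unfold Bifurcates
  constructor
  · intro h'
    have := E.circle_collapse (E.matches_map x) h'
    rwa [collapse_lowerLeft, collapse_upperRight] at this
  · intro h'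
    rw [← E.collapse_lowerLeft, ← E.collapse_upperRight] at h'
    have := E.circle_expand_low h'
    rwa [E.circle_outer (E.low_one x) (E.low_two x) (E.not_inner_lowerLeft a),
      E.circle_outer (E.low_one x) (E.low_two x) (E.not_inner_upperRight a)] at this

/-- Both arcs at a crossing of `S` are on the same side of the cut, so they cannot be the two
different pieces of the circle that was cut. -/
theorem bifurcates_high (x : Finset S.Crossing) (a : S.Crossing) :
    D.Bifurcates (E.high x) (E.incl a) ↔ S.Bifurcates x a := by
  unfold Bifurcates
  constructor
  · intro h'
    have := E.circle_collapse (E.matches_high x) h'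
    rwa [collapse_lowerLeft, collapse_upperRight] at this
  · intro h'
    rw [← E.collapse_lowerLeft, ← E.collapse_upperRight] at h'
    have := E.glue_expand_eq (E.high_one x) (E.high_two x) (E.matches_high x) h'
    rw [E.glue_expand_collapse (E.high_one x) (E.high_two x),
      E.glue_expand_collapse (E.high_one x) (E.high_two x)] at this
    exact E.circle_eq_of_glue (E.high_one x) (E.high_two x)
      ((E.upper_lowerLeft a).trans (E.upper_upperRight a).symm) this

theorem lowerLeft_first : (D.lowerLeft E.first).1 = (h + 1, 0) :=
  Prod.ext rfl (congrArg Slice.pos E.slice_first)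

theorem upperRight_first : (D.upperRight E.first).1 = (h + 2, 1) :=
  Prod.ext rfl (congrArg (fun s => Slice.pos s + 1) E.slice_first)

theorem lowerLeft_second : (D.lowerLeft E.second).1 = (h + 2, 2) :=
  Prod.ext rfl (congrArg Slice.pos E.slice_second)

theorem upperRight_second : (D.upperRight E.second).1 = (h + 3, 3) :=
  Prod.ext rfl (congrArg (fun s => Slice.pos s + 1) E.slice_second)

theorem insert_second_insert_first (x : Finset S.Crossing) :
    insert E.second (insert E.first (x.map E.incl)) = E.high x := Finset.insert_comm _ _ _

theorem low_insert (x : Finset S.Crossing) (a : S.Crossing) :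
    E.low (insert a x) = insert (E.incl a) (E.low x) := Finset.map_insert _ _ _

theorem high_insert (x : Finset S.Crossing) (a : S.Crossing) :
    E.high (insert a x) = insert (E.incl a) (E.high x) := by
  rw [high, high, Finset.map_insert, Finset.insert_comm E.second, Finset.insert_comm E.first]

theorem first_notMem_map (x : Finset S.Crossing) : E.first ∉ x.map E.incl := fun h' => by
  obtain ⟨a, -, h'⟩ := Finset.mem_map.1 h'
  exact E.incl_ne_first a h'

theorem second_notMem_map (x : Finset S.Crossing) : E.second ∉ x.map E.incl := fun h' => by
  obtain ⟨a, -, h'⟩ := Finset.mem_map.1 h'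
  exact E.incl_ne_second a h'

theorem incl_notMem_high {a : S.Crossing} (ha : a ∉ x) : E.incl a ∉ E.high x := fun h' => by
  rcases Finset.mem_insert.1 h' with h' | h'
  · exact E.incl_ne_first a h'
  rcases Finset.mem_insert.1 h' with h' | h'
  · exact E.incl_ne_second a h'
  · exact ha ((Finset.mem_map' _).1 h')

end IsClasp

end Tangle
end Khovanov

/-! ### The part where no crossing of the clasp is 1-smoothed -/

namespace Khovanov

namespace CubeFunctor

/-- A property of pairs of nested sets can be proved by adding one element at a time. -/
theorem subset_induction {A : Type} [DecidableEq A] {P : Finset A → Finset A → Prop}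
    (refl : ∀ x, P x x) (step : ∀ x y a, x ⊆ y → a ∉ y → P x y → P x (insert a y)) {x y : Finset A}
    (hxy : x ⊆ y) : P x y := by
  induction y using Finset.induction_on with
  | empty =>
    rw [Finset.subset_empty.1 hxy]
    exact refl _
  | insert a y ha ih =>
    by_cases hax : a ∈ x
    · have key : ∀ z : Finset A, x ⊆ x ∪ z ∧ P x (x ∪ z) := fun z => by
        induction z using Finset.induction_on with
        | empty => exact ⟨Finset.subset_union_left, by rw [Finset.union_empty]; exact refl x⟩
        | insert b z _ ihz =>
          refine ⟨Finset.subset_union_left, ?_⟩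
          rw [Finset.union_insert]
          by_cases hb : b ∈ x ∪ z
          · rw [Finset.insert_eq_of_mem hb]
            exact ihz.2
          · exact step _ _ _ ihz.1 hb ihz.2
      have := (key (insert a y)).2
      rwa [Finset.union_eq_right.2 hxy] at this
    · have := (Finset.subset_insert_iff_of_notMem hax).1 hxy
      exact step _ _ _ this ha (ih this)

end CubeFunctor

namespace Tangle

noncomputable section

section Gen

variable {D : Tangle 0 0} {x : Finset D.Crossing}

/-- The sums of this form contain 1 and are stable under multiplication by each generator, as the
square of v is 0. Thus one circle is separated from all the others. -/
theorem exists_eq_add_mul {R : Type} [CommRing R] (G : R →+* Tensor (D.Circle x))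
    {v : Tensor (D.Circle x)} (hv : v * v = 0)
    (hgen : ∀ p, D.gen x p = v ∨ ∃ r, D.gen x p = G r) (t : Tensor (D.Circle x)) :
    ∃ a b, t = G a + v * G b := by
  let K : AddSubgroup (Tensor (D.Circle x)) :=
    { carrier := {t | ∃ a b, t = G a + v * G b}
      zero_mem' := ⟨0, 0, by simp⟩
      add_mem' := by
        rintro _ _ ⟨a, b, rfl⟩ ⟨a', b', rfl⟩
        exact ⟨a + a', b + b', by rw [map_add, map_add]; ring⟩
      neg_mem' := by
        rintro _ ⟨a, b, rfl⟩
        exact ⟨-a, -b, by rw [map_neg, map_neg]; ring⟩ }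
  refine tensor_induction K ⟨1, 0, by simp⟩ (fun C r hr => ?_) t
  obtain ⟨a, b, rfl⟩ := hr
  induction C using Quot.inductionOn with
  | h p =>
    change ∃ a' b', D.gen x p * _ = G a' + v * G b'
    rcases hgen p with h | ⟨r, h⟩
    · refine ⟨0, a, ?_⟩
      rw [h, map_zero]
      linear_combination G b * hv
    · refine ⟨r * a, r * b, ?_⟩
      rw [h, map_mul, map_mul]
      ring

end Gen

namespace IsClasp

variable {S D : Tangle 0 0} {h : ℕ} (E : IsClasp S D h) {X : Finset D.Crossing}
  {x : Finset S.Crossing}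

/-- The map of tensor powers given by the collapse of the clasp. -/
def collapseHom (M : Matches h X x) : Tensor (D.Circle X) →+* Tensor (S.Circle x) :=
  evalCircles (fun p => S.gen x (E.collapse p)) (fun _ _ hpq => gen_eq (E.collapse_joined M hpq))
    fun _ => gen_mul_self _

theorem collapseHom_gen (M : Matches h X x) (p : D.Point) :
    E.collapseHom M (D.gen X p) = S.gen x (E.collapse p) := evalCircles_gen _ _ _ p

/-- A map of tensor powers in the other direction. -/
def expandHom (hX : ∀ q q', S.circle x q = S.circle x q' →
    D.circle X (E.expand q) = D.circle X (E.expand q')) :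
    Tensor (S.Circle x) →+* Tensor (D.Circle X) :=
  evalCircles (fun q => D.gen X (E.expand q)) (fun q q' hq => gen_eq (hX q q' (circle_eq hq)))
    fun _ => gen_mul_self _

theorem expandHom_gen (hX : ∀ q q', S.circle x q = S.circle x q' →
    D.circle X (E.expand q) = D.circle X (E.expand q')) (q : S.Point) :
    E.expandHom hX (S.gen x q) = D.gen X (E.expand q) := evalCircles_gen _ _ _ q

section Mixed

theorem circle_expand_of_mixed (M : Matches h X x)
    (hX : D.resolves X (h + 1) = true ∧ D.resolves X (h + 2) = false ∨
      D.resolves X (h + 1) = false ∧ D.resolves X (h + 2) = true) (q q' : S.Point)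
    (hq : S.circle x q = S.circle x q') : D.circle X (E.expand q) = D.circle X (E.expand q') :=
  E.expand_eq M (fun _ _ => circle_eq) (fun j p q hp hq => by
    rw [(E.circle_mixed M hX).1 p (by rw [hp]) (by rw [hp]; simp),
      (E.circle_mixed M hX).1 q (by rw [hq]; simp) (by rw [hq])]) hq

theorem collapse_expandHom (M : Matches h X x) (hX : ∀ q q', S.circle x q = S.circle x q' →
    D.circle X (E.expand q) = D.circle X (E.expand q')) (r : Tensor (S.Circle x)) :
    E.collapseHom M (E.expandHom hX r) = r :=
  ringHom_ext (f := (E.collapseHom M).comp (E.expandHom hX)) (g := RingHom.id _) (fun q => by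
    rw [RingHom.comp_apply, expandHom_gen, collapseHom_gen, collapse_expand]
    rfl) r

theorem expand_collapseHom (M : Matches h X x)
    (hX : D.resolves X (h + 1) = true ∧ D.resolves X (h + 2) = false ∨
      D.resolves X (h + 1) = false ∧ D.resolves X (h + 2) = true) (r : Tensor (D.Circle X)) :
    E.expandHom (E.circle_expand_of_mixed M hX) (E.collapseHom M r) = r :=
  ringHom_ext (f := (E.expandHom (E.circle_expand_of_mixed M hX)).comp (E.collapseHom M))
    (g := RingHom.id _) (fun p => by
      rw [RingHom.comp_apply, collapseHom_gen, expandHom_gen]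
      exact gen_eq ((E.circle_mixed M hX).2 p)) r

end Mixed

section Low

open Classical in
/-- The tensor power for a smoothing in which neither of the crossings of the clasp is
`1`-smoothed; `ε` corresponds to the circle inside the clasp. -/
def lowHom (x : Finset S.Crossing) :
    Tensor (D.Circle (E.low x)) →+* DualNumber (Tensor (S.Circle x)) :=
  evalCircles (fun p => if Inner h p then DualNumber.eps else
      TrivSqZeroExt.inl (S.gen x (E.collapse p)))
    (fun p q hpq => by
      rw [E.inner_joined (E.low_one x) (E.low_two x) p q hpq,
        gen_eq (E.collapse_joined (E.matches_map x) hpq)])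
    fun p => by
      split_ifs
      · exact DualNumber.eps_mul_eps
      · rw [← TrivSqZeroExt.inl_mul, gen_mul_self, TrivSqZeroExt.inl_zero]

theorem lowHom_inner {p : D.Point} (hp : Inner h p) :
    E.lowHom x (D.gen _ p) = DualNumber.eps := (evalCircles_gen _ _ _ p).trans (if_pos hp)

theorem lowHom_outer {p : D.Point} (hp : ¬ Inner h p) :
    E.lowHom x (D.gen _ p) = TrivSqZeroExt.inl (S.gen x (E.collapse p)) :=
  (evalCircles_gen _ _ _ p).trans (if_neg hp)

/-- The tensor power of a smoothing of `S` as part of one of `D`. -/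
def lowExpand (x : Finset S.Crossing) : Tensor (S.Circle x) →+* Tensor (D.Circle (E.low x)) :=
  E.expandHom fun _ _ => E.circle_expand_low

theorem not_inner_expand (q : S.Point) : ¬ Inner h (E.expand q) := by
  rintro ⟨h1, h2, -⟩
  rcases le_or_gt q.1.1 h with h3 | h3
  · rw [E.expand_of_le h3] at h1
    omega
  · rw [E.expand_of_gt h3] at h2
    simp only at h2
    omega

theorem lowHom_lowExpand (r : Tensor (S.Circle x)) :
    E.lowHom x (E.lowExpand x r) = TrivSqZeroExt.inl r := by
  let f : Tensor (S.Circle x) →+* DualNumber (Tensor (S.Circle x)) := (E.lowHom x).comp (E.lowExpand x)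
  let g : Tensor (S.Circle x) →+* DualNumber (Tensor (S.Circle x)) := TrivSqZeroExt.inlHom _ _
  refine ringHom_ext (R := DualNumber (Tensor (S.Circle x))) (f := f) (g := g) (fun q => ?_) r
  change E.lowHom x (E.lowExpand x (S.gen x q)) = TrivSqZeroExt.inl (S.gen x q)
  rw [lowExpand, expandHom_gen, lowHom_outer E (E.not_inner_expand q), collapse_expand]

theorem exists_low_eq (t : Tensor (D.Circle (E.low x))) :
    ∃ a b, t = E.lowExpand x a + D.gen _ E.inside * E.lowExpand x b := by
  refine exists_eq_add_mul _ (gen_mul_self _) (fun p => ?_) t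
  by_cases hp : Inner h p
  · exact Or.inl (gen_eq (E.circle_inner (E.low_one x) (E.low_two x) hp))
  · refine Or.inr ⟨S.gen x (E.collapse p), ?_⟩
    rw [lowExpand, expandHom_gen]
    exact gen_eq (E.circle_outer (E.low_one x) (E.low_two x) hp).symm

theorem lowHom_add (a b : Tensor (S.Circle x)) :
    E.lowHom x (E.lowExpand x a + D.gen _ E.inside * E.lowExpand x b) =
      TrivSqZeroExt.inl a + TrivSqZeroExt.inr b := by
  rw [map_add, map_mul, lowHom_lowExpand, lowHom_lowExpand, lowHom_inner E E.inner_inside]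
  congr 1
  ext <;> simp

/-- The quotient by the part that does not contain the circle inside the clasp. -/
def lowQuotient (x : Finset S.Crossing) : Tensor (D.Circle (E.low x)) →+ Tensor (S.Circle x) where
  toFun t := (E.lowHom x t).snd
  map_zero' := by rw [map_zero, TrivSqZeroExt.snd_zero]
  map_add' t t' := by rw [map_add, TrivSqZeroExt.snd_add]

theorem lowQuotient_add (a b : Tensor (S.Circle x)) :
    E.lowQuotient x (E.lowExpand x a + D.gen _ E.inside * E.lowExpand x b) = b := by
  change (E.lowHom x _).snd = b
  rw [lowHom_add]
  simp

theorem lowQuotient_surjective (x : Finset S.Crossing) : Function.Surjective (E.lowQuotient x) :=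
  fun b => ⟨_, E.lowQuotient_add 0 b⟩

/-- Both sides are linear over the generators of `S`, so only the value at 1 matters. It is 1 or a
sum of two generators, according to whether a circle splits, and `bifurcates_low` says that this is
the same for both diagrams. -/
theorem cubeMap_lowExpand_insert {a : S.Crossing} (ha : a ∉ x)
    (hs : E.low x ⊆ E.low (insert a x)) (r : Tensor (S.Circle x)) :
    D.cubeMap (E.low x) (E.low (insert a x)) (E.lowExpand x r) =
      E.lowExpand (insert a x) (S.cubeMap x (insert a x) r) := by
  classical
  refine addHom_ext (f := (D.cubeMap (E.low x) (E.low (insert a x))).comp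
    (E.lowExpand x).toAddMonoidHom) (g := (E.lowExpand (insert a x)).toAddMonoidHom.comp
      (S.cubeMap x (insert a x))) (fun q => D.gen _ (E.expand q)) (fun q r => ?_) (fun q r => ?_) ?_ r
  · change D.cubeMap _ _ (E.lowExpand x _) = _ * D.cubeMap _ _ (E.lowExpand x r)
    rw [map_mul, lowExpand, expandHom_gen, cubeMap_gen_mul hs]
  · change E.lowExpand _ (S.cubeMap _ _ _) = _ * E.lowExpand _ (S.cubeMap _ _ _)
    rw [cubeMap_gen_mul (Finset.subset_insert a x), map_mul, lowExpand, expandHom_gen]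
  · change D.cubeMap _ _ (E.lowExpand x 1) = E.lowExpand _ (S.cubeMap _ _ 1)
    rw [(E.lowExpand x).map_one, cubeMap_insert_one ha]
    -- The target smoothing is a variable because the tensor power depends on it: the two
    -- descriptions of the set are equal, but not by definition.
    have key : ∀ y : Finset D.Crossing, y = insert (E.incl a) (E.low x) →
        D.cubeMap (E.low x) y 1 = if D.Bifurcates (E.low x) (E.incl a) then
          D.gen y (D.lowerLeft (E.incl a)) + D.gen y (D.upperRight (E.incl a)) else 1 := by
      rintro _ rfl
      exact cubeMap_insert_one fun h' => ha ((Finset.mem_map' _).1 h')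
    rw [key _ (E.low_insert x a)]
    by_cases hb : S.Bifurcates x a
    · rw [if_pos ((E.bifurcates_low x a).2 hb), if_pos hb, map_add, lowExpand, expandHom_gen,
        expandHom_gen, ← E.collapse_lowerLeft, ← E.collapse_upperRight]
      exact congrArg₂ (· + ·)
        (gen_eq (E.circle_outer (E.low_one _) (E.low_two _) (E.not_inner_lowerLeft a)).symm)
        (gen_eq (E.circle_outer (E.low_one _) (E.low_two _) (E.not_inner_upperRight a)).symm)
    · rw [if_neg fun h' => hb ((E.bifurcates_low x a).1 h'), if_neg hb, map_one]

theorem cubeMap_lowExpand {x y : Finset S.Crossing} (hxy : x ⊆ y) (r : Tensor (S.Circle x)) :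
    D.cubeMap (E.low x) (E.low y) (E.lowExpand x r) = E.lowExpand y (S.cubeMap x y r) := by
  refine CubeFunctor.subset_induction (P := fun x y => ∀ r, D.cubeMap (E.low x) (E.low y) (E.lowExpand x r) =
    E.lowExpand y (S.cubeMap x y r)) (fun x r => ?_) (fun x y a hxy ha ih r => ?_) hxy r
  · rw [cubeMap_self, cubeMap_self]
  · have hs : E.low y ⊆ E.low (insert a y) := Finset.map_subset_map.2 (Finset.subset_insert _ _)
    rw [← D.cubeMap_cubeMap (Finset.map_subset_map.2 hxy) hs, ih, E.cubeMap_lowExpand_insert ha hs,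
      S.cubeMap_cubeMap hxy (Finset.subset_insert _ _)]

/-- The changes at crossings of `S` do not involve the small circle, so they act on both
coefficients of 1 and u of that circle by the map of `S`. -/
theorem lowQuotient_cubeMap {x y : Finset S.Crossing} (hxy : x ⊆ y)
    (t : Tensor (D.Circle (E.low x))) :
    E.lowQuotient y (D.cubeMap (E.low x) (E.low y) t) = S.cubeMap x y (E.lowQuotient x t) := by
  obtain ⟨a, b, rfl⟩ := E.exists_low_eq t
  rw [lowQuotient_add, map_add, cubeMap_gen_mul (Finset.map_subset_map.2 hxy), E.cubeMap_lowExpand hxy,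
    E.cubeMap_lowExpand hxy, lowQuotient_add]

theorem mixed_first (x : Finset S.Crossing) :
    D.resolves (insert E.first (E.low x)) (h + 1) = true ∧
        D.resolves (insert E.first (E.low x)) (h + 2) = false ∨
      D.resolves (insert E.first (E.low x)) (h + 1) = false ∧
        D.resolves (insert E.first (E.low x)) (h + 2) = true :=
  Or.inl ⟨(E.resolves_insert_first _).1, (E.resolves_insert_first _).2.trans (E.low_two x)⟩

theorem mixed_second (x : Finset S.Crossing) :
    D.resolves (insert E.second (E.low x)) (h + 1) = true ∧
        D.resolves (insert E.second (E.low x)) (h + 2) = false ∨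
      D.resolves (insert E.second (E.low x)) (h + 1) = false ∧
        D.resolves (insert E.second (E.low x)) (h + 2) = true :=
  Or.inr ⟨(E.resolves_insert_second _).2.trans (E.low_one x), (E.resolves_insert_second _).1⟩

/-- The tensor powers of a smoothing of `S` and of one of `D` in which only the lower crossing of
the clasp is `1`-smoothed. -/
def firstExpand (x : Finset S.Crossing) :
    Tensor (S.Circle x) →+* Tensor (D.Circle (insert E.first (E.low x))) :=
  E.expandHom (E.circle_expand_of_mixed ((E.matches_map x).insert_first E) (E.mixed_first x))

/-- The inverse map. -/
def firstCollapse (x : Finset S.Crossing) :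
    Tensor (D.Circle (insert E.first (E.low x))) →+* Tensor (S.Circle x) :=
  E.collapseHom ((E.matches_map x).insert_first E)

theorem firstCollapse_firstExpand (r : Tensor (S.Circle x)) :
    E.firstCollapse x (E.firstExpand x r) = r := E.collapse_expandHom _ _ r

theorem firstExpand_firstCollapse (r : Tensor (D.Circle (insert E.first (E.low x)))) :
    E.firstExpand x (E.firstCollapse x r) = r := E.expand_collapseHom _ (E.mixed_first x) r

theorem not_bifurcates_low_first (x : Finset S.Crossing) : ¬ D.Bifurcates (E.low x) E.first := by
  intro h'
  have := eq_of_circle_eq (E.inner_joined (E.low_one x) (E.low_two x)) h'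
  simp [Inner, E.lowerLeft_first, E.upperRight_first] at this

/-- A merger with a circle that carries 1 does not change the other label. So the elements with 1 on
the small circle are mapped isomorphically. -/
theorem cubeMap_lowExpand_first (r : Tensor (S.Circle x)) :
    D.cubeMap (E.low x) (insert E.first (E.low x)) (E.lowExpand x r) = E.firstExpand x r := by
  classical
  refine addHom_ext (f := (D.cubeMap (E.low x) (insert E.first (E.low x))).comp
    (E.lowExpand x).toAddMonoidHom) (g := (E.firstExpand x).toAddMonoidHom)
      (fun q => D.gen _ (E.expand q)) (fun q r => ?_) (fun q r => ?_) ?_ r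
  · change D.cubeMap _ _ (E.lowExpand x _) = _ * D.cubeMap _ _ (E.lowExpand x r)
    rw [map_mul, lowExpand, expandHom_gen, cubeMap_gen_mul (Finset.subset_insert _ _)]
  · change E.firstExpand x _ = _ * E.firstExpand x _
    rw [map_mul, firstExpand, expandHom_gen]
  · change D.cubeMap _ _ (E.lowExpand x 1) = E.firstExpand x 1
    rw [(E.lowExpand x).map_one, (E.firstExpand x).map_one, cubeMap_insert_one (E.first_notMem_map x),
      if_neg (E.not_bifurcates_low_first x)]

theorem low_eq_zero {t : Tensor (D.Circle (E.low x))} (h1 : E.lowQuotient x t = 0)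
    (h2 : D.cubeMap (E.low x) (insert E.first (E.low x)) t = 0) : t = 0 := by
  obtain ⟨a, b, rfl⟩ := E.exists_low_eq t
  rw [lowQuotient_add] at h1
  subst h1
  rw [map_zero, mul_zero, add_zero, cubeMap_lowExpand_first] at h2
  have := congrArg (E.firstCollapse x) h2
  rw [firstCollapse_firstExpand, map_zero] at this
  rw [this, map_zero, mul_zero, add_zero]

theorem exists_low (s : Tensor (D.Circle (insert E.first (E.low x)))) :
    ∃ t, E.lowQuotient x t = 0 ∧ D.cubeMap (E.low x) (insert E.first (E.low x)) t = s := by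
  refine ⟨E.lowExpand x (E.firstCollapse x s), ?_, ?_⟩
  · have := E.lowQuotient_add (E.firstCollapse x s) 0
    rwa [map_zero, mul_zero, add_zero] at this
  · rw [cubeMap_lowExpand_first, firstExpand_firstCollapse]

end Low

end IsClasp

end

end Tangle
end Khovanov

/-! ### The part where both crossings of the clasp are 1-smoothed -/

namespace Khovanov
namespace Tangle

noncomputable section

namespace IsClasp

variable {S D : Tangle 0 0} {h : ℕ} (E : IsClasp S D h) {x : Finset S.Crossing}

open Classical in
/-- The map that collapses the clasp and changes the sign of the generators above it. -/
def highCollapse (x : Finset S.Crossing) : Tensor (D.Circle (E.high x)) →+* Tensor (S.Circle x) :=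
  evalCircles (fun p => if Upper h p then -S.gen x (E.collapse p) else S.gen x (E.collapse p))
    (fun p q hpq => by
      rw [E.upper_joined (E.high_one x) (E.high_two x) p q hpq,
        gen_eq (E.collapse_joined (E.matches_high x) hpq)])
    fun p => by
      split_ifs
      · exact (neg_mul_neg _ _).trans (gen_mul_self _)
      · rw [gen_mul_self]

theorem highCollapse_upper {p : D.Point} (hp : Upper h p) :
    E.highCollapse x (D.gen _ p) = -S.gen x (E.collapse p) :=
  (evalCircles_gen _ _ _ p).trans (if_pos hp)

theorem highCollapse_lower {p : D.Point} (hp : ¬ Upper h p) :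
    E.highCollapse x (D.gen _ p) = S.gen x (E.collapse p) :=
  (evalCircles_gen _ _ _ p).trans (if_neg hp)

theorem highCollapse_top : E.highCollapse x (D.gen _ E.top) = -S.gen x E.base := by
  rw [E.highCollapse_upper E.upper_top, collapse_top]

theorem highCollapse_bottom : E.highCollapse x (D.gen _ E.bottom) = S.gen x E.base := by
  rw [E.highCollapse_lower E.not_upper_bottom, collapse_bottom]

/-- The map in the other direction that only meets the lower one of the two circles through the
clasp. -/
def highExpand (x : Finset S.Crossing) : Tensor (S.Circle x) →+* Tensor (D.Circle (E.high x)) :=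
  evalCircles (fun q => factor (E.glue (E.high x) (E.expand q)) u)
    (fun q q' hq => by
      rw [E.glue_expand_eq (E.high_one x) (E.high_two x) (E.matches_high x) (circle_eq hq)])
    fun _ => factor_u_mul_self _

theorem highExpand_gen (q : S.Point) : E.highExpand x (S.gen x q) =
    factor (E.glue (E.high x) (E.expand q)) u := evalCircles_gen _ _ _ q

theorem highExpand_of_eq {q : S.Point}
    (hq : D.circle (E.high x) (E.expand q) = D.circle (E.high x) E.top) :
    E.highExpand x (S.gen x q) = D.gen _ E.bottom := by
  rw [highExpand_gen, glue, if_pos hq]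
  rfl

theorem highExpand_of_ne {q : S.Point}
    (hq : D.circle (E.high x) (E.expand q) ≠ D.circle (E.high x) E.top) :
    E.highExpand x (S.gen x q) = D.gen _ (E.expand q) := by
  rw [highExpand_gen, glue, if_neg hq]
  rfl

theorem gen_of_eq {q : S.Point}
    (hq : D.circle (E.high x) (E.expand q) = D.circle (E.high x) E.top) :
    S.gen x q = S.gen x E.base := by
  have := gen_eq (E.circle_collapse (E.matches_high x) hq)
  rwa [collapse_expand, collapse_top] at this

theorem bottom_ne_top : D.circle (E.high x) E.bottom ≠ D.circle (E.high x) E.top :=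
  E.circle_bottom_ne_top (E.high_one x) (E.high_two x)

theorem highExpand_base : E.highExpand x (S.gen x E.base) = D.gen _ E.bottom := by
  rw [highExpand_of_ne] <;> rw [expand_base]
  exact E.bottom_ne_top

theorem highCollapse_highExpand_base :
    E.highCollapse x (E.highExpand x (S.gen x E.base)) = S.gen x E.base := by
  rw [highExpand_base, highCollapse_bottom]

/-- The composition of the two maps is an involution. -/
theorem highCollapse_highExpand_involutive (r : Tensor (S.Circle x)) :
    E.highCollapse x (E.highExpand x (E.highCollapse x (E.highExpand x r))) = r := by
  refine ringHom_ext (f := ((E.highCollapse x).comp (E.highExpand x)).comp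
    ((E.highCollapse x).comp (E.highExpand x))) (g := RingHom.id _) (fun q => ?_) r
  change E.highCollapse x (E.highExpand x (E.highCollapse x (E.highExpand x (S.gen x q)))) = S.gen x q
  by_cases hq : D.circle (E.high x) (E.expand q) = D.circle (E.high x) E.top
  · rw [E.highExpand_of_eq hq, highCollapse_bottom, highCollapse_highExpand_base, E.gen_of_eq hq]
  · rw [E.highExpand_of_ne hq]
    by_cases hp : Upper h (E.expand q)
    · rw [E.highCollapse_upper hp, collapse_expand, map_neg, map_neg, E.highExpand_of_ne hq,
        E.highCollapse_upper hp, collapse_expand, neg_neg]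
    · rw [E.highCollapse_lower hp, collapse_expand, E.highExpand_of_ne hq,
        E.highCollapse_lower hp, collapse_expand]

open Classical in
/-- The tensor power for a smoothing in which both crossings of the clasp are `1`-smoothed; `ε`
corresponds to the upper one of the two circles through the clasp. -/
def highHom (x : Finset S.Crossing) :
    Tensor (D.Circle (E.high x)) →+* DualNumber (Tensor (S.Circle x)) :=
  evalCircles (fun p => if D.circle (E.high x) p = D.circle (E.high x) E.top then DualNumber.eps else
      TrivSqZeroExt.inl (S.gen x (E.collapse p)))
    (fun p q hpq => by
      rw [circle_eq hpq, gen_eq (E.collapse_joined (E.matches_high x) hpq)])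
    fun p => by
      split_ifs
      · exact DualNumber.eps_mul_eps
      · rw [← TrivSqZeroExt.inl_mul, gen_mul_self, TrivSqZeroExt.inl_zero]

theorem highHom_of_eq {p : D.Point} (hp : D.circle (E.high x) p = D.circle (E.high x) E.top) :
    E.highHom x (D.gen _ p) = DualNumber.eps := (evalCircles_gen _ _ _ p).trans (if_pos hp)

theorem highHom_of_ne {p : D.Point} (hp : D.circle (E.high x) p ≠ D.circle (E.high x) E.top) :
    E.highHom x (D.gen _ p) = TrivSqZeroExt.inl (S.gen x (E.collapse p)) :=
  (evalCircles_gen _ _ _ p).trans (if_neg hp)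

theorem highHom_highExpand (r : Tensor (S.Circle x)) :
    E.highHom x (E.highExpand x r) = TrivSqZeroExt.inl r := by
  let f : Tensor (S.Circle x) →+* DualNumber (Tensor (S.Circle x)) := (E.highHom x).comp (E.highExpand x)
  let g : Tensor (S.Circle x) →+* DualNumber (Tensor (S.Circle x)) := TrivSqZeroExt.inlHom _ _
  refine ringHom_ext (R := DualNumber (Tensor (S.Circle x))) (f := f) (g := g) (fun q => ?_) r
  change E.highHom x (E.highExpand x (S.gen x q)) = TrivSqZeroExt.inl (S.gen x q)
  by_cases hq : D.circle (E.high x) (E.expand q) = D.circle (E.high x) E.top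
  · rw [E.highExpand_of_eq hq, E.highHom_of_ne E.bottom_ne_top, collapse_bottom, E.gen_of_eq hq]
  · rw [E.highExpand_of_ne hq, E.highHom_of_ne hq, collapse_expand]

theorem exists_high_eq (t : Tensor (D.Circle (E.high x))) :
    ∃ a b, t = E.highExpand x a + D.gen _ E.top * E.highExpand x b := by
  refine exists_eq_add_mul _ (gen_mul_self _) (fun p => ?_) t
  by_cases hp : D.circle (E.high x) p = D.circle (E.high x) E.top
  · exact Or.inl (gen_eq hp)
  · refine Or.inr ⟨S.gen x (E.collapse p), ?_⟩
    rw [highExpand_gen, E.glue_expand_collapse (E.high_one x) (E.high_two x), glue, if_neg hp]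
    rfl

theorem highCollapse_surjective (x : Finset S.Crossing) : Function.Surjective (E.highCollapse x) :=
  fun r => ⟨_, E.highCollapse_highExpand_involutive r⟩

theorem gen_high_upper {p : D.Point} (h1 : h ≤ p.1.1) (h2 : p.1.1 ≤ h + 4) (hp : Upper h p) :
    D.gen (E.high x) p = D.gen _ E.top :=
  gen_eq ((E.circle_clasp (E.high_one x) (E.high_two x) h1 h2).resolve_left fun h' =>
    E.not_upper_bottom ((E.upper_iff (E.high_one x) (E.high_two x) h').1 hp))

theorem gen_high_lower {p : D.Point} (h1 : h ≤ p.1.1) (h2 : p.1.1 ≤ h + 4) (hp : ¬ Upper h p) :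
    D.gen (E.high x) p = D.gen _ E.bottom :=
  gen_eq ((E.circle_clasp (E.high_one x) (E.high_two x) h1 h2).resolve_right fun h' =>
    hp ((E.upper_iff (E.high_one x) (E.high_two x) h').2 E.upper_top))

/-- The tensor powers of a smoothing of `S` and of one of `D` in which only the upper crossing of
the clasp is `1`-smoothed. -/
def secondExpand (x : Finset S.Crossing) :
    Tensor (S.Circle x) →+* Tensor (D.Circle (insert E.second (E.low x))) :=
  E.expandHom (E.circle_expand_of_mixed ((E.matches_map x).insert_second E) (E.mixed_second x))

/-- The inverse map. -/
def secondCollapse (x : Finset S.Crossing) :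
    Tensor (D.Circle (insert E.second (E.low x))) →+* Tensor (S.Circle x) :=
  E.collapseHom ((E.matches_map x).insert_second E)

theorem secondExpand_secondCollapse (r : Tensor (D.Circle (insert E.second (E.low x)))) :
    E.secondExpand x (E.secondCollapse x r) = r := E.expand_collapseHom _ (E.mixed_second x) r

theorem first_notMem (x : Finset S.Crossing) : E.first ∉ insert E.second (E.low x) := fun h' =>
  (Finset.mem_insert.1 h').elim E.first_ne_second (E.first_notMem_map x)

theorem second_notMem (x : Finset S.Crossing) : E.second ∉ insert E.first (E.low x) := fun h' =>
  (Finset.mem_insert.1 h').elim E.first_ne_second.symm (E.second_notMem_map x)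

theorem cubeMap_second_one (x : Finset S.Crossing) :
    D.cubeMap (insert E.second (E.low x)) (E.high x) 1 = D.gen _ E.bottom + D.gen _ E.top := by
  classical
  have h1 := E.lowerLeft_first
  have h2 := E.upperRight_first
  have hb : D.Bifurcates (insert E.second (E.low x)) E.first := by
    have := (E.circle_mixed ((E.matches_map x).insert_second E) (E.mixed_second x)).1
    exact (this _ (by rw [h1]; simp) (by rw [h1]; simp)).trans
      (this _ (by rw [h2]; simp) (by rw [h2]; simp)).symm
  refine (cubeMap_insert_one (E.first_notMem x)).trans ?_
  rw [if_pos hb]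
  exact congrArg₂ (· + ·)
    (E.gen_high_lower (by rw [h1]; simp) (by rw [h1]; simp) (by unfold Upper; rw [h1]; simp))
    (E.gen_high_upper (by rw [h2]; simp) (by rw [h2]; simp) (by unfold Upper; rw [h2]; simp))

theorem cubeMap_first_one (x : Finset S.Crossing) :
    D.cubeMap (insert E.first (E.low x)) (E.high x) 1 = D.gen _ E.bottom + D.gen _ E.top := by
  classical
  have h1 := E.lowerLeft_second
  have h2 := E.upperRight_second
  have hb : D.Bifurcates (insert E.first (E.low x)) E.second := by
    have := (E.circle_mixed ((E.matches_map x).insert_first E) (E.mixed_first x)).1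
    exact (this _ (by rw [h1]; simp) (by rw [h1]; simp)).trans
      (this _ (by rw [h2]; simp) (by rw [h2]; simp)).symm
  have key : ∀ y : Finset D.Crossing, y = insert E.second (insert E.first (E.low x)) →
      D.cubeMap (insert E.first (E.low x)) y 1 =
        D.gen y (D.lowerLeft E.second) + D.gen y (D.upperRight E.second) := by
    rintro _ rfl
    rw [cubeMap_insert_one (E.second_notMem x), if_pos hb]
  rw [key _ (E.insert_second_insert_first x).symm]
  exact congrArg₂ (· + ·)
    (E.gen_high_lower (by rw [h1]; simp) (by rw [h1]; simp) (by unfold Upper; rw [h1]; simp))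
    (E.gen_high_upper (by rw [h2]; simp) (by rw [h2]; simp) (by unfold Upper; rw [h2]; simp))

theorem insert_first_subset (x : Finset S.Crossing) : insert E.first (E.low x) ⊆ E.high x :=
  Finset.insert_subset_insert _ (Finset.subset_insert _ _)

/-- The image of 1 is the sum of the generators of the two circles through the clasp, and
`highCollapse` sends these to negatives of each other; linearity over the generators does the rest.
-/
theorem highCollapse_cubeMap_first (t : Tensor (D.Circle (insert E.first (E.low x)))) :
    E.highCollapse x (D.cubeMap (insert E.first (E.low x)) (E.high x) t) = 0 := by
  refine addHom_ext (f := (E.highCollapse x).toAddMonoidHom.comp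
    (D.cubeMap (insert E.first (E.low x)) (E.high x))) (g := 0)
      (fun p => E.highCollapse x (D.gen _ p)) (fun p r => ?_) (fun p r => ?_) ?_ t
  · change E.highCollapse x (D.cubeMap _ _ _) = _ * E.highCollapse x (D.cubeMap _ _ _)
    rw [cubeMap_gen_mul (E.insert_first_subset x), map_mul]
  · exact (mul_zero _).symm
  · change E.highCollapse x (D.cubeMap _ _ _) = 0
    rw [cubeMap_first_one, map_add, highCollapse_top, highCollapse_bottom, add_neg_cancel]

theorem highCollapse_cubeMap_second (t : Tensor (D.Circle (insert E.second (E.low x)))) :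
    E.highCollapse x (D.cubeMap (insert E.second (E.low x)) (E.high x) t) = 0 := by
  refine addHom_ext (f := (E.highCollapse x).toAddMonoidHom.comp
    (D.cubeMap (insert E.second (E.low x)) (E.high x))) (g := 0)
      (fun p => E.highCollapse x (D.gen _ p)) (fun p r => ?_) (fun p r => ?_) ?_ t
  · change E.highCollapse x (D.cubeMap _ _ _) = _ * E.highCollapse x (D.cubeMap _ _ _)
    rw [cubeMap_gen_mul (Finset.subset_insert _ _), map_mul]
  · exact (mul_zero _).symm
  · change E.highCollapse x (D.cubeMap _ _ _) = 0
    rw [cubeMap_second_one, map_add, highCollapse_top, highCollapse_bottom, add_neg_cancel]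

/-- This is the comultiplication in the form Δ(v) = (v ⊗ 1) Δ(1): `highExpand` puts the label of the
divided circle on the lower piece. -/
theorem cubeMap_secondExpand (r : Tensor (S.Circle x)) :
    D.cubeMap (insert E.second (E.low x)) (E.high x) (E.secondExpand x r) =
      E.highExpand x r * (D.gen _ E.bottom + D.gen _ E.top) := by
  refine addHom_ext (f := (D.cubeMap (insert E.second (E.low x)) (E.high x)).comp
    (E.secondExpand x).toAddMonoidHom)
      (g := (AddMonoidHom.mulRight (D.gen _ E.bottom + D.gen _ E.top)).comp
        (E.highExpand x).toAddMonoidHom)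
      (fun q => D.gen _ (E.expand q)) (fun q r => ?_) (fun q r => ?_) ?_ r
  · change D.cubeMap _ _ (E.secondExpand x _) = _ * D.cubeMap _ _ (E.secondExpand x r)
    rw [map_mul, secondExpand, expandHom_gen, cubeMap_gen_mul (Finset.subset_insert _ _)]
  · change E.highExpand x _ * _ = _ * (E.highExpand x r * _)
    rw [map_mul]
    by_cases hq : D.circle (E.high x) (E.expand q) = D.circle (E.high x) E.top
    · rw [E.highExpand_of_eq hq, gen_eq hq]
      -- On the sum of the two generators both of them act in the same way, because their squares
      -- vanish.
      linear_combination E.highExpand x r * (gen_mul_self (x := E.high x) E.bottom -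
        gen_mul_self (x := E.high x) E.top)
    · rw [E.highExpand_of_ne hq, mul_assoc]
  · change D.cubeMap _ _ (E.secondExpand x 1) = E.highExpand x 1 * _
    rw [(E.secondExpand x).map_one, (E.highExpand x).map_one, one_mul, cubeMap_second_one]

/-- The coefficient of the upper generator in the product of `highExpand x r` with the sum of the
two generators is r itself. -/
theorem cubeMap_second_injective (x : Finset S.Crossing) :
    Function.Injective (D.cubeMap (insert E.second (E.low x)) (E.high x)) := by
  refine (injective_iff_map_eq_zero _).2 fun t ht => ?_
  rw [← E.secondExpand_secondCollapse t, cubeMap_secondExpand] at ht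
  have := congrArg (fun r => (E.highHom x r).snd) ht
  change (E.highHom x _).snd = (E.highHom x 0).snd at this
  rw [map_mul, map_add, highHom_highExpand, E.highHom_of_eq rfl, E.highHom_of_ne E.bottom_ne_top,
    map_zero] at this
  have h0 : E.secondCollapse x t = 0 := by simpa using this
  rw [← E.secondExpand_secondCollapse t, h0, map_zero]

/-- Let an element have coefficients a and b of 1 and of the upper generator. If it collapses to 0,
the involution `highCollapse` ∘ `highExpand`, which fixes the generator of the divided circle, shows
that a is that generator times b. Then the element is the comultiplication applied to b. -/
theorem exists_cubeMap_second_eq {t : Tensor (D.Circle (E.high x))} (ht : E.highCollapse x t = 0) :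
    ∃ s, D.cubeMap (insert E.second (E.low x)) (E.high x) s = t := by
  obtain ⟨a, b, rfl⟩ := E.exists_high_eq t
  refine ⟨E.secondExpand x b, ?_⟩
  have hab : a = S.gen x E.base * b := by
    rw [map_add, map_mul, highCollapse_top] at ht
    replace ht : E.highCollapse x (E.highExpand x a) =
        S.gen x E.base * E.highCollapse x (E.highExpand x b) :=
      (eq_neg_of_add_eq_zero_left ht).trans ((congrArg Neg.neg (neg_mul (S.gen x E.base)
        (E.highCollapse x (E.highExpand x b)))).trans (neg_neg _))
    rw [← E.highCollapse_highExpand_involutive a, ht, map_mul, map_mul, highCollapse_highExpand_base,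
      highCollapse_highExpand_involutive]
  rw [cubeMap_secondExpand, hab, map_mul, highExpand_base]
  ring

end IsClasp

end

end Tangle
end Khovanov

/-! ### Signs above the clasp and the doubling of the cube -/

namespace Khovanov
namespace Tangle

/-- The number of splittings at crossings of a certain kind does not depend on the order in which
the crossings are changed. -/
theorem countP_splits_perm (D : Tangle 0 0) (P : D.Crossing → Bool) {l l' : List D.Crossing}
    (hp : l.Perm l') (x : Finset D.Crossing) (hl : l.Nodup) (hx : ∀ c ∈ l, c ∉ x)
    (H : ∀ y c d, c ∈ l → d ∈ l → x ⊆ y → (D.circle y (D.lowerLeft c) = D.circle y (D.lowerLeft d) ∨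
      D.circle y (D.lowerLeft c) = D.circle y (D.upperRight d)) → P c = P d) :
    (D.splits x l).countP P = (D.splits x l').countP P := by
  induction hp generalizing x with
  | nil => rfl
  | cons c _ ih =>
    have ih' := ih (insert c x) (List.nodup_cons.1 hl).2 (fun d hd hd' => by
        rcases Finset.mem_insert.1 hd' with rfl | h
        · exact (List.nodup_cons.1 hl).1 hd
        · exact hx d (by simp [hd]) h)
      fun y a b ha hb hy => H y a b (List.mem_cons_of_mem _ ha) (List.mem_cons_of_mem _ hb)
        ((Finset.subset_insert _ _).trans hy)
    simp only [splits]
    split_ifs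
    · rw [List.countP_cons, List.countP_cons, ih']
    · exact ih'
  | swap c d l =>
    have hcd : c ≠ d := by
      rintro rfl
      simp at hl
    have hc : c ∉ x := hx c (by simp)
    have hd : d ∉ x := hx d (by simp)
    have hsub : x ⊆ insert c (insert d x) :=
      (Finset.subset_insert _ _).trans (Finset.subset_insert _ _)
    have H' := fun h => H (insert c (insert d x)) c d (by simp) (by simp) hsub h
    simp only [splits, Finset.insert_comm d c]
    by_cases h1 : D.Bifurcates x c <;> by_cases h2 : D.Bifurcates (insert d x) c
    · by_cases h3 : D.Bifurcates x d <;> by_cases h4 : D.Bifurcates (insert c x) d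
      · simp only [if_pos h1, if_pos h2, if_pos h3, if_pos h4, List.countP_cons]
        omega
      · exact absurd h2 (D.square hd hc hcd.symm h3 h4).2.1
      · exact absurd h1 (D.square' hd hc hcd.symm h3 h4).1
      · simp only [if_pos h1, if_pos h2, if_neg h3, if_neg h4]
    -- When the order of two crossings matters for which of them splits a circle, they share a
    -- circle after both changes, so that P does not distinguish them.
    · obtain ⟨h3, h4, h5, -⟩ := D.square hc hd hcd h1 h2
      simp only [if_pos h1, if_neg h2, if_pos h3, if_neg h4, List.countP_cons, H' (Or.inl h5)]
    · obtain ⟨h3, h4, h5⟩ := D.square' hc hd hcd h1 h2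
      have : P c = P d := H' (h5.imp (fun h => h.1) fun h => h.1)
      simp only [if_neg h1, if_pos h2, if_neg h3, if_pos h4, List.countP_cons, this]
    · by_cases h3 : D.Bifurcates x d <;> by_cases h4 : D.Bifurcates (insert c x) d
      · simp only [if_neg h1, if_neg h2, if_pos h3, if_pos h4]
      · exact absurd (D.square hd hc hcd.symm h3 h4).1 h1
      · exact absurd (D.square' hd hc hcd.symm h3 h4).2.1 h2
      · simp only [if_neg h1, if_neg h2, if_neg h3, if_neg h4]
  | trans h1 h2 ih1 ih2 =>
    rw [ih1 x hl hx H, ih2 x (h1.nodup_iff.1 hl) (fun c hc => hx c (h1.mem_iff.2 hc))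
      fun y c d hc hd => H y c d (h1.mem_iff.2 hc) (h1.mem_iff.2 hd)]

noncomputable section

theorem neg_gen_mul {D : Tangle 0 0} {x : Finset D.Crossing} (p : D.Point) (r : Tensor (D.Circle x)) :
    -D.gen x p * r = -(D.gen x p * r) := neg_mul (D.gen x p) r

namespace IsClasp

variable {S D : Tangle 0 0} {h : ℕ} (E : IsClasp S D h) {x : Finset S.Crossing}

open Classical in
/-- The number of splittings above the clasp on the way to a smoothing. -/
def splitCount (x : Finset S.Crossing) : ℕ :=
  (D.splits (E.high ∅) ((x.map E.incl).sort (· ≤ ·))).countP fun c => decide (Upper h (D.lowerLeft c))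

theorem resolves_of_subset {y : Finset D.Crossing} (hy : E.high ∅ ⊆ y) :
    D.resolves y (h + 1) = true ∧ D.resolves y (h + 2) = true := by
  constructor
  · exact decide_eq_true ⟨E.first, hy (by simp), rfl⟩
  · exact decide_eq_true ⟨E.second, hy (by simp), rfl⟩

-- The count does not depend on the order, so the new crossing may be changed last. The hypothesis
-- for this holds because two crossings on a common circle are on the same side of the cut.
open Classical in
theorem splitCount_insert {a : S.Crossing} (ha : a ∉ x) : E.splitCount (insert a x) =
    E.splitCount x + if h ≤ a.1.1 ∧ S.Bifurcates x a then 1 else 0 := by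
  have hnd : ((x.map E.incl).sort (· ≤ ·) ++ [E.incl a]).Nodup := by
    refine List.Nodup.append (Finset.sort_nodup _ _) (List.nodup_singleton _) fun c hc hc' => ha ?_
    rw [List.mem_singleton] at hc'
    rw [Finset.mem_sort, hc'] at hc
    exact (Finset.mem_map' _).1 hc
  have hperm : (((insert a x).map E.incl).sort (· ≤ ·)).Perm ((x.map E.incl).sort (· ≤ ·) ++ [E.incl a]) := by
    refine (List.perm_ext_iff_of_nodup (Finset.sort_nodup _ _) hnd).2 fun c => ?_
    rw [Finset.mem_sort, Finset.map_insert, Finset.mem_insert, List.mem_append, Finset.mem_sort,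
      List.mem_singleton, or_comm]
  have hrange : ∀ c ∈ ((insert a x).map E.incl).sort (· ≤ ·), ∃ b, E.incl b = c := fun c hc => by
    obtain ⟨b, -, hb⟩ := Finset.mem_map.1 ((Finset.mem_sort _).1 hc)
    exact ⟨b, hb⟩
  have hunion : E.high ∅ ∪ ((x.map E.incl).sort (· ≤ ·)).toFinset = E.high x := by
    rw [Finset.sort_toFinset, high, high, Finset.insert_union, Finset.insert_union, Finset.map_empty,
      Finset.empty_union]
  unfold splitCount
  rw [D.countP_splits_perm _ hperm _ (Finset.sort_nodup _ _) (fun c hc hc' => ?_)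
    (fun y c d hc hd hy hcd => ?_), splits_append, List.countP_append, hunion]
  · congr 1
    simp only [splits, E.bifurcates_high]
    by_cases hb : S.Bifurcates x a
    · rw [if_pos hb, List.countP_singleton]
      simp only [hb, and_true, decide_eq_true_eq]
      exact if_congr (E.upper_lowerLeft a) rfl rfl
    · simp [hb]
  · obtain ⟨b, rfl⟩ := hrange c hc
    simp only [high, Finset.map_empty, Finset.mem_insert, Finset.notMem_empty, or_false] at hc'
    exact hc'.elim (E.incl_ne_first b) (E.incl_ne_second b)
  · obtain ⟨b, rfl⟩ := hrange c hc
    obtain ⟨b', rfl⟩ := hrange d hd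
    obtain ⟨h1, h2⟩ := E.resolves_of_subset hy
    apply Bool.decide_congr
    rcases hcd with h' | h'
    · exact E.upper_iff h1 h2 h'
    · exact (E.upper_iff h1 h2 h').trans ((E.upper_upperRight b').trans (E.upper_lowerLeft b').symm)

-- `highCollapse` changes the sign of every generator above the clasp. A merger corresponds to the
-- value 1 and produces no sign, while the value of a splitting is linear in the generators and so
-- produces a sign if it takes place above the clasp.
open Classical in
theorem highCollapse_cubeMap_insert {a : S.Crossing} (ha : a ∉ x)
    (hs : E.high x ⊆ E.high (insert a x)) (t : Tensor (D.Circle (E.high x))) :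
    E.highCollapse (insert a x) (D.cubeMap (E.high x) (E.high (insert a x)) t) =
      (if h ≤ a.1.1 ∧ S.Bifurcates x a then -1 else 1 : ℤ) •
        S.cubeMap x (insert a x) (E.highCollapse x t) := by
  generalize hσ : (if h ≤ a.1.1 ∧ S.Bifurcates x a then -1 else 1 : ℤ) = σ
  refine addHom_ext (f := (E.highCollapse (insert a x)).toAddMonoidHom.comp
    (D.cubeMap (E.high x) (E.high (insert a x)))) (g := σ •
      (S.cubeMap x (insert a x)).comp (E.highCollapse x).toAddMonoidHom)
    (fun p => E.highCollapse (insert a x) (D.gen _ p)) (fun p r => ?_) (fun p r => ?_) ?_ t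
  · change E.highCollapse _ (D.cubeMap _ _ _) = _ * E.highCollapse _ (D.cubeMap _ _ _)
    rw [cubeMap_gen_mul hs, map_mul]
  · change σ • S.cubeMap x (insert a x) (E.highCollapse x _) =
      _ * σ • S.cubeMap x (insert a x) (E.highCollapse x r)
    rw [map_mul, mul_smul_comm]
    congr 1
    by_cases hp : Upper h p
    · rw [E.highCollapse_upper hp, E.highCollapse_upper hp, neg_gen_mul, map_neg,
        cubeMap_gen_mul (Finset.subset_insert a x), neg_gen_mul]
    · rw [E.highCollapse_lower hp, E.highCollapse_lower hp,
        cubeMap_gen_mul (Finset.subset_insert a x)]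
  · change E.highCollapse (insert a x) (D.cubeMap _ _ 1) = σ • S.cubeMap x (insert a x) (E.highCollapse x 1)
    subst hσ
    have key : ∀ y : Finset D.Crossing, y = insert (E.incl a) (E.high x) →
        D.cubeMap (E.high x) y 1 = if D.Bifurcates (E.high x) (E.incl a) then
          D.gen y (D.lowerLeft (E.incl a)) + D.gen y (D.upperRight (E.incl a)) else 1 := by
      rintro _ rfl
      exact cubeMap_insert_one (E.incl_notMem_high ha)
    rw [key _ (E.high_insert x a), (E.highCollapse x).map_one, cubeMap_insert_one ha]
    by_cases hb : S.Bifurcates x a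
    · rw [if_pos ((E.bifurcates_high x a).2 hb), if_pos hb, map_add]
      by_cases hk : h ≤ a.1.1
      · rw [if_pos ⟨hk, hb⟩, E.highCollapse_upper ((E.upper_lowerLeft a).2 hk),
          E.highCollapse_upper ((E.upper_upperRight a).2 hk), collapse_lowerLeft, collapse_upperRight,
          neg_one_zsmul, neg_add]
      · rw [if_neg fun h' => hk h'.1, E.highCollapse_lower fun h' => hk ((E.upper_lowerLeft a).1 h'),
          E.highCollapse_lower fun h' => hk ((E.upper_upperRight a).1 h'), collapse_lowerLeft,
          collapse_upperRight, one_zsmul]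
    · rw [if_neg fun h' => hb ((E.bifurcates_high x a).1 h'), if_neg fun h' => hb h'.2, if_neg hb,
        map_one, one_zsmul]

/-- The map `highCollapse` with such signs that it is compatible with the maps of the cubes. -/
def highQuotient (x : Finset S.Crossing) : Tensor (D.Circle (E.high x)) →+ Tensor (S.Circle x) :=
  ((-1 : ℤ) ^ E.splitCount x) • (E.highCollapse x).toAddMonoidHom

theorem highQuotient_apply (t : Tensor (D.Circle (E.high x))) :
    E.highQuotient x t = ((-1 : ℤ) ^ E.splitCount x) • E.highCollapse x t := rfl

theorem sign_mul_self (n : ℕ) : ((-1 : ℤ) ^ n) * (-1) ^ n = 1 := by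
  rw [← pow_add, ← two_mul, pow_mul, neg_one_sq, one_pow]

theorem highQuotient_eq_zero {t : Tensor (D.Circle (E.high x))} (ht : E.highQuotient x t = 0) :
    E.highCollapse x t = 0 := by
  rw [highQuotient_apply] at ht
  rw [← one_smul ℤ (E.highCollapse x t), ← sign_mul_self (E.splitCount x), mul_smul, ht, smul_zero]

theorem highQuotient_surjective (x : Finset S.Crossing) : Function.Surjective (E.highQuotient x) := by
  intro r
  obtain ⟨t, ht⟩ := E.highCollapse_surjective x (((-1 : ℤ) ^ E.splitCount x) • r)
  exact ⟨t, by rw [highQuotient_apply, ht, ← mul_smul, sign_mul_self, one_smul]⟩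

theorem high_mono {x y : Finset S.Crossing} (hxy : x ⊆ y) : E.high x ⊆ E.high y :=
  Finset.insert_subset_insert _ (Finset.insert_subset_insert _ (Finset.map_subset_map.2 hxy))

/-- One crossing at a time, the sign produced by `highCollapse` is the ratio of the signs attached
to the two smoothings, as `splitCount` increases exactly at the splittings above the clasp. -/
theorem highQuotient_cubeMap {x y : Finset S.Crossing} (hxy : x ⊆ y)
    (t : Tensor (D.Circle (E.high x))) :
    E.highQuotient y (D.cubeMap (E.high x) (E.high y) t) = S.cubeMap x y (E.highQuotient x t) := by
  classical
  refine CubeFunctor.subset_induction (P := fun x y => ∀ t,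
    E.highQuotient y (D.cubeMap (E.high x) (E.high y) t) = S.cubeMap x y (E.highQuotient x t))
    (fun x t => ?_) (fun x y a hxy ha ih t => ?_) hxy t
  · rw [cubeMap_self, cubeMap_self]
  · have hs := E.high_mono (Finset.subset_insert a y)
    rw [← D.cubeMap_cubeMap (E.high_mono hxy) hs, ← S.cubeMap_cubeMap hxy (Finset.subset_insert a y),
      ← ih, highQuotient_apply, E.highCollapse_cubeMap_insert ha hs, E.splitCount_insert ha,
      highQuotient_apply, map_zsmul, ← mul_smul]
    congr 1
    split_ifs
    · rw [pow_succ]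
      ring
    · ring

theorem highQuotient_cubeMap_first (t : Tensor (D.Circle (insert E.first (E.low x)))) :
    E.highQuotient x (D.cubeMap (insert E.first (E.low x)) (E.high x) t) = 0 := by
  rw [highQuotient_apply, highCollapse_cubeMap_first, smul_zero]

theorem highQuotient_cubeMap_second (t : Tensor (D.Circle (insert E.second (E.low x)))) :
    E.highQuotient x (D.cubeMap (insert E.second (E.low x)) (E.high x) t) = 0 := by
  rw [highQuotient_apply, highCollapse_cubeMap_second, smul_zero]

/-- The Khovanov cube of `D` is the one of `S` and a shifted copy of it, up to an acyclic part. -/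
def doubling : D.cube.Doubling S.cube where
  incl := { E.incl with
    map_rel_iff' := fun {a b} => not_lt.symm.trans ((not_congr (E.incl_lt_iff b a)).trans not_lt) }
  c := E.first
  d := E.second
  ne := E.first_ne_second
  c_ne := E.incl_ne_first
  d_ne := E.incl_ne_second
  cover := E.crossing_cover
  lt_iff := E.first_lt_iff
  α x := E.lowQuotient x
  β x := E.highQuotient x
  α_map hxy _ t := E.lowQuotient_cubeMap hxy t
  β_map hxy _ t := E.highQuotient_cubeMap hxy t
  β_map_c _ t := E.highQuotient_cubeMap_second t
  β_map_d _ _ t := E.highQuotient_cubeMap_first t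
  α_surjective := E.lowQuotient_surjective
  β_surjective := E.highQuotient_surjective
  map_injective _ _ h1 h2 := E.low_eq_zero h1 h2
  map_surjective _ s := E.exists_low s
  map_injective' x := E.cubeMap_second_injective x
  map_surjective' _ _ ht := E.exists_cubeMap_second_eq (E.highQuotient_eq_zero ht)

end IsClasp

end

end Tangle
end Khovanov

/-! ### Negative crossings -/

namespace Khovanov
namespace Tangle

theorem negative_iff {m n m' n' : ℕ} {T : Tangle m n} {T' : Tangle m' n'} (o : T.Orientation)
    (o' : T'.Orientation) {c : T.Crossing} {c' : T'.Crossing} (hs : T.slice c.1 = T'.slice c'.1)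
    (hu : ∀ j < width m T.slices c.1, o.up c.1 j = o'.up c'.1 j) : Negative o c ↔ Negative o' c' := by
  have h1 : (T.slice c.1).pos + 1 < width m T.slices c.1 := by
    have h := T.slice_fits c.1
    have h' := c.2
    rcases hc : T.slice c.1 with i | i | ⟨i, b⟩ <;> rw [hc] at h h'
    · simp [Slice.isCrossing] at h'
    · simp [Slice.isCrossing] at h'
    · exact h
  unfold Negative
  rw [hu _ (by omega), hu _ h1, hs]

section

variable {D₁ : Tangle 0 2} {D₂ : Tangle 2 0} {s : Bool} (o₁ : D₁.Orientation) (o₂ : D₂.Orientation)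
  (h₁ : ∀ j < 2, o₁.up D₁.height j = ends s j) (h₂ : ∀ j < 2, o₂.up 0 j = ends s j)

theorem claspSumOrientation_up (k j : ℕ) : (claspSumOrientation o₁ o₂ h₁ h₂).up k j =
    if k ≤ D₁.height then o₁.up k j else if k - D₁.height ≤ 4 then
      if k - D₁.height = 0 ∨ k - D₁.height = 4 then ends s j else ends s (j / 2)
      else o₂.up (k - D₁.height - 4) j := rfl

theorem sumOrientation_up (k j : ℕ) : (sumOrientation o₁ o₂ h₁ h₂).up k j =
    if k ≤ D₁.height then o₁.up k j else o₂.up (k - D₁.height) j := rfl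

/-- At the level of the clasp both orientations are given by the prescribed directions of the two
ends; elsewhere this is a matter of renumbering. -/
theorem claspSumOrientation_up_shift (k j : ℕ) (hj : j < width 0 (D₁.sum D₂).slices k) :
    (claspSumOrientation o₁ o₂ h₁ h₂).up (IsClasp.shift D₁.height k) j =
      (sumOrientation o₁ o₂ h₁ h₂).up k j := by
  rw [claspSumOrientation_up, sumOrientation_up]
  rcases lt_trichotomy k D₁.height with hk | rfl | hk
  · rw [IsClasp.shift_of_lt hk, if_pos hk.le, if_pos hk.le]
  · rw [(isClasp_claspSum D₁ D₂).width_eq] at hj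
    rw [IsClasp.shift_of_ge le_rfl, if_neg (by omega), if_pos (by omega), if_pos (by omega), if_pos le_rfl,
      h₁ j hj]
  · rw [IsClasp.shift_of_ge hk.le, if_neg (by omega), if_neg (by omega), if_neg (by omega)]
    congr 1
    omega

theorem negative_incl (a : (D₁.sum D₂).Crossing) :
    Negative (claspSumOrientation o₁ o₂ h₁ h₂) ((isClasp_claspSum D₁ D₂).incl a) ↔
      Negative (sumOrientation o₁ o₂ h₁ h₂) a :=
  (negative_iff _ _ ((isClasp_claspSum D₁ D₂).slice_incl a).symm fun j hj =>
    (claspSumOrientation_up_shift o₁ o₂ h₁ h₂ _ j hj).symm).symm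

/-- At a crossing of the clasp the two strands have the same vertical direction, which makes a
crossing with a rising over-strand positive. The same holds for the second one. -/
theorem not_negative_first :
    ¬ Negative (claspSumOrientation o₁ o₂ h₁ h₂) (isClasp_claspSum D₁ D₂).first := by
  unfold Negative
  rw [(isClasp_claspSum D₁ D₂).slice_first, claspSumOrientation_up, claspSumOrientation_up]
  simp [IsClasp.first, Slice.pos, Slice.risingOver]

theorem not_negative_second :
    ¬ Negative (claspSumOrientation o₁ o₂ h₁ h₂) (isClasp_claspSum D₁ D₂).second := by
  unfold Negative
  rw [(isClasp_claspSum D₁ D₂).slice_second, claspSumOrientation_up, claspSumOrientation_up]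
  simp [IsClasp.second, Slice.pos, Slice.risingOver]

/-- The two diagrams have the same number of negative crossings. -/
theorem card_negative : (Finset.univ.filter (Negative (claspSumOrientation o₁ o₂ h₁ h₂))).card =
    (Finset.univ.filter (Negative (sumOrientation o₁ o₂ h₁ h₂))).card := by
  rw [← Finset.card_map (isClasp_claspSum D₁ D₂).incl]
  congr 1
  ext b
  simp only [Finset.mem_filter, Finset.mem_univ, true_and, Finset.mem_map]
  constructor
  · intro hb
    rcases (isClasp_claspSum D₁ D₂).crossing_cover b with rfl | rfl | ⟨a, rfl⟩
    · exact absurd hb (not_negative_first o₁ o₂ h₁ h₂)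
    · exact absurd hb (not_negative_second o₁ o₂ h₁ h₂)
    · exact ⟨a, (negative_incl o₁ o₂ h₁ h₂ a).1 hb, rfl⟩
  · rintro ⟨a, ha, rfl⟩
    exact (negative_incl o₁ o₂ h₁ h₂ a).2 ha

end

end Tangle
end Khovanov

/-! ### The theorem -/

theorem mainTheorem10 (D₁ : Khovanov.Tangle 0 2) (D₂ : Khovanov.Tangle 2 0) :
    (∀ n : ℕ, Khovanov.Sp.HomotopyEquivalent ((D₁.claspSum D₂).space n)
      (Khovanov.Sp.prod ((D₁.sum D₂).space n)
        (Khovanov.Sp.loop (Khovanov.Sp.loop ((D₁.sum D₂).space n))))) ∧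
    ∀ (s : Bool) (o₁ : D₁.Orientation) (o₂ : D₂.Orientation)
      (h₁ : ∀ j < 2, o₁.up D₁.height j = Khovanov.Tangle.ends s j)
      (h₂ : ∀ j < 2, o₂.up 0 j = Khovanov.Tangle.ends s j) (i : ℤ),
      Nonempty ((D₁.claspSum D₂).KH (Khovanov.Tangle.claspSumOrientation o₁ o₂ h₁ h₂) i ≃+
        (D₁.sum D₂).KH (Khovanov.Tangle.sumOrientation o₁ o₂ h₁ h₂) i ×
        (D₁.sum D₂).KH (Khovanov.Tangle.sumOrientation o₁ o₂ h₁ h₂) (i - 2)) := by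
  have h := (Khovanov.Tangle.isClasp_claspSum D₁ D₂).doubling.nonempty_H_equiv
  refine ⟨Khovanov.Tangle.space_homotopyEquivalent h, fun s o₁ o₂ h₁ h₂ i => ?_⟩
  have := Khovanov.Tangle.nonempty_unnormalisedKH_equiv h
    (i + (Finset.univ.filter (Khovanov.Tangle.Negative (Khovanov.Tangle.sumOrientation o₁ o₂ h₁ h₂))).card)
  unfold Khovanov.Tangle.KH
  -- Both diagrams have the same number of negative crossings, so the unnormalised isomorphism is
  -- used with one common shift; it only remains to move the shift past the −2.
  rw [Khovanov.Tangle.card_negative, sub_add_eq_add_sub]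
  exact this
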